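/- Let $F$ be a field of characteristic $0$, let $d>1$ be odd and let $q\in F$ be a primitive $d$-th root of unity. Let $\bar U_q$ be the associative unital $F$-algebra with generators $k_1^{\pm1},k_2^{\pm1},e_1,e_2,f_1,f_2$ and relations $k_ik_i^{-1}=k_i^{-1}k_i=1$, $k_2k_1=k_1k_2$, $e_1k_1=q^{-2}k_1e_1$, $e_2k_1=qk_1e_2$, $e_1k_2=qk_2e_1$, $e_2k_2=k_2e_2$, $k_1f_1=q^{-2}f_1k_1$, $k_1f_2=qf_2k_1$, $k_2f_1=qf_1k_2$, $k_2f_2=f_2k_2$, $e_1f_1=f_1e_1+\frac{k_1-k_1^{-1}}{q-q^{-1}}$, $e_2f_2=-f_2e_2+\frac{k_2-k_2^{-1}}{q-q^{-1}}$, $e_1f_2=f_2e_1$, $e_2f_1=f_1e_2$, $e_2^2=f_2^2=0$, $e_1^2e_2-(q+q^{-1})e_1e_2e_1+e_2e_1^2=0$, $f_1^2f_2-(q+q^{-1})f_1f_2f_1+f_2f_1^2=0$, $f_1^d=e_1^d=0$, $k_1^d=k_2^d=1$, graded by $\mathbb Z_2$ with $e_2,f_2$ odd and the other generators even. Put $e_3=e_1e_2-q^{-1}e_2e_1$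 and $f_3=f_2f_1-qf_1f_2$. It is a Hopf superalgebra with $\Delta(k_i^{\pm1})=k_i^{\pm1}\otimes k_i^{\pm1}$, $\Delta(e_i)=e_i\otimes1+k_i\otimes e_i$, $\Delta(f_i)=f_i\otimes k_i^{-1}+1\otimes f_i$, $\epsilon(k_i^{\pm1})=1$, $\epsilon(e_i)=\epsilon(f_i)=0$, $S(k_i^{\pm1})=k_i^{\mp1}$, $S(e_i)=-k_i^{-1}e_i$, $S(f_i)=-f_ik_i$ ($\Delta$ and $S$ being superalgebra morphisms $\bar U_q\to\bar U_q\otimes\bar U_q$ and $\bar U_q\to\bar U_q^{op}$). Let $B=B_q^+\subset\bar U_q$ be the Hopf subsuperalgebra that is the linear span of the monomials $k_1^ik_2^je_1^re_3^he_2^t$ ($0\le i,j,r\le d-1$; $h,t\in\{0,1\}$). These monomials form a basis of $B$ and the antipode of $B$ is bijective. Let $(\cdot)^*$ denote the elements of the dual basis of $B^*$. Let $X=(B^{op})^*$ be the Hopf superalgebra $B^*$ with product $(fg)(a)=\sum(-1)^{|g||a'|}f(a')g(a'')$, unit $\epsilon$, coproduct $\Delta_X(f)=\sum_{i,j}f(b_jb_i)\,b_i^*\otimes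 b_j^*$ ($b_i$ running over the monomial basis), counit $f\mapsto f(1)$ and antipode $f\mapsto f\circ S^{-1}$. Define in $X$, all sums being over $0\le v,p\le d-1$, $$\alpha_{k_1}=\sum q^{-2v+p}(k_1^vk_2^p)^*,\qquad \alpha_{k_2}=\sum q^{v}(k_1^vk_2^p)^*,$$ $$\alpha_{e_1}=-(q-q^{-1})^{-1}\sum q^{2v-p}(k_1^vk_2^pe_1)^*,\qquad \alpha_{e_2}=(q-q^{-1})^{-1}\sum q^{-v}(k_1^vk_2^pe_2)^*,$$ $$\alpha_{e_3}=(q-q^{-1})^{-1}\Big(\sum q^{v-p}(k_1^vk_2^pe_1e_2)^*+\sum q^{v-p}(k_1^vk_2^pe_3)^*\Big).$$ Let $D=D(B)=X\bowtie B$ be the quantum double: the superspace $X\otimes B$ with unit $\epsilon\otimes 1$, product $$(f\otimes a)(g\otimes b)=\sum(-1)^{|g||a|+|a_3|(|a_1|+|a_2|)+|?||a_1|}\,f\cdot g\big(S^{-1}(a_3)\,?\,a_1\big)\otimes a_2b,\qquad (\Delta\otimes\mathrm{id})\Delta(a)=\sum a_1\otimes a_2\otimes a_3,$$ coproduct $\Delta(f\otimes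 a)=\sum(-1)^{|f''||a'|}(f'\otimes a')\otimes(f''\otimes a'')$, where $\Delta_X(f)=\sum f'\otimes f''$, counit $f(1)\epsilon(a)$ and antipode $S(f\otimes a)=(-1)^{|f||a|}(1\otimes S(a))(f\circ S^{-1}\otimes 1)$. Theorem. $B$, $D$ and $\bar U_q$ are Hopf superalgebras, and the elements $$\alpha_{e_1}^w\alpha_{e_3}^s\alpha_{e_2}^l\alpha_{k_1}^{i_1}\alpha_{k_2}^{j_1}\otimes k_1^{i_2}k_2^{j_2}e_1^re_3^he_2^t\qquad(0\le w,i_1,i_2,j_1,j_2,r\le d-1,\ l,s,t,h\in\{0,1\})$$ form a basis of $D$. The linear map $\chi:D\to\bar U_q$ determined on this basis by $$\chi\big(\alpha_{e_1}^w\alpha_{e_3}^s\alpha_{e_2}^l\alpha_{k_1}^{i_1}\alpha_{k_2}^{j_1}\otimes k_1^{i_2}k_2^{j_2}e_1^re_3^he_2^t\big)=f_1^wf_3^sf_2^lk_1^{i_1+i_2}k_2^{j_1+j_2}e_1^re_3^he_2^t$$ is a surjective morphism of Hopf superalgebras (an even linear map compatible with products, units, coproducts, counits and antipodes). -/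

import Mathlib

open scoped TensorProduct

noncomputable section

namespace QDouble

open TensorProduct Module

section Generic

variable {F : Type*} [Field F]
variable {V : Type*} [AddCommGroup V] [Module F V]
variable {W : Type*} [AddCommGroup W] [Module F W]

/-- Koszul sign. For involutions `P`, `Q` recording the degrees on `V` and `W`, this is the operator
`v ⊗ w ↦ (-1)^{|v||w|} v ⊗ w`, in the form `id - 2 π ⊗ π'` where `π = (1 - P)/2`, `π' = (1 - Q)/2`
are the projections onto the odd parts. -/
def koszul (P : V →ₗ[F] V) (Q : W →ₗ[F] W) : V ⊗[F] W →ₗ[F] V ⊗[F] W :=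
  LinearMap.id - (1 / 2 : F) • TensorProduct.map (LinearMap.id - P) (LinearMap.id - Q)

theorem koszul_even_left (P : V →ₗ[F] V) (Q : W →ₗ[F] W) {v : V} (hv : P v = v) (w : W) :
    koszul P Q (v ⊗ₜ w) = v ⊗ₜ w := by
  simp [koszul, hv]

theorem koszul_even_right (P : V →ₗ[F] V) (Q : W →ₗ[F] W) (v : V) {w : W} (hw : Q w = w) :
    koszul P Q (v ⊗ₜ w) = v ⊗ₜ w := by
  simp [koszul, hw]

theorem koszul_odd_left [CharZero F] (P : V →ₗ[F] V) (Q : W →ₗ[F] W) {v : V} (hv : P v = -v)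
    (w : W) : koszul P Q (v ⊗ₜ w) = v ⊗ₜ Q w := by
  have h : v - -v = (2 : F) • v := by rw [two_smul]; abel
  simp [koszul, hv, h, ← smul_tmul', tmul_sub, smul_sub]

theorem koszul_odd_right [CharZero F] (P : V →ₗ[F] V) (Q : W →ₗ[F] W) (v : V) {w : W}
    (hw : Q w = -w) : koszul P Q (v ⊗ₜ w) = P v ⊗ₜ w := by
  have h : w - -w = (2 : F) • w := by rw [two_smul]; abel
  simp [koszul, hw, h, sub_tmul]

/-- The product `(a ⊗ b) (c ⊗ d) = (-1)^{|b||c|} a c ⊗ b d` on `V ⊗ V`, for a superalgebra `V`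
with parity involution `P` and product `m`. -/
def superTensorMul (P : V →ₗ[F] V) (m : V ⊗[F] V →ₗ[F] V) :
    (V ⊗[F] V) ⊗[F] (V ⊗[F] V) →ₗ[F] V ⊗[F] V :=
  TensorProduct.map m m ∘ₗ (tensorTensorTensorComm F V V V V).toLinearMap ∘ₗ
    koszul (TensorProduct.map LinearMap.id P) (TensorProduct.map P LinearMap.id)

theorem superTensorMul_even (P : V →ₗ[F] V) (m : V ⊗[F] V →ₗ[F] V) (a : V) {b : V} (hb : P b = b)
    (x y : V) : superTensorMul P m ((a ⊗ₜ b) ⊗ₜ (x ⊗ₜ y)) = m (a ⊗ₜ x) ⊗ₜ m (b ⊗ₜ y) := by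
  simp [superTensorMul, koszul_even_left (TensorProduct.map LinearMap.id P) _
    (v := a ⊗ₜ[F] b) (by simp [hb])]

theorem superTensorMul_odd [CharZero F] (P : V →ₗ[F] V) (m : V ⊗[F] V →ₗ[F] V) (a : V) {b : V}
    (hb : P b = -b) (x y : V) :
    superTensorMul P m ((a ⊗ₜ b) ⊗ₜ (x ⊗ₜ y)) = m (a ⊗ₜ P x) ⊗ₜ m (b ⊗ₜ y) := by
  simp [superTensorMul, koszul_odd_left (TensorProduct.map LinearMap.id P) _
    (v := a ⊗ₜ[F] b) (by simp [hb, tmul_neg])]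

variable (F V) in
/-- The data of a Hopf superalgebra on a vector superspace `V`. The `ℤ₂`-grading `V = V₀ ⊕ V₁` is
recorded by the involution `par : v ↦ (-1)^{|v|} v`. The laws are in `IsHopfSuperalgebra`. -/
structure HopfSuperData where
  par : V →ₗ[F] V
  mul : V ⊗[F] V →ₗ[F] V
  one : V
  comul : V →ₗ[F] V ⊗[F] V
  counit : V →ₗ[F] F
  antipode : V →ₗ[F] V

namespace HopfSuperData

/-- The homogeneous components `V₀` and `V₁`. -/
def gr (H : HopfSuperData F V) (i : ZMod 2) : Submodule F V :=
  LinearMap.ker (H.par - ((-1 : F) ^ i.val) • LinearMap.id)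

theorem isCompl_gr [CharZero F] (H : HopfSuperData F V) (h : H.par ∘ₗ H.par = LinearMap.id) :
    IsCompl (H.gr 0) (H.gr 1) := by
  have h' : ∀ v, H.par (H.par v) = v := fun v => LinearMap.congr_fun h v
  have m0 : ∀ v, v ∈ H.gr 0 ↔ H.par v = v := fun v => by
    simp [gr, sub_eq_zero]
  have m1 : ∀ v, v ∈ H.gr 1 ↔ H.par v = -v := fun v => by
    have : (1 : ZMod 2).val = 1 := rfl
    simp [gr, this, add_eq_zero_iff_eq_neg]
  rw [isCompl_iff, Submodule.disjoint_def, Submodule.codisjoint_iff_exists_add_eq]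
  refine ⟨fun v h0 h1 => ?_, fun v => ?_⟩
  · rw [m0] at h0
    rw [m1, h0] at h1
    have : (2 : F) • v = 0 := by rw [two_smul]; nth_rewrite 1 [h1]; abel
    simpa using this
  · refine ⟨(1 / 2 : F) • (v + H.par v), (1 / 2 : F) • (v - H.par v), ?_, ?_, ?_⟩
    · simp [m0, h', add_comm]
    · simp [m1, h', ← smul_neg]
    · rw [← smul_add, add_add_sub_cancel, ← two_smul F v, smul_smul]; norm_num

/-- The product of the superalgebra `V ⊗ V`. -/
def tensorMul (H : HopfSuperData F V) : (V ⊗[F] V) ⊗[F] (V ⊗[F] V) →ₗ[F] V ⊗[F] V :=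
  superTensorMul H.par H.mul

/-- The laws of a Hopf superalgebra. -/
structure IsHopfSuperalgebra (H : HopfSuperData F V) : Prop where
  par_par : H.par ∘ₗ H.par = LinearMap.id
  par_mul : H.par ∘ₗ H.mul = H.mul ∘ₗ TensorProduct.map H.par H.par
  par_one : H.par H.one = H.one
  par_comul : H.comul ∘ₗ H.par = TensorProduct.map H.par H.par ∘ₗ H.comul
  par_counit : H.counit ∘ₗ H.par = H.counit
  par_antipode : H.antipode ∘ₗ H.par = H.par ∘ₗ H.antipode
  mul_assoc : ∀ a b c : V, H.mul (H.mul (a ⊗ₜ b) ⊗ₜ c) = H.mul (a ⊗ₜ H.mul (b ⊗ₜ c))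
  one_mul : ∀ a : V, H.mul (H.one ⊗ₜ a) = a
  mul_one : ∀ a : V, H.mul (a ⊗ₜ H.one) = a
  coassoc : (TensorProduct.assoc F V V V).toLinearMap ∘ₗ
      TensorProduct.map H.comul LinearMap.id ∘ₗ H.comul =
    TensorProduct.map LinearMap.id H.comul ∘ₗ H.comul
  counit_comul : (TensorProduct.lid F V).toLinearMap ∘ₗ
    TensorProduct.map H.counit LinearMap.id ∘ₗ H.comul = LinearMap.id
  comul_counit : (TensorProduct.rid F V).toLinearMap ∘ₗ
    TensorProduct.map LinearMap.id H.counit ∘ₗ H.comul = LinearMap.id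
  comul_mul : H.comul ∘ₗ H.mul = H.tensorMul ∘ₗ TensorProduct.map H.comul H.comul
  comul_one : H.comul H.one = H.one ⊗ₜ H.one
  counit_mul : ∀ a b : V, H.counit (H.mul (a ⊗ₜ b)) = H.counit a * H.counit b
  counit_one : H.counit H.one = 1
  antipode_left : ∀ a : V,
    H.mul (TensorProduct.map H.antipode LinearMap.id (H.comul a)) = H.counit a • H.one
  antipode_right : ∀ a : V,
    H.mul (TensorProduct.map LinearMap.id H.antipode (H.comul a)) = H.counit a • H.one

/-- Morphisms of Hopf superalgebras: even linear maps that respect all structure maps. -/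
structure IsHopfHom (H : HopfSuperData F V) (K : HopfSuperData F W) (φ : V →ₗ[F] W) : Prop where
  even : ∀ (i : ZMod 2) (v : V), v ∈ H.gr i → φ v ∈ K.gr i
  map_mul : ∀ a b : V, φ (H.mul (a ⊗ₜ b)) = K.mul (φ a ⊗ₜ φ b)
  map_one : φ H.one = K.one
  map_comul : ∀ a : V, K.comul (φ a) = TensorProduct.map φ φ (H.comul a)
  map_counit : ∀ a : V, K.counit (φ a) = H.counit a
  map_antipode : ∀ a : V, K.antipode (φ a) = φ (H.antipode a)

/-- Powers with respect to `H.mul`. -/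
def pow (H : HopfSuperData F V) (a : V) : ℕ → V
  | 0 => H.one
  | n + 1 => H.mul (pow H a n ⊗ₜ a)

/-- The inverse of the antipode. It is the true inverse as soon as the antipode is bijective, which
is automatic in a finite-dimensional Hopf superalgebra. -/
def antipodeInv (H : HopfSuperData F V) : V →ₗ[F] V :=
  Ring.inverse (M₀ := Module.End F V) H.antipode

section Double

variable (H : HopfSuperData F V)

/-- The grading `(V*)ᵢ = (Vᵢ)*` of the dual superspace. -/
def dualPar : Dual F V →ₗ[F] Dual F V :=
  Dual.transpose H.par

/-- The isomorphism `λ : V* ⊗ V* → (V ⊗ V)*`, `λ (f ⊗ g) (m ⊗ n) = (-1)^{|g||m|} f(m) g(n)`.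
As `f(m) = 0` for `|f| ≠ |m|`, the sign can be written `(-1)^{|f||g|}`. -/
def lam : Dual F V ⊗[F] Dual F V →ₗ[F] Dual F (V ⊗[F] V) :=
  dualDistrib F V V ∘ₗ koszul H.dualPar H.dualPar

/-- The inverse of `λ`. -/
def lamInv [Module.Finite F V] : Dual F (V ⊗[F] V) →ₗ[F] Dual F V ⊗[F] Dual F V :=
  koszul H.dualPar H.dualPar ∘ₗ (dualDistribEquiv F V V).symm.toLinearMap

/-- The opposite product `μ ∘ τ : a ⊗ b ↦ (-1)^{|a||b|} b a`. -/
def mulOp : V ⊗[F] V →ₗ[F] V :=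
  H.mul ∘ₗ (TensorProduct.comm F V V).toLinearMap ∘ₗ koszul H.par H.par

/-- The Hopf superalgebra `X = (Hᵒᵖ)*`: its product is `Δ* ∘ λ`, its unit `ε`, its coproduct
`λ⁻¹ ∘ (μ ∘ τ)*`, its counit evaluation at `1`, and its antipode `(S⁻¹)*`. -/
def dualOp [Module.Finite F V] : HopfSuperData F (Dual F V) where
  par := H.dualPar
  mul := Dual.transpose H.comul ∘ₗ H.lam
  one := H.counit
  comul := H.lamInv ∘ₗ Dual.transpose H.mulOp
  counit := Dual.eval F V H.one
  antipode := Dual.transpose H.antipodeInv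

/-- `conj a c : x ↦ (-1)^{|x||a|} S⁻¹(c) x a`. -/
def conj : V →ₗ[F] V →ₗ[F] V →ₗ[F] V :=
  LinearMap.mk₂ F
    (fun a c => TensorProduct.curry H.mul (H.antipodeInv c) ∘ₗ
      (TensorProduct.curry (H.mul ∘ₗ koszul H.par H.par)).flip a)
    (fun _ _ _ => by simp [LinearMap.comp_add]) (fun _ _ _ => by simp [LinearMap.comp_smul])
    (fun _ _ _ => by simp [LinearMap.add_comp]) (fun _ _ _ => by simp [LinearMap.smul_comp])

/-- The linear map `(a₁ ⊗ a₂) ⊗ a₃ ↦ (g ↦ (x ↦ (-1)^{|x||a₁|} g (S⁻¹(a₃) x a₁)) ⊗ a₂)`. -/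
def coadj : (V ⊗[F] V) ⊗[F] V →ₗ[F] Dual F V →ₗ[F] Dual F V ⊗[F] V :=
  TensorProduct.lift (TensorProduct.lift (LinearMap.mk₂ F
    (fun a₁ a₂ => LinearMap.mk₂ F
      (fun a₃ g => (g ∘ₗ H.conj a₁ a₃) ⊗ₜ[F] a₂)
      (fun _ _ _ => by simp [LinearMap.comp_add, add_tmul])
      (fun _ _ _ => by simp [LinearMap.comp_smul, smul_tmul'])
      (fun _ _ _ => by simp [LinearMap.add_comp, add_tmul])
      (fun _ _ _ => by simp [LinearMap.smul_comp, smul_tmul']))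
    (fun _ _ _ => by ext; simp [LinearMap.comp_add, add_tmul]; rfl)
    (fun _ _ _ => by ext; simp [LinearMap.comp_smul]; rfl)
    (fun _ _ _ => by ext; simp [tmul_add]; rfl)
    (fun _ _ _ => by ext; simp [tmul_smul]; rfl)))

theorem coadj_tmul (a₁ a₂ a₃ : V) (g : Dual F V) :
    H.coadj ((a₁ ⊗ₜ a₂) ⊗ₜ a₃) g = (g ∘ₗ H.conj a₁ a₃) ⊗ₜ[F] a₂ := rfl

theorem conj_apply (a c x : V) : H.conj a c x =
    H.mul (H.antipodeInv c ⊗ₜ H.mul (koszul H.par H.par (x ⊗ₜ a))) := rfl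

/-- The exchange rule of the quantum double, i.e. the product `(1 ⊗ a) (g ⊗ 1)`. With
`(Δ ⊗ id) Δ a = ∑ a₁ ⊗ a₂ ⊗ a₃` it sends `a ⊗ g` to
`∑ (-1)^{|g||a| + |a₃|(|a₁| + |a₂|) + |?||a₁|} g (S⁻¹(a₃) ? a₁) ⊗ a₂`. -/
def straighten : V ⊗[F] Dual F V →ₗ[F] Dual F V ⊗[F] V :=
  TensorProduct.lift
    (H.coadj ∘ₗ koszul (TensorProduct.map H.par H.par) H.par ∘ₗ
      TensorProduct.map H.comul LinearMap.id ∘ₗ H.comul) ∘ₗ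
    koszul H.par H.dualPar

/-- The quantum double `D(H) = (Hᵒᵖ)* ⋈ H` on the superspace `X ⊗ H`, where `X = (Hᵒᵖ)*`:
* `(f ⊗ a) (g ⊗ b) = ∑ (f g') ⊗ (a' b)` where `(1 ⊗ a) (g ⊗ 1) = ∑ g' ⊗ a'` by `straighten`;
* `Δ (f ⊗ a) = ∑ (-1)^{|f₂||a₁|} (f₁ ⊗ a₁) ⊗ (f₂ ⊗ a₂)`, `ε (f ⊗ a) = f(1) ε(a)`;
* `S (f ⊗ a) = (-1)^{|f||a|} (1 ⊗ S a) (S f ⊗ 1)`. -/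
def double [Module.Finite F V] : HopfSuperData F (Dual F V ⊗[F] V) where
  par := TensorProduct.map H.dualPar H.par
  mul := TensorProduct.map H.dualOp.mul H.mul ∘ₗ
    (TensorProduct.assoc F (Dual F V) (Dual F V) (V ⊗[F] V)).symm.toLinearMap ∘ₗ
    TensorProduct.map LinearMap.id
      ((TensorProduct.assoc F (Dual F V) V V).toLinearMap ∘ₗ
        TensorProduct.map H.straighten LinearMap.id ∘ₗ
        (TensorProduct.assoc F V (Dual F V) V).symm.toLinearMap) ∘ₗ
    (TensorProduct.assoc F (Dual F V) V (Dual F V ⊗[F] V)).toLinearMap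
  one := H.counit ⊗ₜ H.one
  comul := (tensorTensorTensorComm F (Dual F V) (Dual F V) V V).toLinearMap ∘ₗ
    koszul (V := Dual F V ⊗[F] Dual F V) (W := V ⊗[F] V)
      (TensorProduct.map LinearMap.id H.dualPar) (TensorProduct.map H.par LinearMap.id) ∘ₗ
    TensorProduct.map H.dualOp.comul H.comul
  counit := LinearMap.mul' F F ∘ₗ TensorProduct.map H.dualOp.counit H.counit
  antipode := H.straighten ∘ₗ (TensorProduct.comm F (Dual F V) V).toLinearMap ∘ₗ
    TensorProduct.map H.dualOp.antipode H.antipode ∘ₗ koszul H.dualPar H.par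

end Double

end HopfSuperData

end Generic

variable {F : Type*} [Field F]

/-- `q` is a root of unity of odd order `d > 1`. -/
class OddRoot (q : F) (d : ℕ) : Prop where
  prim : IsPrimitiveRoot q d
  odd : Odd d
  one_lt : 1 < d

/-- Generators `k₁, k₁⁻¹, k₂, k₂⁻¹, e₁, e₂, f₁, f₂`. -/
inductive Gen | k1 | k1i | k2 | k2i | e1 | e2 | f1 | f2


/-- The generators `e₂` and `f₂` are odd, the other ones are even. -/
def Gen.sign (F : Type*) [Field F] : Gen → F
  | .e2 => -1
  | .f2 => -1
  | _ => 1

/-- The defining relations of `Ū_q`, for elements `g x` (`x : Gen`) of an algebra `A`: those of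
`U_q(sl(2|1))`, and `f₁ᵈ = 0`, `k₁ᵈ = 1`, `k₂ᵈ = 1`, `e₁ᵈ = 0`. -/
inductive Rel (q : F) (d : ℕ) {A : Type*} [Ring A] [Algebra F A] (g : Gen → A) : A → A → Prop
  | k1k1i : Rel q d g (g .k1 * g .k1i) 1
  | k1ik1 : Rel q d g (g .k1i * g .k1) 1
  | k2k2i : Rel q d g (g .k2 * g .k2i) 1
  | k2ik2 : Rel q d g (g .k2i * g .k2) 1
  | k2k1 : Rel q d g (g .k2 * g .k1) (g .k1 * g .k2)
  | e1k1 : Rel q d g (g .e1 * g .k1) (q ^ (-2 : ℤ) • (g .k1 * g .e1))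
  | e2k1 : Rel q d g (g .e2 * g .k1) (q • (g .k1 * g .e2))
  | e1k2 : Rel q d g (g .e1 * g .k2) (q • (g .k2 * g .e1))
  | e2k2 : Rel q d g (g .e2 * g .k2) (g .k2 * g .e2)
  | k1f1 : Rel q d g (g .k1 * g .f1) (q ^ (-2 : ℤ) • (g .f1 * g .k1))
  | k1f2 : Rel q d g (g .k1 * g .f2) (q • (g .f2 * g .k1))
  | k2f1 : Rel q d g (g .k2 * g .f1) (q • (g .f1 * g .k2))
  | k2f2 : Rel q d g (g .k2 * g .f2) (g .f2 * g .k2)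
  | e1f1 : Rel q d g (g .e1 * g .f1) (g .f1 * g .e1 + (q - q⁻¹)⁻¹ • (g .k1 - g .k1i))
  | e2f2 : Rel q d g (g .e2 * g .f2) (-(g .f2 * g .e2) + (q - q⁻¹)⁻¹ • (g .k2 - g .k2i))
  | e1f2 : Rel q d g (g .e1 * g .f2) (g .f2 * g .e1)
  | e2f1 : Rel q d g (g .e2 * g .f1) (g .f1 * g .e2)
  | e2e2 : Rel q d g (g .e2 ^ 2) 0
  | f2f2 : Rel q d g (g .f2 ^ 2) 0
  | serre_e : Rel q d g
      (g .e1 ^ 2 * g .e2 - (q + q⁻¹) • (g .e1 * g .e2 * g .e1) + g .e2 * g .e1 ^ 2) 0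
  | serre_f : Rel q d g
      (g .f1 ^ 2 * g .f2 - (q + q⁻¹) • (g .f1 * g .f2 * g .f1) + g .f2 * g .f1 ^ 2) 0
  | f1d : Rel q d g (g .f1 ^ d) 0
  | k1d : Rel q d g (g .k1 ^ d) 1
  | k2d : Rel q d g (g .k2 ^ d) 1
  | e1d : Rel q d g (g .e1 ^ d) 0

/-- The algebra `Ū_q` given by generators and relations. -/
def Ubar (q : F) (d : ℕ) : Type _ :=
  RingQuot (Rel q d (A := FreeAlgebra F Gen) (FreeAlgebra.ι F))

namespace Ubar

variable (q : F) (d : ℕ)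

instance : Ring (Ubar q d) :=
  inferInstanceAs (Ring (RingQuot (Rel q d (A := FreeAlgebra F Gen) (FreeAlgebra.ι F))))

instance : Algebra F (Ubar q d) :=
  inferInstanceAs (Algebra F (RingQuot (Rel q d (A := FreeAlgebra F Gen) (FreeAlgebra.ι F))))

/-- The quotient map from the free algebra. -/
def mk : FreeAlgebra F Gen →ₐ[F] Ubar q d :=
  RingQuot.mkAlgHom F (Rel q d (FreeAlgebra.ι F))

/-- The generators, as elements of `Ū_q`. -/
def gen (x : Gen) : Ubar q d :=
  mk q d (FreeAlgebra.ι F x)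

variable {q d}

theorem rel_map {A B : Type*} [Ring A] [Algebra F A] [Ring B] [Algebra F B] (φ : A →ₐ[F] B)
    {g : Gen → A} {h : Gen → B} (hg : ∀ x, φ (g x) = h x) {a b : A} (r : Rel q d g a b) :
    Rel q d h (φ a) (φ b) := by
  cases r <;>
    simp only [map_mul, map_add, map_sub, map_neg, map_smul, map_pow, map_one, map_zero, hg] <;>
    constructor

theorem mk_rel {a b : FreeAlgebra F Gen} (r : Rel q d (FreeAlgebra.ι F) a b) :
    mk q d a = mk q d b :=
  RingQuot.mkAlgHom_rel F r

theorem gen_rel {a b : Ubar q d} (r : Rel q d (gen q d) a b) : a = b := by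
  have hg : ∀ x, mk q d (FreeAlgebra.ι F x) = gen q d x := fun _ => rfl
  cases r with
  | k1k1i => simpa [hg] using mk_rel (Rel.k1k1i (q := q) (d := d))
  | k1ik1 => simpa [hg] using mk_rel (Rel.k1ik1 (q := q) (d := d))
  | k2k2i => simpa [hg] using mk_rel (Rel.k2k2i (q := q) (d := d))
  | k2ik2 => simpa [hg] using mk_rel (Rel.k2ik2 (q := q) (d := d))
  | k2k1 => simpa [hg] using mk_rel (Rel.k2k1 (q := q) (d := d))
  | e1k1 => simpa [hg] using mk_rel (Rel.e1k1 (q := q) (d := d))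
  | e2k1 => simpa [hg] using mk_rel (Rel.e2k1 (q := q) (d := d))
  | e1k2 => simpa [hg] using mk_rel (Rel.e1k2 (q := q) (d := d))
  | e2k2 => simpa [hg] using mk_rel (Rel.e2k2 (q := q) (d := d))
  | k1f1 => simpa [hg] using mk_rel (Rel.k1f1 (q := q) (d := d))
  | k1f2 => simpa [hg] using mk_rel (Rel.k1f2 (q := q) (d := d))
  | k2f1 => simpa [hg] using mk_rel (Rel.k2f1 (q := q) (d := d))
  | k2f2 => simpa [hg] using mk_rel (Rel.k2f2 (q := q) (d := d))
  | e1f1 => simpa [hg] using mk_rel (Rel.e1f1 (q := q) (d := d))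
  | e2f2 => simpa [hg] using mk_rel (Rel.e2f2 (q := q) (d := d))
  | e1f2 => simpa [hg] using mk_rel (Rel.e1f2 (q := q) (d := d))
  | e2f1 => simpa [hg] using mk_rel (Rel.e2f1 (q := q) (d := d))
  | e2e2 => simpa [hg] using mk_rel (Rel.e2e2 (q := q) (d := d))
  | f2f2 => simpa [hg] using mk_rel (Rel.f2f2 (q := q) (d := d))
  | serre_e => simpa [hg] using mk_rel (Rel.serre_e (q := q) (d := d))
  | serre_f => simpa [hg] using mk_rel (Rel.serre_f (q := q) (d := d))
  | f1d => simpa [hg] using mk_rel (Rel.f1d (q := q) (d := d))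
  | k1d => simpa [hg] using mk_rel (Rel.k1d (q := q) (d := d))
  | k2d => simpa [hg] using mk_rel (Rel.k2d (q := q) (d := d))
  | e1d => simpa [hg] using mk_rel (Rel.e1d (q := q) (d := d))

/-- The universal property of `Ū_q`. -/
def lift {A : Type*} [Ring A] [Algebra F A] (g : Gen → A)
    (hg : ∀ a b, Rel q d g a b → a = b) : Ubar q d →ₐ[F] A :=
  RingQuot.liftAlgHom F ⟨FreeAlgebra.lift F g,
    fun _ _ r => hg _ _ (rel_map (FreeAlgebra.lift F g) (FreeAlgebra.lift_ι_apply g) r)⟩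

@[simp] theorem lift_gen {A : Type*} [Ring A] [Algebra F A] (g : Gen → A)
    (hg : ∀ a b, Rel q d g a b → a = b) (x : Gen) : lift g hg (gen q d x) = g x := by
  have h := RingQuot.liftAlgHom_mkAlgHom_apply F (FreeAlgebra.lift F g)
    (fun _ _ r => hg _ _ (rel_map (FreeAlgebra.lift F g) (FreeAlgebra.lift_ι_apply g) r))
    (FreeAlgebra.ι F x)
  rw [FreeAlgebra.lift_ι_apply] at h
  exact h

theorem q_ne_zero (q : F) (d : ℕ) [OddRoot q d] : q ≠ 0 := by
  have := OddRoot.one_lt (q := q) (d := d)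
  exact (OddRoot.prim (q := q) (d := d)).ne_zero (by omega)

section Rules

variable {A : Type*} [Ring A] [Algebra F A]

theorem push {a b c : A} {s : F} (h : a * b = s • c) (x : A) : a * (b * x) = s • (c * x) := by
  rw [← mul_assoc, h, smul_mul_assoc]

theorem swap_inv {a k k' : A} {s : F} (hs : s ≠ 0) (h : a * k = s • (k * a)) (h1 : k * k' = 1)
    (h2 : k' * k = 1) : a * k' = s⁻¹ • (k' * a) := by
  have : k' * (a * k) * k' = s • (a * k') := by
    rw [h, mul_smul_comm, smul_mul_assoc, ← mul_assoc k', h2, one_mul]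
  rw [mul_assoc, mul_assoc, h1, mul_one] at this
  rw [this, smul_smul, inv_mul_cancel₀ hs, one_smul]

theorem swap_inv' {a k k' : A} {s : F} (hs : s ≠ 0) (h : k * a = s • (a * k)) (h1 : k * k' = 1)
    (h2 : k' * k = 1) : k' * a = s⁻¹ • (a * k') := by
  have : k' * (k * a) * k' = s • (k' * a) := by
    rw [h, mul_smul_comm, smul_mul_assoc, mul_assoc k', mul_assoc a, h1, mul_one]
  rw [← mul_assoc k', h2, one_mul] at this
  rw [this, smul_smul, inv_mul_cancel₀ hs, one_smul]

/-- The `q`-binomial coefficients. -/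
def gauss (c : F) : ℕ → ℕ → F
  | _, 0 => 1
  | 0, _ + 1 => 0
  | n + 1, k + 1 => gauss c n k + c ^ (k + 1) * gauss c n (k + 1)

theorem gauss_gt (c : F) : ∀ n k, n < k → gauss c n k = 0
  | 0, k + 1, _ => rfl
  | n + 1, k + 1, h => by
    rw [gauss, gauss_gt c n k (by omega), gauss_gt c n (k + 1) (by omega)]; simp

theorem gauss_self (c : F) : ∀ n, gauss c n n = 1
  | 0 => rfl
  | n + 1 => by rw [gauss, gauss_self c n, gauss_gt c n (n + 1) (by omega)]; simp

theorem gauss_mul (c : F) : ∀ n k,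
    (1 - c ^ (k + 1)) * gauss c (n + 1) (k + 1) = (1 - c ^ (n + 1)) * gauss c n k
  | 0, 0 => by simp [gauss]
  | 0, k + 1 => by simp [gauss]
  | n + 1, 0 => by
    have h := gauss_mul c n 0
    rw [gauss]
    simp only [gauss, zero_add, pow_one] at h ⊢
    linear_combination c * h
  | n + 1, k + 1 => by
    have h1 := gauss_mul c n k
    have h2 := gauss_mul c n (k + 1)
    rw [gauss]
    have e : gauss c (n + 1) (k + 1) = gauss c n k + c ^ (k + 1) * gauss c n (k + 1) := rfl
    rw [e] at h1 ⊢
    linear_combination c * h1 + c ^ (k + 1 + 1) * h2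

theorem add_pow_gauss {x y : A} {c : F} (h : y * x = c • (x * y)) (n : ℕ) :
    (x + y) ^ n = ∑ k ∈ Finset.range (n + 1), gauss c n k • (x ^ k * y ^ (n - k)) := by
  have hx : ∀ k, y * x ^ k = c ^ k • (x ^ k * y) := by
    intro k
    induction k with
    | zero => simp
    | succ k ih =>
      rw [pow_succ, ← mul_assoc, ih, smul_mul_assoc, mul_assoc, h, mul_smul_comm, smul_smul,
        pow_succ, mul_assoc]
  induction n with
  | zero => simp [gauss]
  | succ n ih =>
    rw [pow_succ', ih, add_mul, Finset.mul_sum, Finset.mul_sum, Finset.sum_range_succ' _ (n + 1)]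
    have e1 : ∀ k ∈ Finset.range (n + 1), gauss c (n + 1) (k + 1) •
        (x ^ (k + 1) * y ^ (n + 1 - (k + 1))) =
        x * (gauss c n k • (x ^ k * y ^ (n - k))) +
        (c ^ (k + 1) * gauss c n (k + 1)) • (x ^ (k + 1) * y ^ (n - k)) := by
      intro k _
      rw [gauss, add_smul, mul_smul_comm, ← mul_assoc, ← pow_succ', Nat.succ_sub_succ]
    have e2 : ∀ k ∈ Finset.range (n + 1), y * (gauss c n k • (x ^ k * y ^ (n - k))) =
        (c ^ k * gauss c n k) • (x ^ k * y ^ (n + 1 - k)) := by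
      intro k hk
      rw [Finset.mem_range] at hk
      rw [mul_smul_comm, ← mul_assoc, hx, smul_mul_assoc, mul_assoc, ← pow_succ', smul_smul,
        mul_comm, show n + 1 - k = n - k + 1 by omega]
    rw [Finset.sum_congr rfl e1, Finset.sum_congr rfl e2, Finset.sum_add_distrib, add_assoc]
    congr 1
    rw [Finset.sum_range_succ', Finset.sum_range_succ _ n, gauss_gt c n (n + 1) (by omega)]
    simp [gauss]

theorem add_pow_root {x y : A} {c : F} {d : ℕ} (hd : 0 < d) (hc : IsPrimitiveRoot c d)
    (h : y * x = c • (x * y)) : (x + y) ^ d = x ^ d + y ^ d := by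
  obtain ⟨n, rfl⟩ : ∃ n, d = n + 1 := ⟨d - 1, by omega⟩
  rw [add_pow_gauss h, Finset.sum_range_succ, Finset.sum_range_succ', gauss_self]
  rw [Finset.sum_eq_zero, zero_add, add_comm]
  · simp [gauss]
  · intro k hk
    rw [Finset.mem_range] at hk
    have g := gauss_mul c n k
    rw [hc.pow_eq_one, sub_self, zero_mul] at g
    have : (1 : F) - c ^ (k + 1) ≠ 0 := fun e =>
      hc.pow_ne_one_of_pos_of_lt (by omega) (by omega : k + 1 < n + 1) (sub_eq_zero.1 e).symm
    rw [(mul_eq_zero.1 g).resolve_left this, zero_smul]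

theorem mul_pow_root {x y : A} {c : F} (h : y * x = c • (x * y)) (n : ℕ) :
    ∃ s : F, (x * y) ^ n = s • (x ^ n * y ^ n) := by
  have hx : ∀ k, y ^ k * x = c ^ k • (x * y ^ k) := by
    intro k
    induction k with
    | zero => simp
    | succ k ih =>
      rw [pow_succ', mul_assoc, ih, mul_smul_comm, ← mul_assoc, h, smul_mul_assoc, smul_smul,
        pow_succ, mul_assoc]
  induction n with
  | zero => exact ⟨1, by simp⟩
  | succ n ih =>
    obtain ⟨s, hs⟩ := ih
    refine ⟨s * c ^ n, ?_⟩
    rw [pow_succ, hs, smul_mul_assoc, mul_assoc, ← mul_assoc (y ^ n), hx, smul_mul_assoc,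
      mul_smul_comm, smul_smul, mul_assoc x, ← pow_succ, ← mul_assoc, ← pow_succ]

end Rules

/- Commutation rules in `Ū_q`, used to check that `Δ` and `S` respect the defining relations. -/

section Commutation

@[simp] theorem k1_k1i :
    gen q d .k1 * gen q d .k1i = 1 := by
  exact gen_rel .k1k1i

@[simp] theorem k1_k1i_assoc (x : Ubar q d) :
    gen q d .k1 * (gen q d .k1i * x) = x := by
  rw [← mul_assoc, k1_k1i, one_mul]

@[simp] theorem k1i_k1 :
    gen q d .k1i * gen q d .k1 = 1 := by
  exact gen_rel .k1ik1

@[simp] theorem k1i_k1_assoc (x : Ubar q d) :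
    gen q d .k1i * (gen q d .k1 * x) = x := by
  rw [← mul_assoc, k1i_k1, one_mul]

@[simp] theorem k2_k2i :
    gen q d .k2 * gen q d .k2i = 1 := by
  exact gen_rel .k2k2i

@[simp] theorem k2_k2i_assoc (x : Ubar q d) :
    gen q d .k2 * (gen q d .k2i * x) = x := by
  rw [← mul_assoc, k2_k2i, one_mul]

@[simp] theorem k2i_k2 :
    gen q d .k2i * gen q d .k2 = 1 := by
  exact gen_rel .k2ik2

@[simp] theorem k2i_k2_assoc (x : Ubar q d) :
    gen q d .k2i * (gen q d .k2 * x) = x := by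
  rw [← mul_assoc, k2i_k2, one_mul]

@[simp] theorem k2_k1 :
    gen q d .k2 * gen q d .k1 = gen q d .k1 * gen q d .k2 := by
  exact gen_rel .k2k1

@[simp] theorem k2_k1_assoc (x : Ubar q d) :
    gen q d .k2 * (gen q d .k1 * x) = gen q d .k1 * (gen q d .k2 * x) := by
  rw [← mul_assoc, k2_k1, mul_assoc]

@[simp] theorem k2_k1i :
    gen q d .k2 * gen q d .k1i = gen q d .k1i * gen q d .k2 := by
  simpa using swap_inv (F := F) one_ne_zero (by simp) (k1_k1i (q := q) (d := d)) k1i_k1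

@[simp] theorem k2_k1i_assoc (x : Ubar q d) :
    gen q d .k2 * (gen q d .k1i * x) = gen q d .k1i * (gen q d .k2 * x) := by
  rw [← mul_assoc, k2_k1i, mul_assoc]

@[simp] theorem k2i_k1 :
    gen q d .k2i * gen q d .k1 = gen q d .k1 * gen q d .k2i := by
  simpa using swap_inv' (F := F) one_ne_zero (by simp) (k2_k2i (q := q) (d := d)) k2i_k2

@[simp] theorem k2i_k1_assoc (x : Ubar q d) :
    gen q d .k2i * (gen q d .k1 * x) = gen q d .k1 * (gen q d .k2i * x) := by
  rw [← mul_assoc, k2i_k1, mul_assoc]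

@[simp] theorem k2i_k1i :
    gen q d .k2i * gen q d .k1i = gen q d .k1i * gen q d .k2i := by
  simpa using swap_inv (F := F) one_ne_zero (by simp) (k1_k1i (q := q) (d := d)) k1i_k1

@[simp] theorem k2i_k1i_assoc (x : Ubar q d) :
    gen q d .k2i * (gen q d .k1i * x) = gen q d .k1i * (gen q d .k2i * x) := by
  rw [← mul_assoc, k2i_k1i, mul_assoc]

@[simp] theorem e1_k1 :
    gen q d .e1 * gen q d .k1 = (q ^ 2)⁻¹ • (gen q d .k1 * gen q d .e1) := by
  simpa using gen_rel (Rel.e1k1 (q := q) (d := d))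

@[simp] theorem e1_k1_assoc (x : Ubar q d) :
    gen q d .e1 * (gen q d .k1 * x) = (q ^ 2)⁻¹ • (gen q d .k1 * (gen q d .e1 * x)) := by
  rw [← mul_assoc, e1_k1, smul_mul_assoc, mul_assoc]

@[simp] theorem e1_k1i [OddRoot q d] :
    gen q d .e1 * gen q d .k1i = q ^ 2 • (gen q d .k1i * gen q d .e1) := by
  simpa using swap_inv (inv_ne_zero (pow_ne_zero 2 (q_ne_zero q d))) (by simp) (k1_k1i (q := q) (d := d)) k1i_k1

@[simp] theorem e1_k1i_assoc (x : Ubar q d) [OddRoot q d] :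
    gen q d .e1 * (gen q d .k1i * x) = q ^ 2 • (gen q d .k1i * (gen q d .e1 * x)) := by
  rw [← mul_assoc, e1_k1i, smul_mul_assoc, mul_assoc]

@[simp] theorem e2_k1 :
    gen q d .e2 * gen q d .k1 = q • (gen q d .k1 * gen q d .e2) := by
  simpa using gen_rel (Rel.e2k1 (q := q) (d := d))

@[simp] theorem e2_k1_assoc (x : Ubar q d) :
    gen q d .e2 * (gen q d .k1 * x) = q • (gen q d .k1 * (gen q d .e2 * x)) := by
  rw [← mul_assoc, e2_k1, smul_mul_assoc, mul_assoc]

@[simp] theorem e2_k1i [OddRoot q d] :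
    gen q d .e2 * gen q d .k1i = q⁻¹ • (gen q d .k1i * gen q d .e2) := by
  simpa using swap_inv (q_ne_zero q d) (by simp) (k1_k1i (q := q) (d := d)) k1i_k1

@[simp] theorem e2_k1i_assoc (x : Ubar q d) [OddRoot q d] :
    gen q d .e2 * (gen q d .k1i * x) = q⁻¹ • (gen q d .k1i * (gen q d .e2 * x)) := by
  rw [← mul_assoc, e2_k1i, smul_mul_assoc, mul_assoc]

@[simp] theorem e1_k2 :
    gen q d .e1 * gen q d .k2 = q • (gen q d .k2 * gen q d .e1) := by
  simpa using gen_rel (Rel.e1k2 (q := q) (d := d))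

@[simp] theorem e1_k2_assoc (x : Ubar q d) :
    gen q d .e1 * (gen q d .k2 * x) = q • (gen q d .k2 * (gen q d .e1 * x)) := by
  rw [← mul_assoc, e1_k2, smul_mul_assoc, mul_assoc]

@[simp] theorem e1_k2i [OddRoot q d] :
    gen q d .e1 * gen q d .k2i = q⁻¹ • (gen q d .k2i * gen q d .e1) := by
  simpa using swap_inv (q_ne_zero q d) (by simp) (k2_k2i (q := q) (d := d)) k2i_k2

@[simp] theorem e1_k2i_assoc (x : Ubar q d) [OddRoot q d] :
    gen q d .e1 * (gen q d .k2i * x) = q⁻¹ • (gen q d .k2i * (gen q d .e1 * x)) := by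
  rw [← mul_assoc, e1_k2i, smul_mul_assoc, mul_assoc]

@[simp] theorem e2_k2 :
    gen q d .e2 * gen q d .k2 = gen q d .k2 * gen q d .e2 := by
  simpa using gen_rel (Rel.e2k2 (q := q) (d := d))

@[simp] theorem e2_k2_assoc (x : Ubar q d) :
    gen q d .e2 * (gen q d .k2 * x) = gen q d .k2 * (gen q d .e2 * x) := by
  rw [← mul_assoc, e2_k2, mul_assoc]

@[simp] theorem e2_k2i :
    gen q d .e2 * gen q d .k2i = gen q d .k2i * gen q d .e2 := by
  simpa using swap_inv (one_ne_zero (α := F)) (by simp) (k2_k2i (q := q) (d := d)) k2i_k2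

@[simp] theorem e2_k2i_assoc (x : Ubar q d) :
    gen q d .e2 * (gen q d .k2i * x) = gen q d .k2i * (gen q d .e2 * x) := by
  rw [← mul_assoc, e2_k2i, mul_assoc]

@[simp] theorem k1_f1 :
    gen q d .k1 * gen q d .f1 = (q ^ 2)⁻¹ • (gen q d .f1 * gen q d .k1) := by
  simpa using gen_rel (Rel.k1f1 (q := q) (d := d))

@[simp] theorem k1_f1_assoc (x : Ubar q d) :
    gen q d .k1 * (gen q d .f1 * x) = (q ^ 2)⁻¹ • (gen q d .f1 * (gen q d .k1 * x)) := by
  rw [← mul_assoc, k1_f1, smul_mul_assoc, mul_assoc]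

@[simp] theorem k1i_f1 [OddRoot q d] :
    gen q d .k1i * gen q d .f1 = q ^ 2 • (gen q d .f1 * gen q d .k1i) := by
  simpa using swap_inv' (inv_ne_zero (pow_ne_zero 2 (q_ne_zero q d))) (by simp) (k1_k1i (q := q) (d := d)) k1i_k1

@[simp] theorem k1i_f1_assoc (x : Ubar q d) [OddRoot q d] :
    gen q d .k1i * (gen q d .f1 * x) = q ^ 2 • (gen q d .f1 * (gen q d .k1i * x)) := by
  rw [← mul_assoc, k1i_f1, smul_mul_assoc, mul_assoc]

@[simp] theorem k1_f2 :
    gen q d .k1 * gen q d .f2 = q • (gen q d .f2 * gen q d .k1) := by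
  simpa using gen_rel (Rel.k1f2 (q := q) (d := d))

@[simp] theorem k1_f2_assoc (x : Ubar q d) :
    gen q d .k1 * (gen q d .f2 * x) = q • (gen q d .f2 * (gen q d .k1 * x)) := by
  rw [← mul_assoc, k1_f2, smul_mul_assoc, mul_assoc]

@[simp] theorem k1i_f2 [OddRoot q d] :
    gen q d .k1i * gen q d .f2 = q⁻¹ • (gen q d .f2 * gen q d .k1i) := by
  simpa using swap_inv' (q_ne_zero q d) (by simp) (k1_k1i (q := q) (d := d)) k1i_k1

@[simp] theorem k1i_f2_assoc (x : Ubar q d) [OddRoot q d] :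
    gen q d .k1i * (gen q d .f2 * x) = q⁻¹ • (gen q d .f2 * (gen q d .k1i * x)) := by
  rw [← mul_assoc, k1i_f2, smul_mul_assoc, mul_assoc]

@[simp] theorem k2_f1 :
    gen q d .k2 * gen q d .f1 = q • (gen q d .f1 * gen q d .k2) := by
  simpa using gen_rel (Rel.k2f1 (q := q) (d := d))

@[simp] theorem k2_f1_assoc (x : Ubar q d) :
    gen q d .k2 * (gen q d .f1 * x) = q • (gen q d .f1 * (gen q d .k2 * x)) := by
  rw [← mul_assoc, k2_f1, smul_mul_assoc, mul_assoc]

@[simp] theorem k2i_f1 [OddRoot q d] :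
    gen q d .k2i * gen q d .f1 = q⁻¹ • (gen q d .f1 * gen q d .k2i) := by
  simpa using swap_inv' (q_ne_zero q d) (by simp) (k2_k2i (q := q) (d := d)) k2i_k2

@[simp] theorem k2i_f1_assoc (x : Ubar q d) [OddRoot q d] :
    gen q d .k2i * (gen q d .f1 * x) = q⁻¹ • (gen q d .f1 * (gen q d .k2i * x)) := by
  rw [← mul_assoc, k2i_f1, smul_mul_assoc, mul_assoc]

@[simp] theorem k2_f2 :
    gen q d .k2 * gen q d .f2 = gen q d .f2 * gen q d .k2 := by
  simpa using gen_rel (Rel.k2f2 (q := q) (d := d))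

@[simp] theorem k2_f2_assoc (x : Ubar q d) :
    gen q d .k2 * (gen q d .f2 * x) = gen q d .f2 * (gen q d .k2 * x) := by
  rw [← mul_assoc, k2_f2, mul_assoc]

@[simp] theorem k2i_f2 :
    gen q d .k2i * gen q d .f2 = gen q d .f2 * gen q d .k2i := by
  simpa using swap_inv' (one_ne_zero (α := F)) (by simp) (k2_k2i (q := q) (d := d)) k2i_k2

@[simp] theorem k2i_f2_assoc (x : Ubar q d) :
    gen q d .k2i * (gen q d .f2 * x) = gen q d .f2 * (gen q d .k2i * x) := by
  rw [← mul_assoc, k2i_f2, mul_assoc]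

@[simp] theorem e1_f2 :
    gen q d .e1 * gen q d .f2 = gen q d .f2 * gen q d .e1 := by
  exact gen_rel .e1f2

@[simp] theorem e1_f2_assoc (x : Ubar q d) :
    gen q d .e1 * (gen q d .f2 * x) = gen q d .f2 * (gen q d .e1 * x) := by
  rw [← mul_assoc, e1_f2, mul_assoc]

@[simp] theorem e2_f1 :
    gen q d .e2 * gen q d .f1 = gen q d .f1 * gen q d .e2 := by
  exact gen_rel .e2f1

@[simp] theorem e2_f1_assoc (x : Ubar q d) :
    gen q d .e2 * (gen q d .f1 * x) = gen q d .f1 * (gen q d .e2 * x) := by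
  rw [← mul_assoc, e2_f1, mul_assoc]

@[simp] theorem e1_f1 :
    gen q d .e1 * gen q d .f1 = gen q d .f1 * gen q d .e1 +
      (q - q⁻¹)⁻¹ • (gen q d .k1 - gen q d .k1i) := by
  exact gen_rel .e1f1

@[simp] theorem e1_f1_assoc (x : Ubar q d) :
    gen q d .e1 * (gen q d .f1 * x) = gen q d .f1 * (gen q d .e1 * x) +
      (q - q⁻¹)⁻¹ • (gen q d .k1 * x - gen q d .k1i * x) := by
  rw [← mul_assoc, e1_f1, add_mul, smul_mul_assoc, sub_mul, mul_assoc]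

@[simp] theorem e2_f2 :
    gen q d .e2 * gen q d .f2 = -(gen q d .f2 * gen q d .e2) +
      (q - q⁻¹)⁻¹ • (gen q d .k2 - gen q d .k2i) := by
  exact gen_rel .e2f2

@[simp] theorem e2_f2_assoc (x : Ubar q d) :
    gen q d .e2 * (gen q d .f2 * x) = -(gen q d .f2 * (gen q d .e2 * x)) +
      (q - q⁻¹)⁻¹ • (gen q d .k2 * x - gen q d .k2i * x) := by
  rw [← mul_assoc, e2_f2, add_mul, smul_mul_assoc, sub_mul, neg_mul, mul_assoc]

@[simp] theorem e2_e2 :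
    gen q d .e2 * gen q d .e2 = 0 := by
  rw [← sq]; exact gen_rel .e2e2

@[simp] theorem e2_e2_assoc (x : Ubar q d) :
    gen q d .e2 * (gen q d .e2 * x) = 0 := by
  rw [← mul_assoc, e2_e2, zero_mul]

@[simp] theorem serre_e :
    gen q d .e1 * (gen q d .e1 * gen q d .e2) = (q + q⁻¹) • (gen q d .e1 * (gen q d .e2 * gen q d .e1)) -
      gen q d .e2 * (gen q d .e1 * gen q d .e1) := by
  have h := gen_rel (Rel.serre_e (q := q) (d := d))
  rw [sq, mul_assoc, mul_assoc, sub_add_eq_add_sub, sub_eq_zero] at h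
  exact eq_sub_of_add_eq h

@[simp] theorem serre_e_assoc (x : Ubar q d) :
    gen q d .e1 * (gen q d .e1 * (gen q d .e2 * x)) =
      (q + q⁻¹) • (gen q d .e1 * (gen q d .e2 * (gen q d .e1 * x))) -
      gen q d .e2 * (gen q d .e1 * (gen q d .e1 * x)) := by
  have h := congrArg (fun y => y * x) (serre_e (q := q) (d := d))
  simpa only [mul_assoc, sub_mul, smul_mul_assoc] using h

@[simp] theorem f2_f2 :
    gen q d .f2 * gen q d .f2 = 0 := by
  rw [← sq]; exact gen_rel .f2f2

@[simp] theorem f2_f2_assoc (x : Ubar q d) :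
    gen q d .f2 * (gen q d .f2 * x) = 0 := by
  rw [← mul_assoc, f2_f2, zero_mul]

@[simp] theorem serre_f :
    gen q d .f1 * (gen q d .f1 * gen q d .f2) = (q + q⁻¹) • (gen q d .f1 * (gen q d .f2 * gen q d .f1)) -
      gen q d .f2 * (gen q d .f1 * gen q d .f1) := by
  have h := gen_rel (Rel.serre_f (q := q) (d := d))
  rw [sq, mul_assoc, mul_assoc, sub_add_eq_add_sub, sub_eq_zero] at h
  exact eq_sub_of_add_eq h

@[simp] theorem serre_f_assoc (x : Ubar q d) :
    gen q d .f1 * (gen q d .f1 * (gen q d .f2 * x)) =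
      (q + q⁻¹) • (gen q d .f1 * (gen q d .f2 * (gen q d .f1 * x))) -
      gen q d .f2 * (gen q d .f1 * (gen q d .f1 * x)) := by
  have h := congrArg (fun y => y * x) (serre_f (q := q) (d := d))
  simpa only [mul_assoc, sub_mul, smul_mul_assoc] using h

end Commutation
section Structure

theorem hom_ext {A : Type*} [Ring A] [Algebra F A] {φ ψ : Ubar q d →ₐ[F] A}
    (h : ∀ x, φ (gen q d x) = ψ (gen q d x)) : φ = ψ := by
  refine RingQuot.ringQuot_ext' F φ ψ ?_
  ext x
  exact h x

theorem e1_pow : gen q d .e1 ^ d = 0 := gen_rel .e1d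
theorem f1_pow : gen q d .f1 ^ d = 0 := gen_rel .f1d
theorem k1_pow : gen q d .k1 ^ d = 1 := gen_rel .k1d
theorem k2_pow : gen q d .k2 ^ d = 1 := gen_rel .k2d

/-- The parity automorphism `u ↦ (-1)^{|u|} u` of `Ū_q`, which defines its `ℤ₂`-grading. -/
def par (q : F) (d : ℕ) : Ubar q d →ₐ[F] Ubar q d :=
  lift (fun x => x.sign F • gen q d x) (by
    intro a b r
    cases r <;> simp [Gen.sign, sq, mul_assoc, e1_pow, f1_pow, k1_pow, k2_pow, smul_sub])

@[simp] theorem par_gen (x : Gen) : par q d (gen q d x) = x.sign F • gen q d x :=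
  lift_gen _ _ x

@[simp] theorem par_par (u : Ubar q d) : par q d (par q d u) = u := by
  have : (par q d).comp (par q d) = AlgHom.id F _ := by
    refine hom_ext fun x => ?_
    cases x <;> simp [Gen.sign]
  exact DFunLike.congr_fun this u

/-- The counit. -/
def counit (q : F) (d : ℕ) [OddRoot q d] : Ubar q d →ₐ[F] F :=
  lift (fun x => match x with
      | .k1 => 1 | .k1i => 1 | .k2 => 1 | .k2i => 1 | .e1 => 0 | .e2 => 0 | .f1 => 0 | .f2 => 0) (by
    have : d ≠ 0 := by have := OddRoot.one_lt (q := q) (d := d); omega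
    intro a b r
    cases r <;> simp [this])

/-- The comultiplication on generators. -/
def comulGen (q : F) (d : ℕ) : Gen → Ubar q d ⊗[F] Ubar q d
  | .k1 => gen q d .k1 ⊗ₜ gen q d .k1
  | .k1i => gen q d .k1i ⊗ₜ gen q d .k1i
  | .k2 => gen q d .k2 ⊗ₜ gen q d .k2
  | .k2i => gen q d .k2i ⊗ₜ gen q d .k2i
  | .e1 => gen q d .e1 ⊗ₜ 1 + gen q d .k1 ⊗ₜ gen q d .e1
  | .e2 => gen q d .e2 ⊗ₜ 1 + gen q d .k2 ⊗ₜ gen q d .e2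
  | .f1 => gen q d .f1 ⊗ₜ gen q d .k1i + 1 ⊗ₜ gen q d .f1
  | .f2 => gen q d .f2 ⊗ₜ gen q d .k2i + 1 ⊗ₜ gen q d .f2

/-- Left multiplication in the superalgebra `Ū_q ⊗ Ū_q`. -/
def tmulLeft (q : F) (d : ℕ) :
    Ubar q d ⊗[F] Ubar q d →ₗ[F] Module.End F (Ubar q d ⊗[F] Ubar q d) :=
  TensorProduct.curry (superTensorMul (par q d).toLinearMap (LinearMap.mul' F (Ubar q d)))

theorem tmulLeft_apply (s t : Ubar q d ⊗[F] Ubar q d) : tmulLeft q d s t =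
    superTensorMul (par q d).toLinearMap (LinearMap.mul' F (Ubar q d)) (s ⊗ₜ t) := rfl

theorem tmulLeft_even (a : Ubar q d) {b : Ubar q d} (hb : par q d b = b) (x y : Ubar q d) :
    tmulLeft q d (a ⊗ₜ b) (x ⊗ₜ y) = (a * x) ⊗ₜ (b * y) := by
  rw [tmulLeft_apply, superTensorMul_even _ _ _ hb]; rfl

theorem tmulLeft_odd [CharZero F] (a : Ubar q d) {b : Ubar q d} (hb : par q d b = -b)
    (x y : Ubar q d) :
    tmulLeft q d (a ⊗ₜ b) (x ⊗ₜ y) = (a * par q d x) ⊗ₜ (b * y) := by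
  rw [tmulLeft_apply, superTensorMul_odd _ _ _ hb]; rfl

/-- Right supermultiplication `x ↦ (-1)^{|a||x|} x a` on `Ū_q`. -/
def superRight (q : F) (d : ℕ) : Ubar q d →ₗ[F] Module.End F (Ubar q d) :=
  (TensorProduct.curry (LinearMap.mul' F (Ubar q d) ∘ₗ
    koszul (par q d).toLinearMap (par q d).toLinearMap)).flip

theorem superRight_even {a : Ubar q d} (ha : par q d a = a) (x : Ubar q d) :
    superRight q d a x = x * a := by
  change LinearMap.mul' F (Ubar q d) (koszul (par q d).toLinearMap (par q d).toLinearMap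
    (x ⊗ₜ a)) = _
  rw [koszul_even_right _ _ _ (by simpa using ha)]; rfl

theorem superRight_odd [CharZero F] {a : Ubar q d} (ha : par q d a = -a) (x : Ubar q d) :
    superRight q d a x = par q d x * a := by
  change LinearMap.mul' F (Ubar q d) (koszul (par q d).toLinearMap (par q d).toLinearMap
    (x ⊗ₜ a)) = _
  rw [koszul_odd_right _ _ _ (by simpa using ha)]; rfl

/-- The antipode on generators. -/
def antipodeGen (q : F) (d : ℕ) : Gen → Ubar q d
  | .k1 => gen q d .k1i
  | .k1i => gen q d .k1
  | .k2 => gen q d .k2i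
  | .k2i => gen q d .k2
  | .e1 => -(gen q d .k1i * gen q d .e1)
  | .e2 => -(gen q d .k2i * gen q d .e2)
  | .f1 => -(gen q d .f1 * gen q d .k1)
  | .f2 => -(gen q d .f2 * gen q d .k2)

variable [CharZero F] [OddRoot q d]

theorem comul_rel : ∀ a b, Rel q d (fun x => tmulLeft q d (comulGen q d x)) a b → a = b := by
  have hq := q_ne_zero q d
  have hd : 0 < d := by have := OddRoot.one_lt (q := q) (d := d); omega
  have hc : IsPrimitiveRoot (q ^ 2) d :=
    OddRoot.prim.pow_of_coprime 2 (OddRoot.odd (q := q) (d := d)).coprime_two_left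
  have D1 : ∀ x y, tmulLeft q d (comulGen q d .k1) (x ⊗ₜ y) =
      (gen q d .k1 * x) ⊗ₜ (gen q d .k1 * y) := fun x y => by
    rw [comulGen, tmulLeft_even _ (by simp [Gen.sign])]
  have D2 : ∀ x y, tmulLeft q d (comulGen q d .k1i) (x ⊗ₜ y) =
      (gen q d .k1i * x) ⊗ₜ (gen q d .k1i * y) := fun x y => by
    rw [comulGen, tmulLeft_even _ (by simp [Gen.sign])]
  have D3 : ∀ x y, tmulLeft q d (comulGen q d .k2) (x ⊗ₜ y) =
      (gen q d .k2 * x) ⊗ₜ (gen q d .k2 * y) := fun x y => by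
    rw [comulGen, tmulLeft_even _ (by simp [Gen.sign])]
  have D4 : ∀ x y, tmulLeft q d (comulGen q d .k2i) (x ⊗ₜ y) =
      (gen q d .k2i * x) ⊗ₜ (gen q d .k2i * y) := fun x y => by
    rw [comulGen, tmulLeft_even _ (by simp [Gen.sign])]
  have D5 : ∀ x y, tmulLeft q d (comulGen q d .e1) (x ⊗ₜ y) =
      (gen q d .e1 * x) ⊗ₜ y + (gen q d .k1 * x) ⊗ₜ (gen q d .e1 * y) := fun x y => by
    rw [comulGen, map_add, LinearMap.add_apply, tmulLeft_even _ (by simp [Gen.sign]),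
      tmulLeft_even _ (by simp [Gen.sign]), one_mul]
  have D6 : ∀ x y, tmulLeft q d (comulGen q d .e2) (x ⊗ₜ y) =
      (gen q d .e2 * x) ⊗ₜ y + (gen q d .k2 * par q d x) ⊗ₜ (gen q d .e2 * y) := fun x y => by
    rw [comulGen, map_add, LinearMap.add_apply, tmulLeft_even _ (by simp [Gen.sign]),
      tmulLeft_odd _ (by simp [Gen.sign]), one_mul]
  have D7 : ∀ x y, tmulLeft q d (comulGen q d .f1) (x ⊗ₜ y) =
      (gen q d .f1 * x) ⊗ₜ (gen q d .k1i * y) + x ⊗ₜ (gen q d .f1 * y) := fun x y => by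
    rw [comulGen, map_add, LinearMap.add_apply, tmulLeft_even _ (by simp [Gen.sign]),
      tmulLeft_even _ (by simp [Gen.sign]), one_mul]
  have D8 : ∀ x y, tmulLeft q d (comulGen q d .f2) (x ⊗ₜ y) =
      (gen q d .f2 * x) ⊗ₜ (gen q d .k2i * y) + par q d x ⊗ₜ (gen q d .f2 * y) := fun x y => by
    rw [comulGen, map_add, LinearMap.add_apply, tmulLeft_even _ (by simp [Gen.sign]),
      tmulLeft_odd _ (by simp [Gen.sign]), one_mul]
  intro a b r
  cases r
  case f1d =>
    have e : tmulLeft q d (comulGen q d .f1) =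
        TensorProduct.map (LinearMap.mulLeft F (gen q d .f1)) (LinearMap.mulLeft F (gen q d .k1i)) +
        TensorProduct.map 1 (LinearMap.mulLeft F (gen q d .f1)) := by
      refine TensorProduct.ext' fun x y => ?_
      simp [D7]
    rw [e, add_pow_root hd hc.inv, TensorProduct.map_pow, TensorProduct.map_pow,
      LinearMap.pow_mulLeft, LinearMap.pow_mulLeft, f1_pow]
    · refine TensorProduct.ext' fun x y => ?_
      simp
    · refine TensorProduct.ext' fun x y => ?_
      simp [← smul_tmul', smul_smul, hq]
  case e1d =>
    have e : tmulLeft q d (comulGen q d .e1) =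
        TensorProduct.map (LinearMap.mulLeft F (gen q d .e1)) 1 +
        TensorProduct.map (LinearMap.mulLeft F (gen q d .k1)) (LinearMap.mulLeft F (gen q d .e1))
        := by
      refine TensorProduct.ext' fun x y => ?_
      simp [D5]
    rw [e, add_pow_root hd hc, TensorProduct.map_pow, TensorProduct.map_pow,
      LinearMap.pow_mulLeft, LinearMap.pow_mulLeft, e1_pow]
    · refine TensorProduct.ext' fun x y => ?_
      simp
    · refine TensorProduct.ext' fun x y => ?_
      simp [← smul_tmul', smul_smul, hq]
  case k1d =>
    have e : tmulLeft q d (comulGen q d .k1) =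
        TensorProduct.map (LinearMap.mulLeft F (gen q d .k1)) (LinearMap.mulLeft F (gen q d .k1))
        := TensorProduct.ext' D1
    rw [e, TensorProduct.map_pow, LinearMap.pow_mulLeft, k1_pow]
    refine TensorProduct.ext' fun x y => ?_
    simp
  case k2d =>
    have e : tmulLeft q d (comulGen q d .k2) =
        TensorProduct.map (LinearMap.mulLeft F (gen q d .k2)) (LinearMap.mulLeft F (gen q d .k2))
        := TensorProduct.ext' D3
    rw [e, TensorProduct.map_pow, LinearMap.pow_mulLeft, k2_pow]
    refine TensorProduct.ext' fun x y => ?_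
    simp
  all_goals
    refine TensorProduct.ext' fun x y => ?_
    simp only [D1, D2, D3, D4, D5, D6, D7, D8, sq, Module.End.mul_apply, Module.End.one_apply,
      LinearMap.smul_apply, LinearMap.add_apply, LinearMap.sub_apply, LinearMap.neg_apply,
      LinearMap.zero_apply, map_add, map_mul]
    simp [tmul_add, add_tmul, tmul_sub, sub_tmul, ← smul_tmul', Gen.sign, neg_tmul, tmul_neg]
  all_goals try (match_scalars <;> field_simp <;> ring)

theorem antipode_rel :
    ∀ a b, Rel q d (fun x => superRight q d (antipodeGen q d x)) a b → a = b := by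
  have hq := q_ne_zero q d
  have S1 : ∀ x, superRight q d (antipodeGen q d .k1) x = x * gen q d .k1i :=
    superRight_even (a := antipodeGen q d .k1) (by simp [antipodeGen, Gen.sign])
  have S2 : ∀ x, superRight q d (antipodeGen q d .k1i) x = x * gen q d .k1 :=
    superRight_even (a := antipodeGen q d .k1i) (by simp [antipodeGen, Gen.sign])
  have S3 : ∀ x, superRight q d (antipodeGen q d .k2) x = x * gen q d .k2i :=
    superRight_even (a := antipodeGen q d .k2) (by simp [antipodeGen, Gen.sign])
  have S4 : ∀ x, superRight q d (antipodeGen q d .k2i) x = x * gen q d .k2 :=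
    superRight_even (a := antipodeGen q d .k2i) (by simp [antipodeGen, Gen.sign])
  have S5 : ∀ x, superRight q d (antipodeGen q d .e1) x = x * -(gen q d .k1i * gen q d .e1) :=
    superRight_even (a := antipodeGen q d .e1) (by simp [antipodeGen, Gen.sign])
  have S6 : ∀ x, superRight q d (antipodeGen q d .e2) x =
      par q d x * -(gen q d .k2i * gen q d .e2) :=
    superRight_odd (a := antipodeGen q d .e2) (by simp [antipodeGen, Gen.sign])
  have S7 : ∀ x, superRight q d (antipodeGen q d .f1) x = x * -(gen q d .f1 * gen q d .k1) :=
    superRight_even (a := antipodeGen q d .f1) (by simp [antipodeGen, Gen.sign])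
  have S8 : ∀ x, superRight q d (antipodeGen q d .f2) x =
      par q d x * -(gen q d .f2 * gen q d .k2) :=
    superRight_odd (a := antipodeGen q d .f2) (by simp [antipodeGen, Gen.sign])
  have hp : ∀ (c : Ubar q d) (n : ℕ), (LinearMap.mulRight F c) ^ n = LinearMap.mulRight F (c ^ n) :=
    fun c n => LinearMap.pow_mulRight ..
  intro a b r
  cases r
  case f1d =>
    have e : superRight q d (antipodeGen q d .f1) =
      LinearMap.mulRight F (-(gen q d .f1 * gen q d .k1)) := LinearMap.ext S7
    obtain ⟨s, hs⟩ := mul_pow_root (x := gen q d .f1) (y := gen q d .k1) (by simp; rfl) d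
    rw [e, hp, neg_pow, hs, f1_pow]
    ext; simp
  case e1d =>
    have e : superRight q d (antipodeGen q d .e1) =
      LinearMap.mulRight F (-(gen q d .k1i * gen q d .e1)) := LinearMap.ext S5
    obtain ⟨s, hs⟩ := mul_pow_root (x := gen q d .k1i) (y := gen q d .e1) (by simp; rfl) d
    rw [e, hp, neg_pow, hs, e1_pow]
    ext; simp
  case k1d =>
    have e : superRight q d (antipodeGen q d .k1) = LinearMap.mulRight F (gen q d .k1i) :=
      LinearMap.ext S1
    have h := Commute.mul_pow (show Commute (gen q d .k1) (gen q d .k1i) by simp [Commute,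
      SemiconjBy]) d
    rw [k1_pow, one_mul, k1_k1i, one_pow] at h
    rw [e, hp, ← h]
    ext; simp
  case k2d =>
    have e : superRight q d (antipodeGen q d .k2) = LinearMap.mulRight F (gen q d .k2i) :=
      LinearMap.ext S3
    have h := Commute.mul_pow (show Commute (gen q d .k2) (gen q d .k2i) by simp [Commute,
      SemiconjBy]) d
    rw [k2_pow, one_mul, k2_k2i, one_pow] at h
    rw [e, hp, ← h]
    ext; simp
  all_goals
    refine LinearMap.ext fun x => ?_
    simp only [S1, S2, S3, S4, S5, S6, S7, S8, sq, Module.End.mul_apply, Module.End.one_apply,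
      LinearMap.smul_apply, LinearMap.add_apply, LinearMap.sub_apply, LinearMap.neg_apply,
      LinearMap.zero_apply, map_neg, map_mul]
    simp [mul_assoc, Gen.sign, mul_add, mul_sub, smul_sub]
  all_goals try (match_scalars <;> field_simp <;> ring)

/-- The comultiplication of `Ū_q`. The superalgebra morphism `Δ : Ū_q → Ū_q ⊗ Ū_q` is given by its
left multiplication operators on `Ū_q ⊗ Ū_q`, and evaluated at `1 ⊗ 1`. -/
def comul (q : F) (d : ℕ) [OddRoot q d] : Ubar q d →ₗ[F] Ubar q d ⊗[F] Ubar q d :=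
  LinearMap.applyₗ (1 ⊗ₜ[F] 1) ∘ₗ (lift _ (comul_rel (q := q) (d := d))).toLinearMap

/-- The antipode of `Ū_q`. The superalgebra morphism `S : Ū_q → Ū_qᵒᵖ` into the superopposite
algebra is given by its left multiplication operators `x ↦ S(u) ·ᵒᵖ x = (-1)^{|u||x|} x S(u)`, and
evaluated at `1`. -/
def antipode (q : F) (d : ℕ) [OddRoot q d] : Ubar q d →ₗ[F] Ubar q d :=
  LinearMap.applyₗ 1 ∘ₗ (lift _ (antipode_rel (q := q) (d := d))).toLinearMap

theorem comul_gen (x : Gen) : comul q d (gen q d x) = comulGen q d x := by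
  change lift _ (comul_rel (q := q) (d := d)) (gen q d x) (1 ⊗ₜ[F] 1) = _
  rw [lift_gen]
  cases x <;> simp [comulGen, Gen.sign, tmulLeft_even, tmulLeft_odd]

theorem antipode_gen (x : Gen) : antipode q d (gen q d x) = antipodeGen q d x := by
  change lift _ (antipode_rel (q := q) (d := d)) (gen q d x) 1 = _
  rw [lift_gen]
  cases x <;> simp [antipodeGen, Gen.sign, superRight_even, superRight_odd]

variable (q d) in
/-- `Ū_q` as a Hopf superalgebra. -/
def hopf : HopfSuperData F (Ubar q d) where
  par := (par q d).toLinearMap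
  mul := LinearMap.mul' F (Ubar q d)
  one := 1
  comul := comul q d
  counit := (counit q d).toLinearMap
  antipode := antipode q d

end Structure

section Borel

variable (q d)

/-- `e₃ = e₁ e₂ - q⁻¹ e₂ e₁`. -/
def e3 : Ubar q d := gen q d .e1 * gen q d .e2 - q⁻¹ • (gen q d .e2 * gen q d .e1)

/-- `f₃ = f₂ f₁ - q f₁ f₂`. -/
def f3 : Ubar q d := gen q d .f2 * gen q d .f1 - q • (gen q d .f1 * gen q d .f2)

/-- The monomial `k₁ⁱ k₂ʲ e₁ʳ e₃ʰ e₂ᵗ`. -/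
def posWord (i j r h t : ℕ) : Ubar q d :=
  gen q d .k1 ^ i * gen q d .k2 ^ j * gen q d .e1 ^ r * e3 q d ^ h * gen q d .e2 ^ t

/-- The exponents `(i, j, r, h, t)` with `0 ≤ i, j, r < d` and `h, t ∈ {0, 1}`. -/
abbrev PosIdx (d : ℕ) : Type := Fin d × Fin d × Fin d × Fin 2 × Fin 2

/-- The monomials `k₁ⁱ k₂ʲ e₁ʳ e₃ʰ e₂ᵗ` with `0 ≤ i, j, r < d` and `h, t ∈ {0, 1}`. -/
def posMono (m : PosIdx d) : Ubar q d :=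
  posWord q d m.1 m.2.1 m.2.2.1 m.2.2.2.1 m.2.2.2.2

variable {q d}

theorem pass_pow {A : Type*} [Ring A] [Algebra F A] {a b : A} {s : F} (h : a * b = s • (b * a))
    (n : ℕ) : ∃ s' : F, ∀ x, a * (b ^ n * x) = s' • (b ^ n * (a * x)) := by
  induction n with
  | zero => exact ⟨1, fun x => by simp⟩
  | succ n ih =>
    obtain ⟨s', hs⟩ := ih
    refine ⟨s' * s, fun x => ?_⟩
    rw [pow_succ, mul_assoc, hs, push h, mul_smul_comm, smul_smul, mul_assoc, mul_assoc]

section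

variable [OddRoot q d]

theorem q_add_ne (q : F) (d : ℕ) [OddRoot q d] : q + q⁻¹ ≠ 0 := by
  have hq := q_ne_zero q d
  intro h
  have h2 : q * q = -1 := by
    field_simp at h
    linear_combination h
  have hp : IsPrimitiveRoot (q ^ 2) d :=
    OddRoot.prim.pow_of_coprime 2 (OddRoot.odd (q := q) (d := d)).coprime_two_left
  have h1 := (OddRoot.odd (q := q) (d := d)).neg_one_pow (α := F)
  have h3 := hp.pow_eq_one
  rw [sq, h2, h1] at h3
  have h4 : (q * q) * (q * q) = 1 := by rw [h2]; norm_num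
  have h5 : d ∣ 4 := (OddRoot.prim (q := q) (d := d)).dvd_of_pow_eq_one _ (by
    linear_combination h4)
  have h6 := OddRoot.one_lt (q := q) (d := d)
  have h7 : d ≤ 4 := Nat.le_of_dvd (by norm_num) h5
  have h8 := OddRoot.odd (q := q) (d := d)
  interval_cases d
  · exact absurd h8 (by decide)
  · exact absurd h5 (by decide)
  · exact absurd h8 (by decide)

theorem e3_k1 : e3 q d * gen q d .k1 = q⁻¹ • (gen q d .k1 * e3 q d) := by
  have hq := q_ne_zero q d
  simp only [e3, sub_mul, mul_sub, smul_mul_assoc, mul_assoc, mul_smul_comm]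
  simp
  match_scalars <;> field_simp

theorem e3_k2 : e3 q d * gen q d .k2 = q • (gen q d .k2 * e3 q d) := by
  simp only [e3, sub_mul, mul_sub, smul_mul_assoc, mul_assoc, mul_smul_comm]
  simp
  module

theorem e3_e1 : e3 q d * gen q d .e1 = q⁻¹ • (gen q d .e1 * e3 q d) := by
  have hq := q_ne_zero q d
  simp only [e3, sub_mul, mul_sub, smul_mul_assoc, mul_assoc, mul_smul_comm]
  simp
  match_scalars <;> field_simp <;> ring

theorem e2_e3 : gen q d .e2 * e3 q d = (-q) • (e3 q d * gen q d .e2) := by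
  have hq := q_ne_zero q d
  simp only [e3, sub_mul, mul_sub, smul_mul_assoc, mul_assoc, mul_smul_comm]
  simp
  match_scalars <;> field_simp

theorem e2_e1 : gen q d .e2 * gen q d .e1 =
    q • (gen q d .e1 * gen q d .e2) + (-q) • e3 q d := by
  have hq := q_ne_zero q d
  simp only [e3]
  match_scalars <;> field_simp <;> ring

theorem e3_e3 : e3 q d * e3 q d = 0 := by
  have hq := q_ne_zero q d
  have hs := q_add_ne q d
  have h1 := congrArg (fun y => gen q d .e2 * y) (serre_e (q := q) (d := d))
  have h2 := serre_e_assoc (q := q) (d := d) (gen q d .e2)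
  simp only [mul_sub, mul_smul_comm, e2_e2_assoc, e2_e2, mul_zero] at h1 h2
  have h3 : gen q d .e1 * (gen q d .e2 * (gen q d .e1 * gen q d .e2)) =
      gen q d .e2 * (gen q d .e1 * (gen q d .e2 * gen q d .e1)) := by
    have : (q + q⁻¹) • (gen q d .e1 * (gen q d .e2 * (gen q d .e1 * gen q d .e2))) =
        (q + q⁻¹) • (gen q d .e2 * (gen q d .e1 * (gen q d .e2 * gen q d .e1))) := by
      rw [sub_zero] at h1
      rw [← h1]
      exact (sub_eq_zero.1 h2.symm)
    exact smul_right_injective _ hs this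
  have h4 : gen q d .e2 * (gen q d .e1 * (gen q d .e1 * gen q d .e2)) =
    (q + q⁻¹) • (gen q d .e2 * (gen q d .e1 * (gen q d .e2 * gen q d .e1))) := by
    rw [h1, sub_zero]
  simp only [e3, sub_mul, mul_sub, smul_mul_assoc, mul_assoc, mul_smul_comm]
  rw [h3, h4, e2_e2_assoc, mul_zero]
  match_scalars
  field_simp
  ring

theorem e2_e1_pow (r : ℕ) : ∃ s s' : F, ∀ x, gen q d .e2 * (gen q d .e1 ^ r * x) =
    s • (gen q d .e1 ^ r * (gen q d .e2 * x)) + s' • (gen q d .e1 ^ (r - 1) * (e3 q d * x)) := by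
  have step : ∀ x, gen q d .e2 * (gen q d .e1 * x) =
      q • (gen q d .e1 * (gen q d .e2 * x)) + (-q) • (e3 q d * x) := fun x => by
    rw [← mul_assoc, e2_e1, add_mul, smul_mul_assoc, smul_mul_assoc, mul_assoc]
  rcases r with _ | r
  · exact ⟨1, 0, fun x => by simp⟩
  induction r with
  | zero => exact ⟨q, -q, fun x => by simpa using step x⟩
  | succ r ih =>
    obtain ⟨s, s', h⟩ := ih
    obtain ⟨u, hu⟩ := pass_pow (e3_e1 (q := q) (d := d)) (r + 1)
    refine ⟨q * s, q * s' + -q * u, fun x => ?_⟩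
    rw [pow_succ' _ (r + 1), mul_assoc, step, h, hu]
    simp only [Nat.add_sub_cancel, mul_add, mul_smul_comm, pow_succ', mul_assoc]
    module

/-- The linear span of the monomials. -/
def posSpan (q : F) (d : ℕ) : Submodule F (Ubar q d) :=
  Submodule.span F (Set.range (posMono q d))

theorem posWord_mem (i j r h t : ℕ) : posWord q d i j r h t ∈ posSpan q d := by
  have hd : 0 < d := by have := OddRoot.one_lt (q := q) (d := d); omega
  by_cases hr : r < d
  swap
  · have : gen q d .e1 ^ r = 0 := by
      rw [← Nat.sub_add_cancel (not_lt.1 hr), pow_add, e1_pow, mul_zero]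
    simp [posWord, this]
  by_cases hh : h < 2
  swap
  · have : e3 q d ^ h = 0 := by
      rw [← Nat.sub_add_cancel (not_lt.1 hh), pow_add, sq, e3_e3, mul_zero]
    simp [posWord, this]
  by_cases ht : t < 2
  swap
  · have : gen q d .e2 ^ t = 0 := by
      rw [← Nat.sub_add_cancel (not_lt.1 ht), pow_add, sq, e2_e2, mul_zero]
    simp [posWord, this]
  refine Submodule.subset_span ⟨(⟨i % d, Nat.mod_lt _ hd⟩, ⟨j % d, Nat.mod_lt _ hd⟩, ⟨r, hr⟩,
    ⟨h, hh⟩, ⟨t, ht⟩), ?_⟩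
  have a1 : gen q d .k1 ^ (i % d) = gen q d .k1 ^ i := by
    conv_rhs => rw [← Nat.mod_add_div i d, pow_add, pow_mul, k1_pow, one_pow, mul_one]
  have a2 : gen q d .k2 ^ (j % d) = gen q d .k2 ^ j := by
    conv_rhs => rw [← Nat.mod_add_div j d, pow_add, pow_mul, k2_pow, one_pow, mul_one]
  simp [posMono, posWord, a1, a2]

theorem posSpan_of_word {a : Ubar q d}
    (ha : ∀ i j r h t : ℕ, a * posWord q d i j r h t ∈ posSpan q d) :
    ∀ x ∈ posSpan q d, a * x ∈ posSpan q d := by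
  intro x hx
  induction hx using Submodule.span_induction with
  | mem x hx => obtain ⟨m, rfl⟩ := hx; exact ha _ _ _ _ _
  | zero => simp
  | add x y _ _ hx hy => rw [mul_add]; exact add_mem hx hy
  | smul c x _ hx => rw [mul_smul_comm]; exact Submodule.smul_mem _ _ hx

theorem k1_mul_mem : ∀ x ∈ posSpan q d, gen q d .k1 * x ∈ posSpan q d :=
  posSpan_of_word fun i j r h t => by
    have := posWord_mem (q := q) (d := d) (i + 1) j r h t
    simpa only [posWord, pow_succ', mul_assoc] using this

theorem k2_mul_mem : ∀ x ∈ posSpan q d, gen q d .k2 * x ∈ posSpan q d :=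
  posSpan_of_word fun i j r h t => by
    have := posWord_mem (q := q) (d := d) i (j + 1) r h t
    obtain ⟨s, hs⟩ := pass_pow (a := gen q d .k2) (b := gen q d .k1) (s := (1 : F)) (by simp) i
    simp only [posWord, pow_succ', mul_assoc] at this ⊢
    rw [hs]
    exact Submodule.smul_mem _ _ this

theorem e1_mul_mem : ∀ x ∈ posSpan q d, gen q d .e1 * x ∈ posSpan q d :=
  posSpan_of_word fun i j r h t => by
    have := posWord_mem (q := q) (d := d) i j (r + 1) h t
    obtain ⟨s, hs⟩ := pass_pow (e1_k1 (q := q) (d := d)) i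
    obtain ⟨s', hs'⟩ := pass_pow (e1_k2 (q := q) (d := d)) j
    simp only [posWord, pow_succ', mul_assoc] at this ⊢
    rw [hs, hs', mul_smul_comm]
    exact Submodule.smul_mem _ _ (Submodule.smul_mem _ _ this)

theorem e3_mul_mem : ∀ x ∈ posSpan q d, e3 q d * x ∈ posSpan q d :=
  posSpan_of_word fun i j r h t => by
    have := posWord_mem (q := q) (d := d) i j r (h + 1) t
    obtain ⟨s, hs⟩ := pass_pow (e3_k1 (q := q) (d := d)) i
    obtain ⟨s', hs'⟩ := pass_pow (e3_k2 (q := q) (d := d)) j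
    obtain ⟨u, hu⟩ := pass_pow (e3_e1 (q := q) (d := d)) r
    simp only [posWord, pow_succ', mul_assoc] at this ⊢
    rw [hs, hs', hu]
    simp only [mul_smul_comm]
    exact Submodule.smul_mem _ _ (Submodule.smul_mem _ _ (Submodule.smul_mem _ _ this))

theorem e2_mul_mem : ∀ x ∈ posSpan q d, gen q d .e2 * x ∈ posSpan q d :=
  posSpan_of_word fun i j r h t => by
    have m1 := posWord_mem (q := q) (d := d) i j r h (t + 1)
    have m2 := posWord_mem (q := q) (d := d) i j (r - 1) (h + 1) t
    obtain ⟨s, hs⟩ := pass_pow (e2_k1 (q := q) (d := d)) i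
    obtain ⟨s', hs'⟩ := pass_pow (a := gen q d .e2) (b := gen q d .k2) (s := (1 : F)) (by simp) j
    obtain ⟨u, u', hu⟩ := e2_e1_pow (q := q) (d := d) r
    obtain ⟨v, hv⟩ := pass_pow (e2_e3 (q := q) (d := d)) h
    simp only [posWord, pow_succ', mul_assoc] at m1 m2 ⊢
    rw [hs, hs', hu, hv]
    simp only [mul_smul_comm, mul_add, smul_add]
    refine add_mem ?_ ?_
    · exact Submodule.smul_mem _ _ (Submodule.smul_mem _ _ (Submodule.smul_mem _ _
        (Submodule.smul_mem _ _ m1)))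
    · exact Submodule.smul_mem _ _ (Submodule.smul_mem _ _ (Submodule.smul_mem _ _ m2))

theorem one_mem_posSpan : (1 : Ubar q d) ∈ posSpan q d := by
  simpa [posWord] using posWord_mem (q := q) (d := d) 0 0 0 0 0

theorem mul_mem_posSpan {x y : Ubar q d} (hx : x ∈ posSpan q d) (hy : y ∈ posSpan q d) :
    x * y ∈ posSpan q d := by
  have pw : ∀ (a : Ubar q d), (∀ x ∈ posSpan q d, a * x ∈ posSpan q d) → ∀ (n : ℕ),
      ∀ x ∈ posSpan q d, a ^ n * x ∈ posSpan q d := by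
    intro a ha n
    induction n with
    | zero => intro x hx; simpa using hx
    | succ n ih => intro x hx; rw [pow_succ, mul_assoc]; exact ih _ (ha _ hx)
  induction hx using Submodule.span_induction with
  | mem x hx =>
    obtain ⟨m, rfl⟩ := hx
    simp only [posMono, posWord, mul_assoc]
    exact pw _ k1_mul_mem _ _ (pw _ k2_mul_mem _ _ (pw _ e1_mul_mem _ _ (pw _ e3_mul_mem _ _
      (pw _ e2_mul_mem _ _ hy))))
  | zero => simp
  | add x z _ _ hx hz => rw [add_mul]; exact add_mem hx hz
  | smul c x _ hx => rw [smul_mul_assoc]; exact Submodule.smul_mem _ _ hx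

end

end Borel

/-- The positive Borel subalgebra `B_q⁺`: the subalgebra of `Ū_q` that is the linear span of the
monomials `k₁ⁱ k₂ʲ e₁ʳ e₃ʰ e₂ᵗ`. -/
def Bplus (q : F) (d : ℕ) [OddRoot q d] : Subalgebra F (Ubar q d) :=
  (Submodule.span F (Set.range (posMono q d))).toSubalgebra one_mem_posSpan
    (fun _ _ => mul_mem_posSpan)

namespace Bplus

variable [OddRoot q d]

theorem mem_iff {x : Ubar q d} : x ∈ Bplus q d ↔ x ∈ posSpan q d := Iff.rfl

instance : Module.Finite F (Bplus q d) :=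
  Module.Finite.iff_fg.2 (Submodule.fg_span (Set.finite_range (posMono q d)))

theorem k1_mem : gen q d .k1 ∈ Bplus q d := by
  simpa [posWord, mem_iff] using posWord_mem (q := q) (d := d) 1 0 0 0 0

theorem k2_mem : gen q d .k2 ∈ Bplus q d := by
  simpa [posWord, mem_iff] using posWord_mem (q := q) (d := d) 0 1 0 0 0

theorem e1_mem : gen q d .e1 ∈ Bplus q d := by
  simpa [posWord, mem_iff] using posWord_mem (q := q) (d := d) 0 0 1 0 0

theorem e2_mem : gen q d .e2 ∈ Bplus q d := by
  simpa [posWord, mem_iff] using posWord_mem (q := q) (d := d) 0 0 0 0 1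

theorem inv_mem {k k' : Ubar q d} (hk : k ∈ Bplus q d) (h : k ^ d = 1) (h1 : k * k' = 1) :
    k' ∈ Bplus q d := by
  have hd := OddRoot.one_lt (q := q) (d := d)
  have : k' = k ^ (d - 1) := by
    calc k' = k ^ (d - 1 + 1) * k' := by rw [Nat.sub_add_cancel (by omega), h, one_mul]
      _ = _ := by rw [pow_succ, mul_assoc, h1, mul_one]
  rw [this]
  exact pow_mem hk _

theorem k1i_mem : gen q d .k1i ∈ Bplus q d := inv_mem k1_mem k1_pow k1_k1i
theorem k2i_mem : gen q d .k2i ∈ Bplus q d := inv_mem k2_mem k2_pow k2_k2i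

theorem le_of_gen {S : Subalgebra F (Ubar q d)} (h1 : gen q d .k1 ∈ S) (h2 : gen q d .k2 ∈ S)
    (h3 : gen q d .e1 ∈ S) (h4 : gen q d .e2 ∈ S) : Bplus q d ≤ S := by
  intro x hx
  rw [mem_iff] at hx
  refine (Submodule.span_le (p := S.toSubmodule)).2 ?_ hx
  rintro _ ⟨m, rfl⟩
  have h5 : e3 q d ∈ S := sub_mem (mul_mem h3 h4) (S.smul_mem (mul_mem h4 h3) _)
  change posMono q d m ∈ S
  exact mul_mem (mul_mem (mul_mem (mul_mem (pow_mem h1 _) (pow_mem h2 _)) (pow_mem h3 _))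
    (pow_mem h5 _)) (pow_mem h4 _)

theorem par_mem : ∀ x ∈ Bplus q d, par q d x ∈ Bplus q d := by
  refine le_of_gen (S := (Bplus q d).comap (par q d)) ?_ ?_ ?_ ?_ <;>
    simp [Gen.sign, k1_mem, k2_mem, e1_mem, e2_mem]

/-- Elements acting on `A` by operators that preserve a subspace. -/
def stab {A M : Type*} [Ring A] [Algebra F A] [AddCommGroup M] [Module F M]
    (φ : A →ₐ[F] Module.End F M) (N : Submodule F M) : Subalgebra F A where
  carrier := {a | ∀ x ∈ N, φ a x ∈ N}
  mul_mem' {a b} ha hb x hx := by rw [map_mul]; exact ha _ (hb _ hx)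
  add_mem' {a b} ha hb x hx := by rw [map_add]; exact add_mem (ha _ hx) (hb _ hx)
  algebraMap_mem' c x hx := by
    rw [AlgHom.commutes]; exact N.smul_mem c hx

theorem antipode_mem [CharZero F] : ∀ x ∈ Bplus q d, antipode q d x ∈ Bplus q d := by
  intro x hx
  have key : Bplus q d ≤ stab (lift _ (antipode_rel (q := q) (d := d)))
      (Subalgebra.toSubmodule (Bplus q d)) := by
    refine le_of_gen ?_ ?_ ?_ ?_ <;> intro x hx <;> rw [lift_gen] <;>
      rw [Subalgebra.mem_toSubmodule] at hx ⊢
    · rw [superRight_even (by simp [antipodeGen, Gen.sign])]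
      exact mul_mem hx k1i_mem
    · rw [superRight_even (by simp [antipodeGen, Gen.sign])]
      exact mul_mem hx k2i_mem
    · rw [superRight_even (by simp [antipodeGen, Gen.sign])]
      exact mul_mem hx (neg_mem (mul_mem k1i_mem e1_mem))
    · rw [superRight_odd (by simp [antipodeGen, Gen.sign])]
      exact mul_mem (par_mem _ hx) (neg_mem (mul_mem k2i_mem e2_mem))
  exact key hx 1 (one_mem (Bplus q d))

/-- The inclusion `B_q⁺ ⊗ B_q⁺ → Ū_q ⊗ Ū_q`. -/
def incl₂ (q : F) (d : ℕ) [OddRoot q d] :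
    Bplus q d ⊗[F] Bplus q d →ₗ[F] Ubar q d ⊗[F] Ubar q d :=
  TensorProduct.map (Bplus q d).val.toLinearMap (Bplus q d).val.toLinearMap

theorem incl₂_injective : Function.Injective (incl₂ q d) :=
  TensorProduct.map_injective_of_flat_flat _ _ Subtype.val_injective Subtype.val_injective

theorem tmul_mem {a b : Ubar q d} (ha : a ∈ Bplus q d) (hb : b ∈ Bplus q d) :
    a ⊗ₜ[F] b ∈ LinearMap.range (incl₂ q d) :=
  ⟨(⟨a, ha⟩ : Bplus q d) ⊗ₜ (⟨b, hb⟩ : Bplus q d), rfl⟩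

theorem comul_mem [CharZero F] : ∀ x ∈ Bplus q d, comul q d x ∈ LinearMap.range (incl₂ q d) := by
  intro x hx
  have ind : ∀ φ : Module.End F (Ubar q d ⊗[F] Ubar q d),
      (∀ x y, x ∈ Bplus q d → y ∈ Bplus q d → φ (x ⊗ₜ y) ∈ LinearMap.range (incl₂ q d)) →
      ∀ t ∈ LinearMap.range (incl₂ q d), φ t ∈ LinearMap.range (incl₂ q d) := by
    rintro φ h _ ⟨t, rfl⟩
    induction t using TensorProduct.induction_on with
    | zero => simp
    | tmul x y => exact h _ _ x.2 y.2
    | add s t hs ht => rw [map_add, map_add]; exact add_mem hs ht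
  have key : Bplus q d ≤ stab (lift _ (comul_rel (q := q) (d := d)))
      (LinearMap.range (incl₂ q d)) := by
    refine le_of_gen ?_ ?_ ?_ ?_ <;> refine ind _ fun x y hx hy => ?_ <;> rw [lift_gen, comulGen]
    · rw [tmulLeft_even _ (by simp [Gen.sign])]
      exact tmul_mem (mul_mem k1_mem hx) (mul_mem k1_mem hy)
    · rw [tmulLeft_even _ (by simp [Gen.sign])]
      exact tmul_mem (mul_mem k2_mem hx) (mul_mem k2_mem hy)
    · rw [map_add, LinearMap.add_apply, tmulLeft_even _ (by simp),
        tmulLeft_even _ (by simp [Gen.sign])]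
      exact add_mem (tmul_mem (mul_mem e1_mem hx) (mul_mem (one_mem _) hy))
        (tmul_mem (mul_mem k1_mem hx) (mul_mem e1_mem hy))
    · rw [map_add, LinearMap.add_apply, tmulLeft_even _ (by simp),
        tmulLeft_odd _ (by simp [Gen.sign])]
      exact add_mem (tmul_mem (mul_mem e2_mem hx) (mul_mem (one_mem _) hy))
        (tmul_mem (mul_mem k2_mem (par_mem _ hx)) (mul_mem e2_mem hy))
  exact key hx _ (tmul_mem (one_mem _) (one_mem _))

variable [CharZero F]

variable (q d) in
/-- `B_q⁺` as a Hopf superalgebra, with the structure restricted from `Ū_q`. -/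
def hopf : HopfSuperData F (Bplus q d) where
  par :=
    { toFun := fun x => ⟨par q d x, par_mem (q := q) (d := d) x.1 x.2⟩
      map_add' := fun x y => by ext; simp
      map_smul' := fun c x => by ext; simp }
  mul := LinearMap.mul' F (Bplus q d)
  one := 1
  comul := (LinearEquiv.ofInjective (incl₂ q d) incl₂_injective).symm.toLinearMap ∘ₗ
    LinearMap.codRestrict (LinearMap.range (incl₂ q d))
      (comul q d ∘ₗ (Bplus q d).val.toLinearMap) (fun x => comul_mem (q := q) (d := d) x.1 x.2)
  counit := (counit q d).toLinearMap ∘ₗ (Bplus q d).val.toLinearMap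
  antipode :=
    { toFun := fun x => ⟨antipode q d x, antipode_mem (q := q) (d := d) x.1 x.2⟩
      map_add' := fun x y => by ext; simp
      map_smul' := fun c x => by ext; simp }

/-- The coproduct of `B_q⁺` is that of `Ū_q`. -/
theorem incl₂_comul (x : Bplus q d) : incl₂ q d ((hopf q d).comul x) = comul q d x := by
  have := (LinearEquiv.ofInjective (incl₂ q d) incl₂_injective).apply_symm_apply
    (LinearMap.codRestrict (LinearMap.range (incl₂ q d))
      (comul q d ∘ₗ (Bplus q d).val.toLinearMap) (fun x => comul_mem (q := q) (d := d) x.1 x.2) x)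
  exact congrArg Subtype.val this

/-- The functional `(k₁ᵛ k₂ᵖ e₁ʳ e₃ʰ e₂ᵗ)*` of the basis dual to the monomial basis `b`,
for `r ∈ {0, 1}`. -/
def star (b : Basis (PosIdx d) F (Bplus q d)) (v p : Fin d) (r h t : Fin 2) :
    Dual F (Bplus q d) :=
  b.coord (v, p, r.castLE (OddRoot.one_lt (q := q)), h, t)

/-- `α_{k₁}` -/
def αk1 (b : Basis (PosIdx d) F (Bplus q d)) : Dual F (Bplus q d) :=
  ∑ v : Fin d, ∑ p : Fin d, q ^ (-2 * (v : ℤ) + p) • star b v p 0 0 0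

/-- `α_{k₂}` -/
def αk2 (b : Basis (PosIdx d) F (Bplus q d)) : Dual F (Bplus q d) :=
  ∑ v : Fin d, ∑ p : Fin d, q ^ (v : ℤ) • star b v p 0 0 0

/-- `α_{e₁}` -/
def αe1 (b : Basis (PosIdx d) F (Bplus q d)) : Dual F (Bplus q d) :=
  (-(q - q⁻¹)⁻¹) • ∑ v : Fin d, ∑ p : Fin d, q ^ (2 * (v : ℤ) - p) • star b v p 1 0 0

/-- `α_{e₂}` -/
def αe2 (b : Basis (PosIdx d) F (Bplus q d)) : Dual F (Bplus q d) :=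
  (q - q⁻¹)⁻¹ • ∑ v : Fin d, ∑ p : Fin d, q ^ (-(v : ℤ)) • star b v p 0 0 1

/-- `α_{e₃}` -/
def αe3 (b : Basis (PosIdx d) F (Bplus q d)) : Dual F (Bplus q d) :=
  (q - q⁻¹)⁻¹ • (∑ v : Fin d, ∑ p : Fin d, q ^ ((v : ℤ) - p) • star b v p 1 0 1 +
    ∑ v : Fin d, ∑ p : Fin d, q ^ ((v : ℤ) - p) • star b v p 0 1 0)

/-- The exponents `(w, s, l, i, j)` with `0 ≤ w, i, j < d` and `s, l ∈ {0, 1}`. -/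
abbrev NegIdx (d : ℕ) : Type := Fin d × Fin 2 × Fin 2 × Fin d × Fin d

/-- The product of the dual Hopf superalgebra `X = ((B_q⁺)ᵒᵖ)*`. -/
def xmul (f g : Dual F (Bplus q d)) : Dual F (Bplus q d) :=
  (hopf q d).dualOp.mul (f ⊗ₜ g)

/-- Powers in `X`. -/
def xpow (f : Dual F (Bplus q d)) (n : ℕ) : Dual F (Bplus q d) :=
  (hopf q d).dualOp.pow f n

/-- The element `α_{e₁}ʷ α_{e₃}ˢ α_{e₂}ˡ α_{k₁}ⁱ α_{k₂}ʲ` of `X`. -/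
def alphaMono (b : Basis (PosIdx d) F (Bplus q d)) : NegIdx d → Dual F (Bplus q d)
  | (w, s, l, i, j) =>
    xmul (xmul (xmul (xmul (xpow (αe1 b) w) (xpow (αe3 b) s)) (xpow (αe2 b) l))
      (xpow (αk1 b) i)) (xpow (αk2 b) j)

end Bplus

end Ubar

end QDouble

end

/-! The proof has a formal half, valid for every finite-dimensional Hopf superalgebra `H` in
characteristic 0 whose antipode is bijective and reverses products and coproducts with Koszul signs,
and a concrete half about `Ū_q` and `B_q⁺`.

Formal half: the double of `H` is a Hopf superalgebra (`double_isHopfSuperalgebra`). Left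
multiplication by `f ⊗ a` is the action of `a` on `X ⊗ H` followed by that of `f`. Each of the two
is a module structure (`act_mul` for `H`), so associativity reduces to `(1 ⊗ a)((g ⊗ 1) z) = ((1 ⊗
a)(g ⊗ 1)) z`, which is `act_lmul`: both sides are the same expression in five legs of `a`. Because
`f ⊗ a = (f ⊗ 1)(1 ⊗ a)`, multiplicativity of the coproduct reduces to the product `(1 ⊗ a)(g ⊗ 1)`;
there six legs of `a` occur and the two innermost cancel through `S⁻¹` (`comul_straighten`). All
signs are handled by splitting vectors into homogeneous parts; what remains are polynomial
identities in degrees over `ZMod 2`.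

Concrete half. The Hopf laws of `Ū_q` spread from the generators to products, and `B_q⁺` inherits
them through its inclusion. The dual `X` acts on `B_q⁺` by the transposes `pd g` of left
multiplication, faithfully because `ε ∘ pd g = g`. The functionals `α` are characters and skew
derivations. They are first constructed, as `chr1`, `chr2`, `der1`, `der2`, from matrix coefficients
of the three-dimensional vector representation, hence without knowing that the monomials of `B_q⁺`
are independent. Their operators act on monomials by explicit rescaling and lowering formulas, and a
subspace stable under them on which `ε` vanishes contains no nontrivial combination of monomials
(`coeff_eq_zero_of_mem`). Applied to the zero subspace this gives the monomial basis. Applied to the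
annihilator of the span of the `α`-monomials it shows that these span `X` (`span_alphaMono`), and a
count makes them a basis.

The operators of the `α` satisfy, in reversed order, the relations of `k₁, k₂, f₁, f₂`
(`negRel_op`). Let `φ` send each `α`-monomial to the corresponding word in the `f` and `k`. Its
graph is the span of the ordered words in the pairs formed by an operator and its counterpart in
`Ū_q`; these pairs satisfy the same relations, so the span is closed under products
(`NegRel.mul_mem`). Hence `φ` is multiplicative, and no presentation of `X` is required.

Finally `χ (f ⊗ a) = φ(f) a`. It is multiplicative as soon as it sends `(1 ⊗ a)(g ⊗ 1)` to `a φ(g)`,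
the property `Exch`. This property is stable under products in `a` and in `g`, so it suffices to
treat `k₁, k₂, e₁, e₂` against the four generators of `X`; there it reduces to the mixed defining
relations of `Ū_q` (`IsPrim.straighten_e_skew`). Gradings, counits and coproducts are compared on
generators, antipodes are respected by uniqueness of convolution inverses, and `χ` is onto since its
range contains every generator. -/

noncomputable section

namespace QDouble

open TensorProduct Module

/-! ### Koszul signs and homogeneous tensors -/

section Homogeneous

variable {F : Type*} [Field F]
variable {V : Type*} [AddCommGroup V] [Module F V]
variable {W : Type*} [AddCommGroup W] [Module F W]
variable {V' : Type*} [AddCommGroup V'] [Module F V']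
variable {W' : Type*} [AddCommGroup W'] [Module F W']

variable (F) in
/-- The sign `(-1)ⁱ`. -/
def sg (i : ZMod 2) : F := (-1) ^ i.val

@[simp] theorem sg_zero : sg F 0 = 1 := by simp [sg]

@[simp] theorem sg_one : sg F 1 = -1 := by simp [sg, show (1 : ZMod 2).val = 1 from rfl]

theorem zmod_two_cases (i : ZMod 2) : i = 0 ∨ i = 1 := by
  revert i; decide

theorem sg_add (i j : ZMod 2) : sg F (i + j) = sg F i * sg F j := by
  rcases zmod_two_cases i with rfl | rfl <;> rcases zmod_two_cases j with rfl | rfl <;>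
    simp [show (1 + 1 : ZMod 2) = 0 from rfl]

@[simp] theorem sg_mul_self (i : ZMod 2) : sg F i * sg F i = 1 := by
  rcases zmod_two_cases i with rfl | rfl <;> simp

theorem zmod_two_two : (2 : ZMod 2) = 0 := rfl

theorem sg_smul_sg_smul (i j : ZMod 2) (v : V) : sg F i • sg F j • v = sg F (i + j) • v := by
  rw [smul_smul, sg_add]

/-- `v` is homogeneous of degree `i` for the grading given by the involution `P`. -/
def IsHomog (P : V →ₗ[F] V) (i : ZMod 2) (v : V) : Prop := P v = sg F i • v

theorem isHomog_zero_iff {P : V →ₗ[F] V} {v : V} : IsHomog P 0 v ↔ P v = v := by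
  simp [IsHomog]

theorem isHomog_one_iff {P : V →ₗ[F] V} {v : V} : IsHomog P 1 v ↔ P v = -v := by
  simp [IsHomog]

theorem IsHomog.tmul {P : V →ₗ[F] V} {Q : W →ₗ[F] W} {i j : ZMod 2} {v : V} {w : W}
    (hv : IsHomog P i v) (hw : IsHomog Q j w) :
    IsHomog (TensorProduct.map P Q) (i + j) (v ⊗ₜ[F] w) := by
  unfold IsHomog at *
  rw [TensorProduct.map_tmul, hv, hw, smul_tmul_smul, sg_add]

theorem IsHomog.map {P : V →ₗ[F] V} {Q : W →ₗ[F] W} {i : ZMod 2} {v : V} {f : V →ₗ[F] W}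
    (hv : IsHomog P i v) (hf : f ∘ₗ P = Q ∘ₗ f) : IsHomog Q i (f v) := by
  have := LinearMap.congr_fun hf v
  unfold IsHomog at *
  rw [LinearMap.comp_apply, LinearMap.comp_apply, hv, map_smul] at this
  exact this.symm

theorem IsHomog.smul {P : V →ₗ[F] V} {i : ZMod 2} {v : V} (hv : IsHomog P i v) (c : F) :
    IsHomog P i (c • v) := by
  unfold IsHomog at *
  rw [map_smul, hv, smul_comm]

theorem IsHomog.add {P : V →ₗ[F] V} {i : ZMod 2} {v w : V} (hv : IsHomog P i v)
    (hw : IsHomog P i w) : IsHomog P i (v + w) := by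
  unfold IsHomog at *
  rw [map_add, hv, hw, smul_add]

theorem IsHomog.neg {P : V →ₗ[F] V} {i : ZMod 2} {v : V} (hv : IsHomog P i v) :
    IsHomog P i (-v) := by
  unfold IsHomog at *
  rw [map_neg, hv, smul_neg]

variable [CharZero F]

/-- This recovers the usual sign rule from the operator form. Signs become exponents in `ZMod 2`, so
that sign identities turn into polynomial identities over that ring. -/
theorem koszul_homog {P : V →ₗ[F] V} {Q : W →ₗ[F] W} {i j : ZMod 2} {v : V} {w : W}
    (hv : IsHomog P i v) (hw : IsHomog Q j w) :
    koszul P Q (v ⊗ₜ w) = sg F (i * j) • (v ⊗ₜ[F] w) := by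
  unfold IsHomog at *
  rcases zmod_two_cases i with rfl | rfl
  · rw [koszul_even_left _ _ (by simpa using hv)]; simp
  · rw [koszul_odd_left _ _ (by simpa using hv), hw, tmul_smul, one_mul]

-- As 2 is invertible, `v = (v + P v)/2 + (v - P v)/2` splits a vector into an even and an odd one.
-- Linear identities with signs are reduced to homogeneous arguments in this way.
@[elab_as_elim] theorem homog_induction {P : V →ₗ[F] V} (hP : P ∘ₗ P = LinearMap.id) {p : V → Prop}
    (add : ∀ v w, p v → p w → p (v + w)) (homog : ∀ i v, IsHomog P i v → p v) (v : V) : p v := by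
  have h' : ∀ v, P (P v) = v := fun v => LinearMap.congr_fun hP v
  have e : v = (1 / 2 : F) • (v + P v) + (1 / 2 : F) • (v - P v) := by
    rw [← smul_add, add_add_sub_cancel, ← two_smul F v, smul_smul]; norm_num
  rw [e]
  refine add _ _ (homog 0 _ ?_) (homog 1 _ ?_)
  · rw [isHomog_zero_iff]; simp [h', add_comm]
  · rw [isHomog_one_iff]; simp [h', ← smul_neg]

@[elab_as_elim] theorem tmul_homog_induction {P : V →ₗ[F] V} {Q : W →ₗ[F] W} (hP : P ∘ₗ P = LinearMap.id)
    (hQ : Q ∘ₗ Q = LinearMap.id) {p : V ⊗[F] W → Prop}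
    (add : ∀ s t, p s → p t → p (s + t))
    (homog : ∀ i v j w, IsHomog P i v → IsHomog Q j w → p (v ⊗ₜ w)) (t : V ⊗[F] W) : p t := by
  induction t using TensorProduct.induction_on with
  | zero => simpa using homog 0 0 0 0 (by simp [IsHomog]) (by simp [IsHomog])
  | add s t hs ht => exact add s t hs ht
  | tmul v w =>
    refine homog_induction hP (p := fun v => p (v ⊗ₜ w)) (fun a b ha hb => ?_) (fun i v hv => ?_) v
    · rw [add_tmul]; exact add _ _ ha hb
    · refine homog_induction hQ (p := fun w => p (v ⊗ₜ w)) (fun a b ha hb => ?_)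
        (fun j w hw => homog i v j w hv hw) w
      rw [tmul_add]; exact add _ _ ha hb

@[elab_as_elim] theorem tmul_homog_induction₃ {P : V →ₗ[F] V} {Q : W →ₗ[F] W} {R : V' →ₗ[F] V'}
    (hP : P ∘ₗ P = LinearMap.id) (hQ : Q ∘ₗ Q = LinearMap.id) (hR : R ∘ₗ R = LinearMap.id)
    {p : (V ⊗[F] W) ⊗[F] V' → Prop}
    (add : ∀ s t, p s → p t → p (s + t))
    (homog : ∀ i v j w k u, IsHomog P i v → IsHomog Q j w → IsHomog R k u →
      p ((v ⊗ₜ w) ⊗ₜ u)) (t : (V ⊗[F] W) ⊗[F] V') : p t := by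
  induction t using TensorProduct.induction_on with
  | zero => simpa using homog 0 0 0 0 0 0 (by simp [IsHomog]) (by simp [IsHomog]) (by simp [IsHomog])
  | add s t hs ht => exact add s t hs ht
  | tmul s u =>
    refine tmul_homog_induction hP hQ (p := fun s => p (s ⊗ₜ u)) (fun a b ha hb => ?_)
      (fun i v j w hv hw => ?_) s
    · rw [add_tmul]; exact add _ _ ha hb
    · refine homog_induction hR (p := fun u => p ((v ⊗ₜ w) ⊗ₜ u)) (fun a b ha hb => ?_)
        (fun k u hu => homog i v j w k u hv hw hu) u
      rw [tmul_add]; exact add _ _ ha hb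

theorem koszul_koszul {P : V →ₗ[F] V} {Q : W →ₗ[F] W} (hP : P ∘ₗ P = LinearMap.id)
    (hQ : Q ∘ₗ Q = LinearMap.id) (t : V ⊗[F] W) : koszul P Q (koszul P Q t) = t := by
  refine tmul_homog_induction hP hQ (fun s t hs ht => by rw [map_add, map_add, hs, ht])
    (fun i v j w hv hw => ?_) t
  rw [koszul_homog hv hw, map_smul, koszul_homog hv hw, smul_smul, sg_mul_self, one_smul]

omit [CharZero F] in
-- Naturality for parity-preserving maps: a Koszul sign can be moved past coproducts, antipodes and
-- inclusions.
theorem koszul_map {P : V →ₗ[F] V} {Q : W →ₗ[F] W} {P' : V' →ₗ[F] V'} {Q' : W' →ₗ[F] W'}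
    {A : V →ₗ[F] V'} {B : W →ₗ[F] W'} (hA : A ∘ₗ P = P' ∘ₗ A) (hB : B ∘ₗ Q = Q' ∘ₗ B)
    (t : V ⊗[F] W) : koszul P' Q' (TensorProduct.map A B t) = TensorProduct.map A B (koszul P Q t) := by
  have hA' : ∀ v, A (P v) = P' (A v) := fun v => LinearMap.congr_fun hA v
  have hB' : ∀ v, B (Q v) = Q' (B v) := fun v => LinearMap.congr_fun hB v
  induction t using TensorProduct.induction_on with
  | zero => simp
  | add s t hs ht => rw [map_add, map_add, map_add, map_add, hs, ht]
  | tmul v w => simp [koszul, hA', hB']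

/-- The product `(a ⊗ b) (x ⊗ y) = (-1)^{|b||x|} a x ⊗ b y` on the tensor product of two
superalgebras. -/
def superMul (P : V →ₗ[F] V) (m : V ⊗[F] V →ₗ[F] V) (Q : W →ₗ[F] W) (n : W ⊗[F] W →ₗ[F] W) :
    (V ⊗[F] W) ⊗[F] (V ⊗[F] W) →ₗ[F] V ⊗[F] W :=
  TensorProduct.map m n ∘ₗ (tensorTensorTensorComm F V W V W).toLinearMap ∘ₗ
    koszul (TensorProduct.map LinearMap.id Q) (TensorProduct.map P LinearMap.id)

omit [CharZero F] in
theorem superTensorMul_eq (P : V →ₗ[F] V) (m : V ⊗[F] V →ₗ[F] V) :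
    superTensorMul P m = superMul P m P m := rfl

variable {P : V →ₗ[F] V} {m : V ⊗[F] V →ₗ[F] V} {Q : W →ₗ[F] W} {n : W ⊗[F] W →ₗ[F] W}

theorem superMul_homog {i j : ZMod 2} (a : V) {b : W} {x : V} (y : W) (hb : IsHomog Q j b)
    (hx : IsHomog P i x) : superMul P m Q n ((a ⊗ₜ b) ⊗ₜ (x ⊗ₜ y)) =
      sg F (j * i) • (m (a ⊗ₜ x) ⊗ₜ[F] n (b ⊗ₜ y)) := by
  have h1 : IsHomog (TensorProduct.map LinearMap.id Q) j (a ⊗ₜ[F] b) := by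
    unfold IsHomog at *; simp [hb]
  have h2 : IsHomog (TensorProduct.map P LinearMap.id) i (x ⊗ₜ[F] y) := by
    unfold IsHomog at *; simp [hx, smul_tmul']
  simp [superMul, koszul_homog h1 h2]

omit [CharZero F] in
theorem IsHomog.mul {i j : ZMod 2} {a b : V} (hm : P ∘ₗ m = m ∘ₗ TensorProduct.map P P)
    (ha : IsHomog P i a) (hb : IsHomog P j b) : IsHomog P (i + j) (m (a ⊗ₜ b)) :=
  (ha.tmul hb).map hm.symm

/-- One bracketing has the exponent `j i' + (j + j') i''`, the other `j' i'' + j (i' + i'')`; these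
are equal, and the rest is associativity in each factor. -/
theorem superMul_assoc (hP : P ∘ₗ P = LinearMap.id) (hQ : Q ∘ₗ Q = LinearMap.id)
    (hPm : P ∘ₗ m = m ∘ₗ TensorProduct.map P P) (hQn : Q ∘ₗ n = n ∘ₗ TensorProduct.map Q Q)
    (hm : ∀ a b c, m (m (a ⊗ₜ b) ⊗ₜ c) = m (a ⊗ₜ m (b ⊗ₜ c)))
    (hn : ∀ a b c, n (n (a ⊗ₜ b) ⊗ₜ c) = n (a ⊗ₜ n (b ⊗ₜ c))) (s t u : V ⊗[F] W) :
    superMul P m Q n (superMul P m Q n (s ⊗ₜ t) ⊗ₜ u) =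
      superMul P m Q n (s ⊗ₜ superMul P m Q n (t ⊗ₜ u)) := by
  refine tmul_homog_induction hP hQ (fun s s' h h' => by
    simp only [add_tmul, map_add, h, h']) (fun i a j b ha hb => ?_) s
  refine tmul_homog_induction hP hQ (fun s s' h h' => by
    simp only [add_tmul, tmul_add, map_add, h, h']) (fun i' a' j' b' ha' hb' => ?_) t
  refine tmul_homog_induction hP hQ (fun s s' h h' => by
    simp only [tmul_add, map_add, h, h']) (fun i'' a'' j'' b'' ha'' hb'' => ?_) u
  rw [superMul_homog _ _ hb ha', superMul_homog _ _ hb' ha'', tmul_smul, ← smul_tmul', map_smul,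
    map_smul, superMul_homog _ _ (hb.mul hQn hb') ha'', superMul_homog _ _ hb (ha'.mul hPm ha''),
    hm, hn, sg_smul_sg_smul, sg_smul_sg_smul]
  congr 2; ring

theorem superMul_even (hPm : P ∘ₗ m = m ∘ₗ TensorProduct.map P P)
    (hQn : Q ∘ₗ n = n ∘ₗ TensorProduct.map Q Q) (hP : P ∘ₗ P = LinearMap.id)
    (hQ : Q ∘ₗ Q = LinearMap.id) :
    TensorProduct.map P Q ∘ₗ superMul P m Q n =
      superMul P m Q n ∘ₗ TensorProduct.map (TensorProduct.map P Q) (TensorProduct.map P Q) := by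
  refine TensorProduct.ext' fun s t => ?_
  refine tmul_homog_induction hP hQ (fun s s' h h' => by
    simp only [add_tmul, map_add, h, h']) (fun i a j b ha hb => ?_) s
  refine tmul_homog_induction hP hQ (fun s s' h h' => by
    simp only [tmul_add, map_add, h, h']) (fun i' a' j' b' ha' hb' => ?_) t
  have h1 := (ha.mul hPm ha').tmul (hb.mul hQn hb')
  have h2 := ha.tmul hb
  have h3 := ha'.tmul hb'
  unfold IsHomog at h1 h2 h3
  simp only [LinearMap.comp_apply, TensorProduct.map_tmul (f := TensorProduct.map P Q)]
  rw [h2, h3, smul_tmul_smul, map_smul, superMul_homog _ _ hb ha', map_smul, h1]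
  simp only [smul_smul, ← sg_add]
  congr 2; ring

/-- Even algebra maps `A`, `B` give a map of superalgebras `A ⊗ B`. -/
theorem superMul_map {P' : V' →ₗ[F] V'} {m' : V' ⊗[F] V' →ₗ[F] V'} {Q' : W' →ₗ[F] W'}
    {n' : W' ⊗[F] W' →ₗ[F] W'} {A : V →ₗ[F] V'} {B : W →ₗ[F] W'}
    (hP : P ∘ₗ P = LinearMap.id) (hQ : Q ∘ₗ Q = LinearMap.id)
    (hA : A ∘ₗ P = P' ∘ₗ A) (hB : B ∘ₗ Q = Q' ∘ₗ B)
    (hAm : ∀ a b, A (m (a ⊗ₜ b)) = m' (A a ⊗ₜ A b)) (hBn : ∀ a b, B (n (a ⊗ₜ b)) = n' (B a ⊗ₜ B b))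
    (s t : V ⊗[F] W) : TensorProduct.map A B (superMul P m Q n (s ⊗ₜ t)) =
      superMul P' m' Q' n' (TensorProduct.map A B s ⊗ₜ TensorProduct.map A B t) := by
  refine tmul_homog_induction hP hQ (fun s s' h h' => by
    simp only [add_tmul, map_add, h, h']) (fun i a j b ha hb => ?_) s
  refine tmul_homog_induction hP hQ (fun s s' h h' => by
    simp only [tmul_add, map_add, h, h']) (fun i' a' j' b' ha' hb' => ?_) t
  rw [superMul_homog _ _ hb ha', map_smul, TensorProduct.map_tmul, TensorProduct.map_tmul,
    TensorProduct.map_tmul, superMul_homog _ _ (hb.map hB) (ha'.map hA), hAm, hBn]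

theorem superMul_tensorAssoc {U : Type*} [AddCommGroup U] [Module F U] {R : U →ₗ[F] U}
    {l : U ⊗[F] U →ₗ[F] U}
    (hP : P ∘ₗ P = LinearMap.id) (hQ : Q ∘ₗ Q = LinearMap.id) (hR : R ∘ₗ R = LinearMap.id)
    (s t : (V ⊗[F] W) ⊗[F] U) :
    TensorProduct.assoc F V W U (superMul (TensorProduct.map P Q) (superMul P m Q n) R l (s ⊗ₜ t)) =
      superMul P m (TensorProduct.map Q R) (superMul Q n R l)
        (TensorProduct.assoc F V W U s ⊗ₜ TensorProduct.assoc F V W U t) := by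
  refine tmul_homog_induction₃ hP hQ hR (fun s s' h h' => by
    simp only [add_tmul, map_add, h, h']) (fun i a j b k c ha hb hc => ?_) s
  refine tmul_homog_induction₃ hP hQ hR (fun s s' h h' => by
    simp only [tmul_add, map_add, h, h']) (fun i' a' j' b' k' c' ha' hb' hc' => ?_) t
  rw [superMul_homog _ _ hc (ha'.tmul hb'), superMul_homog _ _ hb ha', assoc_tmul, assoc_tmul,
    superMul_homog _ _ (hb.tmul hc) ha', superMul_homog _ _ hc hb', map_smul, ← smul_tmul',
    map_smul, assoc_tmul, tmul_smul, sg_smul_sg_smul, sg_smul_sg_smul]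
  congr 2; ring

end Homogeneous

end QDouble

end

/-! ### The dual Hopf superalgebra `(Hᵒᵖ)*` -/

noncomputable section

set_option linter.unusedSectionVars false

namespace QDouble

open TensorProduct Module

namespace HopfSuperData

variable {F : Type*} [Field F]
variable {V : Type*} [AddCommGroup V] [Module F V]
variable {W : Type*} [AddCommGroup W] [Module F W]
variable {U : Type*} [AddCommGroup U] [Module F U]

/-- Evaluation of the first factor of `V* ⊗ W` at a vector. -/
def ev (t : Dual F V ⊗[F] W) (x : V) : W := dualTensorHom F V W t x

@[simp] theorem ev_tmul (f : Dual F V) (w : W) (x : V) : ev (f ⊗ₜ[F] w) x = f x • w := by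
  simp [ev]

@[simp] theorem ev_add (s t : Dual F V ⊗[F] W) (x : V) : ev (s + t) x = ev s x + ev t x := by
  simp [ev]

@[simp] theorem ev_smul (c : F) (t : Dual F V ⊗[F] W) (x : V) : ev (c • t) x = c • ev t x := by
  simp [ev]

@[simp] theorem ev_zero (x : V) : ev (0 : Dual F V ⊗[F] W) x = 0 := by
  simp [ev]

@[simp] theorem ev_arg_add (t : Dual F V ⊗[F] W) (x y : V) : ev t (x + y) = ev t x + ev t y := by
  simp [ev]

@[simp] theorem ev_arg_smul (t : Dual F V ⊗[F] W) (c : F) (x : V) : ev t (c • x) = c • ev t x := by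
  simp [ev]

/-- For finite-dimensional `V` an element of `V* ⊗ W` is the same as a linear map `V → W`.
Identities in the dual and in the double are proved by evaluating the dual factors. -/
theorem ev_ext [Module.Finite F V] {s t : Dual F V ⊗[F] W} (h : ∀ x, ev s x = ev t x) : s = t := by
  apply (dualTensorHomEquiv F V W).injective
  ext x
  simpa [ev] using h x

theorem ev_map (A : V →ₗ[F] U) (B : W →ₗ[F] W) (t : Dual F U ⊗[F] W) (x : V) :
    ev (TensorProduct.map (Dual.transpose (R := F) A) B t) x = B (ev t (A x)) := by
  induction t using TensorProduct.induction_on with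
  | zero => simp
  | add s t hs ht => simp [hs, ht]
  | tmul f w => simp [Dual.transpose_apply]

theorem dualDistrib_eq_ev (t : Dual F V ⊗[F] Dual F W) (x : V) (y : W) :
    dualDistrib F V W t (x ⊗ₜ y) = ev t x y := by
  induction t using TensorProduct.induction_on with
  | zero => simp
  | add s t hs ht => simp [hs, ht]
  | tmul f w => simp

theorem dualDistrib_map (A : V →ₗ[F] V) (B : W →ₗ[F] W) (t : Dual F V ⊗[F] Dual F W)
    (s : V ⊗[F] W) :
    dualDistrib F V W (TensorProduct.map (Dual.transpose (R := F) A) (Dual.transpose (R := F) B) t) s =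
      dualDistrib F V W t (TensorProduct.map A B s) := by
  induction s using TensorProduct.induction_on with
  | zero => simp
  | add s t hs ht => simp [hs, ht]
  | tmul x y =>
    rw [dualDistrib_eq_ev, TensorProduct.map_tmul, dualDistrib_eq_ev, ev_map]; rfl

variable (H : HopfSuperData F V)

/-- The grading of the dual is the transpose of the grading of `V`, so a Koszul sign on the
functionals may be put on their arguments instead. -/
theorem dualDistrib_koszul (t : Dual F V ⊗[F] Dual F V) (s : V ⊗[F] V) :
    dualDistrib F V V (koszul H.dualPar H.dualPar t) s = dualDistrib F V V t (koszul H.par H.par s) := by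
  have e : LinearMap.id - H.dualPar = Dual.transpose (R := F) (LinearMap.id - H.par) := by
    ext f x; simp [dualPar, Dual.transpose_apply]
  have e' : koszul H.dualPar H.dualPar t = t - (1 / 2 : F) • TensorProduct.map
      (Dual.transpose (R := F) (LinearMap.id - H.par))
      (Dual.transpose (R := F) (LinearMap.id - H.par)) t := by
    rw [← e]; rfl
  have e'' : koszul H.par H.par s = s - (1 / 2 : F) • TensorProduct.map
      (LinearMap.id - H.par) (LinearMap.id - H.par) s := rfl
  rw [e', e'', map_sub, map_smul, LinearMap.sub_apply, LinearMap.smul_apply, dualDistrib_map,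
    map_sub, map_smul]

theorem isHomog_dual {i : ZMod 2} {f : Dual F V} (hf : IsHomog H.dualPar i f) (x : V) :
    f (H.par x) = sg F i * f x := by
  have := LinearMap.congr_fun hf x
  simpa [dualPar, Dual.transpose_apply] using this

section

variable [CharZero F]

/-- Computing `f (H.par x)` in two ways gives `(sg i - sg j) * f x = 0`. In practice this allows the
degree of a functional in a sign exponent to be replaced by the degree of its argument. -/
theorem dual_apply_eq_zero {i j : ZMod 2} {f : Dual F V} {x : V} (hf : IsHomog H.dualPar i f)
    (hx : IsHomog H.par j x) (hij : i ≠ j) : f x = 0 := by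
  have h1 := H.isHomog_dual hf x
  unfold IsHomog at hx
  rw [hx, map_smul, smul_eq_mul] at h1
  have h2 : sg F i ≠ sg F j := by
    rcases zmod_two_cases i with rfl | rfl <;> rcases zmod_two_cases j with rfl | rfl <;>
      simp at hij ⊢
    · intro h; have : (2 : F) = 0 := by linear_combination h
      norm_num at this
    · intro h; have : (2 : F) = 0 := by linear_combination -h
      norm_num at this
  have h3 : (sg F i - sg F j) * f x = 0 := by rw [sub_mul, h1, sub_self]
  exact (mul_eq_zero.1 h3).resolve_left (sub_ne_zero.2 h2)

end

variable [Module.Finite F V]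

theorem dualOp_mul_apply (f g : Dual F V) (x : V) : H.dualOp.mul (f ⊗ₜ g) x =
    dualDistrib F V V (f ⊗ₜ g) (koszul H.par H.par (H.comul x)) := by
  rw [← dualDistrib_koszul]; rfl

theorem dualOp_mul_apply' (t : Dual F V ⊗[F] Dual F V) (x : V) : H.dualOp.mul t x =
    dualDistrib F V V t (koszul H.par H.par (H.comul x)) := by
  rw [← dualDistrib_koszul]; rfl

variable {H} [CharZero F]

/-- Two Koszul signs cancel, one from `λ⁻¹` and one from the opposite product, which leaves an
unsigned formula. -/
theorem dualDistrib_dualOp_comul (hP : H.par ∘ₗ H.par = LinearMap.id) (f : Dual F V)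
    (s : V ⊗[F] V) : dualDistrib F V V (H.dualOp.comul f) s =
      f (H.mul (TensorProduct.comm F V V s)) := by
  change dualDistrib F V V (koszul H.dualPar H.dualPar ((dualDistribEquiv F V V).symm
    (Dual.transpose (R := F) H.mulOp f))) s = _
  rw [dualDistrib_koszul]
  have : ∀ u, dualDistrib F V V ((dualDistribEquiv F V V).symm u) = u := fun u =>
    (dualDistribEquiv F V V).apply_symm_apply u
  rw [this, Dual.transpose_apply, LinearMap.comp_apply, mulOp]
  simp only [LinearMap.comp_apply, koszul_koszul hP hP]
  rfl

theorem ev_dualOp_comul (hP : H.par ∘ₗ H.par = LinearMap.id) (f : Dual F V) (x y : V) :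
    ev (H.dualOp.comul f) x y = f (H.mul (y ⊗ₜ x)) := by
  rw [← dualDistrib_eq_ev, dualDistrib_dualOp_comul hP]; simp

theorem dualDistrib_ext {s t : Dual F V ⊗[F] Dual F V}
    (h : ∀ x y, ev s x y = ev t x y) : s = t :=
  ev_ext fun x => LinearMap.ext fun y => h x y

/-- The antipode reverses products: `S(±ba) = S(a) S(b)`. -/
def AntipodeAnti (H : HopfSuperData F V) : Prop :=
  ∀ a b, H.antipode (H.mulOp (a ⊗ₜ b)) = H.mul (H.antipode a ⊗ₜ H.antipode b)

/-- The antipode reverses coproducts: `Δ(S(a)) = ∑ ± S(a₂) ⊗ S(a₁)`. -/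
def AntipodeCoanti (H : HopfSuperData F V) : Prop :=
  ∀ a, H.comul (H.antipode a) = TensorProduct.comm F V V
    (koszul H.par H.par (TensorProduct.map H.antipode H.antipode (H.comul a)))

section Inverse

variable (hS : Function.Bijective H.antipode)

omit [Module.Finite F V] [CharZero F]

include hS in
theorem isUnit_antipode : IsUnit (H.antipode : Module.End F V) :=
  (Module.End.isUnit_iff _).2 hS

include hS in
theorem antipodeInv_antipode (x : V) : H.antipodeInv (H.antipode x) = x :=
  LinearMap.congr_fun (Ring.inverse_mul_cancel (M₀ := Module.End F V) _ (isUnit_antipode hS)) x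

include hS in
theorem antipode_antipodeInv (x : V) : H.antipode (H.antipodeInv x) = x :=
  LinearMap.congr_fun (Ring.mul_inverse_cancel (M₀ := Module.End F V) _ (isUnit_antipode hS)) x

include hS in
theorem par_antipodeInv (hH : H.IsHopfSuperalgebra) :
    H.antipodeInv ∘ₗ H.par = H.par ∘ₗ H.antipodeInv := by
  ext x
  apply hS.1
  have := LinearMap.congr_fun hH.par_antipode (H.antipodeInv x)
  simp only [LinearMap.comp_apply, antipode_antipodeInv hS] at this ⊢
  exact this.symm

theorem mulOp_homog [CharZero F] {i j : ZMod 2} {a b : V} (ha : IsHomog H.par i a)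
    (hb : IsHomog H.par j b) : H.mulOp (a ⊗ₜ b) = sg F (i * j) • H.mul (b ⊗ₜ a) := by
  simp [mulOp, koszul_homog ha hb]

theorem antipode_one (hH : H.IsHopfSuperalgebra) : H.antipode H.one = H.one := by
  have := hH.antipode_left H.one
  rw [hH.comul_one, TensorProduct.map_tmul, LinearMap.id_apply, hH.mul_one, hH.counit_one,
    one_smul] at this
  exact this

include hS in
theorem antipodeInv_one (hH : H.IsHopfSuperalgebra) : H.antipodeInv H.one = H.one := by
  conv_lhs => rw [← antipode_one hH]
  exact antipodeInv_antipode hS _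

include hS in
theorem antipodeInv_mulOp (ha : H.AntipodeAnti) (a b : V) :
    H.antipodeInv (H.mul (a ⊗ₜ b)) = H.mulOp (H.antipodeInv a ⊗ₜ H.antipodeInv b) := by
  apply hS.1
  rw [antipode_antipodeInv hS, ha, antipode_antipodeInv hS, antipode_antipodeInv hS]

include hS in
theorem antipodeInv_mul_homog [CharZero F] (hH : H.IsHopfSuperalgebra) (han : H.AntipodeAnti)
    {i j : ZMod 2} {a b : V} (ha : IsHomog H.par i a) (hb : IsHomog H.par j b) :
    H.antipodeInv (H.mul (a ⊗ₜ b)) =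
      sg F (i * j) • H.mul (H.antipodeInv b ⊗ₜ H.antipodeInv a) := by
  rw [antipodeInv_mulOp hS han, mulOp_homog (ha.map (par_antipodeInv hS hH))
    (hb.map (par_antipodeInv hS hH))]

include hS in
-- The reversal law of `S` at `S⁻¹(a)` expresses `Δ a` through `Δ(S⁻¹(a))`. Inverting it applies the
-- graded flip a second time, and the two signs cancel.
theorem comul_antipodeInv [CharZero F] (hH : H.IsHopfSuperalgebra) (han : H.AntipodeCoanti) (a : V) :
    H.comul (H.antipodeInv a) = TensorProduct.comm F V V
      (koszul H.par H.par (TensorProduct.map H.antipodeInv H.antipodeInv (H.comul a))) := by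
  have h := han (H.antipodeInv a)
  rw [antipode_antipodeInv hS] at h
  rw [h]
  generalize H.comul (H.antipodeInv a) = t
  refine tmul_homog_induction hH.par_par hH.par_par (fun s t h h' => by
    simp only [map_add, ← h, ← h']) (fun i x j y hx hy => ?_) t
  have hS' := hH.par_antipode
  have hx' := hx.map hS'
  have hy' := hy.map hS'
  rw [TensorProduct.map_tmul, koszul_homog hx' hy', map_smul, comm_tmul, map_smul,
    TensorProduct.map_tmul, antipodeInv_antipode hS, antipodeInv_antipode hS, map_smul,
    koszul_homog hy hx, map_smul, map_smul, comm_tmul, smul_smul, mul_comm j, sg_mul_self, one_smul]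

theorem antipode_mulOp' (han : H.AntipodeAnti) (t : V ⊗[F] V) :
    H.antipode (H.mulOp t) = H.mul (TensorProduct.map H.antipode H.antipode t) := by
  induction t using TensorProduct.induction_on with
  | zero => simp
  | add s t hs ht => simp [hs, ht]
  | tmul a b => exact han a b

include hS in
-- `S` turns the opposite product into the product and cancels `S⁻¹`; what remains is the antipode
-- law of the other side, for `∑ x' S(x'')`.
theorem mulOp_antipodeInv_left (hH : H.IsHopfSuperalgebra) (han : H.AntipodeAnti) (x : V) :
    H.mulOp (TensorProduct.map H.antipodeInv LinearMap.id (H.comul x)) = H.counit x • H.one := by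
  apply hS.1
  rw [antipode_mulOp' han, ← LinearMap.comp_apply (TensorProduct.map _ _),
    ← TensorProduct.map_comp, map_smul,
    antipode_one hH, ← hH.antipode_right]
  congr 2
  congr 1
  ext x; exact antipode_antipodeInv hS x

include hS in
theorem mulOp_antipodeInv_right (hH : H.IsHopfSuperalgebra) (han : H.AntipodeAnti) (x : V) :
    H.mulOp (TensorProduct.map LinearMap.id H.antipodeInv (H.comul x)) = H.counit x • H.one := by
  apply hS.1
  rw [antipode_mulOp' han, ← LinearMap.comp_apply (TensorProduct.map _ _),
    ← TensorProduct.map_comp, map_smul,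
    antipode_one hH, ← hH.antipode_left]
  congr 2
  congr 1
  ext x; exact antipode_antipodeInv hS x

end Inverse

section DualHopf

variable (hH : H.IsHopfSuperalgebra)

omit [Module.Finite F V] [CharZero F] in
theorem dualPar_par (hP : H.par ∘ₗ H.par = LinearMap.id) :
    H.dualPar ∘ₗ H.dualPar = LinearMap.id := by
  ext f x
  have : H.par (H.par x) = x := LinearMap.congr_fun hP x
  simp [dualPar, Dual.transpose_apply, this]

include hH

theorem counit_homog {i : ZMod 2} {x : V} (hx : IsHomog H.par i x) (hi : i ≠ 0) :
    H.counit x = 0 :=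
  H.dual_apply_eq_zero (f := H.counit) (isHomog_zero_iff.2 hH.par_counit) hx hi.symm

theorem dualOp_par_mul :
    H.dualPar ∘ₗ H.dualOp.mul = H.dualOp.mul ∘ₗ TensorProduct.map H.dualPar H.dualPar := by
  ext f g x
  have h : H.comul (H.par x) = TensorProduct.map H.par H.par (H.comul x) :=
    LinearMap.congr_fun hH.par_comul x
  simp only [AlgebraTensorModule.curry_apply, LinearMap.coe_comp, Function.comp_apply,
    curry_apply, LinearMap.coe_restrictScalars]
  change H.dualOp.mul (f ⊗ₜ g) (H.par x) = _
  rw [dualOp_mul_apply', dualOp_mul_apply', h, koszul_map rfl rfl]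
  exact (dualDistrib_map _ _ _ _).symm

/-- Either bracketing applies `f`, `g`, `h` to the three legs of the iterated coproduct, with the
product of the three pairwise Koszul signs; coassociativity identifies the legs. -/
theorem dualOp_mul_assoc (f g h : Dual F V) :
    H.dualOp.mul (H.dualOp.mul (f ⊗ₜ g) ⊗ₜ h) = H.dualOp.mul (f ⊗ₜ H.dualOp.mul (g ⊗ₜ h)) := by
  ext x
  rw [dualOp_mul_apply', dualOp_mul_apply']
  set K := koszul H.par H.par with hK
  have e1 : ∀ t : V ⊗[F] V, dualDistrib F V V (H.dualOp.mul (f ⊗ₜ g) ⊗ₜ h) (K t) =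
      dualDistrib F (V ⊗[F] V) V ((dualDistrib F V V (f ⊗ₜ g) ∘ₗ K) ⊗ₜ h)
        (koszul (TensorProduct.map H.par H.par) H.par
          (TensorProduct.map H.comul LinearMap.id t)) := fun t => by
    rw [koszul_map hH.par_comul (LinearMap.id_comp H.par), hK]
    generalize koszul H.par H.par t = t
    induction t using TensorProduct.induction_on with
    | zero => simp
    | add s t hs ht => simp only [map_add, hs, ht]
    | tmul a b =>
      rw [TensorProduct.map_tmul, dualDistrib_apply, dualDistrib_apply, dualOp_mul_apply]; rfl
  have e2 : ∀ t : V ⊗[F] V, dualDistrib F V V (f ⊗ₜ H.dualOp.mul (g ⊗ₜ h)) (K t) =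
      dualDistrib F V (V ⊗[F] V) (f ⊗ₜ (dualDistrib F V V (g ⊗ₜ h) ∘ₗ K))
        (koszul H.par (TensorProduct.map H.par H.par)
          (TensorProduct.map LinearMap.id H.comul t)) := fun t => by
    rw [koszul_map (LinearMap.id_comp H.par) hH.par_comul, hK]
    generalize koszul H.par H.par t = t
    induction t using TensorProduct.induction_on with
    | zero => simp
    | add s t hs ht => simp only [map_add, hs, ht]
    | tmul a b =>
      rw [TensorProduct.map_tmul, dualDistrib_apply, dualDistrib_apply, dualOp_mul_apply]; rfl
  rw [e1, e2]
  have hc := LinearMap.congr_fun hH.coassoc x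
  simp only [LinearMap.comp_apply, LinearEquiv.coe_coe] at hc
  rw [← hc]
  generalize TensorProduct.map H.comul LinearMap.id (H.comul x) = t
  refine tmul_homog_induction₃ hH.par_par hH.par_par hH.par_par (fun s t h h' => by
    simp only [map_add, h, h']) (fun i a j b k c ha hb hc => ?_) t
  rw [koszul_homog (ha.tmul hb) hc, assoc_tmul, koszul_homog ha (hb.tmul hc), map_smul, map_smul,
    dualDistrib_apply, dualDistrib_apply, LinearMap.comp_apply, LinearMap.comp_apply, hK,
    koszul_homog ha hb, koszul_homog hb hc, map_smul, map_smul, dualDistrib_apply,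
    dualDistrib_apply]
  simp only [smul_eq_mul, mul_add, add_mul, sg_add]
  ring

theorem dualOp_one_mul (f : Dual F V) : H.dualOp.mul (H.counit ⊗ₜ f) = f := by
  ext x
  rw [dualOp_mul_apply]
  have e : ∀ t, dualDistrib F V V (H.counit ⊗ₜ f) (koszul H.par H.par t) =
      f (TensorProduct.lid F V (TensorProduct.map H.counit LinearMap.id t)) := fun t => by
    refine tmul_homog_induction hH.par_par hH.par_par (fun s t h h' => by
      simp only [map_add, h, h']) (fun i a j b ha hb => ?_) t
    rw [koszul_homog ha hb, map_smul, dualDistrib_apply, TensorProduct.map_tmul, lid_tmul, map_smul]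
    by_cases hi : i = 0
    · simp [hi]
    · simp [counit_homog hH ha hi]
  rw [e]
  have := LinearMap.congr_fun hH.counit_comul x
  simp only [LinearMap.comp_apply, LinearEquiv.coe_coe] at this
  rw [this]; rfl

theorem dualOp_mul_one (f : Dual F V) : H.dualOp.mul (f ⊗ₜ H.counit) = f := by
  ext x
  rw [dualOp_mul_apply]
  have e : ∀ t, dualDistrib F V V (f ⊗ₜ H.counit) (koszul H.par H.par t) =
      f (TensorProduct.rid F V (TensorProduct.map LinearMap.id H.counit t)) := fun t => by
    refine tmul_homog_induction hH.par_par hH.par_par (fun s t h h' => by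
      simp only [map_add, h, h']) (fun i a j b ha hb => ?_) t
    rw [koszul_homog ha hb, map_smul, dualDistrib_apply, TensorProduct.map_tmul, rid_tmul, map_smul]
    by_cases hi : j = 0
    · simp [hi, mul_comm]
    · simp [counit_homog hH hb hi]
  rw [e]
  have := LinearMap.congr_fun hH.comul_counit x
  simp only [LinearMap.comp_apply, LinearEquiv.coe_coe] at this
  rw [this]; rfl

/-- This is the transpose of the multiplicativity of `Δ`: at `x ⊗ y` both sides pair `f` and `g`
with the legs of `Δ(y) Δ(x)`. -/
theorem dualOp_comul_mul (f g : Dual F V) :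
    H.dualOp.comul (H.dualOp.mul (f ⊗ₜ g)) =
      superTensorMul H.dualPar H.dualOp.mul (H.dualOp.comul f ⊗ₜ H.dualOp.comul g) := by
  have hX := dualPar_par hH.par_par
  refine dualDistrib_ext fun x y => ?_
  rw [ev_dualOp_comul hH.par_par, dualOp_mul_apply]
  have hm := LinearMap.congr_fun hH.comul_mul (y ⊗ₜ x)
  simp only [LinearMap.comp_apply, TensorProduct.map_tmul] at hm
  rw [hm]
  set S : Dual F V ⊗[F] Dual F V → Dual F V ⊗[F] Dual F V →
      (Dual F V ⊗[F] Dual F V) ⊗[F] (Dual F V ⊗[F] Dual F V) := fun s t =>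
    tensorTensorTensorComm F _ _ _ _ (koszul (TensorProduct.map LinearMap.id H.dualPar)
      (TensorProduct.map H.dualPar LinearMap.id) (s ⊗ₜ t)) with hS
  have e1 : ∀ s t, ev (superTensorMul H.dualPar H.dualOp.mul (s ⊗ₜ t)) x y =
      dualDistrib F (V ⊗[F] V) (V ⊗[F] V)
        (TensorProduct.map (dualDistrib F V V) (dualDistrib F V V) (S s t))
        (koszul H.par H.par (H.comul x) ⊗ₜ koszul H.par H.par (H.comul y)) := fun s t => by
    change ev (TensorProduct.map H.dualOp.mul H.dualOp.mul (S s t)) x y = _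
    generalize S s t = z
    induction z using TensorProduct.induction_on with
    | zero => simp
    | add s t hs ht => simp only [map_add, ev_add, LinearMap.add_apply, hs, ht]
    | tmul a b =>
      rw [TensorProduct.map_tmul, TensorProduct.map_tmul, ev_tmul, dualDistrib_apply,
        ← dualOp_mul_apply', ← dualOp_mul_apply']; rfl
  rw [e1]
  generalize H.comul x = u
  generalize H.comul y = v
  refine tmul_homog_induction hH.par_par hH.par_par (fun s t h h' => by
    simp only [tmul_add, add_tmul, map_add, h, h']) (fun i x₁ j x₂ hx₁ hx₂ => ?_) u
  refine tmul_homog_induction hH.par_par hH.par_par (fun s t h h' => by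
    simp only [tmul_add, add_tmul, map_add, h, h']) (fun k y₁ l y₂ hy₁ hy₂ => ?_) v
  have e2 : ∀ s t, dualDistrib F (V ⊗[F] V) (V ⊗[F] V)
        (TensorProduct.map (dualDistrib F V V) (dualDistrib F V V) (S s t))
        ((x₁ ⊗ₜ x₂) ⊗ₜ (y₁ ⊗ₜ y₂)) =
      sg F (k * j) * (dualDistrib F V V s (x₁ ⊗ₜ y₁) * dualDistrib F V V t (x₂ ⊗ₜ y₂)) := by
    intro s t
    refine tmul_homog_induction hX hX (fun s t h h' => by
      simp only [hS, add_tmul, map_add, LinearMap.add_apply, add_mul, mul_add] at h h' ⊢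
      simp only [h, h']) (fun a f₁ b f₂ _ hf₂ => ?_) s
    refine tmul_homog_induction hX hX (fun s t h h' => by
      simp only [hS, tmul_add, map_add, LinearMap.add_apply, mul_add] at h h' ⊢
      simp only [h, h']) (fun c g₁ d g₂ hg₁ _ => ?_) t
    have h1 : IsHomog (TensorProduct.map LinearMap.id H.dualPar) b (f₁ ⊗ₜ[F] f₂) := by
      unfold IsHomog at *; simp [hf₂]
    have h2 : IsHomog (TensorProduct.map H.dualPar LinearMap.id) c (g₁ ⊗ₜ[F] g₂) := by
      unfold IsHomog at *; simp [hg₁, smul_tmul']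
    simp only [hS, koszul_homog h1 h2, map_smul, tensorTensorTensorComm_tmul,
      TensorProduct.map_tmul, LinearMap.smul_apply, dualDistrib_apply, smul_eq_mul]
    -- The sign on the side of the functionals involves `|f₂|` and `|g₁|`. These may be assumed
    -- equal to `|y₁|` and `|x₂|`, since otherwise both sides vanish.
    by_cases hb : b = k
    · by_cases hc : c = j
      · subst hb hc; ring
      · rw [H.dual_apply_eq_zero hg₁ hx₂ hc]; ring
    · rw [H.dual_apply_eq_zero hf₂ hy₁ hb]; ring
  rw [koszul_homog hx₁ hx₂, koszul_homog hy₁ hy₂, smul_tmul_smul, map_smul, e2,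
    dualDistrib_dualOp_comul hH.par_par, dualDistrib_dualOp_comul hH.par_par, comm_tmul, comm_tmul,
    tensorMul, superTensorMul_eq, superMul_homog _ _ hy₂ hx₁, map_smul,
    koszul_homog (hy₁.mul hH.par_mul hx₁) (hy₂.mul hH.par_mul hx₂), map_smul, map_smul,
    dualDistrib_apply]
  simp only [smul_eq_mul, ← mul_assoc, ← sg_add]
  congr 3
  -- The two exponents differ by `2 l i`, which is zero.
  linear_combination (l * i) * zmod_two_two

theorem dualOp_par_comul : H.dualOp.comul ∘ₗ H.dualPar =
    TensorProduct.map H.dualPar H.dualPar ∘ₗ H.dualOp.comul := by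
  have hP := hH.par_par
  refine LinearMap.ext fun f => dualDistrib_ext fun x y => ?_
  have h := LinearMap.congr_fun hH.par_mul (y ⊗ₜ x)
  simp only [LinearMap.comp_apply, TensorProduct.map_tmul] at h ⊢
  rw [ev_dualOp_comul hP]
  change f (H.par _) = ev (TensorProduct.map (Dual.transpose (R := F) H.par)
    (Dual.transpose (R := F) H.par) (H.dualOp.comul f)) x y
  rw [ev_map, Dual.transpose_apply, LinearMap.comp_apply, ev_dualOp_comul hP, h]

theorem dualOp_coassoc : (TensorProduct.assoc F _ _ _).toLinearMap ∘ₗ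
      TensorProduct.map H.dualOp.comul LinearMap.id ∘ₗ H.dualOp.comul =
    TensorProduct.map LinearMap.id H.dualOp.comul ∘ₗ H.dualOp.comul := by
  have hP := hH.par_par
  refine LinearMap.ext fun f => ?_
  refine ev_ext (W := Dual F V ⊗[F] Dual F V) fun x => ?_
  refine dualDistrib_ext fun y z => ?_
  have e1 : ∀ t : Dual F V ⊗[F] Dual F V, ev (F := F) (W := Dual F V) (ev (F := F)
      (W := Dual F V ⊗[F] Dual F V) (TensorProduct.assoc F _ _ _
      (TensorProduct.map H.dualOp.comul LinearMap.id t)) x) y = ev t (H.mul (y ⊗ₜ x)) := fun t => by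
    induction t using TensorProduct.induction_on with
    | zero => simp
    | add s t hs ht => simp only [map_add, ev_add, hs, ht]
    | tmul f g =>
      rw [TensorProduct.map_tmul, ev_tmul, ← ev_dualOp_comul hP]
      generalize H.dualOp.comul f = s
      induction s using TensorProduct.induction_on with
      | zero => simp
      | add s t hs ht => simp only [map_add, ev_add, add_tmul, hs, ht, LinearMap.add_apply, add_smul]
      | tmul f f' => simp [smul_smul]
  have e2 : ∀ t : Dual F V ⊗[F] Dual F V, ev (TensorProduct.map LinearMap.id H.dualOp.comul t) x =
      H.dualOp.comul (ev t x) := fun t => by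
    induction t using TensorProduct.induction_on with
    | zero => simp
    | add s t hs ht => simp only [map_add, ev_add, hs, ht]
    | tmul f g => simp
  simp only [LinearMap.comp_apply, LinearEquiv.coe_coe]
  rw [e1, e2, ev_dualOp_comul hP, ev_dualOp_comul hP, ev_dualOp_comul hP, hH.mul_assoc]

theorem dualOp_counit_comul : (TensorProduct.lid F _).toLinearMap ∘ₗ
    TensorProduct.map H.dualOp.counit LinearMap.id ∘ₗ H.dualOp.comul = LinearMap.id := by
  refine LinearMap.ext fun f => LinearMap.ext fun x => ?_
  have e : ∀ t : Dual F V ⊗[F] Dual F V, TensorProduct.lid F (Dual F V)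
      (TensorProduct.map (Dual.eval F V H.one) LinearMap.id t) = ev t H.one := fun t => by
    induction t using TensorProduct.induction_on with
    | zero => simp
    | add s t hs ht => simp only [map_add, ev_add, hs, ht]
    | tmul f g => simp
  change (TensorProduct.lid F (Dual F V)
      (TensorProduct.map (Dual.eval F V H.one) LinearMap.id (H.dualOp.comul f))) x = f x
  rw [e, ev_dualOp_comul hH.par_par, hH.mul_one]

theorem dualOp_comul_counit : (TensorProduct.rid F _).toLinearMap ∘ₗ
    TensorProduct.map LinearMap.id H.dualOp.counit ∘ₗ H.dualOp.comul = LinearMap.id := by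
  refine LinearMap.ext fun f => LinearMap.ext fun x => ?_
  have e : ∀ t : Dual F V ⊗[F] Dual F V, (TensorProduct.rid F (Dual F V)
      (TensorProduct.map LinearMap.id (Dual.eval F V H.one) t)) x = ev t x H.one := fun t => by
    induction t using TensorProduct.induction_on with
    | zero => simp
    | add s t hs ht => simp only [map_add, ev_add, hs, ht, LinearMap.add_apply]
    | tmul f g => simp [mul_comm]
  change (TensorProduct.rid F (Dual F V)
      (TensorProduct.map LinearMap.id (Dual.eval F V H.one) (H.dualOp.comul f))) x = f x
  rw [e, ev_dualOp_comul hH.par_par, hH.one_mul]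

/-- Transposition moves `A` and `B` to the legs of `Δ x` and turns product after coproduct in `X`
into the opposite product of `H`. The pairs `(S⁻¹, id)` and `(id, S⁻¹)` give the two antipode laws
of the dual. -/
theorem dualOp_antipode (A B : V →ₗ[F] V) (hA : A ∘ₗ H.par = H.par ∘ₗ A)
    (hB : B ∘ₗ H.par = H.par ∘ₗ B)
    (h : ∀ x, H.mulOp (TensorProduct.map A B (H.comul x)) = H.counit x • H.one) (f : Dual F V) :
    H.dualOp.mul (TensorProduct.map (Dual.transpose (R := F) A) (Dual.transpose (R := F) B)
      (H.dualOp.comul f)) = H.dualOp.counit f • H.dualOp.one := by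
  ext x
  rw [dualOp_mul_apply', dualDistrib_map, ← koszul_map hA hB, dualDistrib_dualOp_comul hH.par_par]
  change f (H.mulOp (TensorProduct.map A B (H.comul x))) = f H.one * H.counit x
  rw [h, map_smul, smul_eq_mul, mul_comm]

theorem dualOp_par_counit : H.dualOp.counit ∘ₗ H.dualPar = H.dualOp.counit := by
  refine LinearMap.ext fun f => ?_
  change f (H.par H.one) = f H.one
  rw [hH.par_one]

theorem dualOp_comul_one : H.dualOp.comul H.counit = H.counit ⊗ₜ H.counit := by
  refine dualDistrib_ext fun x y => ?_
  rw [ev_dualOp_comul hH.par_par, hH.counit_mul, ev_tmul, LinearMap.smul_apply, smul_eq_mul,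
    mul_comm]

theorem dualOp_counit_mul (f g : Dual F V) :
    H.dualOp.counit (H.dualOp.mul (f ⊗ₜ g)) = H.dualOp.counit f * H.dualOp.counit g := by
  change H.dualOp.mul (f ⊗ₜ g) H.one = f H.one * g H.one
  rw [dualOp_mul_apply, hH.comul_one, koszul_even_left _ _ hH.par_one, dualDistrib_apply]

theorem dualOp_par_antipode (hS : Function.Bijective H.antipode) :
    H.dualOp.antipode ∘ₗ H.dualPar = H.dualPar ∘ₗ H.dualOp.antipode := by
  refine LinearMap.ext fun f => LinearMap.ext fun x => ?_
  have := LinearMap.congr_fun (par_antipodeInv hS hH) x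
  exact congrArg f this.symm

theorem dualOp_antipode_left (hS : Function.Bijective H.antipode) (han : H.AntipodeAnti)
    (f : Dual F V) : H.dualOp.mul (TensorProduct.map H.dualOp.antipode LinearMap.id
      (H.dualOp.comul f)) = H.dualOp.counit f • H.dualOp.one :=
  dualOp_antipode hH H.antipodeInv LinearMap.id (par_antipodeInv hS hH) rfl
    (mulOp_antipodeInv_left hS hH han) f

theorem dualOp_antipode_right (hS : Function.Bijective H.antipode) (han : H.AntipodeAnti)
    (f : Dual F V) : H.dualOp.mul (TensorProduct.map LinearMap.id H.dualOp.antipode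
      (H.dualOp.comul f)) = H.dualOp.counit f • H.dualOp.one :=
  dualOp_antipode hH LinearMap.id H.antipodeInv rfl (par_antipodeInv hS hH)
    (mulOp_antipodeInv_right hS hH han) f

/-- The dual `(Hᵒᵖ)*` of a finite-dimensional Hopf superalgebra is a Hopf superalgebra. -/
theorem dualOp_isHopfSuperalgebra (hS : Function.Bijective H.antipode) (han : H.AntipodeAnti) :
    H.dualOp.IsHopfSuperalgebra where
  par_par := dualPar_par hH.par_par
  par_mul := dualOp_par_mul hH
  par_one := hH.par_counit
  par_comul := dualOp_par_comul hH
  par_counit := dualOp_par_counit hH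
  par_antipode := dualOp_par_antipode hH hS
  mul_assoc := dualOp_mul_assoc hH
  one_mul := dualOp_one_mul hH
  mul_one := dualOp_mul_one hH
  coassoc := dualOp_coassoc hH
  counit_comul := dualOp_counit_comul hH
  comul_counit := dualOp_comul_counit hH
  comul_mul := TensorProduct.ext' fun f g => dualOp_comul_mul hH f g
  comul_one := dualOp_comul_one hH
  counit_mul := dualOp_counit_mul hH
  counit_one := hH.counit_one
  antipode_left := dualOp_antipode_left hH hS han
  antipode_right := dualOp_antipode_right hH hS han

end DualHopf

end HopfSuperData

end QDouble

end

/-! ### The action of `H` on `X ⊗ H` that defines the double -/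

noncomputable section

set_option linter.unusedSectionVars false

namespace QDouble

open TensorProduct Module

namespace HopfSuperData

variable {F : Type*} [Field F]
variable {V : Type*} [AddCommGroup V] [Module F V]
variable (H : HopfSuperData F V)

/-- The iterated coproduct `(Δ ⊗ id) Δ`. -/
def comul₃ : V →ₗ[F] (V ⊗[F] V) ⊗[F] V :=
  TensorProduct.map H.comul LinearMap.id ∘ₗ H.comul

/-- The grading of `(V ⊗ V) ⊗ V`. -/
def par₃ : (V ⊗[F] V) ⊗[F] V →ₗ[F] (V ⊗[F] V) ⊗[F] V :=
  TensorProduct.map (TensorProduct.map H.par H.par) H.par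

/-- `straighten`, as a function of `(Δ ⊗ id) Δ(a)` instead of `a`. -/
def straighten₃ : ((V ⊗[F] V) ⊗[F] V) ⊗[F] Dual F V →ₗ[F] Dual F V ⊗[F] V :=
  TensorProduct.lift (H.coadj ∘ₗ koszul (TensorProduct.map H.par H.par) H.par) ∘ₗ
    koszul H.par₃ H.dualPar

/-- The action of `(Δ ⊗ id) Δ(a)` on `X ⊗ V` that is left multiplication by `1 ⊗ a` in the double. -/
def act₃ : ((V ⊗[F] V) ⊗[F] V) ⊗[F] (Dual F V ⊗[F] V) →ₗ[F] Dual F V ⊗[F] V :=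
  TensorProduct.map LinearMap.id H.mul ∘ₗ (TensorProduct.assoc F (Dual F V) V V).toLinearMap ∘ₗ
    TensorProduct.map H.straighten₃ LinearMap.id ∘ₗ
    (TensorProduct.assoc F _ (Dual F V) V).symm.toLinearMap

/-- Left multiplication by `1 ⊗ a` in the double. -/
def act (a : V) (z : Dual F V ⊗[F] V) : Dual F V ⊗[F] V := H.act₃ (H.comul₃ a ⊗ₜ z)

/-- Left multiplication by `f ⊗ 1` in the double. -/
def lmul [Module.Finite F V] (f : Dual F V) : Dual F V ⊗[F] V →ₗ[F] Dual F V ⊗[F] V :=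
  TensorProduct.map (TensorProduct.curry H.dualOp.mul f) LinearMap.id

/-- The degree of the sign in the exchange rule. -/
def exch (i j k l : ZMod 2) : ZMod 2 := (i + j + k) * (k + l + i) + ((i + j) * k + l * i)

/-- `S⁻¹(c) x a`. -/
def sandwich (x a c : V) : V := H.mul (H.antipodeInv c ⊗ₜ H.mul (x ⊗ₜ a))

variable {H}

theorem act₃_tmul (t : (V ⊗[F] V) ⊗[F] V) (g : Dual F V) (b : V) : H.act₃ (t ⊗ₜ (g ⊗ₜ b)) =
    TensorProduct.map LinearMap.id (TensorProduct.curry H.mul |>.flip b) (H.straighten₃ (t ⊗ₜ g)) := by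
  simp only [act₃, LinearMap.comp_apply, LinearEquiv.coe_coe, assoc_symm_tmul,
    TensorProduct.map_tmul, LinearMap.id_apply]
  generalize H.straighten₃ (t ⊗ₜ g) = z
  induction z using TensorProduct.induction_on with
  | zero => simp
  | add s t hs ht => simp only [add_tmul, map_add, hs, ht]
  | tmul f c => simp

variable (hH : H.IsHopfSuperalgebra)

section

include hH

theorem par₃_comul₃ : H.comul₃ ∘ₗ H.par = H.par₃ ∘ₗ H.comul₃ := by
  rw [comul₃, par₃, LinearMap.comp_assoc, hH.par_comul, ← LinearMap.comp_assoc,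
    ← LinearMap.comp_assoc, ← TensorProduct.map_comp, ← TensorProduct.map_comp, hH.par_comul]
  rfl

/-- The sign between `a` and `g` only sees the parity of `a`, which is that of `(Δ ⊗ id) Δ(a)`.
Passing to an arbitrary threefold tensor makes induction on homogeneous legs possible. -/
theorem straighten_eq (a : V) (g : Dual F V) :
    H.straighten (a ⊗ₜ g) = H.straighten₃ (H.comul₃ a ⊗ₜ g) := by
  have e : ∀ s : V ⊗[F] Dual F V, koszul H.par₃ H.dualPar
      (TensorProduct.map H.comul₃ LinearMap.id s) =
      TensorProduct.map H.comul₃ LinearMap.id (koszul H.par H.dualPar s) := fun s =>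
    koszul_map (par₃_comul₃ hH) (LinearMap.id_comp _) s
  have := e (a ⊗ₜ g)
  rw [TensorProduct.map_tmul, LinearMap.id_apply] at this
  simp only [straighten, straighten₃, LinearMap.comp_apply, this]
  generalize koszul H.par H.dualPar (a ⊗ₜ g) = s
  induction s using TensorProduct.induction_on with
  | zero => simp
  | add s t hs ht => simp only [map_add, hs, ht]
  | tmul f c => rfl

theorem act_tmul_one (a : V) (g : Dual F V) : H.act a (g ⊗ₜ H.one) = H.straighten (a ⊗ₜ g) := by
  rw [act, act₃_tmul, straighten_eq hH]
  have : (TensorProduct.curry H.mul).flip H.one = LinearMap.id := LinearMap.ext hH.mul_one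
  rw [this, TensorProduct.map_id, LinearMap.id_apply]

variable [CharZero F]

theorem comul₃_mul (a b : V) : H.comul₃ (H.mul (a ⊗ₜ b)) =
    superMul (TensorProduct.map H.par H.par) H.tensorMul H.par H.mul
      (H.comul₃ a ⊗ₜ H.comul₃ b) := by
  have hm : ∀ a b, H.comul (H.mul (a ⊗ₜ b)) = H.tensorMul (H.comul a ⊗ₜ H.comul b) := fun a b => by
    have := LinearMap.congr_fun hH.comul_mul (a ⊗ₜ b)
    simpa only [LinearMap.comp_apply, TensorProduct.map_tmul] using this
  simp only [comul₃, LinearMap.comp_apply]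
  rw [hm]
  exact superMul_map hH.par_par hH.par_par hH.par_comul (LinearMap.id_comp _) hm (fun _ _ => rfl) _ _

variable {i j k l : ZMod 2} {a₁ a₂ a₃ x : V} (h₁ : IsHomog H.par i a₁) (h₂ : IsHomog H.par j a₂)
  (h₃ : IsHomog H.par k a₃) (hx : IsHomog H.par l x) (hS : Function.Bijective H.antipode)

include h₁ h₃ hx hS in
theorem sandwich_homog : IsHomog H.par (k + l + i) (H.sandwich x a₁ a₃) := by
  rw [add_assoc]
  exact (h₃.map (par_antipodeInv hS hH)).mul hH.par_mul (hx.mul hH.par_mul h₁)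

include h₁ h₂ h₃ hx hS in
-- The Koszul sign contains `|g|`, but the value vanishes unless `|g|` is the degree `k + l + i` of
-- `S⁻¹(a₃) x a₁`. After this substitution the exponent is `exch`, free of `g`, so the formula
-- extends to inhomogeneous `g`.
theorem ev_straighten₃ (g : Dual F V) : ev (H.straighten₃ (((a₁ ⊗ₜ a₂) ⊗ₜ a₃) ⊗ₜ g)) x =
    (sg F (exch i j k l) * g (H.sandwich x a₁ a₃)) • a₂ := by
  have hX : H.dualPar ∘ₗ H.dualPar = LinearMap.id := dualPar_par hH.par_par
  refine homog_induction hX (fun g g' h h' => by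
    simp only [tmul_add, map_add, ev_add, h, h', LinearMap.add_apply, mul_add, add_smul])
    (fun n g hg => ?_) g
  simp only [straighten₃, LinearMap.comp_apply]
  rw [koszul_homog (P := H.par₃) ((h₁.tmul h₂).tmul h₃) hg, map_smul, ev_smul, lift.tmul,
    LinearMap.comp_apply, koszul_homog (h₁.tmul h₂) h₃, map_smul, LinearMap.smul_apply, ev_smul,
    coadj_tmul, ev_tmul, LinearMap.comp_apply, conj_apply, koszul_homog hx h₁]
  simp only [tmul_smul, map_smul, smul_eq_mul, smul_smul, ← mul_assoc, ← sg_add]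
  by_cases hn : n = k + l + i
  · subst hn; rfl
  · have := H.dual_apply_eq_zero hg (sandwich_homog hH h₁ h₃ hx hS) hn
    rw [sandwich] at this
    rw [sandwich, this, mul_zero, mul_zero]

include h₁ h₂ h₃ hx hS in
theorem ev_act₃ (z : Dual F V ⊗[F] V) : ev (H.act₃ (((a₁ ⊗ₜ a₂) ⊗ₜ a₃) ⊗ₜ z)) x =
    sg F (exch i j k l) • H.mul (a₂ ⊗ₜ ev z (H.sandwich x a₁ a₃)) := by
  induction z using TensorProduct.induction_on with
  | zero => simp
  | add s t hs ht => simp only [tmul_add, map_add, ev_add, hs, ht, smul_add]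
  | tmul g b =>
    rw [act₃_tmul]
    have e : ∀ z : Dual F V ⊗[F] V, ev (TensorProduct.map LinearMap.id
        (TensorProduct.curry H.mul |>.flip b) z) x = H.mul (ev z x ⊗ₜ b) := fun z => by
      induction z using TensorProduct.induction_on with
      | zero => simp
      | add s t hs ht => simp only [map_add, ev_add, hs, ht, add_tmul]
      | tmul f c => simp [← smul_tmul']
    rw [e, ev_straighten₃ hH h₁ h₂ h₃ hx hS, ev_tmul, ← smul_tmul', map_smul, tmul_smul, map_smul,
      smul_smul]

end

variable [CharZero F] [Module.Finite F V] (hS : Function.Bijective H.antipode)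
  (han : H.AntipodeAnti) (hco : H.AntipodeCoanti)

theorem ev_ext_homog {W : Type*} [AddCommGroup W] [Module F W] (hP : H.par ∘ₗ H.par = LinearMap.id)
    {s t : Dual F V ⊗[F] W} (h : ∀ i x, IsHomog H.par i x → ev s x = ev t x) : s = t := by
  refine ev_ext fun x => ?_
  refine homog_induction hP (fun v w hv hw => ?_) h x
  rw [ev_arg_add, ev_arg_add, hv, hw]

include hH hS han in
-- Since `S⁻¹` reverses products, the sandwich for `a b` is, up to sign, the sandwich for `b` around
-- the one for `a`, while the middle legs multiply in the order `a₂ b₂`.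
theorem act_mul (a b : V) (z : Dual F V ⊗[F] V) : H.act (H.mul (a ⊗ₜ b)) z = H.act a (H.act b z) := by
  have hP := hH.par_par
  refine ev_ext_homog hP fun n x hx => ?_
  simp only [act, comul₃_mul hH]
  generalize H.comul₃ a = s
  generalize H.comul₃ b = t
  refine tmul_homog_induction₃ hP hP hP (fun s t h h' => by
    simp only [add_tmul, map_add, ev_add, h, h']) (fun i a₁ j a₂ k a₃ h₁ h₂ h₃ => ?_) s
  rw [ev_act₃ hH h₁ h₂ h₃ hx hS]
  refine tmul_homog_induction₃ hP hP hP (fun s t h h' => by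
    simp only [add_tmul, tmul_add, map_add, ev_add, h, h', smul_add])
    (fun i' b₁ j' b₂ k' b₃ h₁' h₂' h₃' => ?_) t
  rw [ev_act₃ hH h₁' h₂' h₃' (sandwich_homog hH h₁ h₃ hx hS) hS,
    superMul_homog _ _ h₃ (h₁'.tmul h₂'), tensorMul, superTensorMul_eq, superMul_homog _ _ h₂ h₁']
  simp only [← smul_tmul', map_smul, ev_smul]
  rw [ev_act₃ hH (h₁.mul hH.par_mul h₁') (h₂.mul hH.par_mul h₂') (h₃.mul hH.par_mul h₃') hx hS]
  have e : H.sandwich x (H.mul (a₁ ⊗ₜ b₁)) (H.mul (a₃ ⊗ₜ b₃)) =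
      sg F (k * k') • H.sandwich (H.sandwich x a₁ a₃) b₁ b₃ := by
    simp only [sandwich]
    rw [antipodeInv_mul_homog hS hH han h₃ h₃', ← smul_tmul', map_smul]
    simp only [hH.mul_assoc]
  rw [e, ev_arg_smul]
  simp only [tmul_smul, map_smul, smul_smul, ← sg_add, hH.mul_assoc]
  congr 2
  -- Only an identity between sign exponents in seven degrees is left; it is settled by checking all
  -- values in `ZMod 2`.
  clear * -
  revert n i j k i' j' k'
  unfold exch
  decide

include hH hS in
theorem act_one (z : Dual F V ⊗[F] V) : H.act H.one z = z := by
  have h1 : IsHomog H.par 0 H.one := isHomog_zero_iff.2 hH.par_one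
  refine ev_ext_homog hH.par_par fun n x hx => ?_
  have : H.comul₃ H.one = (H.one ⊗ₜ H.one) ⊗ₜ H.one := by
    simp [comul₃, hH.comul_one]
  rw [act, this, ev_act₃ hH h1 h1 h1 hx hS]
  simp [sandwich, antipodeInv_one hS hH, hH.one_mul, hH.mul_one, exch]

include hH in
-- This separates the two module structures on `X ⊗ H`; the product of the double is afterwards
-- studied only through them and their compatibility.
theorem double_mul_apply (f : Dual F V) (a : V) (z : Dual F V ⊗[F] V) :
    H.double.mul ((f ⊗ₜ a) ⊗ₜ z) = H.lmul f (H.act a z) := by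
  induction z using TensorProduct.induction_on with
  | zero => simp [act]
  | add s t hs ht => simp only [act, tmul_add, map_add, hs, ht] at hs ht ⊢
  | tmul g b =>
    rw [act, act₃_tmul, ← straighten_eq hH]
    simp only [double, LinearMap.comp_apply, LinearEquiv.coe_coe, assoc_tmul,
      TensorProduct.map_tmul, assoc_symm_tmul, LinearMap.id_apply]
    generalize H.straighten (a ⊗ₜ g) = z
    induction z using TensorProduct.induction_on with
    | zero => simp
    | add s t hs ht => simp only [add_tmul, tmul_add, map_add, hs, ht]
    | tmul f c => simp [lmul]

end HopfSuperData

end QDouble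

end

/-! ### Sign operators and iterated coproducts -/

noncomputable section

set_option linter.unusedSectionVars false

namespace QDouble

open TensorProduct Module

section SignOperator

variable {F : Type*} [Field F]
variable {V : Type*} [AddCommGroup V] [Module F V]
variable {W : Type*} [AddCommGroup W] [Module F W]
variable {U : Type*} [AddCommGroup U] [Module F U]
variable {V' : Type*} [AddCommGroup V'] [Module F V']
variable {W' : Type*} [AddCommGroup W'] [Module F W']
variable {U' : Type*} [AddCommGroup U'] [Module F U']

/-- The projection onto the component of degree `i`. -/
def pr (P : V →ₗ[F] V) (i : ZMod 2) : V →ₗ[F] V :=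
  (1 / 2 : F) • (LinearMap.id + sg F i • P)

theorem pr_homog [CharZero F] {P : V →ₗ[F] V} {j : ZMod 2} {v : V} (hv : IsHomog P j v)
    (i : ZMod 2) : pr P i v = if i = j then v else 0 := by
  have h : pr P i v = ((1 / 2 : F) * (1 + sg F i * sg F j)) • v := by
    unfold IsHomog at hv
    simp only [pr, LinearMap.smul_apply, LinearMap.add_apply, LinearMap.id_apply, hv]
    module
  rw [h]
  rcases zmod_two_cases i with rfl | rfl <;> rcases zmod_two_cases j with rfl | rfl <;> norm_num

theorem map_pr {P : V →ₗ[F] V} {Q : W →ₗ[F] W} {f : V →ₗ[F] W} (hf : f ∘ₗ P = Q ∘ₗ f)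
    (i : ZMod 2) : f ∘ₗ pr P i = pr Q i ∘ₗ f := by
  simp only [pr, LinearMap.comp_smul, LinearMap.comp_add, LinearMap.smul_comp, LinearMap.add_comp,
    hf, LinearMap.comp_id, LinearMap.id_comp]

/-- The operator on `(V ⊗ W) ⊗ U` that multiplies `(v ⊗ w) ⊗ u` by `(-1)^{p(|v|, |w|, |u|)}`. -/
def signOp₃ (P : V →ₗ[F] V) (Q : W →ₗ[F] W) (R : U →ₗ[F] U)
    (p : ZMod 2 → ZMod 2 → ZMod 2 → ZMod 2) : (V ⊗[F] W) ⊗[F] U →ₗ[F] (V ⊗[F] W) ⊗[F] U :=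
  ∑ i, ∑ j, ∑ k, sg F (p i j k) • TensorProduct.map (TensorProduct.map (pr P i) (pr Q j)) (pr R k)

variable {P : V →ₗ[F] V} {Q : W →ₗ[F] W} {R : U →ₗ[F] U}
  (p : ZMod 2 → ZMod 2 → ZMod 2 → ZMod 2)

theorem signOp₃_homog [CharZero F] {i j k : ZMod 2} {v : V} {w : W} {u : U} (hv : IsHomog P i v)
    (hw : IsHomog Q j w) (hu : IsHomog R k u) :
    signOp₃ P Q R p ((v ⊗ₜ w) ⊗ₜ u) = sg F (p i j k) • ((v ⊗ₜ[F] w) ⊗ₜ[F] u) := by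
  simp only [signOp₃, LinearMap.sum_apply, LinearMap.smul_apply, TensorProduct.map_tmul,
    pr_homog hv, pr_homog hw, pr_homog hu]
  rw [Finset.sum_eq_single i, Finset.sum_eq_single j, Finset.sum_eq_single k]
  · simp
  · intro b _ hb; simp [hb]
  · simp
  · intro b _ hb; simp [hb]
  · simp
  · intro b _ hb; simp [hb]
  · simp

theorem signOp₃_map {P' : V' →ₗ[F] V'} {Q' : W' →ₗ[F] W'} {R' : U' →ₗ[F] U'}
    {A : V →ₗ[F] V'} {B : W →ₗ[F] W'} {C : U →ₗ[F] U'} (hA : A ∘ₗ P = P' ∘ₗ A)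
    (hB : B ∘ₗ Q = Q' ∘ₗ B) (hC : C ∘ₗ R = R' ∘ₗ C) (t : (V ⊗[F] W) ⊗[F] U) :
    signOp₃ P' Q' R' p (TensorProduct.map (TensorProduct.map A B) C t) =
      TensorProduct.map (TensorProduct.map A B) C (signOp₃ P Q R p t) := by
  simp only [signOp₃, LinearMap.sum_apply, LinearMap.smul_apply, map_sum, map_smul]
  simp only [← LinearMap.comp_apply, ← TensorProduct.map_comp, map_pr hA, map_pr hB, map_pr hC]

/-- Induction on a homogeneous tensor. -/
@[elab_as_elim] theorem tmul_homog_induction_total [CharZero F] (hP : P ∘ₗ P = LinearMap.id)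
    (hQ : Q ∘ₗ Q = LinearMap.id) {l : ZMod 2} {p : V ⊗[F] W → Prop}
    (add : ∀ s t, p s → p t → p (s + t))
    (homog : ∀ i v j w, IsHomog P i v → IsHomog Q j w → i + j = l → p (v ⊗ₜ w)) (t : V ⊗[F] W)
    (ht : IsHomog (TensorProduct.map P Q) l t) : p t := by
  have key : ∀ t, p (pr (TensorProduct.map P Q) l t) := fun t => by
    refine tmul_homog_induction hP hQ (fun s t hs ht => ?_) (fun i v j w hv hw => ?_) t
    · rw [map_add]; exact add _ _ hs ht
    · rw [pr_homog (hv.tmul hw)]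
      split_ifs with h
      · exact homog i v j w hv hw h.symm
      -- A pure tensor of the wrong total degree projects to zero, which is itself a pure tensor `0
      -- ⊗ 0` of degrees `0` and `l`.
      · simpa using homog 0 0 l 0 (by simp [IsHomog]) (by simp [IsHomog]) (zero_add l)
  have := key t
  rwa [pr_homog ht, if_pos rfl] at this

end SignOperator

namespace HopfSuperData

variable {F : Type*} [Field F]
variable {V : Type*} [AddCommGroup V] [Module F V]
variable {W : Type*} [AddCommGroup W] [Module F W]
variable (H : HopfSuperData F V)

/-- `Δ⁽⁴⁾`, associated to the left. -/
def comul₄ : V →ₗ[F] ((V ⊗[F] V) ⊗[F] V) ⊗[F] V :=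
  TensorProduct.map H.comul₃ LinearMap.id ∘ₗ H.comul

/-- `Δ⁽⁵⁾`, associated to the left. -/
def comul₅ : V →ₗ[F] (((V ⊗[F] V) ⊗[F] V) ⊗[F] V) ⊗[F] V :=
  TensorProduct.map H.comul₄ LinearMap.id ∘ₗ H.comul

/-- `((a ⊗ b) ⊗ c ↦ m(b ⊗ φ(a, c)))`. -/
def sandMap {A C : Type*} [AddCommGroup A] [Module F A] [AddCommGroup C] [Module F C]
    (φ : A ⊗[F] C →ₗ[F] V) : (A ⊗[F] V) ⊗[F] C →ₗ[F] V :=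
  H.mul ∘ₗ TensorProduct.map LinearMap.id φ ∘ₗ (TensorProduct.assoc F V A C).toLinearMap ∘ₗ
    TensorProduct.map (TensorProduct.comm F A V).toLinearMap LinearMap.id

/-- `a ⊗ c ↦ S⁻¹(c) x a`, as a linear map. -/
def sandwichMap (x : V) : V ⊗[F] V →ₗ[F] V :=
  H.mul ∘ₗ TensorProduct.map H.antipodeInv (TensorProduct.curry H.mul x) ∘ₗ
    (TensorProduct.comm F V V).toLinearMap

/-- `(a ⊗ w) ⊗ c ↦ ± g(S⁻¹(c) x a) w`, the exchange rule with coefficients in `W`. -/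
def exchMap (Q : W →ₗ[F] W) (g : Dual F V) (l : ZMod 2) (x : V) : (V ⊗[F] W) ⊗[F] V →ₗ[F] W :=
  (TensorProduct.rid F W).toLinearMap ∘ₗ TensorProduct.map LinearMap.id (g ∘ₗ H.sandwichMap x) ∘ₗ
    (TensorProduct.assoc F W V V).toLinearMap ∘ₗ
    TensorProduct.map (TensorProduct.comm F V W).toLinearMap LinearMap.id ∘ₗ
    signOp₃ H.par Q H.par (fun i j k => exch i j k l)

variable {H}

@[simp] theorem sandMap_tmul {A C : Type*} [AddCommGroup A] [Module F A] [AddCommGroup C]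
    [Module F C] (φ : A ⊗[F] C →ₗ[F] V) (a : A) (b : V) (c : C) :
    H.sandMap φ ((a ⊗ₜ b) ⊗ₜ c) = H.mul (b ⊗ₜ φ (a ⊗ₜ c)) := rfl

@[simp] theorem sandwichMap_tmul (x a c : V) : H.sandwichMap x (a ⊗ₜ c) = H.sandwich x a c := rfl

theorem exchMap_homog [CharZero F] {Q : W →ₗ[F] W} {i j k : ZMod 2} {a c : V} {w : W}
    (ha : IsHomog H.par i a) (hw : IsHomog Q j w) (hc : IsHomog H.par k c) (g : Dual F V)
    (l : ZMod 2) (x : V) : H.exchMap Q g l x ((a ⊗ₜ w) ⊗ₜ c) =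
      (sg F (exch i j k l) * g (H.sandwich x a c)) • w := by
  simp only [exchMap, LinearMap.comp_apply, signOp₃_homog _ ha hw hc, map_smul]
  simp [smul_smul]

/-- Allowing an arbitrary graded `W` in the middle makes the exchange rule natural there, so further
coproducts can be applied to the middle leg. -/
theorem exchMap_map {W' : Type*} [AddCommGroup W'] [Module F W'] {Q : W →ₗ[F] W}
    {Q' : W' →ₗ[F] W'} {B : W →ₗ[F] W'} (hB : B ∘ₗ Q = Q' ∘ₗ B) (g : Dual F V) (l : ZMod 2) (x : V)
    (t : (V ⊗[F] W) ⊗[F] V) : B (H.exchMap Q g l x t) =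
      H.exchMap Q' g l x (TensorProduct.map (TensorProduct.map LinearMap.id B) LinearMap.id t) := by
  simp only [exchMap, LinearMap.comp_apply]
  rw [signOp₃_map _ (LinearMap.id_comp H.par) hB (LinearMap.id_comp H.par)]
  generalize signOp₃ H.par Q H.par _ t = t
  induction t using TensorProduct.induction_on with
  | zero => simp
  | add s t hs ht => simp only [map_add, hs, ht]
  | tmul s c =>
    induction s using TensorProduct.induction_on with
    | zero => simp
    | add s t hs ht => simp only [add_tmul, map_add, hs, ht]
    | tmul a b => simp

theorem map_assoc {V₁ V₂ V₃ W₁ W₂ W₃ : Type*} [AddCommGroup V₁] [AddCommGroup V₂] [AddCommGroup V₃]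
    [AddCommGroup W₁] [AddCommGroup W₂] [AddCommGroup W₃] [Module F V₁] [Module F V₂] [Module F V₃]
    [Module F W₁] [Module F W₂] [Module F W₃] (f : V₁ →ₗ[F] W₁) (g : V₂ →ₗ[F] W₂)
    (h : V₃ →ₗ[F] W₃) (t : (V₁ ⊗[F] V₂) ⊗[F] V₃) :
    TensorProduct.map f (TensorProduct.map g h) (TensorProduct.assoc F V₁ V₂ V₃ t) =
      TensorProduct.assoc F W₁ W₂ W₃ (TensorProduct.map (TensorProduct.map f g) h t) := by
  induction t using TensorProduct.induction_on with
  | zero => simp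
  | add s t hs ht => simp only [map_add, hs, ht]
  | tmul s c =>
    induction s using TensorProduct.induction_on with
    | zero => simp
    | add s t hs ht => simp only [add_tmul, map_add, hs, ht]
    | tmul a b => simp

section Coassoc

variable (hH : H.IsHopfSuperalgebra)

include hH

/-- Iterated coproducts are kept bracketed to the left. This lemma and the following ones rewrite a
coproduct of an inner or right leg as a rebracketing of that normal form, so that two sides can be
compared on one generic tensor. -/
theorem comul_assoc (a : V) : TensorProduct.map LinearMap.id H.comul (H.comul a) =
    TensorProduct.assoc F V V V (H.comul₃ a) :=
  (LinearMap.congr_fun hH.coassoc a).symm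

theorem map_comul_comul (a : V) : TensorProduct.map H.comul H.comul (H.comul a) =
    TensorProduct.assoc F _ _ _ (H.comul₄ a) := by
  have e : TensorProduct.map H.comul H.comul (H.comul a) =
      TensorProduct.map H.comul (TensorProduct.map LinearMap.id LinearMap.id)
        (TensorProduct.map LinearMap.id H.comul (H.comul a)) := by
    rw [TensorProduct.map_id, TensorProduct.map_map]; rfl
  rw [e, comul_assoc hH, map_assoc, comul₃, LinearMap.comp_apply, TensorProduct.map_map]
  rfl

theorem map_id_comul_comul₃ (a : V) :
    TensorProduct.map (TensorProduct.map LinearMap.id H.comul) LinearMap.id (H.comul₃ a) =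
      TensorProduct.map (TensorProduct.assoc F V V V).toLinearMap LinearMap.id (H.comul₄ a) := by
  have e : TensorProduct.map LinearMap.id H.comul ∘ₗ H.comul =
    (TensorProduct.assoc F V V V).toLinearMap ∘ₗ H.comul₃ := LinearMap.ext (comul_assoc hH)
  rw [comul₃, LinearMap.comp_apply, TensorProduct.map_map, e, comul₄, LinearMap.comp_apply, TensorProduct.map_map]

theorem map_comul_id_comul_comul₃ (a : V) :
    TensorProduct.map (TensorProduct.map H.comul LinearMap.id) H.comul (H.comul₃ a) =
      TensorProduct.assoc F _ _ _ (H.comul₅ a) := by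
  have e : TensorProduct.map (TensorProduct.map H.comul LinearMap.id) H.comul (H.comul₃ a) =
      TensorProduct.map H.comul₃ (TensorProduct.map LinearMap.id LinearMap.id)
        (TensorProduct.map LinearMap.id H.comul (H.comul a)) := by
    rw [TensorProduct.map_id, TensorProduct.map_map, comul₃, LinearMap.comp_apply, TensorProduct.map_map]; rfl
  rw [e, comul_assoc hH, map_assoc]
  exact congrArg _ (TensorProduct.map_map _ _ _ _ (H.comul a))

theorem map_id_comul₃_comul₃ (a : V) :
    TensorProduct.map (TensorProduct.map LinearMap.id H.comul₃) LinearMap.id (H.comul₃ a) =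
      TensorProduct.map ((TensorProduct.assoc F V (V ⊗[F] V) V).toLinearMap ∘ₗ
        TensorProduct.map (TensorProduct.assoc F V V V).toLinearMap LinearMap.id) LinearMap.id
        (H.comul₅ a) := by
  have e : TensorProduct.map LinearMap.id H.comul₃ ∘ₗ H.comul =
      ((TensorProduct.assoc F V (V ⊗[F] V) V).toLinearMap ∘ₗ
        TensorProduct.map (TensorProduct.assoc F V V V).toLinearMap LinearMap.id) ∘ₗ H.comul₄ := by
    refine LinearMap.ext fun b => ?_
    have : TensorProduct.map LinearMap.id H.comul₃ (H.comul b) =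
        TensorProduct.map LinearMap.id (TensorProduct.map H.comul LinearMap.id)
          (TensorProduct.map LinearMap.id H.comul (H.comul b)) := by
      rw [TensorProduct.map_map]; rfl
    rw [LinearMap.comp_apply, this, comul_assoc hH, map_assoc, map_id_comul_comul₃ hH]
    rfl
  have e2 : H.comul₃ a = TensorProduct.map H.comul LinearMap.id (H.comul a) := rfl
  rw [e2, TensorProduct.map_map, e]
  exact (TensorProduct.map_map _ _ _ _ (H.comul a)).symm

end Coassoc

variable (hH : H.IsHopfSuperalgebra) [CharZero F] (hS : Function.Bijective H.antipode)

include hH hS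

theorem ev_straighten {l : ZMod 2} {x : V} (hx : IsHomog H.par l x) (a : V) (g : Dual F V) :
    ev (H.straighten (a ⊗ₜ g)) x = H.exchMap H.par g l x (H.comul₃ a) := by
  rw [straighten_eq hH]
  generalize H.comul₃ a = t
  refine tmul_homog_induction₃ hH.par_par hH.par_par hH.par_par (fun s t h h' => by
    simp only [add_tmul, map_add, ev_add, h, h']) (fun i a₁ j a₂ k a₃ h₁ h₂ h₃ => ?_) t
  rw [ev_straighten₃ hH h₁ h₂ h₃ hx hS, exchMap_homog h₁ h₂ h₃]

theorem ev_act {l : ZMod 2} {x : V} (hx : IsHomog H.par l x) (a : V) (z : Dual F V ⊗[F] V) :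
    ev (H.act a z) x = H.sandMap (dualTensorHom F V V z ∘ₗ H.sandwichMap x)
      (signOp₃ H.par H.par H.par (fun i j k => exch i j k l) (H.comul₃ a)) := by
  rw [act]
  generalize H.comul₃ a = t
  refine tmul_homog_induction₃ hH.par_par hH.par_par hH.par_par (fun s t h h' => by
    simp only [add_tmul, map_add, ev_add, h, h']) (fun i a₁ j a₂ k a₃ h₁ h₂ h₃ => ?_) t
  rw [ev_act₃ hH h₁ h₂ h₃ hx hS, signOp₃_homog _ h₁ h₂ h₃, map_smul]
  rfl

end HopfSuperData

end QDouble

end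

/-! ### Associativity of the double -/

noncomputable section

set_option linter.unusedSectionVars false

namespace QDouble

open TensorProduct Module

namespace HopfSuperData

variable {F : Type*} [Field F]
variable {V : Type*} [AddCommGroup V] [Module F V]
variable (H : HopfSuperData F V)

/-- `u ⊗ v ↦ (-1)^{|u||v|} g(u) z(v)`. -/
def contr (g : Dual F V) (z : Dual F V ⊗[F] V) : V ⊗[F] V →ₗ[F] V :=
  (TensorProduct.lid F V).toLinearMap ∘ₗ TensorProduct.map g (dualTensorHom F V V z) ∘ₗ
    koszul H.par H.par

/-- `(S⁻¹ ⊗ S⁻¹)` followed by the graded flip. -/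
def coflip : V ⊗[F] V →ₗ[F] V ⊗[F] V :=
  (TensorProduct.comm F V V).toLinearMap ∘ₗ koszul H.par H.par ∘ₗ
    TensorProduct.map H.antipodeInv H.antipodeInv

/-- The coproduct of `S⁻¹(c) x a` as a function of those of `x`, `a` and `c`. -/
def sandwich₂ (D : V ⊗[F] V) : (V ⊗[F] V) ⊗[F] (V ⊗[F] V) →ₗ[F] V ⊗[F] V :=
  H.tensorMul ∘ₗ TensorProduct.map H.coflip (TensorProduct.curry H.tensorMul D) ∘ₗ
    (TensorProduct.comm F _ _).toLinearMap

/-- `x ⊗ y ↦ ± ((1 ⊗ s(x)) z)(y)`. -/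
def actOn (z s : Dual F V ⊗[F] V) : V ⊗[F] V →ₗ[F] V :=
  TensorProduct.lift (LinearMap.mk₂ F (fun x y => ev (H.act (ev s x) z) y)
    (fun x x' y => by simp [act, add_tmul]) (fun c x y => by simp [act, ← smul_tmul'])
    (fun x y y' => by simp) (fun c x y => by simp)) ∘ₗ koszul H.par H.par

variable {H} (hH : H.IsHopfSuperalgebra) [CharZero F] (hS : Function.Bijective H.antipode)

section

variable {i j m n : ZMod 2} {u v : V}

theorem contr_homog (hu : IsHomog H.par i u) (hv : IsHomog H.par j v) (g : Dual F V)
    (z : Dual F V ⊗[F] V) : H.contr g z (u ⊗ₜ v) = (sg F (i * j) * g u) • ev z v := by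
  simp [contr, koszul_homog hu hv, smul_smul, ev]

theorem actOn_homog (hu : IsHomog H.par i u) (hv : IsHomog H.par j v)
    (z s : Dual F V ⊗[F] V) : H.actOn z s (u ⊗ₜ v) = sg F (i * j) • ev (H.act (ev s u) z) v := by
  simp only [actOn, LinearMap.comp_apply, koszul_homog hu hv, map_smul]
  rfl

theorem actOn_add (z s s' : Dual F V ⊗[F] V) : H.actOn z (s + s') = H.actOn z s + H.actOn z s' := by
  ext x y
  simp only [actOn, AlgebraTensorModule.curry_apply, LinearMap.restrictScalars_apply, curry_apply,
    LinearMap.comp_apply, LinearMap.add_apply]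
  generalize koszul H.par H.par (x ⊗ₜ y) = t
  induction t using TensorProduct.induction_on with
  | zero => simp
  | add s t hs ht => simp only [map_add, hs, ht]; abel
  | tmul x y => simp [act, add_tmul]

include hH hS in
theorem coflip_homog (hu : IsHomog H.par i u) (hv : IsHomog H.par j v) :
    H.coflip (u ⊗ₜ v) = sg F (i * j) • (H.antipodeInv v ⊗ₜ[F] H.antipodeInv u) := by
  have e := par_antipodeInv hS hH
  simp [coflip, koszul_homog (hu.map e) (hv.map e)]

include hH hS in
theorem comul_sandwich (hco : H.AntipodeCoanti) (x a c : V) :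
    H.comul (H.sandwich x a c) = H.sandwich₂ (H.comul x) (H.comul a ⊗ₜ H.comul c) := by
  have hm : ∀ a b, H.comul (H.mul (a ⊗ₜ b)) = H.tensorMul (H.comul a ⊗ₜ H.comul b) := fun a b => by
    have := LinearMap.congr_fun hH.comul_mul (a ⊗ₜ b)
    simpa only [LinearMap.comp_apply, TensorProduct.map_tmul] using this
  rw [sandwich, hm, hm, comul_antipodeInv hS hH hco]
  rfl

end

variable [Module.Finite F V]

theorem ev_lmul (g : Dual F V) (z : Dual F V ⊗[F] V) (x : V) :
    ev (H.lmul g z) x = H.contr g z (H.comul x) := by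
  simp only [contr, LinearMap.comp_apply]
  induction z using TensorProduct.induction_on with
  | zero =>
    simp only [map_zero, TensorProduct.map_zero_right, LinearMap.zero_apply, ev_zero]
  | add s t hs ht =>
    simp only [map_add, TensorProduct.map_add_right, LinearMap.add_apply, ev_add, hs, ht]
  | tmul f b =>
    simp only [lmul, TensorProduct.map_tmul, ev_tmul, curry_apply, LinearMap.id_apply,
      dualOp_mul_apply]
    generalize koszul H.par H.par (H.comul x) = t
    induction t using TensorProduct.induction_on with
    | zero => simp
    | add s t hs ht => simp only [map_add, add_smul, hs, ht]
    | tmul u v => simp [smul_smul, mul_comm]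

include hH in
-- Once evaluated at `x`, the product is governed by `Δ x`: the first leg goes into `s`, the
-- resulting vector acts on `z`, and the second leg is evaluated there.
theorem ev_double_mul (s z : Dual F V ⊗[F] V) (x : V) :
    ev (H.double.mul (s ⊗ₜ z)) x = H.actOn z s (H.comul x) := by
  have hP := hH.par_par
  induction s using TensorProduct.induction_on with
  | zero =>
    have : H.actOn z 0 = 0 := by simpa using H.actOn_add z 0 0
    simp [this]
  | add s t hs ht => simp only [add_tmul, map_add, ev_add, hs, ht, actOn_add, LinearMap.add_apply]
  | tmul f a =>
    rw [double_mul_apply hH, ev_lmul]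
    generalize H.comul x = t
    refine tmul_homog_induction hP hP (fun s t hs ht => by simp only [map_add, hs, ht])
      (fun i u j v hu hv => ?_) t
    rw [contr_homog hu hv, actOn_homog hu hv, ev_tmul]
    simp [act, ← smul_tmul', smul_smul]

@[elab_as_elim] theorem tmul_homog_induction₄ {P : V →ₗ[F] V} (hP : P ∘ₗ P = LinearMap.id)
    {p : ((V ⊗[F] V) ⊗[F] V) ⊗[F] V → Prop} (add : ∀ s t, p s → p t → p (s + t))
    (homog : ∀ i a j b k c l d, IsHomog P i a → IsHomog P j b → IsHomog P k c → IsHomog P l d →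
      p (((a ⊗ₜ b) ⊗ₜ c) ⊗ₜ d)) (t : ((V ⊗[F] V) ⊗[F] V) ⊗[F] V) : p t := by
  have h0 : IsHomog P 0 0 := by simp [IsHomog]
  induction t using TensorProduct.induction_on with
  | zero => simpa using homog 0 0 0 0 0 0 0 0 h0 h0 h0 h0
  | add s t hs ht => exact add s t hs ht
  | tmul s d =>
    refine tmul_homog_induction₃ hP hP hP (p := fun s => p (s ⊗ₜ d)) (fun a b ha hb => ?_)
      (fun i a j b k c ha hb hc => ?_) s
    · rw [add_tmul]; exact add _ _ ha hb
    · refine homog_induction hP (p := fun d => p (((a ⊗ₜ b) ⊗ₜ c) ⊗ₜ d)) (fun a b ha hb => ?_)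
        (fun l d hd => homog i a j b k c l d ha hb hc hd) d
      rw [tmul_add]; exact add _ _ ha hb

@[elab_as_elim] theorem tmul_homog_induction₅ {P : V →ₗ[F] V} (hP : P ∘ₗ P = LinearMap.id)
    {p : (((V ⊗[F] V) ⊗[F] V) ⊗[F] V) ⊗[F] V → Prop} (add : ∀ s t, p s → p t → p (s + t))
    (homog : ∀ i a j b k c l d n e, IsHomog P i a → IsHomog P j b → IsHomog P k c →
      IsHomog P l d → IsHomog P n e → p ((((a ⊗ₜ b) ⊗ₜ c) ⊗ₜ d) ⊗ₜ e))
    (t : (((V ⊗[F] V) ⊗[F] V) ⊗[F] V) ⊗[F] V) : p t := by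
  have h0 : IsHomog P 0 0 := by simp [IsHomog]
  induction t using TensorProduct.induction_on with
  | zero => simpa using homog 0 0 0 0 0 0 0 0 0 0 h0 h0 h0 h0 h0
  | add s t hs ht => exact add s t hs ht
  | tmul s e =>
    refine tmul_homog_induction₄ hP (p := fun s => p (s ⊗ₜ e)) (fun a b ha hb => ?_)
      (fun i a j b k c l d ha hb hc hd => ?_) s
    · rw [add_tmul]; exact add _ _ ha hb
    · refine homog_induction hP (p := fun e => p ((((a ⊗ₜ b) ⊗ₜ c) ⊗ₜ d) ⊗ₜ e))
        (fun a b ha hb => ?_) (fun n e he => homog i a j b k c l d n e ha hb hc hd he) e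
      rw [tmul_add]; exact add _ _ ha hb

theorem sandMap_comp_map {A C A' C' : Type*} [AddCommGroup A] [Module F A] [AddCommGroup C]
    [Module F C] [AddCommGroup A'] [Module F A'] [AddCommGroup C'] [Module F C']
    (φ : A' ⊗[F] C' →ₗ[F] V) (f : A →ₗ[F] A') (g : C →ₗ[F] C') (t : (A ⊗[F] V) ⊗[F] C) :
    H.sandMap (φ ∘ₗ TensorProduct.map f g) t =
      H.sandMap φ (TensorProduct.map (TensorProduct.map f LinearMap.id) g t) := by
  induction t using TensorProduct.induction_on with
  | zero => simp
  | add s t hs ht => simp only [map_add, hs, ht]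
  | tmul s c =>
    induction s using TensorProduct.induction_on with
    | zero => simp
    | add s t hs ht => simp only [add_tmul, map_add, hs, ht]
    | tmul a b => simp

theorem sandMap_add {A C : Type*} [AddCommGroup A] [Module F A] [AddCommGroup C]
    [Module F C] (φ ψ : A ⊗[F] C →ₗ[F] V) (t : (A ⊗[F] V) ⊗[F] C) :
    H.sandMap (φ + ψ) t = H.sandMap φ t + H.sandMap ψ t := by
  induction t using TensorProduct.induction_on with
  | zero => simp
  | add s t hs ht => simp only [map_add, hs, ht]; abel
  | tmul s c =>
    induction s using TensorProduct.induction_on with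
    | zero => simp
    | add s t hs ht => simp only [add_tmul, map_add, hs, ht]; abel
    | tmul a b => simp [tmul_add]

theorem sandwich₂_add (D E : V ⊗[F] V) : H.sandwich₂ (D + E) = H.sandwich₂ D + H.sandwich₂ E := by
  simp only [sandwich₂, map_add, TensorProduct.map_add_right, LinearMap.add_comp, LinearMap.comp_add]

include hH hS in
-- The exponent lists the crossings: `b₄` with `b₅` in the reversed coproduct, `x₂` with `b₁`, and
-- `b₄` with `x₁ b₁`.
theorem sandwich₂_homog {i₁ i₂ i₄ i₅ m n : ZMod 2} {b₁ b₂ b₄ b₅ x₁ x₂ : V}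
    (h₁ : IsHomog H.par i₁ b₁) (h₂ : IsHomog H.par i₂ b₂) (h₄ : IsHomog H.par i₄ b₄)
    (h₅ : IsHomog H.par i₅ b₅) (hx₁ : IsHomog H.par m x₁) (hx₂ : IsHomog H.par n x₂) :
    H.sandwich₂ (x₁ ⊗ₜ x₂) ((b₁ ⊗ₜ b₂) ⊗ₜ (b₄ ⊗ₜ b₅)) = sg F (i₄ * i₅ + n * i₁ + i₄ * (m + i₁)) •
      (H.sandwich x₁ b₁ b₅ ⊗ₜ[F] H.sandwich x₂ b₂ b₄) := by
  have e := par_antipodeInv hS hH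
  simp only [sandwich₂, LinearMap.comp_apply, LinearEquiv.coe_coe, comm_tmul,
    TensorProduct.map_tmul, coflip_homog hH hS h₄ h₅, curry_apply, tensorMul, superTensorMul_eq,
    superMul_homog _ _ hx₂ h₁, ← smul_tmul', tmul_smul, map_smul,
    superMul_homog _ _ (h₄.map e) (hx₁.mul hH.par_mul h₁), smul_smul, ← sg_add, sandwich]
  congr 2; ring

include hH hS in
-- At `x`, both sides are `± g(S⁻¹(a₅) x' a₁) a₃ z(S⁻¹(a₄) x'' a₂)` in five legs of `a`. On the left
-- the coproduct of `S⁻¹(a₃) x a₁` splits both outer legs in two; on the right the middle leg of the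
-- first exchange is split in three by the second. This is the compatibility that makes the double
-- associative.
theorem act_lmul (hco : H.AntipodeCoanti) (a : V) (g : Dual F V) (z : Dual F V ⊗[F] V) :
    H.act a (H.lmul g z) = H.double.mul (H.straighten (a ⊗ₜ g) ⊗ₜ z) := by
  have hP := hH.par_par
  have hPP : TensorProduct.map H.par H.par ∘ₗ TensorProduct.map H.par H.par = LinearMap.id := by
    rw [← TensorProduct.map_comp, hP, TensorProduct.map_id]
  refine ev_ext_homog hP fun l x hx => ?_
  rw [ev_act hH hS hx, ev_double_mul hH]
  have e1 : dualTensorHom F V V (H.lmul g z) ∘ₗ H.sandwichMap x =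
      (H.contr g z ∘ₗ H.sandwich₂ (H.comul x)) ∘ₗ TensorProduct.map H.comul H.comul := by
    refine TensorProduct.ext' fun a c => ?_
    have := ev_lmul (H := H) g z (H.sandwich x a c)
    rw [comul_sandwich hH hS hco] at this
    exact this
  rw [e1, sandMap_comp_map, ← signOp₃_map _ hH.par_comul (LinearMap.id_comp H.par) hH.par_comul,
    map_comul_id_comul_comul₃ hH]
  -- The sign on the left involves `|x|` and those on the right the degrees of the legs of `Δ x`.
  -- Hence `Δ x` is decomposed into pure tensors whose degrees add up to `l`.
  refine tmul_homog_induction_total hP hP (p := fun D => H.sandMap (H.contr g z ∘ₗ H.sandwich₂ D)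
    (signOp₃ (TensorProduct.map H.par H.par) H.par (TensorProduct.map H.par H.par)
      (fun i j k => exch i j k l) (TensorProduct.assoc F _ _ _ (H.comul₅ a))) =
      H.actOn z (H.straighten (a ⊗ₜ g)) D) (fun D E hD hE => by
    rw [sandwich₂_add, LinearMap.comp_add, sandMap_add, hD, hE, map_add])
    (fun m x₁ n x₂ hx₁ hx₂ hl => ?_) (H.comul x) (hx.map hH.par_comul)
  have hT : IsHomog (TensorProduct.map H.par H.par) l (H.comul x) := hx.map hH.par_comul
  rw [actOn_homog hx₁ hx₂, ev_act hH hS hx₂, ev_straighten hH hS hx₁, exchMap_map (par₃_comul₃ hH),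
    map_id_comul₃_comul₃ hH]
  generalize H.comul₅ a = T
  refine tmul_homog_induction₅ hP (fun s t hs ht => by
    simp only [map_add, hs, ht, smul_add])
    (fun i₁ b₁ i₂ b₂ i₃ b₃ i₄ b₄ i₅ b₅ h₁ h₂ h₃ h₄ h₅ => ?_) T
  simp only [assoc_tmul, TensorProduct.map_tmul, LinearMap.comp_apply, LinearEquiv.coe_coe,
    LinearMap.id_apply]
  rw [signOp₃_homog _ (h₁.tmul h₂) h₃ (h₄.tmul h₅), map_smul, sandMap_tmul, LinearMap.comp_apply,
    sandwich₂_homog hH hS h₁ h₂ h₄ h₅ hx₁ hx₂, map_smul,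
    contr_homog (sandwich_homog hH h₁ h₅ hx₁ hS) (sandwich_homog hH h₂ h₄ hx₂ hS),
    exchMap_homog (Q := H.par₃) h₁ ((h₂.tmul h₃).tmul h₄) h₅, map_smul, map_smul,
    signOp₃_homog _ h₂ h₃ h₄, map_smul, sandMap_tmul, LinearMap.comp_apply, sandwichMap_tmul]
  simp only [tmul_smul, map_smul, smul_smul, ← mul_assoc, ← sg_add]
  rw [mul_right_comm (sg F _) _ (sg F _), ← sg_add]
  change _ = (_ : F) • H.mul (b₃ ⊗ₜ ev z (H.sandwich x₂ b₂ b₄))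
  subst hl
  congr 3
  clear * -
  revert i₁ i₂ i₃ i₄ i₅ m n
  unfold exch
  decide

include hH hS in
-- In `(f ⊗ a)((g ⊗ b) z)` the outer factors act through modules, and only `1 ⊗ a` and `g ⊗ 1` are
-- out of order. They are interchanged by `act_lmul`.
theorem double_mul_assoc (han : H.AntipodeAnti) (hco : H.AntipodeCoanti)
    (s t z : Dual F V ⊗[F] V) : H.double.mul (H.double.mul (s ⊗ₜ t) ⊗ₜ z) =
      H.double.mul (s ⊗ₜ H.double.mul (t ⊗ₜ z)) := by
  have ll : ∀ f g z, H.lmul (H.dualOp.mul (f ⊗ₜ g)) z = H.lmul f (H.lmul g z) := fun f g z => by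
    induction z using TensorProduct.induction_on with
    | zero => simp
    | add s t hs ht => simp only [map_add, hs, ht]
    | tmul h b => simp [lmul, dualOp_mul_assoc hH]
  have lD : ∀ f s z, H.double.mul (H.lmul f s ⊗ₜ z) = H.lmul f (H.double.mul (s ⊗ₜ z)) :=
    fun f s z => by
      induction s using TensorProduct.induction_on with
      | zero => simp
      | add s t hs ht => simp only [add_tmul, map_add, hs, ht]
      | tmul h b =>
        rw [double_mul_apply hH, ← ll]
        simp [lmul, double_mul_apply hH]
  have lA : ∀ b s z, H.double.mul (TensorProduct.map LinearMap.id
      ((TensorProduct.curry H.mul).flip b) s ⊗ₜ z) = H.double.mul (s ⊗ₜ H.act b z) :=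
    fun b s z => by
      induction s using TensorProduct.induction_on with
      | zero => simp
      | add s t hs ht => simp only [add_tmul, map_add, hs, ht]
      | tmul h b =>
        simp [double_mul_apply hH, act_mul hH hS han]
  induction s using TensorProduct.induction_on with
  | zero => simp
  | add s s' hs ht => simp only [add_tmul, map_add, hs, ht]
  | tmul f a =>
    induction t using TensorProduct.induction_on with
    | zero => simp
    | add s t hs ht => simp only [add_tmul, tmul_add, map_add, hs, ht]
    | tmul g b =>
      rw [double_mul_apply hH, lD, double_mul_apply hH, double_mul_apply hH, act_lmul hH hS hco,
        ← lA, act, act₃_tmul, straighten_eq hH]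

end HopfSuperData

end QDouble

end

/-! ### The coproduct of the double on `(1 ⊗ a)(g ⊗ 1)` -/

noncomputable section

set_option linter.unusedSectionVars false

namespace QDouble

open TensorProduct Module

section

variable {F : Type*} [Field F]
variable {V : Type*} [AddCommGroup V] [Module F V]
variable {W : Type*} [AddCommGroup W] [Module F W]
variable {U : Type*} [AddCommGroup U] [Module F U]

/-- The operator that multiplies `v` by `(-1)^{n|v|}`. -/
def parPow (P : V →ₗ[F] V) (n : ZMod 2) : V →ₗ[F] V := ∑ i, sg F (n * i) • pr P i

theorem parPow_homog [CharZero F] {P : V →ₗ[F] V} {i : ZMod 2} {v : V} (hv : IsHomog P i v)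
    (n : ZMod 2) : parPow P n v = sg F (n * i) • v := by
  simp only [parPow, LinearMap.sum_apply, LinearMap.smul_apply, pr_homog hv]
  rw [Finset.sum_eq_single i]
  · simp
  · intro b _ hb; simp [hb]
  · simp

namespace HopfSuperData

/-- Evaluation of the first tensor factor. -/
def evLin (W : Type*) [AddCommGroup W] [Module F W] (x : V) : Dual F V ⊗[F] W →ₗ[F] W where
  toFun t := ev t x
  map_add' s t := ev_add s t x
  map_smul' c t := ev_smul c t x

/-- Evaluation of both dual tensor factors. -/
def ev₂ (x y : V) : (Dual F V ⊗[F] V) ⊗[F] (Dual F V ⊗[F] V) →ₗ[F] V ⊗[F] V :=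
  TensorProduct.map (evLin V x) (evLin V y)

@[simp] theorem ev₂_tmul (x y : V) (s t : Dual F V ⊗[F] V) :
    ev₂ x y (s ⊗ₜ t) = ev s x ⊗ₜ ev t y := rfl

theorem ev₂_ext [CharZero F] [Module.Finite F V] {H : HopfSuperData F V}
    (hP : H.par ∘ₗ H.par = LinearMap.id) {s t : (Dual F V ⊗[F] V) ⊗[F] (Dual F V ⊗[F] V)}
    (h : ∀ i x j y, IsHomog H.par i x → IsHomog H.par j y → ev₂ x y s = ev₂ x y t) : s = t := by
  apply (TensorProduct.assoc F (Dual F V) V (Dual F V ⊗[F] V)).injective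
  refine ev_ext_homog hP fun i x hx => ?_
  apply (TensorProduct.leftComm F V (Dual F V) V).injective
  refine ev_ext_homog hP fun j y hy => ?_
  have e : ∀ s : (Dual F V ⊗[F] V) ⊗[F] (Dual F V ⊗[F] V),
      ev (TensorProduct.leftComm F V (Dual F V) V
        (ev (TensorProduct.assoc F (Dual F V) V (Dual F V ⊗[F] V) s) x)) y = ev₂ x y s := fun s => by
    induction s using TensorProduct.induction_on with
    | zero => simp
    | add s t hs ht => simp only [map_add, ev_add, hs, ht]
    | tmul s t =>
      induction s using TensorProduct.induction_on with
      | zero => simp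
      | add s t hs ht => simp only [add_tmul, map_add, ev_add, hs, ht]
      | tmul f a =>
        induction t using TensorProduct.induction_on with
        | zero => simp
        | add s t hs ht => simp only [tmul_add, map_add, ev_add, hs, ht]
        | tmul g b => simp [tmul_smul, ← smul_tmul', smul_comm (f x) (g y)]
  rw [e, e, h i x j y hx hy]

variable (H : HopfSuperData F V)

/-- `Δ⁽⁶⁾`, associated to the left. -/
def comul₆ : V →ₗ[F] ((((V ⊗[F] V) ⊗[F] V) ⊗[F] V) ⊗[F] V) ⊗[F] V :=
  TensorProduct.map H.comul₅ LinearMap.id ∘ₗ H.comul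

variable (F V) in
/-- `(s ⊗ (a ⊗ b)) ⊗ (c ⊗ d) ↦ (s ⊗ a) ⊗ ((b ⊗ c) ⊗ d)`. -/
def regroup : ((V ⊗[F] V) ⊗[F] (V ⊗[F] V)) ⊗[F] (V ⊗[F] V) →ₗ[F]
    ((V ⊗[F] V) ⊗[F] V) ⊗[F] ((V ⊗[F] V) ⊗[F] V) :=
  TensorProduct.map LinearMap.id (TensorProduct.assoc F V V V).symm.toLinearMap ∘ₗ
    (TensorProduct.assoc F ((V ⊗[F] V) ⊗[F] V) V (V ⊗[F] V)).toLinearMap ∘ₗ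
    TensorProduct.map (TensorProduct.assoc F (V ⊗[F] V) V V).symm.toLinearMap LinearMap.id

@[simp] theorem regroup_tmul (s : V ⊗[F] V) (a b c d : V) :
    regroup F V ((s ⊗ₜ (a ⊗ₜ b)) ⊗ₜ (c ⊗ₜ d)) = (s ⊗ₜ a) ⊗ₜ ((b ⊗ₜ c) ⊗ₜ d) := rfl

variable {H}

/-- Both sides are rebracketings of the sixfold coproduct. The right-hand form shows the third and
fourth legs as the coproduct of one element, which is what cancels later. -/
theorem map_comul₃_comul₃_comul (hH : H.IsHopfSuperalgebra) (a : V) :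
    TensorProduct.map H.comul₃ H.comul₃ (H.comul a) = regroup F V
      (TensorProduct.map (TensorProduct.map LinearMap.id H.comul) LinearMap.id
        (TensorProduct.map (TensorProduct.map H.comul LinearMap.id) H.comul (H.comul₃ a))) := by
  have e1 : TensorProduct.map H.comul₃ H.comul₃ (H.comul a) =
      TensorProduct.assoc F _ _ _ (TensorProduct.map
        (TensorProduct.assoc F _ _ _).toLinearMap LinearMap.id (H.comul₆ a)) := by
    have : TensorProduct.map H.comul₃ H.comul₃ (H.comul a) =
        TensorProduct.map (TensorProduct.map H.comul LinearMap.id)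
          (TensorProduct.map H.comul LinearMap.id)
          (TensorProduct.map H.comul H.comul (H.comul a)) := by
      rw [TensorProduct.map_map]; rfl
    rw [this, map_comul_comul hH, map_assoc]
    congr 1
    have e : TensorProduct.map (TensorProduct.map H.comul LinearMap.id) H.comul ∘ₗ H.comul₃ =
      (TensorProduct.assoc F _ _ _).toLinearMap ∘ₗ H.comul₅ :=
        LinearMap.ext (map_comul_id_comul_comul₃ hH)
    rw [comul₄, LinearMap.comp_apply, TensorProduct.map_map, e, comul₆, LinearMap.comp_apply,
      TensorProduct.map_map]
  have e2 : TensorProduct.map (TensorProduct.map LinearMap.id H.comul) LinearMap.id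
        (TensorProduct.map (TensorProduct.map H.comul LinearMap.id) H.comul (H.comul₃ a)) =
      TensorProduct.assoc F _ _ _ (TensorProduct.map (TensorProduct.map
        (TensorProduct.assoc F _ _ _).toLinearMap LinearMap.id) LinearMap.id (H.comul₆ a)) := by
    rw [map_comul_id_comul_comul₃ hH]
    have : ∀ t : ((V ⊗[F] V) ⊗[F] V) ⊗[F] (V ⊗[F] V),
        TensorProduct.map (TensorProduct.map LinearMap.id H.comul)
        (LinearMap.id : V ⊗[F] V →ₗ[F] V ⊗[F] V) t = TensorProduct.map
          (TensorProduct.map LinearMap.id H.comul)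
          (TensorProduct.map (LinearMap.id : V →ₗ[F] V) LinearMap.id) t := fun t => by
      rw [TensorProduct.map_id (R := F) (M := V) (N := V)]
    rw [this, map_assoc]
    congr 1
    have e : TensorProduct.map LinearMap.id H.comul ∘ₗ H.comul₃ =
      (TensorProduct.assoc F _ _ _).toLinearMap ∘ₗ H.comul₄ := by
        refine LinearMap.ext fun b => ?_
        rw [LinearMap.comp_apply, comul₃, LinearMap.comp_apply, TensorProduct.map_map]
        exact map_comul_comul hH b
    have e' : TensorProduct.map (TensorProduct.map LinearMap.id H.comul) LinearMap.id ∘ₗ H.comul₄ =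
        TensorProduct.map (TensorProduct.assoc F _ _ _).toLinearMap LinearMap.id ∘ₗ H.comul₅ := by
      refine LinearMap.ext fun b => ?_
      simp only [LinearMap.comp_apply]
      rw [comul₄, LinearMap.comp_apply, TensorProduct.map_map, e, comul₅, LinearMap.comp_apply,
        TensorProduct.map_map]
    rw [comul₅, LinearMap.comp_apply, TensorProduct.map_map, e', comul₆, LinearMap.comp_apply,
      TensorProduct.map_map]
  rw [e1, e2]
  generalize H.comul₆ a = T
  induction T using TensorProduct.induction_on with
  | zero => simp
  | add s t hs ht => simp only [map_add, hs, ht]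
  | tmul T b₆ =>
  induction T using TensorProduct.induction_on with
  | zero => simp
  | add s t hs ht => simp only [add_tmul, map_add, hs, ht]
  | tmul T b₅ =>
  induction T using TensorProduct.induction_on with
  | zero => simp
  | add s t hs ht => simp only [add_tmul, map_add, hs, ht]
  | tmul T b₄ =>
  induction T using TensorProduct.induction_on with
  | zero => simp
  | add s t hs ht => simp only [add_tmul, map_add, hs, ht]
  | tmul T b₃ => simp

variable (H) in
/-- The product `(1 ⊗ a) (g ⊗ 1)` in the tensor square of the double, as a function of
`∑ Δ⁽³⁾(a') ⊗ Δ⁽³⁾(a'')` and of `∑ g' ⊗ g''`, evaluated at `x ⊗ y`. -/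
def straightenSq (x y : V) (γ : Dual F V ⊗[F] Dual F V) :
    ((V ⊗[F] V) ⊗[F] V) ⊗[F] ((V ⊗[F] V) ⊗[F] V) →ₗ[F] V ⊗[F] V :=
  ev₂ x y ∘ₗ TensorProduct.map H.straighten₃ H.straighten₃ ∘ₗ
    (tensorTensorTensorComm F _ _ _ _).toLinearMap ∘ₗ
    koszul (V := ((V ⊗[F] V) ⊗[F] V) ⊗[F] ((V ⊗[F] V) ⊗[F] V)) (W := Dual F V ⊗[F] Dual F V)
      (TensorProduct.map LinearMap.id H.par₃) (TensorProduct.map H.dualPar LinearMap.id) ∘ₗ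
    (TensorProduct.mk F _ _).flip γ

theorem straightenSq_add (x y : V) (γ γ' : Dual F V ⊗[F] Dual F V) :
    H.straightenSq x y (γ + γ') = H.straightenSq x y γ + H.straightenSq x y γ' := by
  simp only [straightenSq, map_add, LinearMap.comp_add]

variable (hH : H.IsHopfSuperalgebra) [CharZero F] (hS : Function.Bijective H.antipode)

theorem tmul_map_id_homog {P : V →ₗ[F] V} {i : ZMod 2} {v : V} (hv : IsHomog P i v) (w : W) :
    IsHomog (TensorProduct.map P LinearMap.id) i (v ⊗ₜ[F] w) := by
  unfold IsHomog at *; simp [hv, smul_tmul']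

theorem map_id_tmul_homog {P : V →ₗ[F] V} {i : ZMod 2} {v : V} (hv : IsHomog P i v) (w : W) :
    IsHomog (TensorProduct.map LinearMap.id P) i (w ⊗ₜ[F] v) := by
  unfold IsHomog at *; simp [hv]

include hH hS in
-- The first summand of the exponent comes from moving the legs `c` past the first functional, whose
-- degree is replaced by that of its argument `S⁻¹(b₃) x b₁`; the other two belong to the two
-- exchanges.
theorem straightenSq_homog {i₁ i₂ i₃ j₁ j₂ j₃ m n : ZMod 2} {b₁ b₂ b₃ c₁ c₂ c₃ x y : V}
    (hb₁ : IsHomog H.par i₁ b₁) (hb₂ : IsHomog H.par i₂ b₂) (hb₃ : IsHomog H.par i₃ b₃)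
    (hc₁ : IsHomog H.par j₁ c₁) (hc₂ : IsHomog H.par j₂ c₂) (hc₃ : IsHomog H.par j₃ c₃)
    (hx : IsHomog H.par m x) (hy : IsHomog H.par n y) (γ : Dual F V ⊗[F] Dual F V) :
    H.straightenSq x y γ (((b₁ ⊗ₜ b₂) ⊗ₜ b₃) ⊗ₜ ((c₁ ⊗ₜ c₂) ⊗ₜ c₃)) =
      (sg F ((j₁ + j₂ + j₃) * (i₃ + m + i₁) + exch i₁ i₂ i₃ m + exch j₁ j₂ j₃ n) *
        ev γ (H.sandwich x b₁ b₃) (H.sandwich y c₁ c₃)) • (b₂ ⊗ₜ[F] c₂) := by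
  have hX : H.dualPar ∘ₗ H.dualPar = LinearMap.id := dualPar_par hH.par_par
  refine tmul_homog_induction hX hX (fun s t hs ht => by
    rw [straightenSq_add, LinearMap.add_apply, hs, ht, ev_add, LinearMap.add_apply, ← add_smul,
      ← mul_add]) (fun i f j g hf hg => ?_) γ
  simp only [straightenSq, LinearMap.comp_apply, LinearMap.flip_apply, mk_apply]
  rw [koszul_homog (map_id_tmul_homog (P := H.par₃) ((hc₁.tmul hc₂).tmul hc₃) _)
    (tmul_map_id_homog hf _)]
  simp only [map_smul, LinearEquiv.coe_coe, tensorTensorTensorComm_tmul, TensorProduct.map_tmul,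
    ev₂_tmul, ev_straighten₃ hH hb₁ hb₂ hb₃ hx hS, ev_straighten₃ hH hc₁ hc₂ hc₃ hy hS]
  by_cases hi : i = i₃ + m + i₁
  · subst hi
    simp only [smul_tmul_smul, smul_smul, sg_add, ev_tmul, LinearMap.smul_apply, smul_eq_mul]
    congr 1; ring
  · rw [H.dual_apply_eq_zero hf (sandwich_homog hH hb₁ hb₃ hx hS) hi, ev_tmul,
      H.dual_apply_eq_zero hf (sandwich_homog hH hb₁ hb₃ hx hS) hi]
    simp

variable [Module.Finite F V]

variable (H) in
/-- The inclusion of `X` in the double. -/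
def inclX : Dual F V →ₗ[F] Dual F V ⊗[F] V := (TensorProduct.mk F _ _).flip H.one

variable (H) in
/-- The inclusion of `V` in the double. -/
def inclV : V →ₗ[F] Dual F V ⊗[F] V := TensorProduct.mk F _ _ H.counit

include hH in
theorem inclX_homog {i : ZMod 2} {f : Dual F V} (hf : IsHomog H.dualPar i f) :
    IsHomog H.double.par i (H.inclX f) := by
  have := hf.tmul (isHomog_zero_iff.2 hH.par_one)
  rwa [add_zero] at this

include hH in
theorem inclV_homog {i : ZMod 2} {a : V} (ha : IsHomog H.par i a) :
    IsHomog H.double.par i (H.inclV a) := by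
  have := (isHomog_zero_iff (P := H.dualPar).2 hH.par_counit).tmul ha
  rwa [zero_add] at this

theorem lmul_counit (hH : H.IsHopfSuperalgebra) (z : Dual F V ⊗[F] V) : H.lmul H.counit z = z := by
  have : TensorProduct.curry H.dualOp.mul H.counit = LinearMap.id :=
    LinearMap.ext (dualOp_one_mul hH)
  rw [lmul, this, TensorProduct.map_id, LinearMap.id_apply]

include hH in
theorem inclV_mul (a : V) (z : Dual F V ⊗[F] V) : H.double.mul (H.inclV a ⊗ₜ z) = H.act a z := by
  rw [inclV, mk_apply, double_mul_apply hH, lmul_counit hH]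

include hH hS in
theorem inclX_mul (f : Dual F V) (z : Dual F V ⊗[F] V) :
    H.double.mul (H.inclX f ⊗ₜ z) = H.lmul f z := by
  rw [inclX, LinearMap.flip_apply, mk_apply, double_mul_apply hH, act_one hH hS]

include hH in
theorem inclV_mul_inclX (a : V) (g : Dual F V) :
    H.double.mul (H.inclV a ⊗ₜ H.inclX g) = H.straighten (a ⊗ₜ g) := by
  rw [inclV_mul hH, ← act_tmul_one hH]; rfl

include hH in
theorem ev₂_tensorMul_incl (x y : V) (γ : Dual F V ⊗[F] Dual F V) (t : V ⊗[F] V) :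
    ev₂ x y (H.double.tensorMul (TensorProduct.map H.inclV H.inclV t ⊗ₜ
      TensorProduct.map H.inclX H.inclX γ)) =
      H.straightenSq x y γ (TensorProduct.map H.comul₃ H.comul₃ t) := by
  have hP := hH.par_par
  have hX : H.dualPar ∘ₗ H.dualPar = LinearMap.id := dualPar_par hH.par_par
  rw [tensorMul, superTensorMul_eq]
  refine tmul_homog_induction hP hP (fun s t hs ht => by
    simp only [map_add, add_tmul, hs, ht]) (fun i a j b ha hb => ?_) t
  refine tmul_homog_induction hX hX (fun s t hs ht => by
    simp only [map_add, tmul_add, hs, ht, straightenSq_add, LinearMap.add_apply])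
    (fun k f l g hf hg => ?_) γ
  have h3 : IsHomog H.par₃ j (H.comul₃ b) := hb.map (par₃_comul₃ hH)
  simp only [TensorProduct.map_tmul]
  rw [superMul_homog _ _ (inclV_homog hH hb) (inclX_homog hH hf), inclV_mul_inclX hH,
    inclV_mul_inclX hH, map_smul, ev₂_tmul, straighten_eq hH, straighten_eq hH]
  simp only [straightenSq, LinearMap.comp_apply, LinearMap.flip_apply, mk_apply]
  rw [koszul_homog (map_id_tmul_homog h3 _) (tmul_map_id_homog hf _)]
  simp

include hH in
-- The coproduct of `X` contributes `f(y x)`. The sign for moving `f''` past `a'` can be written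
-- `(-1)^{|y||a'|}`, because `f''(y)` vanishes unless the degrees agree; this is the operator
-- `parPow`.
theorem ev₂_comul_double {n : ZMod 2} (x : V) {y : V} (hy : IsHomog H.par n y)
    (s : Dual F V ⊗[F] V) : ev₂ x y (H.double.comul s) =
      TensorProduct.map (parPow H.par n) LinearMap.id (H.comul (ev s (H.mul (y ⊗ₜ x)))) := by
  have hP := hH.par_par
  have hX : H.dualPar ∘ₗ H.dualPar = LinearMap.id := dualPar_par hH.par_par
  induction s using TensorProduct.induction_on with
  | zero => simp
  | add s t hs ht => simp only [map_add, ev_add, hs, ht]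
  | tmul f a =>
    rw [ev_tmul, map_smul, map_smul, ← ev_dualOp_comul hP]
    simp only [double, LinearMap.comp_apply, TensorProduct.map_tmul]
    generalize H.dualOp.comul f = γ
    refine tmul_homog_induction hX hX (fun s t hs ht => by
      simp only [map_add, add_tmul, hs, ht, ev_add, LinearMap.add_apply, add_smul])
      (fun k f l g hf hg => ?_) γ
    generalize H.comul a = t
    refine tmul_homog_induction hP hP (fun s t hs ht => by
      simp only [map_add, tmul_add, hs, ht, smul_add]) (fun i a j b ha hb => ?_) t
    rw [koszul_homog (map_id_tmul_homog hg _) (tmul_map_id_homog ha _)]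
    simp only [map_smul, LinearEquiv.coe_coe, tensorTensorTensorComm_tmul, ev₂_tmul, ev_tmul,
      TensorProduct.map_tmul, parPow_homog ha, LinearMap.id_apply, LinearMap.smul_apply]
    by_cases hl : l = n
    · subst hl
      simp only [smul_smul, smul_eq_mul, ← smul_tmul', tmul_smul]
      congr 1; ring
    · rw [H.dual_apply_eq_zero hg hy hl]; simp

include hH hS in
-- The argument of `g` contains `c₁ S⁻¹(b₃)` with `b₃ ⊗ c₁` running through `Δ u`. Up to sign this
-- is the opposite product of `S⁻¹(u') ⊗ u''`, that is `ε(u)`, and six legs shrink to four.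
theorem straightenSq_regroup (han : H.AntipodeAnti) {i₁ i₂ j₂ j₃ m n k : ZMod 2}
    {b₁ b₂ c₂ c₃ x y u : V}
    (hb₁ : IsHomog H.par i₁ b₁) (hb₂ : IsHomog H.par i₂ b₂) (hu : IsHomog H.par k u)
    (hc₂ : IsHomog H.par j₂ c₂) (hc₃ : IsHomog H.par j₃ c₃)
    (hx : IsHomog H.par m x) (hy : IsHomog H.par n y) (g : Dual F V) :
    H.straightenSq x y (H.dualOp.comul g)
        (regroup F V (((b₁ ⊗ₜ b₂) ⊗ₜ H.comul u) ⊗ₜ (c₂ ⊗ₜ c₃))) =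
      H.counit u • TensorProduct.map (parPow H.par n) LinearMap.id
        (H.exchMap (TensorProduct.map H.par H.par) g (m + n) (H.mul (y ⊗ₜ x))
          ((b₁ ⊗ₜ (b₂ ⊗ₜ c₂)) ⊗ₜ c₃)) := by
  have hP := hH.par_par
  -- The remaining sign depends on the degrees of the two inner legs only through their sum `k`. The
  -- formula thus makes sense for every `D` of degree `k` and can be specialised to `Δ u`.
  have key : ∀ D : V ⊗[F] V, IsHomog (TensorProduct.map H.par H.par) k D →
      H.straightenSq x y (H.dualOp.comul g) (regroup F V (((b₁ ⊗ₜ b₂) ⊗ₜ D) ⊗ₜ (c₂ ⊗ₜ c₃))) =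
      (sg F ((j₂ + j₃) * (k + m + i₁) + exch i₁ i₂ k m + exch 0 j₂ j₃ n) *
        g (H.mul (H.antipodeInv c₃ ⊗ₜ H.mul (y ⊗ₜ H.mul
          (H.mulOp (TensorProduct.map H.antipodeInv LinearMap.id D) ⊗ₜ H.mul (x ⊗ₜ b₁)))))) •
        (b₂ ⊗ₜ[F] c₂) := fun D hD => by
    refine tmul_homog_induction_total hP hP (fun s t hs ht => by
      simp only [map_add, add_tmul, tmul_add, hs, ht, mul_add, add_smul])
      (fun i₃ b₃ j₁ c₁ hb₃ hc₁ hk => ?_) D hD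
    rw [regroup_tmul, straightenSq_homog hH hS hb₁ hb₂ hb₃ hc₁ hc₂ hc₃ hx hy,
      ev_dualOp_comul hP, TensorProduct.map_tmul, LinearMap.id_apply,
      mulOp_homog (hb₃.map (par_antipodeInv hS hH)) hc₁]
    simp only [sandwich, hH.mul_assoc, ← smul_tmul', map_smul, tmul_smul, smul_eq_mul, ← mul_assoc,
      ← sg_add]
    subst hk
    congr 3
    clear * -
    revert i₁ i₂ i₃ j₁ j₂ j₃ m n
    unfold exch
    decide
  rw [key _ (hu.map hH.par_comul), mulOp_antipodeInv_left hS hH han,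
    exchMap_homog hb₁ (hb₂.tmul hc₂) hc₃]
  by_cases hk : k = 0
  · subst hk
    simp only [sandwich, hH.mul_assoc, ← smul_tmul', map_smul, tmul_smul, smul_eq_mul, smul_smul,
      hH.one_mul, TensorProduct.map_tmul, parPow_homog hb₂, LinearMap.id_apply]
    have hs : sg F ((j₂ + j₃) * (0 + m + i₁) + exch i₁ i₂ 0 m + exch 0 j₂ j₃ n) =
        sg F (exch i₁ (i₂ + j₂) j₃ (m + n)) * sg F (n * i₂) := by
      rw [← sg_add]
      congr 1
      clear * -
      revert i₁ i₂ j₂ j₃ m n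
      unfold exch
      decide
    rw [hs]
    congr 1; ring
  · rw [counit_homog hH hu hk]; simp

include hH hS in
/-- The coproduct of the double is multiplicative on `(1 ⊗ a) (g ⊗ 1)`. -/
theorem comul_straighten (han : H.AntipodeAnti) (a : V) (g : Dual F V) :
    H.double.comul (H.straighten (a ⊗ₜ g)) =
      H.double.tensorMul (TensorProduct.map H.inclV H.inclV (H.comul a) ⊗ₜ
        TensorProduct.map H.inclX H.inclX (H.dualOp.comul g)) := by
  have hP := hH.par_par
  refine ev₂_ext hP fun m x n y hx hy => ?_
  rw [ev₂_tensorMul_incl hH, ev₂_comul_double hH x hy,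
    ev_straighten hH hS (add_comm n m ▸ hy.mul hH.par_mul hx), exchMap_map hH.par_comul,
    map_comul₃_comul₃_comul hH, map_id_comul_comul₃ hH]
  -- Both sides are expressed through `(Δ ⊗ id) Δ(a) = ∑ p ⊗ u ⊗ r`: the left by inserting `ε(u)` in
  -- the middle of a coproduct, the right as `Δ p ⊗ Δ u ⊗ Δ r`.
  have e4 : H.comul₄ a = (TensorProduct.assoc F _ _ _).symm
      (TensorProduct.map H.comul H.comul (H.comul a)) := by
    rw [map_comul_comul hH, LinearEquiv.symm_apply_apply]
  have e3 : H.comul a = TensorProduct.map ((TensorProduct.rid F V).toLinearMap ∘ₗ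
      TensorProduct.map LinearMap.id H.counit) LinearMap.id (H.comul₃ a) := by
    have := hH.comul_counit
    rw [← LinearMap.comp_assoc] at this
    rw [comul₃, LinearMap.comp_apply, TensorProduct.map_map, this]
    simp
  rw [e4, e3]
  generalize H.comul₃ a = T
  induction T using TensorProduct.induction_on with
  | zero => simp
  | add s t hs ht => simp only [map_add, hs, ht]
  | tmul T r =>
  induction T using TensorProduct.induction_on with
  | zero => simp
  | add s t hs ht => simp only [add_tmul, map_add, hs, ht]
  | tmul p u =>
  refine homog_induction hP (fun v w hv hw => by
    simp only [add_tmul, tmul_add, map_add, hv, hw]) (fun k u hu => ?_) u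
  simp only [TensorProduct.map_tmul, LinearMap.comp_apply, LinearMap.id_apply, LinearEquiv.coe_coe,
    rid_tmul, map_smul, ← smul_tmul']
  generalize H.comul p = s
  generalize H.comul r = t
  refine tmul_homog_induction hP hP (fun s s' h h' => by
    simp only [add_tmul, map_add, smul_add, h, h']) (fun i₁ b₁ i₂ b₂ hb₁ hb₂ => ?_) s
  refine tmul_homog_induction hP hP (fun s s' h h' => by
    simp only [tmul_add, map_add, smul_add, h, h']) (fun j₂ c₂ j₃ c₃ hc₂ hc₃ => ?_) t
  rw [straightenSq_regroup hH hS han hb₁ hb₂ hu hc₂ hc₃ hx hy]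
  simp

end HopfSuperData

end

end QDouble

end

/-! ### Grading and coalgebra structure of the double -/

noncomputable section

set_option linter.unusedSectionVars false

namespace QDouble

open TensorProduct Module

section Shuffle

variable {F : Type*} [Field F]
variable {A : Type*} [AddCommGroup A] [Module F A]
variable {B : Type*} [AddCommGroup B] [Module F B]
variable {C : Type*} [AddCommGroup C] [Module F C]
variable {D : Type*} [AddCommGroup D] [Module F D]
variable {A' : Type*} [AddCommGroup A'] [Module F A']
variable {B' : Type*} [AddCommGroup B'] [Module F B']
variable {C' : Type*} [AddCommGroup C'] [Module F C']
variable {D' : Type*} [AddCommGroup D'] [Module F D']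

variable (A D) in
/-- `(a ⊗ b) ⊗ (c ⊗ d) ↦ (-1)^{|b||c|} (a ⊗ c) ⊗ (b ⊗ d)`. -/
def shuffle (Q : B →ₗ[F] B) (P : C →ₗ[F] C) :
    (A ⊗[F] B) ⊗[F] (C ⊗[F] D) →ₗ[F] (A ⊗[F] C) ⊗[F] (B ⊗[F] D) :=
  (tensorTensorTensorComm F A B C D).toLinearMap ∘ₗ
    koszul (V := A ⊗[F] B) (W := C ⊗[F] D) (TensorProduct.map LinearMap.id Q)
      (TensorProduct.map P LinearMap.id)

theorem shuffle_homog [CharZero F] {Q : B →ₗ[F] B} {P : C →ₗ[F] C} {i j : ZMod 2} (a : A) {b : B}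
    {c : C} (d : D) (hb : IsHomog Q i b) (hc : IsHomog P j c) :
    shuffle A D Q P ((a ⊗ₜ b) ⊗ₜ (c ⊗ₜ d)) = sg F (i * j) • ((a ⊗ₜ[F] c) ⊗ₜ[F] (b ⊗ₜ[F] d)) := by
  simp only [shuffle, LinearMap.comp_apply]
  rw [koszul_homog (HopfSuperData.map_id_tmul_homog hb _) (HopfSuperData.tmul_map_id_homog hc _)]
  simp

theorem shuffle_map {Q : B →ₗ[F] B} {P : C →ₗ[F] C} {Q' : B' →ₗ[F] B'} {P' : C' →ₗ[F] C'}
    (f : A →ₗ[F] A') {g : B →ₗ[F] B'} {h : C →ₗ[F] C'} (k : D →ₗ[F] D')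
    (hg : g ∘ₗ Q = Q' ∘ₗ g) (hh : h ∘ₗ P = P' ∘ₗ h) (t : (A ⊗[F] B) ⊗[F] (C ⊗[F] D)) :
    shuffle A' D' Q' P' (TensorProduct.map (TensorProduct.map f g) (TensorProduct.map h k) t) =
      TensorProduct.map (TensorProduct.map f h) (TensorProduct.map g k) (shuffle A D Q P t) := by
  simp only [shuffle, LinearMap.comp_apply]
  rw [koszul_map (P := TensorProduct.map LinearMap.id Q) (Q := TensorProduct.map P LinearMap.id)]
  · generalize koszul (V := A ⊗[F] B) (W := C ⊗[F] D) _ _ t = t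
    induction t using TensorProduct.induction_on with
    | zero => simp
    | add s t hs ht => simp only [map_add, hs, ht]
    | tmul s t =>
    induction s using TensorProduct.induction_on with
    | zero => simp
    | add s t hs ht => simp only [map_add, add_tmul, hs, ht]
    | tmul a b =>
    induction t using TensorProduct.induction_on with
    | zero => simp
    | add s t hs ht => simp only [map_add, tmul_add, hs, ht]
    | tmul c d => simp
  · rw [← TensorProduct.map_comp, ← TensorProduct.map_comp, hg]; rfl
  · rw [← TensorProduct.map_comp, ← TensorProduct.map_comp, hh]; rfl

end Shuffle

namespace HopfSuperData

variable {F : Type*} [Field F]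
variable {V : Type*} [AddCommGroup V] [Module F V]
variable {H : HopfSuperData F V} (hH : H.IsHopfSuperalgebra) [CharZero F] [Module.Finite F V]

theorem double_comul_tmul (f : Dual F V) (a : V) : H.double.comul (f ⊗ₜ a) =
    shuffle (Dual F V) V H.dualPar H.par (H.dualOp.comul f ⊗ₜ H.comul a) := rfl

theorem double_comul_eq : H.double.comul =
    shuffle (Dual F V) V H.dualPar H.par ∘ₗ TensorProduct.map H.dualOp.comul H.comul := rfl

include hH in
theorem double_mul_tmul (f g : Dual F V) (a b : V) : H.double.mul ((f ⊗ₜ a) ⊗ₜ (g ⊗ₜ b)) =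
    TensorProduct.map (TensorProduct.curry H.dualOp.mul f) ((TensorProduct.curry H.mul).flip b)
      (H.straighten (a ⊗ₜ g)) := by
  rw [double_mul_apply hH, act, act₃_tmul, ← straighten_eq hH, lmul, TensorProduct.map_map]
  rfl

include hH in
theorem double_par_par : H.double.par ∘ₗ H.double.par = LinearMap.id := by
  change TensorProduct.map H.dualPar H.par ∘ₗ TensorProduct.map H.dualPar H.par = _
  rw [← TensorProduct.map_comp, hH.par_par, dualPar_par hH.par_par, TensorProduct.map_id]

section

variable (hS : Function.Bijective H.antipode)

include hH hS in
-- Where the exchange rule is nonzero, `|g|` is the degree of `S⁻¹(a₃) x a₁`. Comparing the degrees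
-- of `x`, of the middle leg and of `a` then shows that the rule is even.
theorem straighten_homog {i j : ZMod 2} {a : V} {g : Dual F V} (ha : IsHomog H.par i a)
    (hg : IsHomog H.dualPar j g) :
    IsHomog (TensorProduct.map H.dualPar H.par) (i + j) (H.straighten (a ⊗ₜ g)) := by
  have hP := hH.par_par
  have h3 : IsHomog H.par₃ i (H.comul₃ a) := ha.map (par₃_comul₃ hH)
  rw [straighten_eq hH]
  have key : ∀ t, TensorProduct.map H.dualPar H.par (H.straighten₃ (t ⊗ₜ g)) =
      sg F j • H.straighten₃ (H.par₃ t ⊗ₜ g) := fun t => by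
    refine tmul_homog_induction₃ hP hP hP (fun s t hs ht => by
      simp only [add_tmul, map_add, smul_add, hs, ht]) (fun i b₁ j' b₂ k b₃ h₁ h₂ h₃ => ?_) t
    refine ev_ext_homog hP fun l x hx => ?_
    have e : H.par₃ ((b₁ ⊗ₜ b₂) ⊗ₜ b₃) = sg F (i + j' + k) • ((b₁ ⊗ₜ b₂) ⊗ₜ b₃) :=
      (h₁.tmul h₂).tmul h₃
    have hx' : H.par x = sg F l • x := hx
    have h₂' : H.par b₂ = sg F j' • b₂ := h₂
    rw [dualPar, ev_map, hx', ev_arg_smul, e, ← smul_tmul', map_smul H.straighten₃, ev_smul, ev_smul,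
      ev_straighten₃ hH h₁ h₂ h₃ hx hS, map_smul, map_smul, h₂']
    simp only [smul_smul]
    by_cases hj : j = k + l + i
    · subst hj
      congr 1
      simp only [← mul_assoc, ← sg_add]
      rw [mul_right_comm (sg F _) _ (sg F _), ← sg_add]
      congr 2
      clear * -
      revert i j' k l
      unfold exch
      decide
    · rw [H.dual_apply_eq_zero hg (sandwich_homog hH h₁ h₃ hx hS) hj]; simp
  unfold IsHomog at h3 ⊢
  rw [key, h3, ← smul_tmul', map_smul, smul_smul, add_comm, sg_add]

include hH hS in
theorem double_par_mul : H.double.par ∘ₗ H.double.mul =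
    H.double.mul ∘ₗ TensorProduct.map H.double.par H.double.par := by
  have hP := hH.par_par
  have hX : H.dualPar ∘ₗ H.dualPar = LinearMap.id := dualPar_par hP
  refine TensorProduct.ext' fun s t => ?_
  refine tmul_homog_induction hX hP (fun s s' h h' => by
    simp only [add_tmul, map_add, h, h']) (fun i f j a hf ha => ?_) s
  refine tmul_homog_induction hX hP (fun s s' h h' => by
    simp only [tmul_add, map_add, h, h']) (fun k g l b hg hb => ?_) t
  have e1 : H.double.par (f ⊗ₜ a) = sg F (i + j) • (f ⊗ₜ a) := hf.tmul ha
  have e2 : H.double.par (g ⊗ₜ b) = sg F (k + l) • (g ⊗ₜ b) := hg.tmul hb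
  have e3 := straighten_homog hH hS ha hg
  simp only [LinearMap.comp_apply, TensorProduct.map_tmul]
  rw [e1, e2, smul_tmul_smul, map_smul, double_mul_tmul hH]
  have e4 : ∀ z, H.double.par (TensorProduct.map (TensorProduct.curry H.dualOp.mul f)
      ((TensorProduct.curry H.mul).flip b) z) = sg F (i + l) • TensorProduct.map
        (TensorProduct.curry H.dualOp.mul f) ((TensorProduct.curry H.mul).flip b)
          (TensorProduct.map H.dualPar H.par z) := fun z => by
    refine tmul_homog_induction hX hP (fun s s' h h' => by
      simp only [smul_add, map_add, h, h']) (fun m h n c hh hc => ?_) z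
    have e5 : H.double.par (H.dualOp.mul (f ⊗ₜ h) ⊗ₜ H.mul (c ⊗ₜ b)) =
        sg F (i + m + (n + l)) • (H.dualOp.mul (f ⊗ₜ h) ⊗ₜ H.mul (c ⊗ₜ b)) :=
      (hf.mul (dualOp_par_mul hH) hh).tmul (hc.mul hH.par_mul hb)
    have e6 : TensorProduct.map H.dualPar H.par (h ⊗ₜ c) = sg F (m + n) • (h ⊗ₜ c) := hh.tmul hc
    rw [e6, map_smul]
    simp only [TensorProduct.map_tmul, curry_apply, LinearMap.flip_apply, smul_smul, ← sg_add]
    rw [e5]; congr 2; ring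
  have e3' : TensorProduct.map H.dualPar H.par (H.straighten (a ⊗ₜ g)) = sg F (j + k) •
    H.straighten (a ⊗ₜ g) := e3
  rw [e4, e3', map_smul, smul_smul, ← sg_add, ← sg_add]
  congr 2; ring

include hH in
theorem double_par_comul : H.double.comul ∘ₗ H.double.par =
    TensorProduct.map H.double.par H.double.par ∘ₗ H.double.comul := by
  refine TensorProduct.ext' fun f a => ?_
  have e1 : H.dualOp.comul (H.dualPar f) = TensorProduct.map H.dualPar H.dualPar
    (H.dualOp.comul f) := LinearMap.congr_fun (dualOp_par_comul hH) f
  have e2 : H.comul (H.par a) = TensorProduct.map H.par H.par (H.comul a) :=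
    LinearMap.congr_fun hH.par_comul a
  have := shuffle_map H.dualPar (g := H.dualPar) (h := H.par) H.par (Q := H.dualPar)
    (P := H.par) rfl rfl (H.dualOp.comul f ⊗ₜ H.comul a)
  rw [TensorProduct.map_tmul, ← e1, ← e2] at this
  exact this

include hH in
-- The graded flip is natural for even maps, so the coproducts of `X` and `H` can be pulled in front
-- of it. Coassociativity of each factor applies, and the flips on both sides involve the same
-- crossings.
theorem double_coassoc : (TensorProduct.assoc F _ _ _).toLinearMap ∘ₗ
      TensorProduct.map H.double.comul LinearMap.id ∘ₗ H.double.comul =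
    TensorProduct.map LinearMap.id H.double.comul ∘ₗ H.double.comul := by
  have hP := hH.par_par
  have hX : H.dualPar ∘ₗ H.dualPar = LinearMap.id := dualPar_par hP
  refine TensorProduct.ext' fun f a => ?_
  have e1 : ∀ s : (Dual F V ⊗[F] Dual F V) ⊗[F] (V ⊗[F] V),
      TensorProduct.map H.double.comul LinearMap.id (shuffle (Dual F V) V H.dualPar H.par s) =
      TensorProduct.map (shuffle (Dual F V) V H.dualPar H.par) LinearMap.id
        (shuffle (Dual F V ⊗[F] Dual F V) V H.dualPar (TensorProduct.map H.par H.par)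
        (TensorProduct.map (TensorProduct.map H.dualOp.comul LinearMap.id)
          (TensorProduct.map H.comul LinearMap.id) s)) := fun s => by
    rw [shuffle_map (Q := H.dualPar) (P := H.par) (g := LinearMap.id) (Q' := H.dualPar) _ _ rfl
      hH.par_comul, TensorProduct.map_map,
      double_comul_eq, TensorProduct.map_id, LinearMap.id_comp]
  have e2 : ∀ s : (Dual F V ⊗[F] Dual F V) ⊗[F] (V ⊗[F] V),
      TensorProduct.map LinearMap.id H.double.comul (shuffle (Dual F V) V H.dualPar H.par s) =
      TensorProduct.map LinearMap.id (shuffle (Dual F V) V H.dualPar H.par)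
        (shuffle (B := Dual F V ⊗[F] Dual F V) (C := V) (Dual F V) (V ⊗[F] V)
        (TensorProduct.map H.dualPar H.dualPar) H.par
        (TensorProduct.map (TensorProduct.map LinearMap.id H.dualOp.comul)
          (TensorProduct.map LinearMap.id H.comul) s)) := fun s => by
    rw [shuffle_map (Q := H.dualPar) (P := H.par) (h := LinearMap.id) (P' := H.par) _ _
      (dualOp_par_comul hH) rfl,
      TensorProduct.map_map, double_comul_eq, TensorProduct.map_id, LinearMap.id_comp]
  simp only [LinearMap.comp_apply, double_comul_tmul, LinearEquiv.coe_coe]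
  have e3 := LinearMap.congr_fun (dualOp_coassoc hH) f
  have e4 := LinearMap.congr_fun hH.coassoc a
  rw [e1, e2, TensorProduct.map_tmul, TensorProduct.map_tmul]
  simp only [LinearMap.comp_apply, LinearEquiv.coe_coe] at e3 e4
  rw [← e3, ← e4]
  generalize TensorProduct.map H.dualOp.comul LinearMap.id (H.dualOp.comul f) = s
  generalize TensorProduct.map H.comul LinearMap.id (H.comul a) = t
  refine tmul_homog_induction₃ hX hX hX (fun s s' h h' => by
    simp only [add_tmul, map_add, h, h']) (fun i f j g k h hf hg hh => ?_) s
  refine tmul_homog_induction₃ hP hP hP (fun s s' h h' => by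
    simp only [tmul_add, map_add, h, h']) (fun i' a j' b k' c ha hb hc => ?_) t
  simp only [assoc_tmul]
  rw [shuffle_homog _ _ hh (ha.tmul hb), shuffle_homog _ _ (hg.tmul hh) ha]
  simp only [map_smul, TensorProduct.map_tmul, shuffle_homog _ _ hg ha, shuffle_homog _ _ hh hb,
    LinearMap.id_apply, ← smul_tmul', tmul_smul, assoc_tmul, smul_smul, ← sg_add]
  congr 2; ring

theorem double_counit_tmul (f : Dual F V) (a : V) :
    H.double.counit (f ⊗ₜ a) = f H.one * H.counit a := rfl

include hH in
theorem double_counit_comul : (TensorProduct.lid F _).toLinearMap ∘ₗ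
    TensorProduct.map H.double.counit LinearMap.id ∘ₗ H.double.comul = LinearMap.id := by
  have hP := hH.par_par
  have hX : H.dualPar ∘ₗ H.dualPar = LinearMap.id := dualPar_par hP
  refine TensorProduct.ext' fun f a => ?_
  simp only [LinearMap.comp_apply, double_comul_tmul, LinearEquiv.coe_coe]
  have e1 := LinearMap.congr_fun (dualOp_counit_comul hH) f
  have e2 := LinearMap.congr_fun hH.counit_comul a
  simp only [LinearMap.comp_apply, LinearEquiv.coe_coe, LinearMap.id_apply] at e1 e2
  conv_rhs => rw [LinearMap.id_apply, ← e1, ← e2]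
  generalize H.dualOp.comul f = s
  generalize H.comul a = t
  refine tmul_homog_induction hX hX (fun s s' h h' => by
    simp only [add_tmul, map_add, h, h']) (fun i f j g hf hg => ?_) s
  refine tmul_homog_induction hP hP (fun s s' h h' => by
    simp only [tmul_add, map_add, h, h']) (fun i' a j' b ha hb => ?_) t
  rw [shuffle_homog _ _ hg ha]
  simp only [map_smul, TensorProduct.map_tmul, double_counit_tmul, lid_tmul, LinearMap.id_apply,
    smul_tmul_smul]
  change _ = (f H.one * _) • _
  by_cases hi : i' = 0
  · subst hi; simp
  · rw [counit_homog hH ha hi]; simp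

include hH in
theorem double_comul_counit : (TensorProduct.rid F _).toLinearMap ∘ₗ
    TensorProduct.map LinearMap.id H.double.counit ∘ₗ H.double.comul = LinearMap.id := by
  have hP := hH.par_par
  have hX : H.dualPar ∘ₗ H.dualPar = LinearMap.id := dualPar_par hP
  refine TensorProduct.ext' fun f a => ?_
  simp only [LinearMap.comp_apply, double_comul_tmul, LinearEquiv.coe_coe]
  have e1 := LinearMap.congr_fun (dualOp_comul_counit hH) f
  have e2 := LinearMap.congr_fun hH.comul_counit a
  simp only [LinearMap.comp_apply, LinearEquiv.coe_coe, LinearMap.id_apply] at e1 e2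
  conv_rhs => rw [LinearMap.id_apply, ← e1, ← e2]
  generalize H.dualOp.comul f = s
  generalize H.comul a = t
  refine tmul_homog_induction hX hX (fun s s' h h' => by
    simp only [add_tmul, map_add, h, h']) (fun i f j g hf hg => ?_) s
  refine tmul_homog_induction hP hP (fun s s' h h' => by
    simp only [tmul_add, map_add, h, h']) (fun i' a j' b ha hb => ?_) t
  rw [shuffle_homog _ _ hg ha]
  simp only [map_smul, TensorProduct.map_tmul, double_counit_tmul, rid_tmul, LinearMap.id_apply,
    smul_tmul_smul]
  change _ = (g H.one * _) • _
  by_cases hj : j = 0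
  · subst hj; simp
  · rw [H.dual_apply_eq_zero hg (isHomog_zero_iff.2 hH.par_one) hj]; simp

end

end HopfSuperData

end QDouble

end

/-! ### Unit, counit and antipode of the double -/

noncomputable section

set_option linter.unusedSectionVars false

namespace QDouble

open TensorProduct Module

namespace HopfSuperData

variable {F : Type*} [Field F]
variable {V : Type*} [AddCommGroup V] [Module F V]
variable {H : HopfSuperData F V} (hH : H.IsHopfSuperalgebra) [CharZero F]
  (hS : Function.Bijective H.antipode)

include hH in
-- Applying `ε` to the left antipode law separates the two legs, and the counit law absorbs the
-- second.
theorem counit_antipode (a : V) : H.counit (H.antipode a) = H.counit a := by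
  have h := congrArg H.counit (hH.antipode_left a)
  have e : ∀ t, H.counit (H.mul (TensorProduct.map H.antipode LinearMap.id t)) =
      H.counit (H.antipode (TensorProduct.rid F V (TensorProduct.map LinearMap.id H.counit t))) :=
    fun t => by
      induction t using TensorProduct.induction_on with
      | zero => simp
      | add s t hs ht => simp only [map_add, hs, ht]
      | tmul u v => simp [hH.counit_mul, mul_comm]
  have e2 := LinearMap.congr_fun hH.comul_counit a
  simp only [LinearMap.comp_apply, LinearEquiv.coe_coe, LinearMap.id_apply] at e2
  rw [e, e2, map_smul, hH.counit_one, smul_eq_mul, mul_one] at h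
  exact h

include hH hS in
theorem counit_antipodeInv (a : V) : H.counit (H.antipodeInv a) = H.counit a := by
  rw [← counit_antipode hH, antipode_antipodeInv hS]

variable [Module.Finite F V]

include hH hS in
-- `ε` is multiplicative and invariant under `S⁻¹`, so the outer legs enter only as `ε(a₁)` and
-- `ε(a₃)` and disappear by the counit laws. No sign survives, since `ε` vanishes on odd elements.
theorem straighten_counit (a : V) : H.straighten (a ⊗ₜ H.counit) = H.counit ⊗ₜ a := by
  have hP := hH.par_par
  refine ev_ext_homog hP fun l x hx => ?_
  rw [ev_straighten hH hS hx]
  have e : ∀ t, H.exchMap H.par H.counit l x t = H.counit x • TensorProduct.rid F V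
      (TensorProduct.map ((TensorProduct.lid F V).toLinearMap ∘ₗ
        TensorProduct.map H.counit LinearMap.id) H.counit t) := fun t => by
    refine tmul_homog_induction₃ hP hP hP (fun s t hs ht => by
      simp only [map_add, smul_add, hs, ht]) (fun i a j b k c ha hb hc => ?_) t
    rw [exchMap_homog ha hb hc]
    simp only [sandwich, hH.counit_mul, counit_antipodeInv hH hS, TensorProduct.map_tmul,
      LinearMap.comp_apply, LinearEquiv.coe_coe, lid_tmul, rid_tmul, LinearMap.id_apply, smul_smul]
    by_cases hi : i = 0
    · by_cases hk : k = 0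
      · by_cases hl : l = 0
        · subst hi hk hl
          simp [exch]; congr 1; ring
        · rw [counit_homog hH hx hl]; simp
      · rw [counit_homog hH hc hk]; simp
    · rw [counit_homog hH ha hi]; simp
  have e1 := hH.counit_comul
  rw [← LinearMap.comp_assoc] at e1
  have e2 := LinearMap.congr_fun hH.comul_counit a
  simp only [LinearMap.comp_apply, LinearEquiv.coe_coe, LinearMap.id_apply] at e2
  rw [e, comul₃, LinearMap.comp_apply, TensorProduct.map_map, e1, LinearMap.comp_id, e2, ev_tmul]

include hH hS in
theorem double_mul_one (z : Dual F V ⊗[F] V) : H.double.mul (z ⊗ₜ (H.counit ⊗ₜ H.one)) = z := by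
  induction z using TensorProduct.induction_on with
  | zero => simp
  | add s t hs ht => simp only [map_add, add_tmul, hs, ht]
  | tmul f a =>
    rw [double_mul_tmul hH, straighten_counit hH hS]
    simp only [TensorProduct.map_tmul, curry_apply, LinearMap.flip_apply, hH.mul_one,
      dualOp_mul_one hH]

include hH in
theorem inclX_mul_inclV (f : Dual F V) (a : V) (hS : Function.Bijective H.antipode) :
    H.double.mul (H.inclX f ⊗ₜ H.inclV a) = f ⊗ₜ a := by
  rw [inclX_mul hH hS]
  simp [lmul, inclV, dualOp_mul_one hH]

include hH hS in
theorem inclX_mul_inclX (f g : Dual F V) :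
    H.double.mul (H.inclX f ⊗ₜ H.inclX g) = H.inclX (H.dualOp.mul (f ⊗ₜ g)) := by
  rw [inclX_mul hH hS]
  simp [lmul, inclX]

include hH hS in
theorem inclV_mul_inclV (a b : V) :
    H.double.mul (H.inclV a ⊗ₜ H.inclV b) = H.inclV (H.mul (a ⊗ₜ b)) := by
  simp only [inclV, mk_apply]
  rw [double_mul_tmul hH, straighten_counit hH hS]
  simp [dualOp_mul_one hH]

include hH in
theorem double_comul_inclX (f : Dual F V) : H.double.comul (H.inclX f) =
    TensorProduct.map H.inclX H.inclX (H.dualOp.comul f) := by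
  have hX : H.dualPar ∘ₗ H.dualPar = LinearMap.id := dualPar_par hH.par_par
  simp only [inclX, LinearMap.flip_apply, mk_apply]
  rw [double_comul_tmul, hH.comul_one]
  generalize H.dualOp.comul f = s
  refine tmul_homog_induction hX hX (fun s s' h h' => by
    simp only [add_tmul, map_add, h, h']) (fun i f j g hf hg => ?_) s
  rw [shuffle_homog _ _ hg (isHomog_zero_iff.2 hH.par_one)]
  simp

include hH in
theorem double_comul_inclV (a : V) : H.double.comul (H.inclV a) =
    TensorProduct.map H.inclV H.inclV (H.comul a) := by
  have hP := hH.par_par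
  have hc : IsHomog H.dualPar 0 H.counit := isHomog_zero_iff.2 hH.par_counit
  simp only [inclV, mk_apply]
  rw [double_comul_tmul, dualOp_comul_one hH]
  generalize H.comul a = s
  refine tmul_homog_induction hP hP (fun s s' h h' => by
    simp only [tmul_add, map_add, h, h']) (fun i a j b ha hb => ?_) s
  rw [shuffle_homog _ _ hc ha]
  simp

omit [CharZero F] in
theorem double_tmul_homog {i j : ZMod 2} {f : Dual F V} {a : V} (hf : IsHomog H.dualPar i f)
    (ha : IsHomog H.par j a) : IsHomog H.double.par (i + j) (f ⊗ₜ[F] a) := hf.tmul ha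

include hH hS in
theorem double_comul_lmul (f : Dual F V) (z : Dual F V ⊗[F] V) : H.double.comul (H.lmul f z) =
    H.double.tensorMul (TensorProduct.map H.inclX H.inclX (H.dualOp.comul f) ⊗ₜ
      H.double.comul z) := by
  have hP := hH.par_par
  have hX : H.dualPar ∘ₗ H.dualPar = LinearMap.id := dualPar_par hP
  induction z using TensorProduct.induction_on with
  | zero => simp
  | add s t hs ht => simp only [map_add, tmul_add, hs, ht]
  | tmul g b =>
    simp only [lmul, TensorProduct.map_tmul, curry_apply, LinearMap.id_apply]
    rw [double_comul_tmul, double_comul_tmul, dualOp_comul_mul hH, tensorMul, superTensorMul_eq,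
      superTensorMul_eq]
    generalize H.dualOp.comul f = s
    generalize H.dualOp.comul g = t
    generalize H.comul b = u
    refine tmul_homog_induction hX hX (fun s s' h h' => by
      simp only [add_tmul, map_add, h, h']) (fun i f₁ j f₂ hf₁ hf₂ => ?_) s
    refine tmul_homog_induction hX hX (fun s s' h h' => by
      simp only [add_tmul, tmul_add, map_add, h, h']) (fun i' g₁ j' g₂ hg₁ hg₂ => ?_) t
    refine tmul_homog_induction hP hP (fun s s' h h' => by
      simp only [tmul_add, map_add, h, h']) (fun k b₁ l b₂ hb₁ hb₂ => ?_) u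
    rw [superMul_homog _ _ hf₂ hg₁, shuffle_homog _ _ hg₂ hb₁, ← smul_tmul', map_smul,
      shuffle_homog _ _ (hf₂.mul (dualOp_par_mul hH) hg₂) hb₁, tmul_smul, map_smul,
      TensorProduct.map_tmul, superMul_homog _ _ (inclX_homog hH hf₂)
        (double_tmul_homog hg₁ hb₁), inclX_mul hH hS, inclX_mul hH hS]
    simp only [lmul, TensorProduct.map_tmul, curry_apply, LinearMap.id_apply, smul_smul, ← sg_add]
    congr 2; ring

include hH hS in
theorem double_comul_mul_inclV (z : Dual F V ⊗[F] V) (b : V) :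
    H.double.comul (H.double.mul (z ⊗ₜ H.inclV b)) =
      H.double.tensorMul (H.double.comul z ⊗ₜ TensorProduct.map H.inclV H.inclV (H.comul b)) := by
  have hP := hH.par_par
  have hX : H.dualPar ∘ₗ H.dualPar = LinearMap.id := dualPar_par hP
  have hm : ∀ f a b, H.double.mul ((f ⊗ₜ a) ⊗ₜ H.inclV b) = f ⊗ₜ H.mul (a ⊗ₜ b) := fun f a b => by
    simp only [inclV, mk_apply]
    rw [double_mul_tmul hH, straighten_counit hH hS]
    simp [dualOp_mul_one hH]
  have hm' : ∀ a b, H.comul (H.mul (a ⊗ₜ b)) = H.tensorMul (H.comul a ⊗ₜ H.comul b) := fun a b => by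
    have := LinearMap.congr_fun hH.comul_mul (a ⊗ₜ b)
    simpa only [LinearMap.comp_apply, TensorProduct.map_tmul] using this
  induction z using TensorProduct.induction_on with
  | zero => simp
  | add s t hs ht => simp only [map_add, add_tmul, hs, ht]
  | tmul g a =>
    rw [hm, double_comul_tmul, double_comul_tmul, hm', tensorMul, tensorMul, superTensorMul_eq,
      superTensorMul_eq]
    generalize H.dualOp.comul g = s
    generalize H.comul a = t
    generalize H.comul b = u
    refine tmul_homog_induction hX hX (fun s s' h h' => by
      simp only [add_tmul, map_add, h, h']) (fun i f₁ j f₂ hf₁ hf₂ => ?_) s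
    refine tmul_homog_induction hP hP (fun s s' h h' => by
      simp only [add_tmul, tmul_add, map_add, h, h']) (fun i' g₁ j' g₂ hg₁ hg₂ => ?_) t
    refine tmul_homog_induction hP hP (fun s s' h h' => by
      simp only [tmul_add, map_add, h, h']) (fun k b₁ l b₂ hb₁ hb₂ => ?_) u
    rw [superMul_homog _ _ hg₂ hb₁, shuffle_homog _ _ hf₂ hg₁, ← smul_tmul', tmul_smul, map_smul,
      map_smul, shuffle_homog _ _ hf₂ (hg₁.mul hH.par_mul hb₁), TensorProduct.map_tmul,
      superMul_homog _ _ (double_tmul_homog hf₂ hg₂) (inclV_homog hH hb₁), hm,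
      hm]
    simp only [smul_smul, ← sg_add]
    congr 2; ring

include hH hS in
-- Write `f ⊗ a = (f ⊗ 1)(1 ⊗ a)` and `g ⊗ b` likewise. The coproduct respects the outer
-- multiplications by `f ⊗ 1` and `1 ⊗ b` and the inner product `(1 ⊗ a)(g ⊗ 1)`; associativity of
-- the tensor square reassembles the four factors.
theorem double_comul_mul (han : H.AntipodeAnti) (hco : H.AntipodeCoanti) : H.double.comul ∘ₗ
    H.double.mul = H.double.tensorMul ∘ₗ TensorProduct.map H.double.comul H.double.comul := by
  have hP := double_par_par hH
  have hm := double_par_mul hH hS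
  have ha := double_mul_assoc hH hS han hco
  have hT := superMul_assoc (V := Dual F V ⊗[F] V) (W := Dual F V ⊗[F] V) hP hP hm hm ha ha
  refine TensorProduct.ext' fun s t => ?_
  simp only [LinearMap.comp_apply, TensorProduct.map_tmul]
  induction s using TensorProduct.induction_on with
  | zero => simp
  | add s s' hs hs' => simp only [add_tmul, map_add, hs, hs']
  | tmul f a =>
  induction t using TensorProduct.induction_on with
  | zero => simp
  | add s s' hs hs' => simp only [tmul_add, map_add, hs, hs']
  | tmul g b =>
    have e1 : f ⊗ₜ a = H.double.mul (H.inclX f ⊗ₜ H.inclV a) := (inclX_mul_inclV hH f a hS).symm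
    have e2 : g ⊗ₜ b = H.double.mul (H.inclX g ⊗ₜ H.inclV b) := (inclX_mul_inclV hH g b hS).symm
    have e3 : H.double.mul ((f ⊗ₜ a) ⊗ₜ (g ⊗ₜ b)) = H.lmul f
        (H.double.mul (H.straighten (a ⊗ₜ g) ⊗ₜ H.inclV b)) := by
      rw [e1, e2, ha, ← ha (H.inclV a), inclV_mul_inclX hH, inclX_mul hH hS]
    rw [e3, double_comul_lmul hH hS, double_comul_mul_inclV hH hS, comul_straighten hH hS han,
      e1, e2, double_comul_mul_inclV hH hS, double_comul_mul_inclV hH hS, double_comul_inclX hH,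
      double_comul_inclX hH]
    simp only [tensorMul, superTensorMul_eq, hT]

include hH hS in
-- At `x = 1` the counit removes the middle leg, and the outer legs form `S⁻¹(a'') a'`, an instance
-- of the antipode law for the opposite product.
theorem double_counit_straighten (han : H.AntipodeAnti) (a : V) (g : Dual F V) :
    H.double.counit (H.straighten (a ⊗ₜ g)) = g H.one * H.counit a := by
  have hP := hH.par_par
  have e0 : ∀ s, H.double.counit s = H.counit (ev s H.one) := fun s => by
    induction s using TensorProduct.induction_on with
    | zero => simp
    | add s s' hs hs' => simp only [map_add, ev_add, hs, hs']
    | tmul f a => simp [double_counit_tmul]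
  rw [e0, ev_straighten hH hS (isHomog_zero_iff.2 hH.par_one)]
  refine homog_induction hP (fun a b ha hb => by simp only [map_add, mul_add, ha, hb])
    (fun n a ha => ?_) a
  -- Here `exch i 0 k 0 = k + i + i k`. The term `i k` is the sign of the opposite product, and `i +
  -- k` is absorbed by the grading involution on both outer legs. The latter becomes `sg n` on `Δ
  -- a`, harmless because `ε(a) = 0` when `n = 1`.
  have e1 : ∀ t : (V ⊗[F] V) ⊗[F] V, H.counit (H.exchMap H.par g 0 H.one t) =
      g (H.mulOp (TensorProduct.map LinearMap.id H.antipodeInv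
        (TensorProduct.map (TensorProduct.rid F V ∘ₗ TensorProduct.map H.par H.counit)
          H.par t))) := fun t => by
    refine tmul_homog_induction₃ hP hP hP (fun s t hs ht => by
      simp only [map_add, hs, ht]) (fun i a j b k c ha hb hc => ?_) t
    have ha' : H.par a = sg F i • a := ha
    have hc' : H.par c = sg F k • c := hc
    rw [exchMap_homog ha hb hc]
    simp only [TensorProduct.map_tmul, LinearMap.comp_apply, LinearEquiv.coe_coe, rid_tmul, ha',
      hc', LinearMap.id_apply, ← smul_tmul', tmul_smul, map_smul]
    rw [mulOp_homog ha (hc.map (par_antipodeInv hS hH)), sandwich, hH.one_mul]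
    by_cases hj : j = 0
    · subst hj
      simp only [map_smul, smul_eq_mul, ← mul_assoc]
      have : exch i 0 k 0 = k + i + i * k := by
        clear * -; revert i k; unfold exch; decide
      rw [this, sg_add, sg_add]; ring
    · rw [counit_homog hH hb hj]; simp
  have e2 : TensorProduct.map (TensorProduct.rid F V ∘ₗ TensorProduct.map H.par H.counit) H.par
      (H.comul₃ a) = sg F n • H.comul a := by
    have : (TensorProduct.rid F V ∘ₗ TensorProduct.map H.par H.counit) ∘ₗ H.comul = H.par := by
      have := hH.comul_counit
      refine LinearMap.ext fun b => ?_
      have := LinearMap.congr_fun this (H.par b)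
      simp only [LinearMap.comp_apply, LinearEquiv.coe_coe, LinearMap.id_apply] at this ⊢
      have h2 := LinearMap.congr_fun hH.par_comul b
      simp only [LinearMap.comp_apply] at h2
      rw [h2, TensorProduct.map_map, hH.par_counit] at this
      exact this
    rw [comul₃, LinearMap.comp_apply, TensorProduct.map_map, this, LinearMap.comp_id]
    exact ha.map hH.par_comul
  rw [e1, e2, map_smul, map_smul, mulOp_antipodeInv_right hS hH han]
  by_cases hn : n = 0
  · subst hn; simp [mul_comm]
  · rw [counit_homog hH ha hn]; simp

include hH hS in
theorem double_counit_mul (han : H.AntipodeAnti) (s t : Dual F V ⊗[F] V) :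
    H.double.counit (H.double.mul (s ⊗ₜ t)) = H.double.counit s * H.double.counit t := by
  induction s using TensorProduct.induction_on with
  | zero => simp
  | add s s' hs hs' => simp only [add_tmul, map_add, hs, hs', add_mul]
  | tmul f a =>
  induction t using TensorProduct.induction_on with
  | zero => simp
  | add s s' hs hs' => simp only [tmul_add, map_add, hs, hs', mul_add]
  | tmul g b =>
    have e : ∀ z, H.double.counit (TensorProduct.map (TensorProduct.curry H.dualOp.mul f)
        ((TensorProduct.curry H.mul).flip b) z) = f H.one * H.double.counit z * H.counit b :=
      fun z => by
        induction z using TensorProduct.induction_on with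
        | zero => simp
        | add s s' hs hs' => simp only [map_add, mul_add, add_mul, hs, hs']
        | tmul h c =>
          have := dualOp_counit_mul hH f h
          change H.dualOp.mul (f ⊗ₜ h) H.one = f H.one * h H.one at this
          simp only [TensorProduct.map_tmul, curry_apply, LinearMap.flip_apply, double_counit_tmul,
            hH.counit_mul, this]
          ring
    rw [double_mul_tmul hH, e, double_counit_straighten hH hS han, double_counit_tmul,
      double_counit_tmul]
    ring

include hH in
theorem double_antipode_homog {i j : ZMod 2} {f : Dual F V} {a : V} (hf : IsHomog H.dualPar i f)
    (ha : IsHomog H.par j a) : H.double.antipode (f ⊗ₜ a) = sg F (i * j) •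
      H.double.mul (H.inclV (H.antipode a) ⊗ₜ H.inclX (H.dualOp.antipode f)) := by
  rw [inclV_mul_inclX hH]
  simp only [double, LinearMap.comp_apply, koszul_homog hf ha, map_smul]
  rfl

include hH hS in
theorem double_par_antipode : H.double.antipode ∘ₗ H.double.par =
    H.double.par ∘ₗ H.double.antipode := by
  have hX : H.dualPar ∘ₗ H.dualPar = LinearMap.id := dualPar_par hH.par_par
  refine LinearMap.ext fun s => ?_
  refine tmul_homog_induction hX hH.par_par (fun s s' h h' => by
    simp only [map_add, h, h']) (fun i f j a hf ha => ?_) s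
  simp only [LinearMap.comp_apply]
  have e1 : H.double.par (f ⊗ₜ a) = sg F (i + j) • (f ⊗ₜ a) := hf.tmul ha
  have e2 : TensorProduct.map H.dualPar H.par _ = _ := straighten_homog hH hS (ha.map hH.par_antipode)
    (hf.map (dualOp_par_antipode hH hS))
  rw [e1, map_smul, double_antipode_homog hH hf ha, inclV_mul_inclX hH, map_smul, smul_comm,
    add_comm]
  exact congrArg _ e2.symm

include hH hS in
-- The factors occur in the order `S(a') S(f') f'' a''`. The antipode law of `X` therefore applies
-- first, in the middle, and then that of `H`.
theorem double_antipode_left (han : H.AntipodeAnti) (hco : H.AntipodeCoanti)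
    (z : Dual F V ⊗[F] V) : H.double.mul (TensorProduct.map H.double.antipode LinearMap.id
      (H.double.comul z)) = H.double.counit z • H.double.one := by
  have hP := hH.par_par
  have hX : H.dualPar ∘ₗ H.dualPar = LinearMap.id := dualPar_par hP
  have hD := double_mul_assoc hH hS han hco
  have h1 : ∀ z, H.double.mul (H.inclV H.one ⊗ₜ z) = z := fun z => by
    rw [inclV_mul hH, act_one hH hS]
  induction z using TensorProduct.induction_on with
  | zero => simp
  | add s s' hs hs' => simp only [map_add, add_smul, hs, hs']
  | tmul f a =>
    refine homog_induction hX (fun f f' h h' => by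
      simp only [add_tmul, map_add, add_smul, h, h']) (fun n f hf => ?_) f
    rw [double_comul_tmul, double_counit_tmul]
    -- Once `S(f') f''` is collected, the sign on `a'` depends only on the total degree `n` of `f`.
    -- It is trivial for `n = 0`, and `f(1) = 0` otherwise.
    have key : ∀ (s : Dual F V ⊗[F] Dual F V) (t : V ⊗[F] V),
        IsHomog (TensorProduct.map H.dualPar H.dualPar) n s →
        H.double.mul (TensorProduct.map H.double.antipode LinearMap.id
          (shuffle (Dual F V) V H.dualPar H.par (s ⊗ₜ t))) =
        H.double.mul (TensorProduct.map (H.inclV ∘ₗ H.antipode ∘ₗ parPow H.par n)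
          (TensorProduct.curry H.double.mul (H.inclX (H.dualOp.mul (TensorProduct.map
            H.dualOp.antipode LinearMap.id s))) ∘ₗ H.inclV) t) := fun s t hs => by
      refine tmul_homog_induction_total hX hX (fun s s' h h' => by
        simp only [add_tmul, map_add, h, h', LinearMap.add_comp, TensorProduct.map_add_right,
          LinearMap.add_apply]) (fun i f j g hf hg hn => ?_) s hs
      refine tmul_homog_induction hP hP (fun s s' h h' => by
        simp only [tmul_add, map_add, h, h']) (fun k a l b ha hb => ?_) t
      simp only [TensorProduct.map_tmul, LinearMap.comp_apply, curry_apply, LinearMap.id_apply]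
      rw [shuffle_homog _ _ hg ha, parPow_homog ha, map_smul,
        TensorProduct.map_tmul, double_antipode_homog hH hf ha,
        ← inclX_mul_inclX hH hS, hD (H.inclX _), LinearMap.id_apply,
        inclX_mul_inclV hH _ _ hS]
      simp only [map_smul, ← smul_tmul', smul_smul, ← sg_add]
      rw [hD, ← hn]
      congr 2; ring
    rw [key _ _ (hf.map (dualOp_par_comul hH)), dualOp_antipode_left hH hS han]
    have e : H.dualOp.counit f = f H.one := rfl
    have e2 : H.inclX H.dualOp.one = H.inclV H.one := rfl
    rw [e, map_smul, e2]
    generalize hc : f H.one = c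
    have hn : n ≠ 0 → c = 0 := fun hn => by
      rw [← hc, H.dual_apply_eq_zero hf (isHomog_zero_iff.2 hH.par_one) hn]
    have e3 : ∀ t, H.double.mul (TensorProduct.map (H.inclV ∘ₗ H.antipode ∘ₗ parPow H.par n)
          (TensorProduct.curry H.double.mul (c • H.inclV H.one) ∘ₗ H.inclV) t) =
        c • H.inclV (H.mul (TensorProduct.map H.antipode LinearMap.id t)) := fun t => by
      refine tmul_homog_induction hP hP (fun s s' h h' => by
        simp only [map_add, h, h', smul_add]) (fun k a l b ha hb => ?_) t
      simp only [TensorProduct.map_tmul, LinearMap.comp_apply, LinearMap.id_apply,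
        ← smul_tmul', map_smul, parPow_homog ha]
      by_cases h : n = 0
      · subst h; simp [h1, inclV_mul_inclV hH hS]
      · rw [hn h]; simp
    rw [e3, hH.antipode_left, map_smul, smul_smul]
    rfl

include hH hS in
-- Now the order is `f' a' S(a'') S(f'')`, so the law of `H` is used first and that of `X` second.
theorem double_antipode_right (han : H.AntipodeAnti) (hco : H.AntipodeCoanti)
    (z : Dual F V ⊗[F] V) : H.double.mul (TensorProduct.map LinearMap.id H.double.antipode
      (H.double.comul z)) = H.double.counit z • H.double.one := by
  have hP := hH.par_par
  have hX : H.dualPar ∘ₗ H.dualPar = LinearMap.id := dualPar_par hP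
  have hD := double_mul_assoc hH hS han hco
  have h1 : ∀ z, H.double.mul (H.inclV H.one ⊗ₜ z) = z := fun z => by
    rw [inclV_mul hH, act_one hH hS]
  induction z using TensorProduct.induction_on with
  | zero => simp
  | add s s' hs hs' => simp only [map_add, add_smul, hs, hs']
  | tmul f a =>
    refine homog_induction hP (fun a b h h' => by
      simp only [tmul_add, map_add, add_smul, h, h']) (fun n a ha => ?_) a
    rw [double_comul_tmul, double_counit_tmul]
    have key : ∀ (s : Dual F V ⊗[F] Dual F V) (t : V ⊗[F] V),
        IsHomog (TensorProduct.map H.par H.par) n t →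
        H.double.mul (TensorProduct.map LinearMap.id H.double.antipode
          (shuffle (Dual F V) V H.dualPar H.par (s ⊗ₜ t))) =
        H.double.mul (TensorProduct.map H.inclX (TensorProduct.curry H.double.mul
          (H.inclV (H.mul (TensorProduct.map LinearMap.id H.antipode t))) ∘ₗ
            H.inclX ∘ₗ H.dualOp.antipode ∘ₗ parPow H.dualPar n) s) := fun s t ht => by
      refine tmul_homog_induction_total hP hP (fun t t' h h' => by
        simp only [tmul_add, map_add, h, h', LinearMap.add_comp, TensorProduct.map_add_right,
          LinearMap.add_apply]) (fun k a l b ha hb hn => ?_) t ht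
      refine tmul_homog_induction hX hX (fun s s' h h' => by
        simp only [add_tmul, map_add, h, h']) (fun i f j g hf hg => ?_) s
      simp only [TensorProduct.map_tmul, LinearMap.comp_apply, curry_apply, LinearMap.id_apply]
      rw [shuffle_homog _ _ hg ha, parPow_homog hg, map_smul,
        TensorProduct.map_tmul, double_antipode_homog hH hg hb,
        ← inclV_mul_inclV hH hS, LinearMap.id_apply, ← inclX_mul_inclV hH _ _ hS]
      simp only [map_smul, tmul_smul, smul_smul, ← sg_add]
      rw [hD, hD, ← hn]
      congr 2; ring
    rw [key _ _ (ha.map hH.par_comul), hH.antipode_right, map_smul]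
    generalize hc : H.counit a = c
    have hn : n ≠ 0 → c = 0 := fun hn => by rw [← hc, counit_homog hH ha hn]
    have e3 : ∀ s, H.double.mul (TensorProduct.map H.inclX (TensorProduct.curry H.double.mul
          (c • H.inclV H.one) ∘ₗ H.inclX ∘ₗ H.dualOp.antipode ∘ₗ parPow H.dualPar n) s) =
        c • H.inclX (H.dualOp.mul (TensorProduct.map LinearMap.id H.dualOp.antipode s)) :=
      fun s => by
        refine tmul_homog_induction hX hX (fun s s' h h' => by
          simp only [map_add, h, h', smul_add]) (fun i f j g hf hg => ?_) s
        simp only [TensorProduct.map_tmul, LinearMap.comp_apply, LinearMap.id_apply,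
          map_smul, tmul_smul, parPow_homog hg]
        by_cases h : n = 0
        · subst h; simp [h1, inclX_mul_inclX hH hS]
        · rw [hn h]; simp
    rw [e3, dualOp_antipode_right hH hS han, map_smul, smul_smul, mul_comm]
    rfl

include hH hS in
theorem double_isHopfSuperalgebra (han : H.AntipodeAnti) (hco : H.AntipodeCoanti) :
    H.double.IsHopfSuperalgebra where
  par_par := double_par_par hH
  par_mul := double_par_mul hH hS
  par_one := by
    change TensorProduct.map H.dualPar H.par (H.counit ⊗ₜ H.one) = _
    rw [TensorProduct.map_tmul, hH.par_one]
    exact congrArg (· ⊗ₜ H.one) hH.par_counit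
  par_comul := double_par_comul hH
  par_counit := by
    refine TensorProduct.ext' fun f a => ?_
    change f (H.par H.one) * H.counit (H.par a) = f H.one * H.counit a
    rw [hH.par_one, ← LinearMap.comp_apply, hH.par_counit]
  par_antipode := double_par_antipode hH hS
  mul_assoc := double_mul_assoc hH hS han hco
  one_mul z := by
    change H.double.mul (H.inclV H.one ⊗ₜ z) = z
    rw [inclV_mul hH, act_one hH hS]
  mul_one := double_mul_one hH hS
  coassoc := double_coassoc hH
  counit_comul := double_counit_comul hH
  comul_counit := double_comul_counit hH
  comul_mul := double_comul_mul hH hS han hco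
  comul_one := by
    change H.double.comul (H.inclV H.one) = H.inclV H.one ⊗ₜ H.inclV H.one
    rw [double_comul_inclV hH, hH.comul_one, TensorProduct.map_tmul]
  counit_mul := double_counit_mul hH hS han
  counit_one := by
    change H.counit H.one * H.counit H.one = 1
    rw [hH.counit_one, mul_one]
  antipode_left := double_antipode_left hH hS han hco
  antipode_right := double_antipode_right hH hS han hco

end HopfSuperData

end QDouble

end

/-! ### `Ū_q` is a Hopf superalgebra -/

noncomputable section

set_option linter.unusedSectionVars false

namespace QDouble

open TensorProduct Module

variable {F : Type*} [Field F]

namespace Ubar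

variable {q : F} {d : ℕ}

/-- The degree of a generator. -/
def _root_.QDouble.Gen.deg : Gen → ZMod 2
  | .e2 => 1
  | .f2 => 1
  | _ => 0

/-- The grading involution as a linear map. -/
abbrev P (q : F) (d : ℕ) : Ubar q d →ₗ[F] Ubar q d := (par q d).toLinearMap

/-- The product as a linear map. -/
abbrev m (q : F) (d : ℕ) : Ubar q d ⊗[F] Ubar q d →ₗ[F] Ubar q d := LinearMap.mul' F (Ubar q d)

theorem P_P : P q d ∘ₗ P q d = LinearMap.id := LinearMap.ext par_par

theorem P_m : P q d ∘ₗ m q d = m q d ∘ₗ TensorProduct.map (P q d) (P q d) :=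
  TensorProduct.ext' fun a b => by simp

theorem gen_homog (x : Gen) : IsHomog (P q d) x.deg (gen q d x) := by
  cases x <;> simp [IsHomog, Gen.deg, Gen.sign]

theorem mul_homog {i j : ZMod 2} {a b : Ubar q d} (ha : IsHomog (P q d) i a)
    (hb : IsHomog (P q d) j b) : IsHomog (P q d) (i + j) (a * b) := ha.mul P_m hb

theorem one_homog : IsHomog (P q d) 0 1 := by simp [IsHomog]

theorem mk_surjective : Function.Surjective (mk q d) :=
  RingQuot.mkAlgHom_surjective F _

theorem eq_top_of_gen (S : Subalgebra F (Ubar q d)) (h : ∀ x, gen q d x ∈ S) : S = ⊤ := by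
  refine eq_top_iff.2 fun u _ => ?_
  obtain ⟨a, rfl⟩ := mk_surjective u
  induction a using FreeAlgebra.induction with
  | grade0 r => rw [AlgHom.commutes]; exact S.algebraMap_mem r
  | grade1 x => exact h x
  | mul a b ha hb => rw [map_mul]; exact S.mul_mem (ha trivial) (hb trivial)
  | add a b ha hb => rw [map_add]; exact S.add_mem (ha trivial) (hb trivial)

/-- A subspace that contains `1` and is stable under the generators is everything. -/
theorem mem_of_gen_mul (N : Submodule F (Ubar q d)) (h1 : 1 ∈ N)
    (h : ∀ x, ∀ u ∈ N, gen q d x * u ∈ N) (u : Ubar q d) : u ∈ N := by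
  let S : Subalgebra F (Ubar q d) :=
    { carrier := {a | ∀ u ∈ N, a * u ∈ N}
      mul_mem' := fun {a b} ha hb u hu => by rw [mul_assoc]; exact ha _ (hb _ hu)
      add_mem' := fun {a b} ha hb u hu => by rw [add_mul]; exact add_mem (ha _ hu) (hb _ hu)
      algebraMap_mem' := fun r u hu => by
        rw [← Algebra.smul_def]; exact N.smul_mem _ hu }
  have : u ∈ S := by rw [eq_top_of_gen S h]; trivial
  simpa using this 1 h1

/-- Words in the generators span `Ū_q`. Induction on left multiplication suits `Δ` and `S`, which
are given by the operators attached to the generators. -/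
theorem ext_of_gen_mul {M : Type*} [AddCommGroup M] [Module F M] (f g : Ubar q d →ₗ[F] M)
    (h1 : f 1 = g 1) (h : ∀ x u, f u = g u → f (gen q d x * u) = g (gen q d x * u)) : f = g :=
  LinearMap.ext fun u => mem_of_gen_mul (LinearMap.eqLocus f g) h1 h u

/-- The homogeneous parts of `x u` are `x` times those of `u`. Running the induction on both parts
at once makes a homogeneous `u` available in the inductive step, where sign rules are needed. -/
theorem ext_of_gen_mul_homog [CharZero F] {M : Type*} [AddCommGroup M] [Module F M]
    (f g : Ubar q d →ₗ[F] M) (h1 : f 1 = g 1) (h : ∀ x i u, IsHomog (P q d) i u → f u = g u →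
      f (gen q d x * u) = g (gen q d x * u)) : f = g := by
  have hpr : ∀ i x u, pr (P q d) i (gen q d x * u) = gen q d x * pr (P q d) (i + x.deg) u :=
    fun i x u => by
      refine homog_induction P_P (fun u v hu hv => by simp only [mul_add, map_add, hu, hv])
        (fun j u hu => ?_) u
      rw [pr_homog (mul_homog (gen_homog x) hu), pr_homog hu]
      have : i = x.deg + j ↔ i + x.deg = j := by
        generalize x.deg = k; clear * -; revert i j k; decide
      simp only [this]
      split_ifs <;> simp
  have hh : ∀ i u, IsHomog (P q d) i (pr (P q d) i u) := fun i u => by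
    refine homog_induction P_P (fun u v hu hv => by rw [map_add]; exact hu.add hv)
      (fun j u hu => ?_) u
    rw [pr_homog hu]
    split_ifs with h
    · exact h ▸ hu
    · simp [IsHomog]
  have key : ∀ u, f (pr (P q d) 0 u) = g (pr (P q d) 0 u) ∧ f (pr (P q d) 1 u) =
      g (pr (P q d) 1 u) := fun u => by
    refine mem_of_gen_mul (LinearMap.eqLocus (f ∘ₗ pr (P q d) 0) (g ∘ₗ pr (P q d) 0) ⊓
      LinearMap.eqLocus (f ∘ₗ pr (P q d) 1) (g ∘ₗ pr (P q d) 1)) ?_ (fun x u hu => ?_) u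
    · simp [pr_homog one_homog, h1]
    · have hu' : ∀ i, f (pr (P q d) i u) = g (pr (P q d) i u) := fun i => by
        rcases zmod_two_cases i with rfl | rfl
        · exact hu.1
        · exact hu.2
      have : ∀ i, f (pr (P q d) i (gen q d x * u)) = g (pr (P q d) i (gen q d x * u)) := fun i => by
        rw [hpr]; exact h x _ _ (hh _ _) (hu' _)
      exact ⟨this 0, this 1⟩
  refine LinearMap.ext fun u => ?_
  have hu : u = pr (P q d) 0 u + pr (P q d) 1 u := by
    refine homog_induction P_P (fun u v hu hv => by
      rw [map_add, map_add]; nth_rewrite 1 [hu, hv]; abel) (fun j u hu => ?_) u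
    rw [pr_homog hu, pr_homog hu]
    rcases zmod_two_cases j with rfl | rfl <;> simp
  rw [hu, map_add, map_add, (key u).1, (key u).2]

variable [CharZero F] [OddRoot q d]

theorem comul_gen_mul (x : Gen) (u : Ubar q d) : comul q d (gen q d x * u) =
    superMul (P q d) (m q d) (P q d) (m q d) (comulGen q d x ⊗ₜ comul q d u) := by
  change lift _ (comul_rel (q := q) (d := d)) (gen q d x * u) (1 ⊗ₜ[F] 1) = _
  rw [map_mul, lift_gen]
  rfl

theorem comul_one : comul q d 1 = 1 ⊗ₜ 1 := by
  change lift _ (comul_rel (q := q) (d := d)) 1 (1 ⊗ₜ[F] 1) = _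
  rw [map_one]; rfl

theorem antipode_gen_mul (x : Gen) (u : Ubar q d) : antipode q d (gen q d x * u) =
    superRight q d (antipodeGen q d x) (antipode q d u) := by
  change lift _ (antipode_rel (q := q) (d := d)) (gen q d x * u) 1 = _
  rw [map_mul, lift_gen]
  rfl

theorem antipode_one : antipode q d 1 = 1 := by
  change lift _ (antipode_rel (q := q) (d := d)) 1 1 = _
  rw [map_one (lift _ (antipode_rel (q := q) (d := d)))]; rfl

theorem m_assoc (a b c : Ubar q d) : m q d (m q d (a ⊗ₜ b) ⊗ₜ c) = m q d (a ⊗ₜ m q d (b ⊗ₜ c)) := by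
  simp [mul_assoc]

theorem tensor_mul_assoc (s t u : Ubar q d ⊗[F] Ubar q d) :
    superMul (P q d) (m q d) (P q d) (m q d) (superMul (P q d) (m q d) (P q d) (m q d) (s ⊗ₜ t) ⊗ₜ u) =
      superMul (P q d) (m q d) (P q d) (m q d) (s ⊗ₜ
        superMul (P q d) (m q d) (P q d) (m q d) (t ⊗ₜ u)) :=
  superMul_assoc P_P P_P P_m P_m m_assoc m_assoc s t u

theorem tensor_one_mul (t : Ubar q d ⊗[F] Ubar q d) :
    superMul (P q d) (m q d) (P q d) (m q d) ((1 ⊗ₜ 1) ⊗ₜ t) = t := by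
  induction t using TensorProduct.induction_on with
  | zero => simp
  | add s t hs ht => rw [tmul_add, map_add, hs, ht]
  | tmul a b => 
    have := superTensorMul_even (P q d) (m q d) 1 (b := 1) (by simp) a b
    rw [superTensorMul_eq] at this
    rw [this]; simp

theorem comul_mul (u v : Ubar q d) : comul q d (u * v) =
    superMul (P q d) (m q d) (P q d) (m q d) (comul q d u ⊗ₜ comul q d v) := by
  have := ext_of_gen_mul (q := q) (d := d) (comul q d ∘ₗ LinearMap.mulRight F v)
    (superMul (P q d) (m q d) (P q d) (m q d) ∘ₗ (TensorProduct.mk F _ _).flip (comul q d v) ∘ₗ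
      comul q d) (by simp [comul_one, tensor_one_mul]) (fun x u hu => by
        simp only [LinearMap.comp_apply, LinearMap.mulRight_apply, LinearMap.flip_apply,
          mk_apply] at hu ⊢
        rw [mul_assoc, comul_gen_mul, hu, comul_gen_mul, tensor_mul_assoc])
  exact LinearMap.congr_fun this u

theorem comulGen_homog (x : Gen) :
    IsHomog (TensorProduct.map (P q d) (P q d)) x.deg (comulGen q d x) := by
  cases x <;> simp [IsHomog, comulGen, Gen.deg, Gen.sign, tmul_neg, neg_tmul, add_comm]

theorem antipodeGen_homog (x : Gen) : IsHomog (P q d) x.deg (antipodeGen q d x) := by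
  have h := fun y => gen_homog (q := q) (d := d) y
  cases x
  · exact h .k1i
  · exact h .k1
  · exact h .k2i
  · exact h .k2
  · exact (mul_homog (h .k1i) (h .e1)).neg
  · exact (mul_homog (h .k2i) (h .e2)).neg
  · exact (mul_homog (h .f1) (h .k1)).neg
  · exact (mul_homog (h .f2) (h .k2)).neg

theorem superRight_homog {i j : ZMod 2} {a x : Ubar q d} (ha : IsHomog (P q d) i a)
    (hx : IsHomog (P q d) j x) : superRight q d a x = sg F (i * j) • (x * a) := by
  change m q d (koszul (P q d) (P q d) (x ⊗ₜ a)) = _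
  rw [koszul_homog hx ha, map_smul, mul_comm]; rfl

theorem antipode_P : antipode q d ∘ₗ P q d = P q d ∘ₗ antipode q d := by
  refine ext_of_gen_mul_homog _ _ (by simp [antipode_one]) fun x i u hu h => ?_
  have h2 : P q d (gen q d x * u) = _ := mul_homog (gen_homog x) hu
  have h3 : IsHomog (P q d) i (antipode q d u) := by
    have hu' : P q d u = sg F i • u := hu
    simp only [LinearMap.comp_apply, hu', map_smul] at h
    exact h.symm
  simp only [LinearMap.comp_apply] at h ⊢
  rw [h2, map_smul, antipode_gen_mul, superRight_homog (antipodeGen_homog x) h3, map_smul, add_comm,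
    mul_homog h3 (antipodeGen_homog x), smul_comm]

theorem antipode_homog {i : ZMod 2} {u : Ubar q d} (hu : IsHomog (P q d) i u) :
    IsHomog (P q d) i (antipode q d u) := hu.map antipode_P

theorem comul_P : comul q d ∘ₗ P q d = TensorProduct.map (P q d) (P q d) ∘ₗ comul q d := by
  have hT := superMul_even (m := m q d) (n := m q d) P_m P_m P_P P_P
  refine ext_of_gen_mul_homog _ _ (by simp [comul_one]) fun x i u hu h => ?_
  have h2 : P q d (gen q d x * u) = _ := mul_homog (gen_homog x) hu
  have h3 : TensorProduct.map (P q d) (P q d) (comul q d u) = sg F i • comul q d u := by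
    have hu' : P q d u = sg F i • u := hu
    simp only [LinearMap.comp_apply, hu', map_smul] at h
    exact h.symm
  have h4 : TensorProduct.map (P q d) (P q d) (comulGen q d x) = _ := comulGen_homog x
  have h5 := LinearMap.congr_fun hT (comulGen q d x ⊗ₜ comul q d u)
  simp only [LinearMap.comp_apply] at h5 ⊢
  rw [h2, map_smul, comul_gen_mul, h5]
  rw [TensorProduct.map_tmul, h3, h4, smul_tmul_smul, map_smul, sg_add]

theorem comul_homog {i : ZMod 2} {u : Ubar q d} (hu : IsHomog (P q d) i u) :
    IsHomog (TensorProduct.map (P q d) (P q d)) i (comul q d u) := hu.map comul_P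

theorem antipode_mul {i j : ZMod 2} {u v : Ubar q d} (hu : IsHomog (P q d) i u)
    (hv : IsHomog (P q d) j v) :
    antipode q d (u * v) = sg F (i * j) • (antipode q d v * antipode q d u) := by
  -- The operator `parPow (P q d) j` encodes the sign `(-1)^{ij}`, so that the right-hand side is
  -- linear in `u`.
  have key := ext_of_gen_mul_homog (q := q) (d := d) (antipode q d ∘ₗ LinearMap.mulRight F v)
    (m q d ∘ₗ TensorProduct.mk F _ _ (antipode q d v) ∘ₗ antipode q d ∘ₗ parPow (P q d) j)
    (by simp [parPow_homog one_homog, antipode_one]) (fun x i u hu h => by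
      simp only [LinearMap.comp_apply, LinearMap.mulRight_apply, mk_apply,
        parPow_homog hu, parPow_homog (mul_homog (gen_homog x) hu)] at h ⊢
      simp only [map_smul, tmul_smul, LinearMap.mul'_apply] at h ⊢
      rw [mul_assoc, antipode_gen_mul, antipode_gen_mul, h, map_smul]
      rw [superRight_homog (antipodeGen_homog x) (antipode_homog hu),
        superRight_homog (antipodeGen_homog x) (mul_homog (antipode_homog hv) (antipode_homog hu))]
      simp only [mul_smul_comm, smul_smul, ← sg_add, mul_assoc]
      congr 2; ring)
  have := LinearMap.congr_fun key u
  simp only [LinearMap.comp_apply, LinearMap.mulRight_apply, mk_apply, parPow_homog hu, map_smul,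
    LinearMap.mul'_apply] at this
  rw [this, mul_comm]

theorem antipodeAnti : (hopf q d).AntipodeAnti := by
  intro a b
  refine homog_induction P_P (fun a a' h h' => by
    simp only [add_tmul, map_add, h, h']) (fun i a ha => ?_) a
  refine homog_induction P_P (fun b b' h h' => by
    simp only [tmul_add, map_add, h, h']) (fun j b hb => ?_) b
  rw [HopfSuperData.mulOp_homog ha hb, map_smul]
  change sg F (i * j) • antipode q d (b * a) = antipode q d a * antipode q d b
  rw [antipode_mul hb ha, smul_smul, mul_comm j i, sg_mul_self, one_smul]

/-- Both iterated coproducts are multiplicative for the triple tensor product, whose two bracketings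
are identified by `superMul_tensorAssoc`; only the generators have to be compared. -/
theorem coassoc : (TensorProduct.assoc F _ _ _).toLinearMap ∘ₗ
      TensorProduct.map (comul q d) LinearMap.id ∘ₗ comul q d =
    TensorProduct.map LinearMap.id (comul q d) ∘ₗ comul q d := by
  refine ext_of_gen_mul _ _ (by simp [comul_one]) fun x u hu => ?_
  have hPP : TensorProduct.map (P q d) (P q d) ∘ₗ TensorProduct.map (P q d) (P q d) =
      LinearMap.id := by rw [← TensorProduct.map_comp, P_P, TensorProduct.map_id]
  have e1 := superMul_map (m' := superMul (P q d) (m q d) (P q d) (m q d)) (n' := m q d)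
    (m := m q d) (n := m q d) (Q' := P q d) (B := LinearMap.id) P_P P_P comul_P rfl (comul_mul (q := q) (d := d))
    (fun _ _ => rfl) (comulGen q d x) (comul q d u)
  have e2 := superMul_map (n' := superMul (P q d) (m q d) (P q d) (m q d)) (m' := m q d)
    (m := m q d) (n := m q d) (P' := P q d) (A := LinearMap.id) P_P P_P rfl comul_P
    (fun _ _ => rfl) (comul_mul (q := q) (d := d)) (comulGen q d x) (comul q d u)
  simp only [LinearMap.comp_apply, LinearEquiv.coe_coe] at hu ⊢
  rw [comul_gen_mul, e1, e2, superMul_tensorAssoc P_P P_P P_P, hu]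
  congr 2
  cases x <;> simp [comulGen, comul_gen, comul_one, add_tmul, tmul_add, add_assoc]

/-- The operator `a ⊗ b ↦ (-1)^{|a||b|} S(b) ⊗ S(a)`. -/
def swapAntipode (q : F) (d : ℕ) [OddRoot q d] :
    Ubar q d ⊗[F] Ubar q d →ₗ[F] Ubar q d ⊗[F] Ubar q d :=
  (TensorProduct.comm F _ _).toLinearMap ∘ₗ koszul (P q d) (P q d) ∘ₗ
    TensorProduct.map (antipode q d) (antipode q d)

theorem swapAntipode_tmul {i j : ZMod 2} {a b : Ubar q d} (ha : IsHomog (P q d) i a)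
    (hb : IsHomog (P q d) j b) : swapAntipode q d (a ⊗ₜ b) =
      sg F (i * j) • (antipode q d b ⊗ₜ antipode q d a) := by
  simp [swapAntipode, koszul_homog (antipode_homog ha) (antipode_homog hb)]

/-- Graded antimultiplicativity is inherited from `S` in each factor; the extra signs come from the
crossings in the tensor square and in the flip. -/
theorem swapAntipode_mul (s t : Ubar q d ⊗[F] Ubar q d) :
    swapAntipode q d (superMul (P q d) (m q d) (P q d) (m q d) (s ⊗ₜ t)) =
    superMul (P q d) (m q d) (P q d) (m q d) (TensorProduct.map (swapAntipode q d)
      (swapAntipode q d) (TensorProduct.comm F _ _ (koszul (TensorProduct.map (P q d) (P q d))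
        (TensorProduct.map (P q d) (P q d)) (s ⊗ₜ t)))) := by
  refine tmul_homog_induction P_P P_P (fun s s' h h' => by
    simp only [add_tmul, map_add, h, h']) (fun i a j b ha hb => ?_) s
  refine tmul_homog_induction P_P P_P (fun t t' h h' => by
    simp only [tmul_add, map_add, h, h']) (fun k x l y hx hy => ?_) t
  rw [superMul_homog _ _ hb hx, koszul_homog (ha.tmul hb) (hx.tmul hy), map_smul, map_smul,
    map_smul, map_smul, comm_tmul, TensorProduct.map_tmul, swapAntipode_tmul ha hb,
    swapAntipode_tmul hx hy, smul_tmul_smul, map_smul,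
    superMul_homog _ _ (antipode_homog hx) (antipode_homog hb)]
  simp only [LinearMap.mul'_apply]
  rw [swapAntipode_tmul (mul_homog ha hx) (mul_homog hb hy), antipode_mul ha hx, antipode_mul hb hy,
    smul_tmul_smul]
  simp only [smul_smul, ← sg_add]
  congr 2
  clear * -
  revert i j k l
  decide

/-- Both `Δ ∘ S` and the flipped `(S ⊗ S) ∘ Δ` reverse products with the same sign, so agreement on
the generators is enough. -/
theorem antipodeCoanti : (hopf q d).AntipodeCoanti := by
  intro u
  change comul q d (antipode q d u) = swapAntipode q d (comul q d u)
  refine LinearMap.congr_fun (f := comul q d ∘ₗ antipode q d)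
    (g := swapAntipode q d ∘ₗ comul q d) (ext_of_gen_mul_homog _ _ ?_ fun x i u hu h => ?_) u
  · simp [antipode_one, comul_one, swapAntipode_tmul one_homog one_homog]
  · have hx : comul q d (antipodeGen q d x) = swapAntipode q d (comulGen q d x) := by
      have hg := fun y => gen_homog (q := q) (d := d) y
      have h1 := one_homog (q := q) (d := d)
      have hs := fun a y b x => superMul_homog (m := m q d) (n := m q d) a y (hg b) (hg x)
      cases x
      · simp [comulGen, swapAntipode_tmul (hg .k1) (hg .k1), antipode_gen, antipodeGen, comul_gen,
          Gen.deg]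
      · simp [comulGen, swapAntipode_tmul (hg .k1i) (hg .k1i), antipode_gen, antipodeGen, comul_gen,
          Gen.deg]
      · simp [comulGen, swapAntipode_tmul (hg .k2) (hg .k2), antipode_gen, antipodeGen, comul_gen,
          Gen.deg]
      · simp [comulGen, swapAntipode_tmul (hg .k2i) (hg .k2i), antipode_gen, antipodeGen, comul_gen,
          Gen.deg]
      · rw [comulGen, map_add, swapAntipode_tmul (hg _) h1, swapAntipode_tmul (hg _) (hg _)]
        simp [antipodeGen, antipode_gen, antipode_one, comul_mul, comul_gen, comulGen, tmul_add,
          hs, Gen.deg, tmul_neg, neg_tmul, add_comm]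
      · rw [comulGen, map_add, swapAntipode_tmul (hg _) h1, swapAntipode_tmul (hg _) (hg _)]
        simp [antipodeGen, antipode_gen, antipode_one, comul_mul, comul_gen, comulGen, tmul_add,
          hs, Gen.deg, tmul_neg, neg_tmul, add_comm]
      · rw [comulGen, map_add, swapAntipode_tmul (hg _) (hg _), swapAntipode_tmul h1 (hg _)]
        simp [antipodeGen, antipode_gen, antipode_one, comul_mul, comul_gen, comulGen, add_tmul,
          hs, Gen.deg, tmul_neg, neg_tmul, add_comm]
      · rw [comulGen, map_add, swapAntipode_tmul (hg _) (hg _), swapAntipode_tmul h1 (hg _)]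
        simp [antipodeGen, antipode_gen, antipode_one, comul_mul, comul_gen, comulGen, add_tmul,
          hs, Gen.deg, tmul_neg, neg_tmul, add_comm]
    simp only [LinearMap.comp_apply] at h ⊢
    rw [antipode_gen_mul, superRight_homog (antipodeGen_homog x) (antipode_homog hu), map_smul,
      comul_mul, h, hx, comul_gen_mul, swapAntipode_mul,
      koszul_homog (comulGen_homog x) (comul_homog hu)]
    simp

theorem counit_gen (x : Gen) : counit q d (gen q d x) = match x with
    | .k1 => 1 | .k1i => 1 | .k2 => 1 | .k2i => 1 | .e1 => 0 | .e2 => 0 | .f1 => 0 | .f2 => 0 :=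
  lift_gen _ _ x

theorem counit_P : (counit q d).toLinearMap ∘ₗ P q d = (counit q d).toLinearMap := by
  have : (counit q d).comp (par q d) = counit q d := by
    refine hom_ext fun x => ?_
    cases x <;> simp [Gen.sign, counit_gen]
  exact congrArg AlgHom.toLinearMap this

theorem counit_odd {x : Ubar q d} (hx : IsHomog (P q d) 1 x) : counit q d x = 0 := by
  have h := LinearMap.congr_fun (counit_P (q := q) (d := d)) x
  unfold IsHomog at hx
  simp only [LinearMap.comp_apply, hx] at h
  simp only [sg_one, map_smul, AlgHom.toLinearMap_apply, smul_eq_mul, neg_mul, one_mul] at h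
  exact self_eq_neg.1 h.symm

/-- `ε ⊗ id` is multiplicative on the superalgebra `Ū_q ⊗ Ū_q`. -/
theorem counit_left_mul (s t : Ubar q d ⊗[F] Ubar q d) :
    TensorProduct.lid F _ (TensorProduct.map (counit q d).toLinearMap LinearMap.id
      (superMul (P q d) (m q d) (P q d) (m q d) (s ⊗ₜ t))) =
    TensorProduct.lid F _ (TensorProduct.map (counit q d).toLinearMap LinearMap.id s) *
    TensorProduct.lid F _ (TensorProduct.map (counit q d).toLinearMap LinearMap.id t) := by
  refine tmul_homog_induction P_P P_P (fun s s' h h' => by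
    simp only [add_tmul, map_add, h, h', add_mul]) (fun i a j b ha hb => ?_) s
  refine tmul_homog_induction P_P P_P (fun t t' h h' => by
    simp only [tmul_add, map_add, h, h', mul_add]) (fun k x l y hx hy => ?_) t
  rw [superMul_homog _ _ hb hx]
  rcases zmod_two_cases k with rfl | rfl
  · simp [smul_smul, mul_comm (counit q d x)]
  · simp [counit_odd hx]

theorem counit_right_mul (s t : Ubar q d ⊗[F] Ubar q d) :
    TensorProduct.rid F _ (TensorProduct.map LinearMap.id (counit q d).toLinearMap
      (superMul (P q d) (m q d) (P q d) (m q d) (s ⊗ₜ t))) =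
    TensorProduct.rid F _ (TensorProduct.map LinearMap.id (counit q d).toLinearMap s) *
    TensorProduct.rid F _ (TensorProduct.map LinearMap.id (counit q d).toLinearMap t) := by
  refine tmul_homog_induction P_P P_P (fun s s' h h' => by
    simp only [add_tmul, map_add, h, h', add_mul]) (fun i a j b ha hb => ?_) s
  refine tmul_homog_induction P_P P_P (fun t t' h h' => by
    simp only [tmul_add, map_add, h, h', mul_add]) (fun k x l y hx hy => ?_) t
  rw [superMul_homog _ _ hb hx]
  rcases zmod_two_cases j with rfl | rfl
  · simp [smul_smul, mul_comm (counit q d y)]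
  · simp [counit_odd hb]

theorem counit_comul : (TensorProduct.lid F _).toLinearMap ∘ₗ
    TensorProduct.map (counit q d).toLinearMap LinearMap.id ∘ₗ comul q d = LinearMap.id := by
  refine ext_of_gen_mul _ _ (by simp [comul_one]) fun x u hu => ?_
  simp only [LinearMap.comp_apply, LinearEquiv.coe_coe, LinearMap.id_apply] at hu ⊢
  rw [comul_gen_mul, counit_left_mul, hu]
  congr 1
  cases x <;> simp [comulGen, counit_gen]

theorem comul_counit : (TensorProduct.rid F _).toLinearMap ∘ₗ
    TensorProduct.map LinearMap.id (counit q d).toLinearMap ∘ₗ comul q d = LinearMap.id := by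
  refine ext_of_gen_mul _ _ (by simp [comul_one]) fun x u hu => ?_
  simp only [LinearMap.comp_apply, LinearEquiv.coe_coe, LinearMap.id_apply] at hu ⊢
  rw [comul_gen_mul, counit_right_mul, hu]
  congr 1
  cases x <;> simp [comulGen, counit_gen]

/-- With `s = ∑ a ⊗ b` and `t = ∑ x ⊗ y` the expression is `± S(x) S(a) b y`. The inner sum is the
scalar `c`, and the sign disappears because a scalar is even. The antipode law thus passes from
generators to products. -/
theorem antipode_left_mul {s t : Ubar q d ⊗[F] Ubar q d} {c : F}
    (hs : m q d (TensorProduct.map (antipode q d) LinearMap.id s) = c • 1) :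
    m q d (TensorProduct.map (antipode q d) LinearMap.id
      (superMul (P q d) (m q d) (P q d) (m q d) (s ⊗ₜ t))) =
    c • m q d (TensorProduct.map (antipode q d) LinearMap.id t) := by
  have key : ∀ (s : Ubar q d ⊗[F] Ubar q d) {k : ZMod 2} {x y : Ubar q d}, IsHomog (P q d) k x →
      m q d (TensorProduct.map (antipode q d) LinearMap.id
        (superMul (P q d) (m q d) (P q d) (m q d) (s ⊗ₜ (x ⊗ₜ y)))) =
      antipode q d x * parPow (P q d) k (m q d (TensorProduct.map (antipode q d) LinearMap.id s)) *
        y := fun s k x y hx => by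
    refine tmul_homog_induction P_P P_P (fun s s' h h' => by
      simp only [add_tmul, map_add, h, h', add_mul, mul_add]) (fun i a j b ha hb => ?_) s
    rw [superMul_homog _ _ hb hx]
    simp only [map_smul, TensorProduct.map_tmul, LinearMap.mul'_apply, LinearMap.id_apply]
    rw [antipode_mul ha hx, parPow_homog (mul_homog (antipode_homog ha) hb)]
    simp only [smul_mul_assoc, mul_smul_comm, smul_smul, ← sg_add, mul_assoc]
    congr 2; ring
  refine tmul_homog_induction P_P P_P (fun t t' h h' => by
    simp only [tmul_add, map_add, h, h', smul_add]) (fun i x j y hx hy => ?_) t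
  rw [key s hx, hs, map_smul, parPow_homog one_homog]
  simp

theorem antipode_right_mul {s t : Ubar q d ⊗[F] Ubar q d} {c : F}
    (ht : m q d (TensorProduct.map LinearMap.id (antipode q d) t) = c • 1) :
    m q d (TensorProduct.map LinearMap.id (antipode q d)
      (superMul (P q d) (m q d) (P q d) (m q d) (s ⊗ₜ t))) =
    c • m q d (TensorProduct.map LinearMap.id (antipode q d) s) := by
  have key : ∀ (t : Ubar q d ⊗[F] Ubar q d) {j : ZMod 2} {a b : Ubar q d}, IsHomog (P q d) j b →
      m q d (TensorProduct.map LinearMap.id (antipode q d)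
        (superMul (P q d) (m q d) (P q d) (m q d) ((a ⊗ₜ b) ⊗ₜ t))) =
      a * parPow (P q d) j (m q d (TensorProduct.map LinearMap.id (antipode q d) t)) *
        antipode q d b := fun t j a b hb => by
    refine tmul_homog_induction P_P P_P (fun s s' h h' => by
      simp only [tmul_add, map_add, h, h', add_mul, mul_add]) (fun k x l y hx hy => ?_) t
    rw [superMul_homog _ _ hb hx]
    simp only [map_smul, TensorProduct.map_tmul, LinearMap.mul'_apply, LinearMap.id_apply]
    rw [antipode_mul hb hy, parPow_homog (mul_homog hx (antipode_homog hy))]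
    simp only [smul_mul_assoc, mul_smul_comm, smul_smul, ← sg_add, mul_assoc, mul_add]
  refine tmul_homog_induction P_P P_P (fun t t' h h' => by
    simp only [add_tmul, map_add, h, h', smul_add]) (fun i a j b ha hb => ?_) s
  rw [key t hb, ht, map_smul, parPow_homog one_homog]
  simp

theorem antipode_left (u : Ubar q d) :
    m q d (TensorProduct.map (antipode q d) LinearMap.id (comul q d u)) = counit q d u • 1 := by
  refine LinearMap.congr_fun (f := m q d ∘ₗ TensorProduct.map (antipode q d) LinearMap.id ∘ₗ
    comul q d) (g := (LinearMap.toSpanSingleton F _ 1) ∘ₗ (counit q d).toLinearMap)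
    (ext_of_gen_mul _ _ (by simp [comul_one, antipode_one]) fun x u h => ?_) u
  simp only [LinearMap.comp_apply] at h ⊢
  rw [comul_gen_mul, antipode_left_mul (c := counit q d (gen q d x)) ?_, h]
  · simp [mul_smul]
  · cases x <;> simp [comulGen, antipode_gen, antipodeGen, counit_gen, antipode_one, mul_assoc]

theorem antipode_right (u : Ubar q d) :
    m q d (TensorProduct.map LinearMap.id (antipode q d) (comul q d u)) = counit q d u • 1 := by
  refine LinearMap.congr_fun (f := m q d ∘ₗ TensorProduct.map LinearMap.id (antipode q d) ∘ₗ
    comul q d) (g := (LinearMap.toSpanSingleton F _ 1) ∘ₗ (counit q d).toLinearMap)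
    (ext_of_gen_mul _ _ (by simp [comul_one, antipode_one]) fun x u h => ?_) u
  simp only [LinearMap.comp_apply] at h ⊢
  have h' : m q d (TensorProduct.map LinearMap.id (antipode q d) (comul q d u)) =
    counit q d u • 1 := h
  rw [comul_gen_mul, antipode_right_mul h']
  have : m q d (TensorProduct.map LinearMap.id (antipode q d) (comulGen q d x)) =
      counit q d (gen q d x) • 1 := by
    cases x <;> simp [comulGen, antipode_gen, antipodeGen, counit_gen, antipode_one]
  simp [this, smul_smul, mul_comm]

theorem hopf_isHopfSuperalgebra : (hopf q d).IsHopfSuperalgebra where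
  par_par := P_P
  par_mul := P_m
  par_one := map_one (par q d)
  par_comul := comul_P
  par_counit := counit_P
  par_antipode := antipode_P
  mul_assoc := m_assoc
  one_mul := by simp [hopf]
  mul_one := by simp [hopf]
  coassoc := coassoc
  counit_comul := counit_comul
  comul_counit := comul_counit
  comul_mul := TensorProduct.ext' fun a b => comul_mul a b
  comul_one := comul_one
  counit_mul := by simp [hopf]
  counit_one := by simp [hopf]
  antipode_left := antipode_left
  antipode_right := antipode_right

end Ubar

end QDouble

end

/-! ### Transfer of the Hopf structure to `B_q⁺` -/

noncomputable section

set_option linter.unusedSectionVars false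

namespace QDouble

open TensorProduct Module

variable {F : Type*} [Field F]

namespace HopfSuperData

variable {V : Type*} [AddCommGroup V] [Module F V]
variable {W : Type*} [AddCommGroup W] [Module F W]

/-- A linear map that is compatible with all structure maps. -/
structure IsStrict (H : HopfSuperData F V) (K : HopfSuperData F W) (ι : V →ₗ[F] W) : Prop where
  par : ∀ a, K.par (ι a) = ι (H.par a)
  mul : ∀ t, K.mul (TensorProduct.map ι ι t) = ι (H.mul t)
  one : ι H.one = K.one
  comul : ∀ a, K.comul (ι a) = TensorProduct.map ι ι (H.comul a)
  counit : ∀ a, K.counit (ι a) = H.counit a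
  antipode : ∀ a, K.antipode (ι a) = ι (H.antipode a)

namespace IsStrict

variable {H : HopfSuperData F V} {K : HopfSuperData F W} {ι : V →ₗ[F] W}

theorem map_koszul (h : H.IsStrict K ι) (t : V ⊗[F] V) :
    TensorProduct.map ι ι (koszul H.par H.par t) =
      koszul K.par K.par (TensorProduct.map ι ι t) := by
  induction t using TensorProduct.induction_on with
  | zero => simp
  | add s t hs ht => simp only [map_add, hs, ht]
  | tmul a b => simp [koszul, h.par]

theorem tensorMul (h : H.IsStrict K ι) (s t : V ⊗[F] V) :
    TensorProduct.map ι ι (H.tensorMul (s ⊗ₜ t)) =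
      K.tensorMul (TensorProduct.map ι ι s ⊗ₜ TensorProduct.map ι ι t) := by
  have hm : ∀ a b, ι (H.mul (a ⊗ₜ b)) = K.mul (ι a ⊗ₜ ι b) := fun a b => by
    rw [← h.mul, TensorProduct.map_tmul]
  induction s using TensorProduct.induction_on with
  | zero => simp
  | add s s' hs ht => simp only [map_add, add_tmul, hs, ht]
  | tmul a b =>
    induction t using TensorProduct.induction_on with
    | zero => simp
    | add s s' hs ht => simp only [map_add, tmul_add, hs, ht]
    | tmul x y =>
      simp [HopfSuperData.tensorMul, superTensorMul, koszul, h.par, hm, sub_tmul, tmul_sub]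

/-- Each law is an equation in `V`, in one of its tensor powers or in the field. Over a field the
tensor powers of an injection are injective, so it can be checked in the larger object. -/
theorem isHopfSuperalgebra (h : H.IsStrict K ι) (hι : Function.Injective ι)
    (hK : K.IsHopfSuperalgebra) : H.IsHopfSuperalgebra := by
  have hm : ∀ a b, ι (H.mul (a ⊗ₜ b)) = K.mul (ι a ⊗ₜ ι b) := fun a b => by
    rw [← h.mul, TensorProduct.map_tmul]
  have h₂ : Function.Injective (TensorProduct.map ι ι) :=
    TensorProduct.map_injective_of_flat_flat _ _ hι hι
  have h₃ : Function.Injective (TensorProduct.map ι (TensorProduct.map ι ι)) :=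
    TensorProduct.map_injective_of_flat_flat _ _ hι h₂
  have hc : K.comul ∘ₗ ι = TensorProduct.map ι ι ∘ₗ H.comul := LinearMap.ext h.comul
  have he : K.counit ∘ₗ ι = H.counit := LinearMap.ext h.counit
  have hs : K.antipode ∘ₗ ι = ι ∘ₗ H.antipode := LinearMap.ext h.antipode
  have hp : K.par ∘ₗ ι = ι ∘ₗ H.par := LinearMap.ext h.par
  refine
    { par_par := LinearMap.ext fun a => hι ?_
      par_mul := TensorProduct.ext' fun a b => hι ?_
      par_one := hι ?_
      par_comul := LinearMap.ext fun a => h₂ ?_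
      par_counit := LinearMap.ext fun a => ?_
      par_antipode := LinearMap.ext fun a => hι ?_
      mul_assoc := fun a b c => hι ?_
      one_mul := fun a => hι ?_
      mul_one := fun a => hι ?_
      coassoc := LinearMap.ext fun a => h₃ ?_
      counit_comul := LinearMap.ext fun a => hι ?_
      comul_counit := LinearMap.ext fun a => hι ?_
      comul_mul := TensorProduct.ext' fun a b => h₂ ?_
      comul_one := h₂ ?_
      counit_mul := fun a b => ?_
      counit_one := ?_
      antipode_left := fun a => hι ?_
      antipode_right := fun a => hι ?_ }
  · have := LinearMap.congr_fun hK.par_par (ι a)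
    simpa [h.par] using this
  · have := LinearMap.congr_fun hK.par_mul (ι a ⊗ₜ ι b)
    simp only [LinearMap.comp_apply, TensorProduct.map_tmul, ← hm, h.par] at this ⊢
    rw [this]
  · rw [← h.par, h.one, hK.par_one]
  · have := LinearMap.congr_fun hK.par_comul (ι a)
    simp only [LinearMap.comp_apply, h.par, h.comul] at this ⊢
    rw [this, TensorProduct.map_map, TensorProduct.map_map, hp]
  · have := LinearMap.congr_fun hK.par_counit (ι a)
    simpa [h.par, h.counit] using this
  · have := LinearMap.congr_fun hK.par_antipode (ι a)
    simpa [h.par, h.antipode] using this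
  · simp only [hm, hK.mul_assoc]
  · rw [hm, h.one, hK.one_mul]
  · rw [hm, h.one, hK.mul_one]
  · have := LinearMap.congr_fun hK.coassoc (ι a)
    simp only [LinearMap.comp_apply, h.comul, LinearEquiv.coe_coe, TensorProduct.map_map, hc, LinearMap.id_comp]
      at this ⊢
    rw [LinearMap.comp_id, ← this, TensorProduct.map_map_assoc, TensorProduct.map_map,
      LinearMap.comp_id]
  · have := LinearMap.congr_fun hK.counit_comul (ι a)
    simp only [LinearMap.comp_apply, h.comul, LinearEquiv.coe_coe,
      LinearMap.id_apply] at this ⊢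
    rw [← this]
    generalize H.comul a = t
    induction t using TensorProduct.induction_on with
    | zero => simp
    | add s t hs ht => simp only [map_add, hs, ht]
    | tmul a b => simp [h.counit]
  · have := LinearMap.congr_fun hK.comul_counit (ι a)
    simp only [LinearMap.comp_apply, h.comul, LinearEquiv.coe_coe,
      LinearMap.id_apply] at this ⊢
    rw [← this]
    generalize H.comul a = t
    induction t using TensorProduct.induction_on with
    | zero => simp
    | add s t hs ht => simp only [map_add, hs, ht]
    | tmul a b => simp [h.counit]
  · have := LinearMap.congr_fun hK.comul_mul (ι a ⊗ₜ ι b)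
    simp only [LinearMap.comp_apply, TensorProduct.map_tmul, h.comul, ← hm] at this ⊢
    rw [this, h.tensorMul]
  · rw [← h.comul, h.one, hK.comul_one, TensorProduct.map_tmul, h.one]
  · rw [← h.counit, hm, hK.counit_mul, h.counit, h.counit]
  · rw [← h.counit, h.one, hK.counit_one]
  · have := hK.antipode_left (ι a)
    rw [h.comul, TensorProduct.map_map, hs, LinearMap.id_comp, h.counit] at this
    rw [map_smul, h.one, ← this, ← h.mul, TensorProduct.map_map, LinearMap.comp_id]
  · have := hK.antipode_right (ι a)
    rw [h.comul, TensorProduct.map_map, hs, LinearMap.id_comp, h.counit] at this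
    rw [map_smul, h.one, ← this, ← h.mul, TensorProduct.map_map, LinearMap.comp_id]

theorem antipodeAnti (h : H.IsStrict K ι) (hι : Function.Injective ι) (hK : K.AntipodeAnti) :
    H.AntipodeAnti := by
  intro a b
  have := hK (ι a) (ι b)
  apply hι
  rw [← h.mul, ← h.antipode, TensorProduct.map_tmul, ← h.antipode, ← h.antipode, ← this]
  congr 1
  simp only [mulOp, LinearMap.comp_apply, LinearEquiv.coe_coe]
  rw [← h.mul, ← TensorProduct.map_tmul, ← h.map_koszul, TensorProduct.map_comm]

theorem antipodeCoanti (h : H.IsStrict K ι) (hι : Function.Injective ι) (hK : K.AntipodeCoanti) :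
    H.AntipodeCoanti := by
  intro a
  have h₂ : Function.Injective (TensorProduct.map ι ι) :=
    TensorProduct.map_injective_of_flat_flat _ _ hι hι
  have hs : K.antipode ∘ₗ ι = ι ∘ₗ H.antipode := LinearMap.ext h.antipode
  have := hK (ι a)
  apply h₂
  rw [← h.comul, ← h.antipode, this, TensorProduct.map_comm, h.map_koszul, h.comul]
  congr 2
  rw [TensorProduct.map_map, TensorProduct.map_map, hs]

end IsStrict

end HopfSuperData

namespace Ubar.Bplus

variable {q : F} {d : ℕ} [CharZero F] [OddRoot q d]

theorem isStrict_val : (hopf q d).IsStrict (Ubar.hopf q d) (Bplus q d).val.toLinearMap where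
  par _ := rfl
  mul t := by
    induction t using TensorProduct.induction_on with
    | zero => simp
    | add s t hs ht => simp only [map_add, hs, ht]
    | tmul a b => rfl
  one := rfl
  comul a := (incl₂_comul a).symm
  counit _ := rfl
  antipode _ := rfl

theorem hopf_isHopfSuperalgebra : (hopf q d).IsHopfSuperalgebra :=
  isStrict_val.isHopfSuperalgebra Subtype.val_injective Ubar.hopf_isHopfSuperalgebra

theorem antipodeAnti : (hopf q d).AntipodeAnti :=
  isStrict_val.antipodeAnti Subtype.val_injective Ubar.antipodeAnti

theorem antipodeCoanti : (hopf q d).AntipodeCoanti :=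
  isStrict_val.antipodeCoanti Subtype.val_injective Ubar.antipodeCoanti

/-- The image is a subalgebra since `S` reverses products up to sign. It contains `k_i = S(k_i⁻¹)`
and `k_i⁻¹ e_i = S(-e_i)`, hence all generators, and in finite dimension surjectivity implies
injectivity. -/
theorem antipode_bijective : Function.Bijective (hopf q d).antipode := by
  have hsurj : Function.Surjective (hopf q d).antipode := by
    let R : Subalgebra F (Bplus q d) := (LinearMap.range (hopf q d).antipode).toSubalgebra
      ⟨1, HopfSuperData.antipode_one hopf_isHopfSuperalgebra⟩ (by
        rintro _ _ ⟨u, rfl⟩ ⟨v, rfl⟩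
        exact ⟨_, antipodeAnti u v⟩)
    have hR : ∀ {u v : Ubar q d} (hu : u ∈ Bplus q d), antipode q d u = v →
        v ∈ R.map (Bplus q d).val := by
      rintro u _ hu rfl
      exact ⟨(hopf q d).antipode ⟨u, hu⟩, ⟨_, rfl⟩, rfl⟩
    have h1 := hR k1i_mem (antipode_gen _)
    have h2 := hR k2i_mem (antipode_gen _)
    have h3 := hR (neg_mem e1_mem) (by rw [map_neg, antipode_gen, antipodeGen, neg_neg])
    have h4 := hR (neg_mem e2_mem) (by rw [map_neg, antipode_gen, antipodeGen, neg_neg])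
    have key : Bplus q d ≤ R.map (Bplus q d).val := by
      refine le_of_gen h1 h2 ?_ ?_
      · simpa [antipodeGen] using mul_mem h1 h3
      · simpa [antipodeGen] using mul_mem h2 h4
    intro x
    obtain ⟨y, ⟨z, hz⟩, hy⟩ := key x.2
    exact ⟨z, hz.trans (Subtype.val_injective hy)⟩
  exact ⟨LinearMap.injective_iff_surjective.2 hsurj, hsurj⟩

theorem double_isHopfSuperalgebra : (hopf q d).double.IsHopfSuperalgebra :=
  HopfSuperData.double_isHopfSuperalgebra hopf_isHopfSuperalgebra antipode_bijective antipodeAnti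
    antipodeCoanti

end Ubar.Bplus

end QDouble

end

/-! ### Operators on `B_q⁺` attached to characters and skew derivations -/

noncomputable section

set_option linter.unusedSectionVars false

namespace QDouble

open TensorProduct Module

variable {F : Type*} [Field F]

namespace Ubar.Bplus

variable {q : F} {d : ℕ}

section Gens

variable (q d) [OddRoot q d]

/-- `k₁` as an element of `B_q⁺`. -/
def bk1 : Bplus q d := ⟨gen q d .k1, k1_mem⟩
/-- `k₂` as an element of `B_q⁺`. -/
def bk2 : Bplus q d := ⟨gen q d .k2, k2_mem⟩
/-- `e₁` as an element of `B_q⁺`. -/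
def be1 : Bplus q d := ⟨gen q d .e1, e1_mem⟩
/-- `e₂` as an element of `B_q⁺`. -/
def be2 : Bplus q d := ⟨gen q d .e2, e2_mem⟩
/-- `e₃` as an element of `B_q⁺`. -/
def be3 : Bplus q d := be1 q d * be2 q d - q⁻¹ • (be2 q d * be1 q d)

/-- The monomials as elements of `B_q⁺`. -/
def bword (i j r h t : ℕ) : Bplus q d :=
  bk1 q d ^ i * bk2 q d ^ j * be1 q d ^ r * be3 q d ^ h * be2 q d ^ t

variable {q d}

theorem eq_top_of_gen {S : Subalgebra F (Bplus q d)} (h1 : bk1 q d ∈ S) (h2 : bk2 q d ∈ S)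
    (h3 : be1 q d ∈ S) (h4 : be2 q d ∈ S) : S = ⊤ := by
  have : Bplus q d ≤ S.map (Bplus q d).val :=
    le_of_gen ⟨_, h1, rfl⟩ ⟨_, h2, rfl⟩ ⟨_, h3, rfl⟩ ⟨_, h4, rfl⟩
  refine eq_top_iff.2 fun x _ => ?_
  obtain ⟨y, hy, e⟩ := this x.2
  exact Subtype.val_injective e ▸ hy

theorem mem_of_gen {p : Bplus q d → Prop} (hc : ∀ c : F, p (algebraMap F _ c))
    (add : ∀ x y, p x → p y → p (x + y)) (mul : ∀ x y, p x → p y → p (x * y))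
    (h1 : p (bk1 q d)) (h2 : p (bk2 q d)) (h3 : p (be1 q d)) (h4 : p (be2 q d)) (x : Bplus q d) :
    p x := by
  let S : Subalgebra F (Bplus q d) :=
    { carrier := {x | p x}
      mul_mem' := fun ha hb => mul _ _ ha hb
      add_mem' := fun ha hb => add _ _ ha hb
      algebraMap_mem' := hc }
  have : x ∈ S := by rw [eq_top_of_gen (S := S) h1 h2 h3 h4]; trivial
  exact this

theorem span_bword : Submodule.span F (Set.range fun m : PosIdx d =>
    bword q d m.1 m.2.1 m.2.2.1 m.2.2.2.1 m.2.2.2.2) = ⊤ := by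
  have h : (Submodule.span F (Set.range fun m : PosIdx d =>
      bword q d m.1 m.2.1 m.2.2.1 m.2.2.2.1 m.2.2.2.2)).map (Bplus q d).val.toLinearMap =
      posSpan q d := by
    rw [Submodule.map_span, ← Set.range_comp]; rfl
  refine eq_top_iff.2 fun x _ => ?_
  have hx := mem_iff.1 x.2
  rw [← h] at hx
  obtain ⟨y, hy, e⟩ := hx
  exact Subtype.val_injective e ▸ hy

end Gens

variable [CharZero F] [OddRoot q d]

variable (q d) in
/-- The grading involution of `B_q⁺`. -/
abbrev PB : Bplus q d →ₗ[F] Bplus q d := (hopf q d).par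

variable (q d) in
/-- The product of `B_q⁺` as a linear map. -/
abbrev mB : Bplus q d ⊗[F] Bplus q d →ₗ[F] Bplus q d := LinearMap.mul' F (Bplus q d)

theorem PB_PB : PB q d ∘ₗ PB q d = LinearMap.id := hopf_isHopfSuperalgebra.par_par

theorem PB_mul (x y : Bplus q d) : PB q d (x * y) = PB q d x * PB q d y :=
  LinearMap.congr_fun hopf_isHopfSuperalgebra.par_mul (x ⊗ₜ y)

theorem bmul_homog {i j : ZMod 2} {a b : Bplus q d} (ha : IsHomog (PB q d) i a)
    (hb : IsHomog (PB q d) j b) : IsHomog (PB q d) (i + j) (a * b) :=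
  ha.mul (m := mB q d) hopf_isHopfSuperalgebra.par_mul hb

theorem PB_one : PB q d 1 = 1 := hopf_isHopfSuperalgebra.par_one

@[simp] theorem PB_bk1 : PB q d (bk1 q d) = bk1 q d :=
  Subtype.ext ((par_gen _).trans (by simp [Gen.sign, bk1]))
@[simp] theorem PB_bk2 : PB q d (bk2 q d) = bk2 q d :=
  Subtype.ext ((par_gen _).trans (by simp [Gen.sign, bk2]))
@[simp] theorem PB_be1 : PB q d (be1 q d) = be1 q d :=
  Subtype.ext ((par_gen _).trans (by simp [Gen.sign, be1]))
@[simp] theorem PB_be2 : PB q d (be2 q d) = -be2 q d :=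
  Subtype.ext ((par_gen _).trans (by simp [Gen.sign, be2]))

theorem comul_bk1 : (hopf q d).comul (bk1 q d) = bk1 q d ⊗ₜ bk1 q d :=
  incl₂_injective ((incl₂_comul _).trans (comul_gen .k1))
theorem comul_bk2 : (hopf q d).comul (bk2 q d) = bk2 q d ⊗ₜ bk2 q d :=
  incl₂_injective ((incl₂_comul _).trans (comul_gen .k2))
theorem comul_be1 : (hopf q d).comul (be1 q d) = be1 q d ⊗ₜ 1 + bk1 q d ⊗ₜ be1 q d :=
  incl₂_injective ((incl₂_comul _).trans (comul_gen .e1))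
theorem comul_be2 : (hopf q d).comul (be2 q d) = be2 q d ⊗ₜ 1 + bk2 q d ⊗ₜ be2 q d :=
  incl₂_injective ((incl₂_comul _).trans (comul_gen .e2))

theorem comul_bone : (hopf q d).comul 1 = 1 ⊗ₜ 1 := hopf_isHopfSuperalgebra.comul_one

theorem comul_bmul (x y : Bplus q d) : (hopf q d).comul (x * y) =
    superMul (PB q d) (mB q d) (PB q d) (mB q d) ((hopf q d).comul x ⊗ₜ (hopf q d).comul y) :=
  LinearMap.congr_fun hopf_isHopfSuperalgebra.comul_mul (x ⊗ₜ y)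

variable (q d) in
/-- The counit of `B_q⁺`. -/
abbrev εB : Dual F (Bplus q d) := (hopf q d).counit

theorem xmul_assoc (f g h : Dual F (Bplus q d)) : xmul (xmul f g) h = xmul f (xmul g h) :=
  HopfSuperData.dualOp_mul_assoc hopf_isHopfSuperalgebra f g h

theorem ε_xmul (f : Dual F (Bplus q d)) : xmul (εB q d) f = f :=
  HopfSuperData.dualOp_one_mul hopf_isHopfSuperalgebra f

theorem xmul_ε (f : Dual F (Bplus q d)) : xmul f (εB q d) = f :=
  HopfSuperData.dualOp_mul_one hopf_isHopfSuperalgebra f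

theorem xpow_zero (f : Dual F (Bplus q d)) : xpow f 0 = εB q d := rfl
theorem xpow_succ (f : Dual F (Bplus q d)) (n : ℕ) : xpow f (n + 1) = xmul (xpow f n) f := rfl

/-- `a ⊗ b ↦ (-1)^{|a||b|} g(a) b` -/
def contract (g : Dual F (Bplus q d)) : Bplus q d ⊗[F] Bplus q d →ₗ[F] Bplus q d :=
  (TensorProduct.lid F _).toLinearMap ∘ₗ TensorProduct.map g LinearMap.id ∘ₗ
    koszul (PB q d) (PB q d)

theorem contract_homog (g : Dual F (Bplus q d)) {i j : ZMod 2} {a b : Bplus q d}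
    (ha : IsHomog (PB q d) i a) (hb : IsHomog (PB q d) j b) :
    contract g (a ⊗ₜ b) = (sg F (i * j) * g a) • b := by
  simp [contract, koszul_homog ha hb, smul_smul]

/-- The operator `x ↦ ∑ (-1)^{|x'||x''|} g(x') x''`, the transpose of left multiplication by `g`
in `X`. -/
def pd : Dual F (Bplus q d) →ₗ[F] Module.End F (Bplus q d) where
  toFun g := contract g ∘ₗ (hopf q d).comul
  map_add' f g := LinearMap.ext fun x => by
    simp [contract, TensorProduct.map_add_left]
  map_smul' c f := LinearMap.ext fun x => by
    simp [contract, TensorProduct.map_smul_left]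

theorem pd_apply (g : Dual F (Bplus q d)) (x : Bplus q d) :
    pd g x = contract g ((hopf q d).comul x) := rfl

theorem xmul_apply (f g : Dual F (Bplus q d)) (x : Bplus q d) : xmul f g x = g (pd f x) := by
  rw [xmul, HopfSuperData.dualOp_mul_apply, pd_apply, contract]
  simp only [LinearMap.comp_apply]
  generalize koszul (PB q d) (PB q d) ((hopf q d).comul x) = t
  induction t using TensorProduct.induction_on with
  | zero => simp
  | add s t hs ht => simp only [map_add, hs, ht]
  | tmul a b => simp

theorem ext_dual {x y : Bplus q d} (h : ∀ f : Dual F (Bplus q d), f x = f y) : x = y := by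
  refine sub_eq_zero.1 ((Module.forall_dual_apply_eq_zero_iff F (x - y)).1 fun f => ?_)
  rw [map_sub, h, sub_self]

/-- Transposes compose in reverse order, which is why opposite algebras of operators appear later.
-/
theorem pd_xmul (f g : Dual F (Bplus q d)) : pd (xmul f g) = pd g * pd f :=
  LinearMap.ext fun x => ext_dual fun h => by
    rw [← xmul_apply, xmul_assoc, xmul_apply, xmul_apply]; rfl

theorem pd_ε : pd (εB q d) = 1 :=
  LinearMap.ext fun x => ext_dual fun h => by rw [← xmul_apply, ε_xmul]; rfl

theorem pd_xpow (f : Dual F (Bplus q d)) (n : ℕ) : pd (xpow f n) = pd f ^ n := by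
  induction n with
  | zero => exact pd_ε
  | succ n ih => rw [xpow_succ, pd_xmul, ih, pow_succ']

theorem ε_pd (f : Dual F (Bplus q d)) (x : Bplus q d) : εB q d (pd f x) = f x := by
  rw [← xmul_apply, xmul_ε]

/-- `g` is recovered as `ε ∘ pd g`. Relations in `X` may therefore be verified on operators. -/
theorem pd_injective : Function.Injective (pd (q := q) (d := d)) := fun f g h =>
  LinearMap.ext fun x => by rw [← ε_pd, h, ε_pd]

theorem pd_even (g : Dual F (Bplus q d)) {a b : Bplus q d} (ha : PB q d a = a) :
    contract g (a ⊗ₜ b) = g a • b := by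
  simp [contract, koszul_even_left _ _ ha]

theorem pd_even_right (g : Dual F (Bplus q d)) {a b : Bplus q d} (hb : PB q d b = b) :
    contract g (a ⊗ₜ b) = g a • b := by
  simp [contract, koszul_even_right _ _ _ hb]

theorem pd_one (g : Dual F (Bplus q d)) : pd g 1 = g 1 • 1 := by
  rw [pd_apply, comul_bone, pd_even g PB_one]

theorem pd_bk1 (g : Dual F (Bplus q d)) : pd g (bk1 q d) = g (bk1 q d) • bk1 q d := by
  rw [pd_apply, comul_bk1, pd_even g PB_bk1]

theorem pd_bk2 (g : Dual F (Bplus q d)) : pd g (bk2 q d) = g (bk2 q d) • bk2 q d := by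
  rw [pd_apply, comul_bk2, pd_even g PB_bk2]

theorem pd_be1 (g : Dual F (Bplus q d)) :
    pd g (be1 q d) = g (be1 q d) • 1 + g (bk1 q d) • be1 q d := by
  rw [pd_apply, comul_be1, map_add, pd_even g PB_bk1, pd_even_right g PB_one]

theorem pd_be2 (g : Dual F (Bplus q d)) :
    pd g (be2 q d) = g (be2 q d) • 1 + g (bk2 q d) • be2 q d := by
  rw [pd_apply, comul_be2, map_add, pd_even g PB_bk2, pd_even_right g PB_one]

/-- `κ` is an algebra morphism `B_q⁺ → F` with `k₁ ↦ s`, `k₂ ↦ t`, `eᵢ ↦ 0`. -/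
structure IsChar (κ : Dual F (Bplus q d)) (s t : F) : Prop where
  one : κ 1 = 1
  mul : ∀ x y, κ (x * y) = κ x * κ y
  bk1 : κ (bk1 q d) = s
  bk2 : κ (bk2 q d) = t
  be1 : κ (be1 q d) = 0
  be2 : κ (be2 q d) = 0

/-- `g` is a skew derivation of degree `i` with respect to `κ` and `l`, that vanishes at `k₁`
and `k₂`. -/
structure IsSkew (i : ZMod 2) (κ l g : Dual F (Bplus q d)) (a b : F) : Prop where
  mul : ∀ x y, g (x * y) = κ x * g y + g x * l y
  one : g 1 = 0
  bk1 : g (bk1 q d) = 0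
  bk2 : g (bk2 q d) = 0
  be1 : g (be1 q d) = a
  be2 : g (be2 q d) = b
  par : IsHomog (hopf q d).dualPar i g

theorem isChar_ε : IsChar (εB q d) 1 1 where
  one := hopf_isHopfSuperalgebra.counit_one
  mul := hopf_isHopfSuperalgebra.counit_mul
  bk1 := counit_gen .k1
  bk2 := counit_gen .k2
  be1 := counit_gen .e1
  be2 := counit_gen .e2

theorem IsChar.ext {κ μ : Dual F (Bplus q d)} {s t : F} (h : IsChar κ s t) (h' : IsChar μ s t) :
    κ = μ :=
  LinearMap.ext (mem_of_gen (p := fun x => κ x = μ x)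
    (fun c => by simp [Algebra.algebraMap_eq_smul_one, h.one, h'.one])
    (fun x y hx hy => by rw [map_add, map_add, hx, hy])
    (fun x y hx hy => by rw [h.mul, h'.mul, hx, hy]) (h.bk1.trans h'.bk1.symm)
    (h.bk2.trans h'.bk2.symm) (h.be1.trans h'.be1.symm) (h.be2.trans h'.be2.symm))

theorem IsChar.par {κ : Dual F (Bplus q d)} {s t : F} (h : IsChar κ s t) :
    IsHomog (hopf q d).dualPar 0 κ := by
  have : IsChar ((hopf q d).dualPar κ) s t :=
    { one := (congrArg κ PB_one).trans h.one
      mul := fun x y => (congrArg κ (PB_mul x y)).trans (h.mul _ _)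
      bk1 := (congrArg κ PB_bk1).trans h.bk1
      bk2 := (congrArg κ PB_bk2).trans h.bk2
      be1 := (congrArg κ PB_be1).trans h.be1
      be2 := (congrArg κ PB_be2).trans (by rw [map_neg, h.be2, neg_zero]) }
  exact isHomog_zero_iff.2 (this.ext h)

theorem apply_eq_zero {i j : ZMod 2} {f : Dual F (Bplus q d)} {x : Bplus q d}
    (hf : IsHomog (hopf q d).dualPar i f) (hx : IsHomog (PB q d) j x) (hij : i ≠ j) : f x = 0 :=
  (hopf q d).dual_apply_eq_zero hf hx hij

/-- A character is even, so only even first legs contribute and all signs are trivial. -/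
theorem IsChar.pd_mul {κ : Dual F (Bplus q d)} {s t : F} (h : IsChar κ s t) (x y : Bplus q d) :
    pd κ (x * y) = pd κ x * pd κ y := by
  have key : ∀ u v : Bplus q d ⊗[F] Bplus q d,
      contract κ (superMul (PB q d) (mB q d) (PB q d) (mB q d) (u ⊗ₜ v)) =
        contract κ u * contract κ v := fun u v => by
    refine tmul_homog_induction PB_PB PB_PB (fun s s' h h' => by
      simp only [add_tmul, map_add, h, h', add_mul]) (fun i a j b ha hb => ?_) u
    refine tmul_homog_induction PB_PB PB_PB (fun t t' h h' => by
      simp only [tmul_add, map_add, h, h', mul_add]) (fun k a' l b' ha' hb' => ?_) v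
    rw [superMul_homog _ _ hb ha', map_smul, LinearMap.mul'_apply, LinearMap.mul'_apply,
      contract_homog κ (bmul_homog ha ha') (bmul_homog hb hb'),
      contract_homog κ ha hb, contract_homog κ ha' hb', h.mul]
    by_cases hi : 0 = i
    · by_cases hk : 0 = k
      · subst hi hk; simp [smul_smul, mul_comm]
      · simp [apply_eq_zero h.par ha' hk]
    · simp [apply_eq_zero h.par ha hi]
  rw [pd_apply, comul_bmul, key]; rfl

/-- The term `κ(a) g(a')` survives only for `a` even and `a'` of degree `i`, and then the signs
agree. The term `g(a) l(a')` survives only for `a` of degree `i` and `a'` even, and then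
`(-1)^{i|b'|}` is left over; this is the `parPow`. -/
theorem IsSkew.pd_mul {i : ZMod 2} {κ l g : Dual F (Bplus q d)} {a b s t s' t' : F}
    (h : IsSkew i κ l g a b) (hκ : IsChar κ s t) (hl : IsChar l s' t') (x y : Bplus q d) :
    pd g (x * y) = pd κ x * pd g y + pd g x * parPow (PB q d) i (pd l y) := by
  have key : ∀ u v : Bplus q d ⊗[F] Bplus q d,
      contract g (superMul (PB q d) (mB q d) (PB q d) (mB q d) (u ⊗ₜ v)) =
        contract κ u * contract g v + contract g u * parPow (PB q d) i (contract l v) :=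
    fun u v => by
    refine tmul_homog_induction PB_PB PB_PB (fun s s' h h' => by
      simp only [add_tmul, map_add, h, h', add_mul]; abel) (fun i' a j b ha hb => ?_) u
    refine tmul_homog_induction PB_PB PB_PB (fun t t' h h' => by
      simp only [tmul_add, map_add, h, h', mul_add]; abel) (fun k a' m b' ha' hb' => ?_) v
    rw [superMul_homog _ _ hb ha', map_smul, LinearMap.mul'_apply, LinearMap.mul'_apply,
      contract_homog g (bmul_homog ha ha') (bmul_homog hb hb'),
      contract_homog g ha hb, contract_homog g ha' hb', contract_homog κ ha hb,
      contract_homog l ha' hb', h.mul, map_smul, parPow_homog hb']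
    simp only [smul_mul_smul_comm, smul_smul, ← add_smul]
    congr 1
    have e1 : κ a * g a' = 0 ∨ (i' = 0 ∧ k = i) := by
      by_cases hi : 0 = i'
      · by_cases hk : i = k
        · exact .inr ⟨hi.symm, hk.symm⟩
        · simp [apply_eq_zero h.par ha' hk]
      · simp [apply_eq_zero hκ.par ha hi]
    have e2 : g a * l a' = 0 ∨ (i' = i ∧ k = 0) := by
      by_cases hi : i = i'
      · by_cases hk : 0 = k
        · exact .inr ⟨hi.symm, hk.symm⟩
        · simp [apply_eq_zero hl.par ha' hk]
      · simp [apply_eq_zero h.par ha hi]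
    have e1' : sg F (j * k) * sg F ((i' + k) * (j + m)) * (κ a * g a') =
        sg F (i' * j) * sg F (k * m) * (κ a * g a') := by
      rcases e1 with e | ⟨rfl, rfl⟩
      · rw [e, mul_zero, mul_zero]
      · simp only [← sg_add]
        congr 2; clear * -; revert j k m; decide
    have e2' : sg F (j * k) * sg F ((i' + k) * (j + m)) * (g a * l a') =
        sg F (i' * j) * sg F (k * m) * sg F (i * m) * (g a * l a') := by
      rcases e2 with e | ⟨rfl, rfl⟩
      · rw [e, mul_zero, mul_zero]
      · simp only [← sg_add]
        congr 2; clear * -; revert i' j m; decide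
    linear_combination e1' + e2'
  rw [pd_apply, comul_bmul, key]; rfl

theorem IsChar.mul_char {κ μ : Dual F (Bplus q d)} {s t s' t' : F} (h : IsChar κ s t)
    (h' : IsChar μ s' t') : IsChar (xmul κ μ) (s * s') (t * t') where
  one := by rw [xmul_apply, pd_one, map_smul, h.one, h'.one]; simp
  mul x y := by rw [xmul_apply, h.pd_mul, h'.mul, ← xmul_apply, ← xmul_apply]
  bk1 := by rw [xmul_apply, pd_bk1, map_smul, h.bk1, h'.bk1]; rfl
  bk2 := by rw [xmul_apply, pd_bk2, map_smul, h.bk2, h'.bk2]; rfl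
  be1 := by rw [xmul_apply, pd_be1, map_add, map_smul, map_smul, h.be1, h'.be1]; simp
  be2 := by rw [xmul_apply, pd_be2, map_add, map_smul, map_smul, h.be2, h'.be2]; simp

theorem IsChar.pow {κ : Dual F (Bplus q d)} {s t : F} (h : IsChar κ s t) (n : ℕ) :
    IsChar (xpow κ n) (s ^ n) (t ^ n) := by
  induction n with
  | zero => rw [pow_zero, pow_zero]; exact isChar_ε
  | succ n ih => rw [pow_succ, pow_succ]; exact ih.mul_char h

theorem IsSkew.smul {i : ZMod 2} {κ l g : Dual F (Bplus q d)} {a b : F}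
    (h : IsSkew i κ l g a b) (c : F) : IsSkew i κ l (c • g) (c * a) (c * b) where
  mul x y := by simp [h.mul]; ring
  one := by simp [h.one]
  bk1 := by simp [h.bk1]
  bk2 := by simp [h.bk2]
  be1 := by simp [h.be1]
  be2 := by simp [h.be2]
  par := h.par.smul c

/-- Left multiplication by a character changes both twisting characters. It serves to normalise the
second one to `ε`. -/
theorem IsSkew.char_mul {i : ZMod 2} {κ l g μ : Dual F (Bplus q d)} {a b s t : F}
    (h : IsSkew i κ l g a b) (hμ : IsChar μ s t) :
    IsSkew i (xmul μ κ) (xmul μ l) (xmul μ g) (s * a) (t * b) where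
  mul x y := by simp only [xmul_apply]; rw [hμ.pd_mul, h.mul]
  one := by rw [xmul_apply, pd_one, map_smul, h.one, smul_zero]
  bk1 := by rw [xmul_apply, pd_bk1, map_smul, h.bk1, smul_zero]
  bk2 := by rw [xmul_apply, pd_bk2, map_smul, h.bk2, smul_zero]
  be1 := by
    rw [xmul_apply, pd_be1, map_add, map_smul, map_smul, h.be1, h.one, hμ.bk1]; simp
  be2 := by
    rw [xmul_apply, pd_be2, map_add, map_smul, map_smul, h.be2, h.one, hμ.bk2]; simp
  par := by
    have := LinearMap.congr_fun (HopfSuperData.dualOp_par_mul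
      (hopf_isHopfSuperalgebra (q := q) (d := d))) (μ ⊗ₜ g)
    have h1 := hμ.par
    have h2 := h.par
    unfold IsHomog at *
    simp only [LinearMap.comp_apply, TensorProduct.map_tmul, h1, h2] at this
    simpa [xmul] using this

end Ubar.Bplus

end QDouble

end

/-! ### Matrix coefficients of the vector representation -/

noncomputable section

set_option linter.unusedSectionVars false

namespace QDouble

open TensorProduct Module

variable {F : Type*} [Field F]

namespace Ubar

variable (q : F) (d : ℕ)

theorem q_sub_ne [CharZero F] [OddRoot q d] : q - q⁻¹ ≠ 0 := by
  have hq := q_ne_zero q d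
  intro h
  have h2 : q ^ 2 = 1 := by
    field_simp at h
    linear_combination h
  have hp : IsPrimitiveRoot (q ^ 2) d :=
    OddRoot.prim.pow_of_coprime 2 (OddRoot.odd (q := q) (d := d)).coprime_two_left
  have := OddRoot.one_lt (q := q) (d := d)
  exact hp.ne_one this h2

/-- The matrices of the generators in the vector representation. -/
def vecGen (q : F) : Gen → Matrix (Fin 3) (Fin 3) F
  | .k1 => !![q, 0, 0; 0, q⁻¹, 0; 0, 0, 1]
  | .k1i => !![q⁻¹, 0, 0; 0, q, 0; 0, 0, 1]
  | .k2 => !![1, 0, 0; 0, q, 0; 0, 0, q]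
  | .k2i => !![1, 0, 0; 0, q⁻¹, 0; 0, 0, q⁻¹]
  | .e1 => !![0, 1, 0; 0, 0, 0; 0, 0, 0]
  | .e2 => !![0, 0, 0; 0, 0, 1; 0, 0, 0]
  | .f1 => !![0, 0, 0; 1, 0, 0; 0, 0, 0]
  | .f2 => !![0, 0, 0; 0, 0, 0; 0, 1, 0]

theorem diag_pow (a b c : F) (n : ℕ) : !![a, 0, 0; 0, b, 0; 0, 0, c] ^ n =
    !![a ^ n, 0, 0; 0, b ^ n, 0; 0, 0, c ^ n] := by
  induction n with
  | zero => ext i j; fin_cases i <;> fin_cases j <;> simp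
  | succ n ih =>
    rw [pow_succ, ih]
    ext i j; fin_cases i <;> fin_cases j <;> simp [Matrix.mul_apply, Fin.sum_univ_three, pow_succ]

variable [CharZero F] [OddRoot q d]

theorem vec_rel : ∀ a b, Rel q d (vecGen q) a b → a = b := by
  have hq := q_ne_zero q d
  have hs := q_sub_ne q d
  have hs2 : q ^ 2 - 1 ≠ 0 := fun h => hs (by field_simp; linear_combination h)
  have hs3 : -1 + q ^ 2 ≠ 0 := fun h => hs2 (by linear_combination h)
  have hd := OddRoot.one_lt (q := q) (d := d)
  have hqd : q ^ d = 1 := (OddRoot.prim (q := q) (d := d)).pow_eq_one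
  -- The matrices of `e₁` and `f₁` already have square zero, and `d ≥ 2`.
  have hpow : ∀ M : Matrix (Fin 3) (Fin 3) F, M * M = 0 → M ^ d = 0 := fun M h => by
    rw [← Nat.sub_add_cancel hd, pow_add, sq, h, mul_zero]
  intro a b r
  cases r
  case k1d => simp [vecGen, diag_pow, hqd, Matrix.one_fin_three]
  case k2d => simp [vecGen, diag_pow, hqd, Matrix.one_fin_three]
  case e1d => exact hpow _ (by ext i j; fin_cases i <;> fin_cases j <;> simp [vecGen])
  case f1d => exact hpow _ (by ext i j; fin_cases i <;> fin_cases j <;> simp [vecGen])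
  all_goals
    ext i j
    fin_cases i <;> fin_cases j <;>
      simp [vecGen, hq, sq, Matrix.mul_apply, Fin.sum_univ_three, zpow_neg] <;>
      field_simp <;> try ring

/-- The vector representation. -/
def vec : Ubar q d →ₐ[F] Matrix (Fin 3) (Fin 3) F := lift (vecGen q) (vec_rel q d)

namespace Bplus

/-- The generators of `B_q⁺` act by upper triangular matrices. Diagonal coefficients are then
characters and those just above the diagonal are skew derivations: functionals that exist before any
basis of `B_q⁺` is known. -/
theorem vec_triangular (x : Bplus q d) :
    vec q d x 1 0 = 0 ∧ vec q d x 2 0 = 0 ∧ vec q d x 2 1 = 0 := by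
  refine mem_of_gen (p := fun x : Bplus q d => vec q d x 1 0 = 0 ∧ vec q d x 2 0 = 0 ∧
    vec q d x 2 1 = 0) (fun c => ?_) (fun x y hx hy => ?_) (fun x y hx hy => ?_) ?_ ?_ ?_ ?_ x
  · simp [Matrix.algebraMap_matrix_apply]
  · simp [hx, hy]
  · simp [Matrix.mul_apply, Fin.sum_univ_three, hx, hy]
  all_goals simp [bk1, bk2, be1, be2, vec, vecGen]

/-- The matrix coefficients of the vector representation, as functionals on `B_q⁺`. -/
def coeff (i j : Fin 3) : Dual F (Bplus q d) where
  toFun x := vec q d x i j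
  map_add' x y := by simp
  map_smul' c x := by simp

theorem coeff_gen (i j : Fin 3) (x : Gen) (hx : gen q d x ∈ Bplus q d) :
    coeff q d i j ⟨gen q d x, hx⟩ = vecGen q x i j := by
  change lift (vecGen q) _ (gen q d x) i j = _
  rw [lift_gen]

theorem coeff_one (i j : Fin 3) : coeff q d i j 1 = (1 : Matrix (Fin 3) (Fin 3) F) i j := by
  change vec q d 1 i j = _
  rw [map_one]

theorem coeff_mul (i j : Fin 3) (x y : Bplus q d) : coeff q d i j (x * y) =
    coeff q d i 0 x * coeff q d 0 j y + coeff q d i 1 x * coeff q d 1 j y +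
      coeff q d i 2 x * coeff q d 2 j y := by
  change vec q d (x * y : Ubar q d) i j = _
  rw [map_mul, Matrix.mul_apply, Fin.sum_univ_three]; rfl

theorem coeff_lower (x : Bplus q d) : coeff q d 1 0 x = 0 ∧ coeff q d 2 0 x = 0 ∧
    coeff q d 2 1 x = 0 := vec_triangular q d x

theorem isChar_coeff (i : Fin 3) : IsChar (coeff q d i i) (vecGen q .k1 i i) (vecGen q .k2 i i) where
  one := by simp [coeff_one]
  mul x y := by
    rw [coeff_mul]
    have h1 := coeff_lower q d x
    have h2 := coeff_lower q d y
    fin_cases i <;> simp [h1, h2]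
  bk1 := coeff_gen q d i i .k1 _
  bk2 := coeff_gen q d i i .k2 _
  be1 := (coeff_gen q d i i .e1 _).trans (by fin_cases i <;> simp [vecGen])
  be2 := (coeff_gen q d i i .e2 _).trans (by fin_cases i <;> simp [vecGen])

theorem isHomog_of_skew {i : ZMod 2} {κ l g : Dual F (Bplus q d)} {s t s' t' : F}
    (hκ : IsChar κ s t) (hl : IsChar l s' t') (h : ∀ x y, g (x * y) = κ x * g y + g x * l y)
    (one : g 1 = 0) (h1 : g (bk1 q d) = 0) (h2 : g (bk2 q d) = 0)
    (h3 : g (be1 q d) = sg F i * g (be1 q d)) (h4 : -g (be2 q d) = sg F i * g (be2 q d)) :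
    IsHomog (hopf q d).dualPar i g := by
  have hP : ∀ {κ : Dual F (Bplus q d)} {s t : F}, IsChar κ s t → ∀ x, κ (PB q d x) = κ x :=
    fun h x => LinearMap.congr_fun (isHomog_zero_iff.1 h.par) x
  refine LinearMap.ext (mem_of_gen (p := fun x => g (PB q d x) = sg F i * g x) (fun c => ?_)
    (fun x y hx hy => ?_) (fun x y hx hy => ?_) ?_ ?_ ?_ ?_)
  · rw [Algebra.algebraMap_eq_smul_one, map_smul, map_smul, map_smul, PB_one, one]; simp
  · rw [map_add, map_add, map_add, hx, hy, mul_add]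
  · rw [PB_mul, h, h, hP hκ, hP hl, hx, hy]; ring
  · rw [PB_bk1, h1, mul_zero]
  · rw [PB_bk2, h2, mul_zero]
  · rw [PB_be1, ← h3]
  · rw [PB_be2, map_neg, h4]

theorem isSkew_coeff01 : IsSkew 0 (coeff q d 0 0) (coeff q d 1 1) (coeff q d 0 1) 1 0 := by
  have hm : ∀ x y, coeff q d 0 1 (x * y) =
      coeff q d 0 0 x * coeff q d 0 1 y + coeff q d 0 1 x * coeff q d 1 1 y := fun x y => by
    rw [coeff_mul, (coeff_lower q d y).2.2]; ring
  have h0 : coeff q d 0 1 1 = 0 := by simp [coeff_one]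
  have h1 : coeff q d 0 1 (bk1 q d) = 0 := (coeff_gen q d 0 1 .k1 _).trans (by simp [vecGen])
  have h2 : coeff q d 0 1 (bk2 q d) = 0 := (coeff_gen q d 0 1 .k2 _).trans (by simp [vecGen])
  have h3 : coeff q d 0 1 (be1 q d) = 1 := (coeff_gen q d 0 1 .e1 _).trans (by simp [vecGen])
  have h4 : coeff q d 0 1 (be2 q d) = 0 := (coeff_gen q d 0 1 .e2 _).trans (by simp [vecGen])
  exact ⟨hm, h0, h1, h2, h3, h4, isHomog_of_skew q d (isChar_coeff q d 0) (isChar_coeff q d 1) hm h0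
    h1 h2 (by simp) (by simp [h4])⟩

theorem isSkew_coeff12 : IsSkew 1 (coeff q d 1 1) (coeff q d 2 2) (coeff q d 1 2) 0 1 := by
  have hm : ∀ x y, coeff q d 1 2 (x * y) =
      coeff q d 1 1 x * coeff q d 1 2 y + coeff q d 1 2 x * coeff q d 2 2 y := fun x y => by
    rw [coeff_mul, (coeff_lower q d x).1]; ring
  have h0 : coeff q d 1 2 1 = 0 := by simp [coeff_one]
  have h1 : coeff q d 1 2 (bk1 q d) = 0 := (coeff_gen q d 1 2 .k1 _).trans (by simp [vecGen])
  have h2 : coeff q d 1 2 (bk2 q d) = 0 := (coeff_gen q d 1 2 .k2 _).trans (by simp [vecGen])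
  have h3 : coeff q d 1 2 (be1 q d) = 0 := (coeff_gen q d 1 2 .e1 _).trans (by simp [vecGen])
  have h4 : coeff q d 1 2 (be2 q d) = 1 := (coeff_gen q d 1 2 .e2 _).trans (by simp [vecGen])
  exact ⟨hm, h0, h1, h2, h3, h4, isHomog_of_skew q d (isChar_coeff q d 1) (isChar_coeff q d 2) hm h0
    h1 h2 (by simp [h3]) (by simp)⟩

/-- The values of the characters at `k₁` and `k₂` are `d`-th roots of unity, so inverse characters
are obtained in `X` as powers of exponent `d - 1`. -/
theorem pow_sub_one (q : F) (d : ℕ) [OddRoot q d] {s : F} (hs : s ^ d = 1) : s ^ (d - 1) = s⁻¹ := by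
  have hd := OddRoot.one_lt (q := q) (d := d)
  refine eq_inv_of_mul_eq_one_left ?_
  rw [← pow_succ, Nat.sub_add_cancel (by omega), hs]

/-- The character `k₁ ↦ q`, `k₂ ↦ 1`. -/
def chr2 : Dual F (Bplus q d) := coeff q d 0 0

/-- The character `k₁ ↦ q⁻²`, `k₂ ↦ q`. -/
def chr1 : Dual F (Bplus q d) := xmul (coeff q d 1 1) (xpow (coeff q d 0 0) (d - 1))

/-- The skew derivation `e₁ ↦ -(q - q⁻¹)⁻¹`. -/
def der1 : Dual F (Bplus q d) :=
  (-(q - q⁻¹)⁻¹ * q⁻¹) • xmul (xpow (coeff q d 1 1) (d - 1)) (coeff q d 0 1)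

/-- The skew derivation `e₂ ↦ (q - q⁻¹)⁻¹`. -/
def der2 : Dual F (Bplus q d) :=
  ((q - q⁻¹)⁻¹ * q) • xmul (xpow (coeff q d 2 2) (d - 1)) (coeff q d 1 2)

/-- The character inverse to `chr1`. -/
def chr1i : Dual F (Bplus q d) := xpow (chr1 q d) (d - 1)

/-- The character inverse to `chr2`. -/
def chr2i : Dual F (Bplus q d) := xpow (chr2 q d) (d - 1)

variable {q d}

theorem q_pow : q ^ d = 1 := (OddRoot.prim (q := q) (d := d)).pow_eq_one

theorem chr2_isChar : IsChar (chr2 q d) q 1 := by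
  have h := isChar_coeff q d 0
  simp only [vecGen] at h
  exact h

theorem chr1_isChar : IsChar (chr1 q d) (q⁻¹ * q⁻¹) q := by
  have h := (isChar_coeff q d 1).mul_char ((isChar_coeff q d 0).pow (d - 1))
  have e : q ^ (d - 1) = q⁻¹ := pow_sub_one q d q_pow
  simp only [vecGen] at h
  simpa [e] using (show IsChar (chr1 q d) _ _ from h)

theorem chr2i_isChar : IsChar (chr2i q d) q⁻¹ 1 := by
  have h := (chr2_isChar (q := q) (d := d)).pow (d - 1)
  rw [pow_sub_one q d q_pow, one_pow] at h
  exact h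

theorem chr1i_isChar : IsChar (chr1i q d) (q * q) q⁻¹ := by
  have h := (chr1_isChar (q := q) (d := d)).pow (d - 1)
  have e : (q⁻¹ * q⁻¹) ^ d = 1 := by rw [mul_pow, inv_pow, q_pow]; simp
  rw [pow_sub_one q d e, pow_sub_one q d q_pow] at h
  simpa using (show IsChar (chr1i q d) _ _ from h)

/-- Multiplying the coefficient at `(0, 1)` by the inverse of the diagonal character at `(1, 1)`
makes the second twist trivial and the first equal to `chr1i`. The value at `e₁` gets a factor `q`,
which the scalar `q⁻¹` compensates. -/
theorem der1_isSkew : IsSkew 0 (chr1i q d) (εB q d) (der1 q d) (-(q - q⁻¹)⁻¹) 0 := by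
  have hq := q_ne_zero q d
  have e : q ^ (d - 1) = q⁻¹ := pow_sub_one q d q_pow
  have h1 : IsChar (xpow (coeff q d 1 1) (d - 1)) q q⁻¹ := by
    simpa [vecGen, e] using (isChar_coeff q d 1).pow (d - 1)
  have h := ((isSkew_coeff01 q d).char_mul h1).smul (-(q - q⁻¹)⁻¹ * q⁻¹)
  have e1 : xmul (xpow (coeff q d 1 1) (d - 1)) (coeff q d 0 0) = chr1i q d :=
    IsChar.ext (s := q * q) (t := q⁻¹) (by simpa [vecGen] using h1.mul_char (isChar_coeff q d 0))
      chr1i_isChar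
  have e2 : xmul (xpow (coeff q d 1 1) (d - 1)) (coeff q d 1 1) = εB q d :=
    IsChar.ext (s := 1) (t := 1) (by simpa [vecGen, hq] using h1.mul_char (isChar_coeff q d 1))
      isChar_ε
  rw [e1, e2] at h
  have h3 : -(q - q⁻¹)⁻¹ * q⁻¹ * (q * 1) = -(q - q⁻¹)⁻¹ := by field_simp
  rw [h3, mul_zero, mul_zero] at h
  exact h

/-- The same normalisation with the coefficient at `(1, 2)` and the character at `(2, 2)`. Here the
value at `e₂` gets a factor `q⁻¹`, whence the scalar `q`. -/
theorem der2_isSkew : IsSkew 1 (chr2i q d) (εB q d) (der2 q d) 0 ((q - q⁻¹)⁻¹) := by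
  have hq := q_ne_zero q d
  have e : q ^ (d - 1) = q⁻¹ := pow_sub_one q d q_pow
  have h1 : IsChar (xpow (coeff q d 2 2) (d - 1)) 1 q⁻¹ := by
    simpa [vecGen, e] using (isChar_coeff q d 2).pow (d - 1)
  have h := ((isSkew_coeff12 q d).char_mul h1).smul ((q - q⁻¹)⁻¹ * q)
  have e1 : xmul (xpow (coeff q d 2 2) (d - 1)) (coeff q d 1 1) = chr2i q d :=
    IsChar.ext (s := q⁻¹) (t := 1)
      (by simpa [vecGen, hq] using h1.mul_char (isChar_coeff q d 1)) chr2i_isChar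
  have e2 : xmul (xpow (coeff q d 2 2) (d - 1)) (coeff q d 2 2) = εB q d :=
    IsChar.ext (s := 1) (t := 1) (by simpa [vecGen, hq] using h1.mul_char (isChar_coeff q d 2))
      isChar_ε
  rw [e1, e2] at h
  have h3 : (q - q⁻¹)⁻¹ * q * (q⁻¹ * 1) = (q - q⁻¹)⁻¹ := by field_simp
  rw [h3, mul_zero, mul_zero] at h
  exact h

end Bplus

end Ubar

end QDouble

end

/-! ### Lowering operators and independence of the monomials of `B_q⁺` -/

noncomputable section

set_option linter.unusedSectionVars false

namespace QDouble

open TensorProduct Module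

variable {F : Type*} [Field F]

namespace Ubar.Bplus

variable {q : F} {d : ℕ} [CharZero F] [OddRoot q d]

theorem pd_one_char {κ : Dual F (Bplus q d)} {s t : F} (h : IsChar κ s t) : pd κ 1 = 1 := by
  rw [pd_one, h.one, one_smul]

theorem pd_bk1_char {κ : Dual F (Bplus q d)} {s t : F} (h : IsChar κ s t) :
    pd κ (bk1 q d) = s • bk1 q d := by rw [pd_bk1, h.bk1]

theorem pd_bk2_char {κ : Dual F (Bplus q d)} {s t : F} (h : IsChar κ s t) :
    pd κ (bk2 q d) = t • bk2 q d := by rw [pd_bk2, h.bk2]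

theorem pd_be1_char {κ : Dual F (Bplus q d)} {s t : F} (h : IsChar κ s t) :
    pd κ (be1 q d) = s • be1 q d := by rw [pd_be1, h.be1, h.bk1, zero_smul, zero_add]

theorem pd_be2_char {κ : Dual F (Bplus q d)} {s t : F} (h : IsChar κ s t) :
    pd κ (be2 q d) = t • be2 q d := by rw [pd_be2, h.be2, h.bk2, zero_smul, zero_add]

theorem pd_be3_char {κ : Dual F (Bplus q d)} {s t : F} (h : IsChar κ s t) :
    pd κ (be3 q d) = (s * t) • be3 q d := by
  rw [be3, map_sub, map_smul, h.pd_mul, h.pd_mul, pd_be1_char h, pd_be2_char h]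
  simp only [smul_mul_smul_comm, smul_sub, smul_smul]
  congr 2; ring

theorem pd_pow_char {κ : Dual F (Bplus q d)} {s t : F} (h : IsChar κ s t) (x : Bplus q d) (n : ℕ) :
    pd κ (x ^ n) = pd κ x ^ n := by
  induction n with
  | zero => rw [pow_zero, pow_zero, pd_one_char h]
  | succ n ih => rw [pow_succ, h.pd_mul, ih, pow_succ]

/-- The linear combinations of the monomials `k₁ⁱ k₂ʲ`. -/
def torus (q : F) (d : ℕ) [OddRoot q d] (a : Fin d → Fin d → F) : Bplus q d :=
  ∑ i, ∑ j, a i j • (bk1 q d ^ (i : ℕ) * bk2 q d ^ (j : ℕ))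

theorem torus_mem {p : Submodule F (Bplus q d)} (h : ∀ i j : ℕ, bk1 q d ^ i * bk2 q d ^ j ∈ p)
    (a : Fin d → Fin d → F) : torus q d a ∈ p :=
  sum_mem fun i _ => sum_mem fun j _ => p.smul_mem _ (h i j)

theorem pd_torus {κ : Dual F (Bplus q d)} {s t : F} (h : IsChar κ s t) (a : Fin d → Fin d → F) :
    pd κ (torus q d a) = torus q d fun i j => s ^ (i : ℕ) * t ^ (j : ℕ) * a i j := by
  simp only [torus, map_sum, map_smul, h.pd_mul, pd_pow_char h, pd_bk1_char h, pd_bk2_char h,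
    smul_pow, smul_mul_smul_comm, smul_smul]
  refine Finset.sum_congr rfl fun i _ => Finset.sum_congr rfl fun j _ => ?_
  congr 1; ring

theorem torus_smul (c : F) (a : Fin d → Fin d → F) :
    c • torus q d a = torus q d fun i j => c * a i j := by
  simp only [torus, Finset.smul_sum, smul_smul]

theorem IsSkew.pd_pow_zero {i : ZMod 2} {κ g : Dual F (Bplus q d)} {a b s t : F}
    (h : IsSkew i κ (εB q d) g a b) (hκ : IsChar κ s t) {x : Bplus q d} (hx : pd g x = 0) (n : ℕ) :
    pd g (x ^ n) = 0 := by
  induction n with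
  | zero => rw [pow_zero, pd_one, h.one, zero_smul]
  | succ n ih => rw [pow_succ, h.pd_mul hκ isChar_ε, hx, ih, mul_zero, zero_mul, add_zero]

/-- The operator kills `k₁` and `k₂`, so by the twisted Leibniz rule a torus factor is merely
rescaled by `κ`. -/
theorem IsSkew.pd_torus_mul {i : ZMod 2} {κ g : Dual F (Bplus q d)} {a b s t : F}
    (h : IsSkew i κ (εB q d) g a b) (hκ : IsChar κ s t) (u : Fin d → Fin d → F) (y : Bplus q d) :
    pd g (torus q d u * y) = pd κ (torus q d u) * pd g y := by
  have : pd g (torus q d u) = 0 := torus_mem (p := LinearMap.ker (pd g)) (fun i j => by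
    rw [LinearMap.mem_ker, h.pd_mul hκ isChar_ε,
      h.pd_pow_zero hκ (by rw [pd_bk2, h.bk2, zero_smul]),
      h.pd_pow_zero hκ (by rw [pd_bk1, h.bk1, zero_smul]), mul_zero, zero_mul, add_zero]) u
  rw [h.pd_mul hκ isChar_ε, this, zero_mul, add_zero]

variable (q d) in
/-- The operator of `der1`. -/
abbrev D1 : Module.End F (Bplus q d) := pd (der1 q d)

variable (q d) in
/-- The operator of `der2`. -/
abbrev D2 : Module.End F (Bplus q d) := pd (der2 q d)

theorem parPow_zero (x : Bplus q d) : parPow (PB q d) 0 x = x :=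
  homog_induction PB_PB (fun x y hx hy => by rw [map_add, hx, hy])
    (fun i x hx => by rw [parPow_homog hx]; simp) x

theorem parPow_one (x : Bplus q d) : parPow (PB q d) 1 x = PB q d x :=
  homog_induction PB_PB (fun x y hx hy => by rw [map_add, hx, hy, map_add])
    (fun i x hx => by rw [parPow_homog hx, one_mul]; exact hx.symm) x

theorem D1_mul (x y : Bplus q d) : D1 q d (x * y) = pd (chr1i q d) x * D1 q d y + D1 q d x * y := by
  rw [der1_isSkew.pd_mul chr1i_isChar isChar_ε, parPow_zero, pd_ε]; rfl

theorem D2_mul (x y : Bplus q d) :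
    D2 q d (x * y) = pd (chr2i q d) x * D2 q d y + D2 q d x * PB q d y := by
  rw [der2_isSkew.pd_mul chr2i_isChar isChar_ε, parPow_one, pd_ε]; rfl

theorem D1_one : D1 q d 1 = 0 := by rw [pd_one, der1_isSkew.one, zero_smul]
theorem D2_one : D2 q d 1 = 0 := by rw [pd_one, der2_isSkew.one, zero_smul]

theorem D1_be1 : D1 q d (be1 q d) = (-(q - q⁻¹)⁻¹) • 1 := by
  rw [pd_be1, der1_isSkew.be1, der1_isSkew.bk1, zero_smul, add_zero]

theorem D1_be2 : D1 q d (be2 q d) = 0 := by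
  rw [pd_be2, der1_isSkew.be2, der1_isSkew.bk2, zero_smul, zero_smul, add_zero]

theorem D2_be1 : D2 q d (be1 q d) = 0 := by
  rw [pd_be1, der2_isSkew.be1, der2_isSkew.bk1, zero_smul, zero_smul, add_zero]

theorem D2_be2 : D2 q d (be2 q d) = (q - q⁻¹)⁻¹ • 1 := by
  rw [pd_be2, der2_isSkew.be2, der2_isSkew.bk2, zero_smul, add_zero]

theorem be2_be2 : be2 q d * be2 q d = 0 := Subtype.ext e2_e2

theorem D1_be3 : D1 q d (be3 q d) = (-q⁻¹) • be2 q d := by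
  have hs := q_sub_ne q d
  have hq := q_ne_zero q d
  rw [be3, map_sub, map_smul, D1_mul, D1_mul, D1_be1, D1_be2, pd_be2_char chr1i_isChar]
  simp only [mul_zero, zero_add, zero_mul, add_zero, smul_mul_assoc, one_mul, mul_smul_comm,
    mul_one, smul_smul, ← sub_smul]
  congr 1
  have : (q - q⁻¹) * (q - q⁻¹)⁻¹ = 1 := mul_inv_cancel₀ hs
  linear_combination (-q⁻¹) * this + (q - q⁻¹)⁻¹ * (mul_inv_cancel₀ hq)

/-- The coefficient `q⁻¹` in the definition of `e₃` is exactly what makes the contributions of `e₁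
e₂` and `e₂ e₁` cancel. -/
theorem D2_be3 : D2 q d (be3 q d) = 0 := by
  rw [be3, map_sub, map_smul, D2_mul, D2_mul, D2_be1, D2_be2, pd_be1_char chr2i_isChar, PB_be1]
  simp only [mul_zero, zero_add, zero_mul, add_zero, smul_mul_assoc, one_mul, mul_smul_comm,
    mul_one, smul_smul, ← sub_smul]
  rw [mul_comm, sub_self, zero_smul]

theorem D1_be3_be2 : D1 q d (be3 q d * be2 q d) = 0 := by
  rw [D1_mul, D1_be2, D1_be3, smul_mul_assoc, be2_be2, mul_zero, smul_zero, add_zero]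

theorem D2_be3_be2 : D2 q d (be3 q d * be2 q d) = (q⁻¹ * (q - q⁻¹)⁻¹) • be3 q d := by
  rw [D2_mul, D2_be2, D2_be3, pd_be3_char chr2i_isChar]
  simp [smul_smul, mul_comm]

/-- The numbers `1 + q² + ⋯ + q²⁽ʳ⁻¹⁾`. -/
def qnum (q : F) : ℕ → F
  | 0 => 0
  | r + 1 => 1 + q * q * qnum q r

theorem qnum_mul (r : ℕ) : (q ^ 2 - 1) * qnum q r = (q ^ 2) ^ r - 1 := by
  induction r with
  | zero => simp [qnum]
  | succ r ih => rw [qnum]; linear_combination q ^ 2 * ih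

/-- As `d` is odd, `q²` is again a primitive `d`-th root of unity, so `q²ʳ - 1`, which is `q² - 1`
times this sum, does not vanish for `0 < r < d`. -/
theorem qnum_ne_zero (q : F) (d : ℕ) [OddRoot q d] {r : ℕ} (h0 : 0 < r) (hr : r < d) :
    qnum q r ≠ 0 := by
  have hp : IsPrimitiveRoot (q ^ 2) d :=
    (OddRoot.prim (q := q) (d := d)).pow_of_coprime 2 (OddRoot.odd (q := q) (d := d)).coprime_two_left
  intro h
  have := qnum_mul (q := q) r
  rw [h, mul_zero] at this
  exact hp.pow_ne_one_of_pos_of_lt h0.ne' hr (sub_eq_zero.1 this.symm)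

theorem D1_be1_pow_mul (r : ℕ) (y : Bplus q d) : D1 q d (be1 q d ^ r * y) =
    (q * q) ^ r • (be1 q d ^ r * D1 q d y) +
      (-(q - q⁻¹)⁻¹ * qnum q r) • (be1 q d ^ (r - 1) * y) := by
  induction r with
  | zero => simp [qnum]
  | succ r ih =>
    rw [pow_succ', mul_assoc, D1_mul, ih, D1_be1, pd_be1_char chr1i_isChar, qnum]
    rcases r with _ | r
    · simp [qnum]
    · simp only [mul_add, smul_mul_assoc, mul_smul_comm, one_mul, Nat.add_sub_cancel,
        ← mul_assoc, ← pow_succ']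
      simp only [pow_succ', mul_assoc]
      module

theorem D2_be1_pow_mul (r : ℕ) (y : Bplus q d) : D2 q d (be1 q d ^ r * y) =
    q⁻¹ ^ r • (be1 q d ^ r * D2 q d y) := by
  induction r with
  | zero => simp
  | succ r ih =>
    rw [pow_succ', mul_assoc, D2_mul, ih, D2_be1, pd_be1_char chr2i_isChar]
    simp only [smul_mul_assoc, mul_smul_comm, zero_mul, add_zero, pow_succ', mul_assoc]
    module

theorem D1_be1_pow (r : ℕ) : D1 q d (be1 q d ^ r) =
    (-(q - q⁻¹)⁻¹ * qnum q r) • be1 q d ^ (r - 1) := by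
  simpa [D1_one] using D1_be1_pow_mul r (1 : Bplus q d)

theorem D2_be1_pow (r : ℕ) : D2 q d (be1 q d ^ r) = 0 := by
  simpa [D2_one] using D2_be1_pow_mul r (1 : Bplus q d)

/-! ### Subspaces stable under the operators of `X` -/

section Reduction

variable {N : Submodule F (Bplus q d)} (h1 : ∀ x ∈ N, pd (chr1 q d) x ∈ N)
  (h2 : ∀ x ∈ N, pd (chr2 q d) x ∈ N) (h3 : ∀ x ∈ N, D1 q d x ∈ N) (h4 : ∀ x ∈ N, D2 q d x ∈ N)
  (h5 : ∀ x ∈ N, εB q d x = 0)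

include h1 h2 h5 in
-- The operators of characters are diagonal on the `k₁ⁱ k₂ʲ`; applying their powers and then `ε`
-- yields two nested Vandermonde systems in the distinct numbers `qⁱ`. The subspace `N` is general
-- because two cases are needed: zero, for independence in `B_q⁺`, and the annihilator of the
-- `α`-monomials, for generation of `X`.
theorem torus_eq_zero {a : Fin d → Fin d → F} (ha : torus q d a ∈ N) : a = 0 := by
  have hq := q_ne_zero q d
  have hinj : Function.Injective fun i : Fin d => q ^ (i : ℕ) := fun i j h =>
    Fin.ext ((OddRoot.prim (q := q) (d := d)).pow_inj i.2 j.2 h)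
  have m1 : ∀ (n : ℕ) (x : Bplus q d), x ∈ N → (pd (chr1 q d) ^ n) x ∈ N := fun n => by
    induction n with
    | zero => intro x hx; exact hx
    | succ n ih => intro x hx; rw [pow_succ]; exact ih _ (h1 _ hx)
  have m2 : ∀ (n : ℕ) (x : Bplus q d), x ∈ N → (pd (chr2 q d) ^ n) x ∈ N := fun n => by
    induction n with
    | zero => intro x hx; exact hx
    | succ n ih => intro x hx; rw [pow_succ]; exact ih _ (h2 _ hx)
  have e : ∀ m n : ℕ, ∑ i : Fin d, (∑ j : Fin d, (q⁻¹ * q⁻¹) ^ (i * m : ℕ) * q ^ (j * m : ℕ) *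
      a i j) * (q ^ (i : ℕ)) ^ n = 0 := fun m n => by
    have := h5 _ (m1 m _ (m2 n _ ha))
    rw [← pd_xpow, ← pd_xpow, pd_torus (chr2_isChar.pow n), pd_torus (chr1_isChar.pow m), torus,
      map_sum] at this
    simp only [map_sum, map_smul, (isChar_ε (q := q) (d := d)).mul] at this
    have ep : ∀ (x : Bplus q d) (hx : εB q d x = 1) (n : ℕ), εB q d (x ^ n) = 1 := fun x hx n => by
      induction n with
      | zero => rw [pow_zero]; exact isChar_ε.one
      | succ n ih => rw [pow_succ, isChar_ε.mul, ih, hx, one_mul]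
    rw [← this]
    refine Finset.sum_congr rfl fun i _ => ?_
    rw [Finset.sum_mul]
    refine Finset.sum_congr rfl fun j _ => ?_
    rw [ep _ isChar_ε.bk1, ep _ isChar_ε.bk2, one_pow]
    simp only [smul_eq_mul, pow_mul, mul_pow, one_pow]
    rw [← pow_mul, ← pow_mul, ← pow_mul, ← pow_mul, mul_comm (i : ℕ) n, mul_comm (i : ℕ) m,
      mul_comm (j : ℕ) m]
    ring
  -- For fixed `m` the powers of `chr2` separate the indices `i`. For fixed `i` the nonzero factor
  -- `(q⁻²)^{im}` is then cancelled, and the powers of `chr1` separate the `j`.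
  have e' : ∀ (m : ℕ) (i : Fin d), ∑ j : Fin d, (q⁻¹ * q⁻¹) ^ (i * m : ℕ) * q ^ (j * m : ℕ) *
      a i j = 0 := fun m i => congrFun (Matrix.eq_zero_of_forall_pow_sum_mul_pow_eq_zero hinj
        fun n => e m n) i
  funext i
  refine Matrix.eq_zero_of_forall_pow_sum_mul_pow_eq_zero hinj fun m => ?_
  have := e' m i
  simp only [mul_assoc] at this
  rw [← Finset.mul_sum] at this
  rw [← (mul_eq_zero.1 this).resolve_left (pow_ne_zero _ (mul_ne_zero (inv_ne_zero hq)
    (inv_ne_zero hq)))]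
  exact Finset.sum_congr rfl fun j _ => by rw [pow_mul, mul_comm]

include h1 h2 h5 in
-- `D1` lowers the exponent of `e₁` by one, with a coefficient containing `qnum q (r + 1)`, which is
-- nonzero as exponents stay below `d`. By induction all terms but the one of exponent 0 vanish, and
-- that one is a torus element.
theorem torus_family_eq_zero {n : ℕ} (hn : n ≤ d) (h3 : ∀ x ∈ N, D1 q d x ∈ N)
    {a : Fin n → Fin d → Fin d → F}
    (ha : ∑ r : Fin n, torus q d (a r) * be1 q d ^ (r : ℕ) ∈ N) : a = 0 := by
  have hq := q_ne_zero q d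
  have hs := q_sub_ne q d
  induction n with
  | zero => funext r; exact r.elim0
  | succ n ih =>
    have key : ∑ r : Fin n, torus q d (fun i j => (-(q - q⁻¹)⁻¹ * qnum q (r + 1)) *
        ((q * q) ^ (i : ℕ) * q⁻¹ ^ (j : ℕ) * a r.succ i j)) * be1 q d ^ (r : ℕ) ∈ N := by
      have := h3 _ ha
      rw [Fin.sum_univ_succ, map_add, map_sum, der1_isSkew.pd_torus_mul chr1i_isChar, Fin.val_zero,
        pow_zero, D1_one, mul_zero, zero_add] at this
      convert this using 2 with r
      rw [der1_isSkew.pd_torus_mul chr1i_isChar, Fin.val_succ, D1_be1_pow, mul_smul_comm,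
        pd_torus chr1i_isChar, ← smul_mul_assoc, torus_smul]
      rfl
    have ha' : ∀ r : Fin n, a r.succ = 0 := fun r => by
      funext i j
      have := congrFun (congrFun (congrFun (ih (by omega) key) r) i) j
      have hn' := qnum_ne_zero q d (Nat.succ_pos r) (by omega : (r : ℕ) + 1 < d)
      simpa [hq, hs, hn', sub_eq_zero] using this
    have h0 : torus q d (a 0) ∈ N := by
      rw [Fin.sum_univ_succ] at ha
      have hz : torus q d 0 = 0 := by simp [torus]
      simpa [ha', hz] using ha
    have h0' := torus_eq_zero h1 h2 h5 h0
    funext r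
    exact Fin.cases h0' ha' r

include h1 h2 h3 h4 h5 in
-- `D2 ∘ D1` kills the terms in `e₁ʳ` and turns `e₁ʳ e₃` into a nonzero multiple of `e₁ʳ`. So `b`
-- vanishes first, and then `a`.
theorem lower_eq_zero {a b : Fin d → Fin d → Fin d → F}
    (h : ∑ r : Fin d, torus q d (a r) * be1 q d ^ (r : ℕ) +
      ∑ r : Fin d, torus q d (b r) * (be1 q d ^ (r : ℕ) * be3 q d) ∈ N) : a = 0 ∧ b = 0 := by
  have hq := q_ne_zero q d
  have hs := q_sub_ne q d
  have key : ∑ r : Fin d, torus q d (fun i j =>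
      ((q * q) ^ (r : ℕ) * -q⁻¹ * (q⁻¹ ^ (r : ℕ) * (q - q⁻¹)⁻¹)) * (q⁻¹ ^ (i : ℕ) * 1 ^ (j : ℕ) *
        ((q * q) ^ (i : ℕ) * q⁻¹ ^ (j : ℕ) * b r i j))) * be1 q d ^ (r : ℕ) ∈ N := by
    have := h4 _ (h3 _ h)
    simp only [map_add, map_sum, der1_isSkew.pd_torus_mul chr1i_isChar] at this
    simp only [pd_torus chr1i_isChar, der2_isSkew.pd_torus_mul chr2i_isChar] at this
    simp only [pd_torus chr2i_isChar, D1_be1_pow, map_smul, D2_be1_pow, smul_zero, mul_zero,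
      Finset.sum_const_zero, zero_add, D1_be1_pow_mul, D1_be3, mul_smul_comm, map_add,
      D2_be1_pow_mul, D2_be3, D2_be2, add_zero, mul_one] at this
    convert this using 2 with r
    rw [← torus_smul, smul_mul_assoc]
    simp only [smul_smul, mul_assoc]
  have hb : b = 0 := by
    funext r i j
    have := congrFun (congrFun (congrFun (torus_family_eq_zero h1 h2 h5 le_rfl h3 key) r) i) j
    simpa [hq, hs, sub_eq_zero] using this
  subst hb
  have hz : torus q d 0 = 0 := by simp [torus]
  simp only [Pi.zero_apply, hz, zero_mul, Finset.sum_const_zero, add_zero] at h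
  exact ⟨torus_family_eq_zero h1 h2 h5 le_rfl h3 h, rfl⟩

include h1 h2 h3 h4 h5 in
-- `D2` kills the monomials without `e₂` and strips `e₂` from the others up to a nonzero factor,
-- which reduces to the case without `e₂`.
theorem full_eq_zero {a b a' b' : Fin d → Fin d → Fin d → F}
    (h : ∑ r : Fin d, torus q d (a r) * be1 q d ^ (r : ℕ) +
      ∑ r : Fin d, torus q d (b r) * (be1 q d ^ (r : ℕ) * be3 q d) +
      (∑ r : Fin d, torus q d (a' r) * (be1 q d ^ (r : ℕ) * be2 q d) +
      ∑ r : Fin d, torus q d (b' r) * (be1 q d ^ (r : ℕ) * (be3 q d * be2 q d))) ∈ N) :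
    (a = 0 ∧ b = 0) ∧ a' = 0 ∧ b' = 0 := by
  have hq := q_ne_zero q d
  have hs := q_sub_ne q d
  have key : ∑ r : Fin d, torus q d (fun i j => (q⁻¹ ^ (r : ℕ) * (q - q⁻¹)⁻¹) *
        (q⁻¹ ^ (i : ℕ) * 1 ^ (j : ℕ) * a' r i j)) * be1 q d ^ (r : ℕ) +
      ∑ r : Fin d, torus q d (fun i j => (q⁻¹ ^ (r : ℕ) * (q⁻¹ * (q - q⁻¹)⁻¹)) *
        (q⁻¹ ^ (i : ℕ) * 1 ^ (j : ℕ) * b' r i j)) * (be1 q d ^ (r : ℕ) * be3 q d) ∈ N := by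
    have := h4 _ h
    simp only [map_add, map_sum, der2_isSkew.pd_torus_mul chr2i_isChar] at this
    simp only [pd_torus chr2i_isChar, D2_be1_pow, smul_zero, mul_zero,
      Finset.sum_const_zero, zero_add, mul_smul_comm, D2_be3_be2,
      D2_be1_pow_mul, D2_be3, D2_be2, add_zero, mul_one] at this
    convert this using 3 with r _ r
    · rw [← torus_smul, smul_mul_assoc, smul_smul]
    · rw [← torus_smul, smul_mul_assoc, smul_smul]
  obtain ⟨k1, k2⟩ := lower_eq_zero h1 h2 h3 h4 h5 key
  have ha : a' = 0 := by
    funext r i j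
    have := congrFun (congrFun (congrFun k1 r) i) j
    simpa [hq, hs, sub_eq_zero] using this
  have hb : b' = 0 := by
    funext r i j
    have := congrFun (congrFun (congrFun k2 r) i) j
    simpa [hq, hs, sub_eq_zero] using this
  subst ha hb
  have hz : torus q d 0 = 0 := by simp [torus]
  simp only [Pi.zero_apply, hz, zero_mul, Finset.sum_const_zero, add_zero] at h
  exact ⟨lower_eq_zero h1 h2 h3 h4 h5 h, rfl, rfl⟩

include h1 h2 h3 h4 h5 in
/-- A subspace that is stable under the operators of `α_{k₁}, α_{k₂}, α_{e₁}, α_{e₂}` and on which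
the counit vanishes contains no nontrivial linear combination of the monomials. -/
theorem coeff_eq_zero_of_mem {c : PosIdx d → F}
    (h : ∑ m, c m • bword q d m.1 m.2.1 m.2.2.1 m.2.2.2.1 m.2.2.2.2 ∈ N) : c = 0 := by
  have e : ∀ hh tt : Fin 2, ∑ r : Fin d, torus q d (fun i j => c (i, j, r, hh, tt)) *
      (be1 q d ^ (r : ℕ) * (be3 q d ^ (hh : ℕ) * be2 q d ^ (tt : ℕ))) =
      ∑ i, ∑ j, ∑ r, c (i, j, r, hh, tt) • bword q d i j r hh tt := fun hh tt => by
    simp only [torus, Finset.sum_mul, smul_mul_assoc, bword, mul_assoc]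
    rw [Finset.sum_comm]
    exact Finset.sum_congr rfl fun i _ => Finset.sum_comm
  have h' := full_eq_zero (a := fun r i j => c (i, j, r, 0, 0)) (b := fun r i j => c (i, j, r, 1, 0))
    (a' := fun r i j => c (i, j, r, 0, 1)) (b' := fun r i j => c (i, j, r, 1, 1)) h1 h2 h3 h4 h5 (by
      have e00 := e 0 0
      have e10 := e 1 0
      have e01 := e 0 1
      have e11 := e 1 1
      simp only [Fin.val_zero, Fin.val_one, pow_zero, pow_one, mul_one, one_mul] at e00 e10 e01 e11
      rw [e00, e10, e01, e11]
      convert h using 1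
      simp only [Fintype.sum_prod_type, Fin.sum_univ_two, Finset.sum_add_distrib, Fin.val_zero,
        Fin.val_one])
  obtain ⟨⟨q1, q2⟩, q3, q4⟩ := h'
  funext ⟨i, j, r, hh, tt⟩
  have p1 := congrFun (congrFun (congrFun q1 r) i) j
  have p2 := congrFun (congrFun (congrFun q2 r) i) j
  have p3 := congrFun (congrFun (congrFun q3 r) i) j
  have p4 := congrFun (congrFun (congrFun q4 r) i) j
  fin_cases hh <;> fin_cases tt <;> assumption

end Reduction

variable (q d) in
/-- The basis of `B_q⁺` of the monomials `k₁ⁱ k₂ʲ e₁ʳ e₃ʰ e₂ᵗ`. -/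
def posBasis : Basis (PosIdx d) F (Bplus q d) :=
  Basis.mk (v := fun m : PosIdx d => bword q d m.1 m.2.1 m.2.2.1 m.2.2.2.1 m.2.2.2.2)
    (Fintype.linearIndependent_iff.2 fun c hc => congrFun
      (coeff_eq_zero_of_mem (N := ⊥) (q := q) (d := d) (by simp) (by simp) (by simp) (by simp)
        (by simp) (by simpa using hc))) span_bword.ge

theorem posBasis_apply (m : PosIdx d) :
    posBasis q d m = bword q d m.1 m.2.1 m.2.2.1 m.2.2.2.1 m.2.2.2.2 := by
  rw [posBasis, Basis.mk_apply]

theorem coe_posBasis (m : PosIdx d) : (posBasis q d m : Ubar q d) = posMono q d m := by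
  rw [posBasis_apply]; rfl

end Ubar.Bplus

end QDouble

end

/-! ### Normal forms under the relations of the negative Borel part -/

noncomputable section

set_option linter.unusedSectionVars false

namespace QDouble

open TensorProduct Module

variable {F : Type*} [Field F]

namespace Ubar

/-- The relations of the negative Borel subalgebra, for elements of an algebra `A`. -/
structure NegRel (q : F) (d : ℕ) {A : Type*} [Ring A] [Algebra F A] (k1 k2 f1 f2 : A) : Prop where
  k2k1 : k2 * k1 = k1 * k2
  k1f1 : k1 * f1 = (q⁻¹ * q⁻¹) • (f1 * k1)
  k1f2 : k1 * f2 = q • (f2 * k1)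
  k2f1 : k2 * f1 = q • (f1 * k2)
  k2f2 : k2 * f2 = f2 * k2
  f2f2 : f2 * f2 = 0
  serre : f1 * (f1 * f2) - (q + q⁻¹) • (f1 * (f2 * f1)) + f2 * (f1 * f1) = 0
  f1d : f1 ^ d = 0
  k1d : k1 ^ d = 1
  k2d : k2 ^ d = 1

namespace NegRel

variable {q : F} {d : ℕ} {A B : Type*} [Ring A] [Algebra F A] [Ring B] [Algebra F B]
  {k1 k2 f1 f2 : A} {l1 l2 g1 g2 : B}

/-- Relations hold componentwise in a product algebra. For pairs of an operator on `B_q⁺` and an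
element of `Ū_q` this controls the graph of `φ`. -/
theorem prod (h : NegRel q d k1 k2 f1 f2) (h' : NegRel q d l1 l2 g1 g2) :
    NegRel q d (k1, l1) (k2, l2) (f1, g1) (f2, g2) where
  k2k1 := Prod.ext h.k2k1 h'.k2k1
  k1f1 := Prod.ext h.k1f1 h'.k1f1
  k1f2 := Prod.ext h.k1f2 h'.k1f2
  k2f1 := Prod.ext h.k2f1 h'.k2f1
  k2f2 := Prod.ext h.k2f2 h'.k2f2
  f2f2 := Prod.ext h.f2f2 h'.f2f2
  serre := Prod.ext h.serre h'.serre
  f1d := Prod.ext h.f1d h'.f1d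
  k1d := Prod.ext h.k1d h'.k1d
  k2d := Prod.ext h.k2d h'.k2d

variable (q f1 f2) in
/-- `f₃ = f₂ f₁ - q f₁ f₂` -/
def f3 : A := f2 * f1 - q • (f1 * f2)

variable (q k1 k2 f1 f2) in
/-- The monomial `f₁ʷ f₃ˢ f₂ˡ k₁ⁱ k₂ʲ`. -/
def word (w s l i j : ℕ) : A := f1 ^ w * f3 q f1 f2 ^ s * f2 ^ l * k1 ^ i * k2 ^ j

variable (q d k1 k2 f1 f2) in
/-- The linear span of the monomials. -/
def wordSpan : Submodule F A := Submodule.span F (Set.range fun n : Bplus.NegIdx d =>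
  word q k1 k2 f1 f2 n.1 n.2.1 n.2.2.1 n.2.2.2.1 n.2.2.2.2)

variable [OddRoot q d] (H : NegRel q d k1 k2 f1 f2)
include H

theorem serre' : f2 * (f1 * f1) = (q + q⁻¹) • (f1 * (f2 * f1)) - f1 * (f1 * f2) := by
  have := H.serre
  rw [sub_add_eq_add_sub, sub_eq_zero] at this
  rw [← this]; abel

theorem f2f2_assoc (x : A) : f2 * (f2 * x) = 0 := by rw [← mul_assoc, H.f2f2, zero_mul]

theorem f3_f1 : f3 q f1 f2 * f1 = q⁻¹ • (f1 * f3 q f1 f2) := by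
  have hq := q_ne_zero q d
  simp only [f3, sub_mul, mul_sub, smul_mul_assoc, mul_assoc, mul_smul_comm, H.serre']
  match_scalars <;> field_simp <;> ring

theorem f2_f3 : f2 * f3 q f1 f2 = (-q) • (f3 q f1 f2 * f2) := by
  simp only [f3, sub_mul, mul_sub, smul_mul_assoc, mul_assoc, mul_smul_comm, H.f2f2,
    H.f2f2_assoc, mul_zero, smul_zero, sub_zero, zero_sub, neg_smul]

/-- Multiply the Serre relation by `f₂` on either side and use `f₂² = 0`: dividing by `q + q⁻¹`,
which is nonzero for odd `d > 1`, gives `f₁f₂f₁f₂ = f₂f₁f₂f₁`. The surviving coefficients in `f₃²`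
then add up to `1 + q² - q(q + q⁻¹) = 0`. -/
theorem f3_f3 [CharZero F] : f3 q f1 f2 * f3 q f1 f2 = 0 := by
  have hq := q_ne_zero q d
  have hs := q_add_ne q d
  have h1 := congrArg (fun y => f2 * y) H.serre'
  have h2 := congrArg (fun y => y * f2) H.serre'
  simp only [mul_sub, sub_mul, mul_smul_comm, smul_mul_assoc, mul_assoc, H.f2f2, H.f2f2_assoc,
    mul_zero, sub_zero] at h1 h2
  have h3 : f1 * (f2 * (f1 * f2)) = f2 * (f1 * (f2 * f1)) := by
    refine smul_right_injective A hs ?_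
    change (q + q⁻¹) • (f1 * (f2 * (f1 * f2))) = (q + q⁻¹) • (f2 * (f1 * (f2 * f1)))
    rw [← h2]
    exact (sub_eq_zero.1 h1.symm).symm
  simp only [f3, sub_mul, mul_sub, smul_mul_assoc, mul_assoc, mul_smul_comm, H.f2f2_assoc, h2, h3,
    mul_zero]
  match_scalars
  field_simp
  ring

theorem k1_f3 : k1 * f3 q f1 f2 = q⁻¹ • (f3 q f1 f2 * k1) := by
  have hq := q_ne_zero q d
  have a1 := push H.k1f1
  have a2 := push H.k1f2
  simp only [f3, sub_mul, mul_sub, smul_mul_assoc, mul_assoc, mul_smul_comm, a1, a2, H.k1f1, H.k1f2]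
  match_scalars <;> field_simp

theorem k2_f3 : k2 * f3 q f1 f2 = q • (f3 q f1 f2 * k2) := by
  have a1 := push H.k2f1
  have a2 : ∀ x, k2 * (f2 * x) = f2 * (k2 * x) := fun x => by
    rw [← mul_assoc, H.k2f2, mul_assoc]
  simp only [f3, sub_mul, mul_sub, smul_mul_assoc, mul_assoc, mul_smul_comm, a1, a2, H.k2f1, H.k2f2]
  module

/-- Each passage of `f₂` over `f₁` creates one `f₃`, which can be moved to the right up to a scalar.
Only membership in a span matters, so the scalars stay existential. -/
theorem f2_f1_pow (r : ℕ) : ∃ s s' : F, ∀ x, f2 * (f1 ^ r * x) =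
    s • (f1 ^ r * (f2 * x)) + s' • (f1 ^ (r - 1) * (f3 q f1 f2 * x)) := by
  have step : ∀ x, f2 * (f1 * x) = q • (f1 * (f2 * x)) + (1 : F) • (f3 q f1 f2 * x) := fun x => by
    simp [f3, sub_mul, mul_assoc]
  rcases r with _ | r
  · exact ⟨1, 0, fun x => by simp⟩
  induction r with
  | zero => exact ⟨q, 1, fun x => by simpa using step x⟩
  | succ r ih =>
    obtain ⟨s, s', h⟩ := ih
    obtain ⟨u, hu⟩ := pass_pow H.f3_f1 (r + 1)
    refine ⟨q * s, q * s' + u, fun x => ?_⟩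
    rw [pow_succ' _ (r + 1), mul_assoc, step, h, hu]
    simp only [Nat.add_sub_cancel, mul_add, mul_smul_comm, pow_succ', mul_assoc]
    module

variable [CharZero F]

/-- Exponents out of range do no harm: those of `f₁`, `f₃`, `f₂` give zero by nilpotency, and those
of `k₁`, `k₂` are reduced modulo `d`. -/
theorem word_mem (w s l i j : ℕ) : word q k1 k2 f1 f2 w s l i j ∈ wordSpan q d k1 k2 f1 f2 := by
  have hd : 0 < d := by have := OddRoot.one_lt (q := q) (d := d); omega
  by_cases hw : w < d
  swap
  · have : f1 ^ w = 0 := by rw [← Nat.sub_add_cancel (not_lt.1 hw), pow_add, H.f1d, mul_zero]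
    simp [word, this]
  by_cases hs : s < 2
  swap
  · have : f3 q f1 f2 ^ s = 0 := by
      rw [← Nat.sub_add_cancel (not_lt.1 hs), pow_add, sq, H.f3_f3, mul_zero]
    simp [word, this]
  by_cases hl : l < 2
  swap
  · have : f2 ^ l = 0 := by
      rw [← Nat.sub_add_cancel (not_lt.1 hl), pow_add, sq, H.f2f2, mul_zero]
    simp [word, this]
  have hi : k1 ^ i = k1 ^ (i % d) := by
    rw [pow_eq_pow_mod i H.k1d]
  have hj : k2 ^ j = k2 ^ (j % d) := by
    rw [pow_eq_pow_mod j H.k2d]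
  rw [word, hi, hj]
  exact Submodule.subset_span ⟨(⟨w, hw⟩, ⟨s, hs⟩, ⟨l, hl⟩, ⟨i % d, Nat.mod_lt _ hd⟩,
    ⟨j % d, Nat.mod_lt _ hd⟩), rfl⟩

omit H in
theorem wordSpan_induction {p : A → Prop} (hp : ∀ w s l i j : ℕ, p (word q k1 k2 f1 f2 w s l i j))
    (zero : p 0) (add : ∀ x y, p x → p y → p (x + y)) (smul : ∀ (c : F) x, p x → p (c • x)) :
    ∀ x ∈ wordSpan q d k1 k2 f1 f2, p x := by
  intro x hx
  induction hx using Submodule.span_induction with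
  | mem x hx => obtain ⟨n, rfl⟩ := hx; exact hp _ _ _ _ _
  | zero => exact zero
  | add x y _ _ hx hy => exact add _ _ hx hy
  | smul c x _ hx => exact smul _ _ hx

omit H in
theorem mul_mem_of_word {a : A}
    (h : ∀ w s l i j : ℕ, a * word q k1 k2 f1 f2 w s l i j ∈ wordSpan q d k1 k2 f1 f2) :
    ∀ x ∈ wordSpan q d k1 k2 f1 f2, a * x ∈ wordSpan q d k1 k2 f1 f2 :=
  wordSpan_induction h (by simp) (fun x y hx hy => by rw [mul_add]; exact add_mem hx hy)
    (fun c x hx => by rw [mul_smul_comm]; exact Submodule.smul_mem _ _ hx)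

theorem f1_mul_mem : ∀ x ∈ wordSpan q d k1 k2 f1 f2, f1 * x ∈ wordSpan q d k1 k2 f1 f2 :=
  mul_mem_of_word fun w s l i j => by
    simpa only [word, pow_succ', mul_assoc] using H.word_mem (w + 1) s l i j

theorem f3_mul_mem : ∀ x ∈ wordSpan q d k1 k2 f1 f2,
    f3 q f1 f2 * x ∈ wordSpan q d k1 k2 f1 f2 :=
  mul_mem_of_word fun w s l i j => by
    have := H.word_mem w (s + 1) l i j
    obtain ⟨u, hu⟩ := pass_pow H.f3_f1 w
    simp only [word, pow_succ', mul_assoc] at this ⊢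
    rw [hu]
    exact Submodule.smul_mem _ _ this

theorem f2_mul_mem : ∀ x ∈ wordSpan q d k1 k2 f1 f2, f2 * x ∈ wordSpan q d k1 k2 f1 f2 :=
  mul_mem_of_word fun w s l i j => by
    have m1 := H.word_mem w s (l + 1) i j
    have m2 := H.word_mem (w - 1) (s + 1) l i j
    obtain ⟨u, u', hu⟩ := H.f2_f1_pow w
    obtain ⟨v, hv⟩ := pass_pow H.f2_f3 s
    simp only [word, pow_succ', mul_assoc] at m1 m2 ⊢
    rw [hu, hv]
    simp only [mul_smul_comm]
    exact add_mem (Submodule.smul_mem _ _ (Submodule.smul_mem _ _ m1)) (Submodule.smul_mem _ _ m2)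

theorem k1_mul_mem : ∀ x ∈ wordSpan q d k1 k2 f1 f2, k1 * x ∈ wordSpan q d k1 k2 f1 f2 :=
  mul_mem_of_word fun w s l i j => by
    have m1 := H.word_mem w s l (i + 1) j
    obtain ⟨u, hu⟩ := pass_pow H.k1f1 w
    obtain ⟨v, hv⟩ := pass_pow H.k1_f3 s
    obtain ⟨t, ht⟩ := pass_pow H.k1f2 l
    simp only [word, pow_succ', mul_assoc] at m1 ⊢
    rw [hu, hv, ht]
    simp only [mul_smul_comm]
    exact Submodule.smul_mem _ _ (Submodule.smul_mem _ _ (Submodule.smul_mem _ _ m1))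

theorem k2_mul_mem : ∀ x ∈ wordSpan q d k1 k2 f1 f2, k2 * x ∈ wordSpan q d k1 k2 f1 f2 :=
  mul_mem_of_word fun w s l i j => by
    have m1 := H.word_mem w s l i (j + 1)
    obtain ⟨u, hu⟩ := pass_pow H.k2f1 w
    obtain ⟨v, hv⟩ := pass_pow H.k2_f3 s
    obtain ⟨t, ht⟩ := pass_pow (a := k2) (b := f2) (s := (1 : F)) (by rw [one_smul]; exact H.k2f2) l
    obtain ⟨t', ht'⟩ := pass_pow (a := k2) (b := k1) (s := (1 : F)) (by rw [one_smul]; exact H.k2k1) i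
    simp only [word, pow_succ', mul_assoc] at m1 ⊢
    rw [hu, hv, ht, ht']
    simp only [mul_smul_comm]
    exact Submodule.smul_mem _ _ (Submodule.smul_mem _ _ (Submodule.smul_mem _ _
      (Submodule.smul_mem _ _ m1)))

theorem one_mem : (1 : A) ∈ wordSpan q d k1 k2 f1 f2 := by
  simpa [word] using H.word_mem 0 0 0 0 0

/-- Left multiplication by each letter rewrites an ordered word into a combination of ordered words,
so the span is a subalgebra. Independence of the words plays no role. -/
theorem mul_mem {x y : A} (hx : x ∈ wordSpan q d k1 k2 f1 f2)
    (hy : y ∈ wordSpan q d k1 k2 f1 f2) : x * y ∈ wordSpan q d k1 k2 f1 f2 := by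
  have pw : ∀ (a : A), (∀ x ∈ wordSpan q d k1 k2 f1 f2, a * x ∈ wordSpan q d k1 k2 f1 f2) →
      ∀ (n : ℕ), ∀ x ∈ wordSpan q d k1 k2 f1 f2, a ^ n * x ∈ wordSpan q d k1 k2 f1 f2 := by
    intro a ha n
    induction n with
    | zero => intro x hx; simpa using hx
    | succ n ih => intro x hx; rw [pow_succ, mul_assoc]; exact ih _ (ha _ hx)
  refine wordSpan_induction (p := fun x => x * y ∈ wordSpan q d k1 k2 f1 f2)
    (fun w s l i j => ?_) (by simp) (fun x z hx hz => by rw [add_mul]; exact add_mem hx hz)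
    (fun c x hx => by rw [smul_mul_assoc]; exact Submodule.smul_mem _ _ hx) x hx
  simp only [word, mul_assoc]
  exact pw _ H.f1_mul_mem _ _ (pw _ H.f3_mul_mem _ _ (pw _ H.f2_mul_mem _ _
    (pw _ H.k1_mul_mem _ _ (pw _ H.k2_mul_mem _ _ hy))))

end NegRel

variable {q : F} {d : ℕ} [OddRoot q d]

theorem negRel_gen : NegRel q d (gen q d .k1) (gen q d .k2) (gen q d .f1) (gen q d .f2) where
  k2k1 := k2_k1
  k1f1 := by simp [sq]
  k1f2 := k1_f2
  k2f1 := k2_f1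
  k2f2 := k2_f2
  f2f2 := f2_f2
  serre := by simp
  f1d := f1_pow
  k1d := k1_pow
  k2d := k2_pow

end Ubar

end QDouble

end

/-! ### The negative Borel relations for the operators of `X` -/

noncomputable section

set_option linter.unusedSectionVars false

namespace QDouble

open TensorProduct Module

variable {F : Type*} [Field F]

namespace Ubar.Bplus

variable {q : F} {d : ℕ} [CharZero F] [OddRoot q d]

theorem IsSkew.mul_char {i : ZMod 2} {κ l g μ : Dual F (Bplus q d)} {a b s t s₁ t₁ s₂ t₂ : F}
    (h : IsSkew i κ l g a b) (hκ : IsChar κ s₁ t₁) (hl : IsChar l s₂ t₂) (hμ : IsChar μ s t) :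
    IsSkew i (xmul κ μ) (xmul l μ) (xmul g μ) a b where
  mul x y := by
    have hp : ∀ z, μ (parPow (PB q d) i z) = μ z := fun z => by
      refine homog_induction PB_PB (fun x y hx hy => by simp only [map_add, hx, hy])
        (fun j z hz => ?_) z
      rw [parPow_homog hz, map_smul]
      by_cases hj : 0 = j
      · subst hj; simp
      · rw [apply_eq_zero hμ.par hz hj, smul_zero]
    simp only [xmul_apply]
    rw [h.pd_mul hκ hl, map_add, hμ.mul, hμ.mul, hp]
  one := by rw [xmul_apply, pd_one, map_smul, h.one, zero_smul]
  bk1 := by rw [xmul_apply, pd_bk1, map_smul, h.bk1, zero_smul]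
  bk2 := by rw [xmul_apply, pd_bk2, map_smul, h.bk2, zero_smul]
  be1 := by
    rw [xmul_apply, pd_be1, map_add, map_smul, map_smul, h.be1, h.bk1, hμ.one]; simp
  be2 := by
    rw [xmul_apply, pd_be2, map_add, map_smul, map_smul, h.be2, h.bk2, hμ.one]; simp
  par := by
    have := LinearMap.congr_fun (HopfSuperData.dualOp_par_mul
      (hopf_isHopfSuperalgebra (q := q) (d := d))) (g ⊗ₜ μ)
    have h1 := hμ.par
    have h2 := h.par
    unfold IsHomog at *
    simp only [LinearMap.comp_apply, TensorProduct.map_tmul, h1, h2] at this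
    simpa [xmul, ← smul_tmul'] using this

theorem IsSkew.ext {i i' : ZMod 2} {κ l g g' : Dual F (Bplus q d)} {a b : F}
    (h : IsSkew i κ l g a b) (h' : IsSkew i' κ l g' a b) : g = g' :=
  LinearMap.ext (mem_of_gen (p := fun x => g x = g' x)
    (fun c => by simp [Algebra.algebraMap_eq_smul_one, h.one, h'.one])
    (fun x y hx hy => by rw [map_add, map_add, hx, hy])
    (fun x y hx hy => by rw [h.mul, h'.mul, hx, hy]) (h.bk1.trans h'.bk1.symm)
    (h.bk2.trans h'.bk2.symm) (h.be1.trans h'.be1.symm) (h.be2.trans h'.be2.symm))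

theorem IsChar.comm {κ μ : Dual F (Bplus q d)} {s t s' t' : F} (h : IsChar κ s t)
    (h' : IsChar μ s' t') : xmul κ μ = xmul μ κ :=
  (h.mul_char h').ext (by rw [mul_comm s, mul_comm t]; exact h'.mul_char h)

theorem IsChar.pow_d {κ : Dual F (Bplus q d)} {s t : F} (h : IsChar κ s t) (hs : s ^ d = 1)
    (ht : t ^ d = 1) : xpow κ d = εB q d :=
  IsChar.ext (by have := h.pow d; rwa [hs, ht] at this) isChar_ε

/-- Commutation of a character with `der1` or `der2`. -/
theorem IsSkew.char_comm {i : ZMod 2} {κ g μ : Dual F (Bplus q d)} {a b s t s₁ t₁ u : F}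
    (h : IsSkew i κ (εB q d) g a b) (hκ : IsChar κ s₁ t₁) (hμ : IsChar μ s t)
    (ha : s * a = u * a) (hb : t * b = u * b) : xmul μ g = u • xmul g μ := by
  have h1 := h.char_mul hμ
  have h2 := (h.mul_char hκ isChar_ε hμ).smul u
  rw [hμ.comm hκ, hμ.comm isChar_ε, ha, hb] at h1
  exact h1.ext h2

theorem chr_comm : xmul (chr2 q d) (chr1 q d) = xmul (chr1 q d) (chr2 q d) :=
  chr2_isChar.comm chr1_isChar

theorem chr1_der1 : xmul (chr1 q d) (der1 q d) = (q⁻¹ * q⁻¹) • xmul (der1 q d) (chr1 q d) :=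
  der1_isSkew.char_comm chr1i_isChar chr1_isChar rfl (by simp)

theorem chr1_der2 : xmul (chr1 q d) (der2 q d) = q • xmul (der2 q d) (chr1 q d) :=
  der2_isSkew.char_comm chr2i_isChar chr1_isChar (by simp) rfl

theorem chr2_der1 : xmul (chr2 q d) (der1 q d) = q • xmul (der1 q d) (chr2 q d) :=
  der1_isSkew.char_comm chr1i_isChar chr2_isChar rfl (by simp)

theorem chr2_der2 : xmul (chr2 q d) (der2 q d) = xmul (der2 q d) (chr2 q d) := by
  rw [← one_smul F (xmul (der2 q d) (chr2 q d))]
  exact der2_isSkew.char_comm chr2i_isChar chr2_isChar (by simp) rfl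

theorem chr1i_der1 : xmul (chr1i q d) (der1 q d) = (q * q) • xmul (der1 q d) (chr1i q d) :=
  der1_isSkew.char_comm chr1i_isChar chr1i_isChar rfl (by simp)

theorem chr1_pow_d : xpow (chr1 q d) d = εB q d :=
  chr1_isChar.pow_d (by rw [mul_pow, inv_pow, q_pow]; simp) q_pow

theorem chr2_pow_d : xpow (chr2 q d) d = εB q d :=
  chr2_isChar.pow_d q_pow (one_pow _)

theorem pd_kpow_char {κ : Dual F (Bplus q d)} {s t : F} (h : IsChar κ s t) (i j : ℕ) :
    pd κ (bk1 q d ^ i * bk2 q d ^ j) = (s ^ i * t ^ j) • (bk1 q d ^ i * bk2 q d ^ j) := by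
  rw [h.pd_mul, pd_pow_char h, pd_pow_char h, pd_bk1_char h, pd_bk2_char h, smul_pow, smul_pow,
    smul_mul_smul_comm]

theorem IsSkew.pd_kpow_mul {i' : ZMod 2} {κ g : Dual F (Bplus q d)} {a b s t : F}
    (h : IsSkew i' κ (εB q d) g a b) (hκ : IsChar κ s t) (i j : ℕ) (y : Bplus q d) :
    pd g (Bplus.bk1 q d ^ i * Bplus.bk2 q d ^ j * y) =
      (s ^ i * t ^ j) • (Bplus.bk1 q d ^ i * Bplus.bk2 q d ^ j * pd g y) := by
  have : pd g (Bplus.bk1 q d ^ i * Bplus.bk2 q d ^ j) = 0 := by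
    rw [h.pd_mul hκ isChar_ε,
      h.pd_pow_zero hκ (by rw [pd_bk2, h.bk2, zero_smul]),
      h.pd_pow_zero hκ (by rw [pd_bk1, h.bk1, zero_smul]), mul_zero, zero_mul, add_zero]
  rw [h.pd_mul hκ isChar_ε, this, zero_mul, add_zero, pd_kpow_char hκ, smul_mul_assoc]

theorem D1_kpow_mul (i j : ℕ) (y : Bplus q d) : D1 q d (bk1 q d ^ i * bk2 q d ^ j * y) =
    ((q * q) ^ i * q⁻¹ ^ j) • (bk1 q d ^ i * bk2 q d ^ j * D1 q d y) :=
  der1_isSkew.pd_kpow_mul chr1i_isChar i j y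

theorem D2_kpow_mul (i j : ℕ) (y : Bplus q d) : D2 q d (bk1 q d ^ i * bk2 q d ^ j * y) =
    (q⁻¹ ^ i * 1 ^ j) • (bk1 q d ^ i * bk2 q d ^ j * D2 q d y) :=
  der2_isSkew.pd_kpow_mul chr2i_isChar i j y

theorem bword_assoc (i j r h t : ℕ) : bword q d i j r h t =
    bk1 q d ^ i * bk2 q d ^ j * (be1 q d ^ r * (be3 q d ^ h * be2 q d ^ t)) := by
  simp only [bword, mul_assoc]

theorem eq_zero_of_bword {M : Type*} [AddCommGroup M] [Module F M] {f : Bplus q d →ₗ[F] M}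
    (h00 : ∀ i j r, f (bk1 q d ^ i * bk2 q d ^ j * be1 q d ^ r) = 0)
    (h01 : ∀ i j r, f (bk1 q d ^ i * bk2 q d ^ j * (be1 q d ^ r * be2 q d)) = 0)
    (h10 : ∀ i j r, f (bk1 q d ^ i * bk2 q d ^ j * (be1 q d ^ r * be3 q d)) = 0)
    (h11 : ∀ i j r, f (bk1 q d ^ i * bk2 q d ^ j * (be1 q d ^ r * (be3 q d * be2 q d))) = 0) :
    f = 0 := by
  refine (posBasis q d).ext fun ⟨i, j, r, h, t⟩ => ?_
  rw [posBasis_apply, bword_assoc]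
  fin_cases h <;> fin_cases t
  · simpa using h00 i j r
  · simpa using h01 i j r
  · simpa using h10 i j r
  · simpa using h11 i j r

theorem D2_D2 : D2 q d * D2 q d = 0 := by
  refine eq_zero_of_bword ?_ ?_ ?_ ?_ <;> intro i j r <;>
    simp only [Module.End.mul_apply, D2_kpow_mul, map_smul, D2_be1_pow, D2_be1_pow_mul, D2_be2,
      D2_be3, D2_be3_be2, D2_one, mul_zero, map_zero, smul_zero, mul_smul_comm]

/-- By the twisted Leibniz rule `D1 ∘ m = m ∘ (u + v)` with `v u = q² u v`. As `q²` is a primitive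
`d`-th root of unity, `(u + v)ᵈ = uᵈ + vᵈ`, so the `d`-th power of `D1` is again a twisted
derivation. It vanishes on the generators, because `D1` maps them to scalars and `d ≥ 2`. -/
theorem D1_pow_d : D1 q d ^ d = 0 := by
  have hd := OddRoot.one_lt (q := q) (d := d)
  have hc : IsPrimitiveRoot (q * q) d := by
    rw [← sq]
    exact (OddRoot.prim (q := q) (d := d)).pow_of_coprime 2
      (OddRoot.odd (q := q) (d := d)).coprime_two_left
  have hS : D1 q d * pd (chr1i q d) = (q * q) • (pd (chr1i q d) * D1 q d) := by
    rw [← pd_xmul, ← pd_xmul, chr1i_der1, map_smul]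
  let u : Module.End F (Bplus q d ⊗[F] Bplus q d) := TensorProduct.map (pd (chr1i q d)) (D1 q d)
  let v : Module.End F (Bplus q d ⊗[F] Bplus q d) := TensorProduct.map (D1 q d) 1
  have huv : v * u = (q * q) • (u * v) := by
    refine TensorProduct.ext' fun x y => ?_
    have := LinearMap.congr_fun hS x
    simp only [Module.End.mul_apply, LinearMap.smul_apply] at this
    simp [u, v, this, smul_tmul']
  have hm : ∀ (n : ℕ) t, (D1 q d ^ n) (mB q d t) = mB q d (((u + v) ^ n) t) := fun n => by
    induction n with
    | zero => intro t; rfl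
    | succ n ih =>
      intro t
      rw [pow_succ', Module.End.mul_apply, ih, pow_succ', Module.End.mul_apply]
      generalize ((u + v) ^ n) t = t
      induction t using TensorProduct.induction_on with
      | zero => simp
      | add s t hs ht => simp only [map_add, hs, ht]
      | tmul x y => simp [u, v, D1_mul]
  have h2 : ∀ x y, (D1 q d ^ d) (x * y) =
      (pd (chr1i q d) ^ d) x * (D1 q d ^ d) y + (D1 q d ^ d) x * y := fun x y => by
    have := hm d (x ⊗ₜ y)
    have e : (u + v) ^ d = u ^ d + v ^ d :=
      add_pow_root (A := Module.End F (Bplus q d ⊗[F] Bplus q d)) (by omega) hc huv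
    rw [e, TensorProduct.map_pow, TensorProduct.map_pow,
      one_pow] at this
    simpa using this
  have h4 : ∀ n, 0 < n → ∀ x, D1 q d x = 0 → (D1 q d ^ n) x = 0 := fun n hn x hx => by
    obtain ⟨n, rfl⟩ := Nat.exists_eq_add_one_of_ne_zero hn.ne'
    rw [pow_succ, Module.End.mul_apply, hx, map_zero]
  have h3 := h4 d (by omega)
  have h5 : D1 q d ^ d = D1 q d ^ (d - 1) * D1 q d := by rw [← pow_succ, Nat.sub_add_cancel hd.le]
  refine LinearMap.ext (mem_of_gen (p := fun x => (D1 q d ^ d) x = 0) (fun c => ?_)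
    (fun x y hx hy => ?_) (fun x y hx hy => ?_) ?_ ?_ ?_ ?_)
  · rw [Algebra.algebraMap_eq_smul_one, map_smul, h3 _ D1_one, smul_zero]
  · rw [map_add, hx, hy, add_zero]
  · rw [h2, hx, hy, mul_zero, zero_mul, add_zero]
  · exact h3 _ (by rw [pd_bk1, der1_isSkew.bk1, zero_smul])
  · exact h3 _ (by rw [pd_bk2, der1_isSkew.bk2, zero_smul])
  · rw [h5, Module.End.mul_apply, D1_be1, map_smul, h4 _ (by omega) _ D1_one, smul_zero]
  · exact h3 _ D1_be2

/-- The compositions are in reverse order compared with the relation of `f₁, f₂`, since `pd`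
reverses products. On monomials the exponents 0, 1 and at least 2 of `e₁` are separated, because
`D1` may lower the exponent twice. -/
theorem D_serre : D2 q d * D1 q d * D1 q d - (q + q⁻¹) • (D1 q d * D2 q d * D1 q d) +
    D1 q d * D1 q d * D2 q d = 0 := by
  have hq := q_ne_zero q d
  refine eq_zero_of_bword ?_ ?_ ?_ ?_ <;> intro i j r <;> rcases r with _ | _ | r <;>
    simp only [Module.End.mul_apply, LinearMap.add_apply, LinearMap.sub_apply, LinearMap.smul_apply,
      D1_kpow_mul, D2_kpow_mul, map_smul, map_add, D2_be1_pow, D2_be1_pow_mul, D2_be2, D1_be1_pow,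
      D1_be1_pow_mul, D1_be2, D1_be3, D1_be3_be2,
      D2_be3, D2_be3_be2, mul_zero, map_zero, smul_zero, mul_smul_comm, mul_one, qnum,
      zero_smul, add_zero, zero_add, smul_add, mul_add, Nat.add_sub_cancel, sub_self] <;>
    generalize (q - q⁻¹)⁻¹ = c <;> match_scalars
  -- All powers are replaced by free variables; the claims become polynomial identities modulo `q
  -- q⁻¹ = 1`.
  all_goals
    simp only [Nat.sub_self, qnum, pow_succ, pow_zero, one_mul, Nat.zero_sub]
    have hpq : q * q⁻¹ = 1 := mul_inv_cancel₀ hq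
    generalize q⁻¹ = p at hpq ⊢
    generalize p ^ i = x₁, p ^ j = x₂, (q * q) ^ i = x₄
    try generalize p ^ r = x₃, (q * q) ^ r = x₅
    grind

/-- The opposite algebra undoes the reversal of products by `pd`. The mixed relations come from
comparing skew derivations on generators, the others from the operator identities above. -/
theorem negRel_op : NegRel q d (MulOpposite.op (pd (chr1 q d))) (MulOpposite.op (pd (chr2 q d)))
    (MulOpposite.op (D1 q d)) (MulOpposite.op (D2 q d)) where
  k2k1 := by simp only [← MulOpposite.op_mul, ← pd_xmul, chr_comm]
  k1f1 := by simp only [← MulOpposite.op_mul, ← pd_xmul, chr1_der1, map_smul, MulOpposite.op_smul]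
  k1f2 := by simp only [← MulOpposite.op_mul, ← pd_xmul, chr1_der2, map_smul, MulOpposite.op_smul]
  k2f1 := by simp only [← MulOpposite.op_mul, ← pd_xmul, chr2_der1, map_smul, MulOpposite.op_smul]
  k2f2 := by simp only [← MulOpposite.op_mul, ← pd_xmul, chr2_der2]
  f2f2 := by rw [← MulOpposite.op_mul, D2_D2]; rfl
  serre := by
    simp only [← MulOpposite.op_mul, ← MulOpposite.op_smul, ← MulOpposite.op_sub,
      ← MulOpposite.op_add, D_serre]; rfl
  f1d := by rw [← MulOpposite.op_pow, D1_pow_d]; rfl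
  k1d := by rw [← MulOpposite.op_pow, ← pd_xpow, chr1_pow_d, pd_ε]; rfl
  k2d := by rw [← MulOpposite.op_pow, ← pd_xpow, chr2_pow_d, pd_ε]; rfl

end Ubar.Bplus

end QDouble

end

/-! ### Identification of the functionals `α` -/

noncomputable section

set_option linter.unusedSectionVars false

namespace QDouble

open TensorProduct Module

variable {F : Type*} [Field F]

namespace Ubar.Bplus

variable {q : F} {d : ℕ} [CharZero F] [OddRoot q d]

theorem IsChar.apply_pow {κ : Dual F (Bplus q d)} {s t : F} (h : IsChar κ s t) (x : Bplus q d)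
    (n : ℕ) : κ (x ^ n) = κ x ^ n := by
  induction n with
  | zero => rw [pow_zero, pow_zero, h.one]
  | succ n ih => rw [pow_succ, h.mul, ih, pow_succ]

theorem IsChar.apply_be3 {κ : Dual F (Bplus q d)} {s t : F} (h : IsChar κ s t) :
    κ (Bplus.be3 q d) = 0 := by
  rw [Bplus.be3, map_sub, map_smul, h.mul, h.mul, h.be1]; simp

theorem IsChar.apply_bword {κ : Dual F (Bplus q d)} {a b : F} (H : IsChar κ a b)
    (i j r h t : ℕ) : κ (bword q d i j r h t) =
      a ^ i * b ^ j * if r = 0 ∧ h = 0 ∧ t = 0 then 1 else 0 := by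
  simp only [bword, H.mul, H.apply_pow, H.bk1, H.bk2, H.be1, H.be2, H.apply_be3, zero_pow_eq]
  split_ifs <;> simp_all

theorem IsSkew.apply_kpow_mul {i' : ZMod 2} {κ g : Dual F (Bplus q d)} {a b s t : F}
    (h : IsSkew i' κ (εB q d) g a b) (hκ : IsChar κ s t) (i j : ℕ) (y : Bplus q d) :
    g (Bplus.bk1 q d ^ i * Bplus.bk2 q d ^ j * y) = s ^ i * t ^ j * g y := by
  have hε := isChar_ε (q := q) (d := d)
  rw [← ε_pd, h.pd_kpow_mul hκ, map_smul, hε.mul, hε.mul, hε.apply_pow, hε.apply_pow, hε.bk1,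
    hε.bk2, ε_pd]
  simp

theorem ε_be1_pow (r : ℕ) : εB q d (be1 q d ^ r) = if r = 0 then 1 else 0 := by
  have hε := isChar_ε (q := q) (d := d)
  rw [hε.apply_pow, hε.be1, zero_pow_eq]

/-- The possible exponents of `e₃` and `e₂`. -/
theorem two_cases {p : ℕ → ℕ → Prop} (h00 : p 0 0) (h01 : p 0 1) (h10 : p 1 0) (h11 : p 1 1)
    (h t : Fin 2) : p h t := by
  fin_cases h <;> fin_cases t <;> assumption

theorem der1_be1_pow (r : ℕ) :
    der1 q d (be1 q d ^ r) = if r = 1 then -(q - q⁻¹)⁻¹ else 0 := by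
  rw [← ε_pd, D1_be1_pow, map_smul, ε_be1_pow]
  rcases r with _ | _ | r <;> simp [qnum]

theorem der1_be1_pow_mul_of_D1 (r : ℕ) {y : Bplus q d} (h : D1 q d y = 0) (h' : εB q d y = 0) :
    der1 q d (be1 q d ^ r * y) = 0 := by
  rw [← ε_pd, D1_be1_pow_mul, h, mul_zero, smul_zero, zero_add, map_smul, isChar_ε.mul, h',
    mul_zero, smul_zero]

theorem der1_be1_pow_mul_be3 (r : ℕ) : der1 q d (be1 q d ^ r * be3 q d) = 0 := by
  have hε := isChar_ε (q := q) (d := d)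
  rw [← ε_pd, D1_be1_pow_mul, D1_be3, map_add, map_smul, map_smul, hε.mul, hε.mul, map_smul,
    hε.be2, hε.apply_be3]
  simp

theorem der2_be1_pow (r : ℕ) : der2 q d (be1 q d ^ r) = 0 := by
  rw [← ε_pd, D2_be1_pow, map_zero]

theorem der2_be1_pow_mul_be2 (r : ℕ) :
    der2 q d (be1 q d ^ r * be2 q d) = if r = 0 then (q - q⁻¹)⁻¹ else 0 := by
  rw [← ε_pd, D2_be1_pow_mul, D2_be2, map_smul, mul_smul_comm, mul_one, map_smul, ε_be1_pow]
  rcases r with _ | r <;> simp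

theorem der2_be1_pow_mul_be3 (r : ℕ) : der2 q d (be1 q d ^ r * be3 q d) = 0 := by
  rw [← ε_pd, D2_be1_pow_mul, D2_be3, mul_zero, smul_zero, map_zero]

theorem der2_be1_pow_mul_be3_be2 (r : ℕ) :
    der2 q d (be1 q d ^ r * (be3 q d * be2 q d)) = 0 := by
  have hε := isChar_ε (q := q) (d := d)
  rw [← ε_pd, D2_be1_pow_mul, D2_be3_be2, map_smul, mul_smul_comm, map_smul, hε.mul,
    hε.apply_be3]
  simp

variable (q d) in
/-- `der3 = der2 der1 - q der1 der2` in `X`. -/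
def der3 : Dual F (Bplus q d) := xmul (der2 q d) (der1 q d) - q • xmul (der1 q d) (der2 q d)

theorem der3_apply (x : Bplus q d) :
    der3 q d x = der1 q d (D2 q d x) - q * der2 q d (D1 q d x) := by
  simp [der3, xmul_apply]

/-- Values are read off from `g x = ε (pd g x)` and the operator formulas: `ε` retains only terms in
which no `e` is left. -/
theorem der1_bword (i j r : ℕ) (h t : Fin 2) : der1 q d (bword q d i j r h t) =
    (q * q) ^ i * q⁻¹ ^ j * if r = 1 ∧ (h : ℕ) = 0 ∧ (t : ℕ) = 0 then -(q - q⁻¹)⁻¹ else 0 := by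
  rw [bword_assoc, der1_isSkew.apply_kpow_mul chr1i_isChar]
  congr 1
  refine two_cases (p := fun h t => der1 q d (be1 q d ^ r * (be3 q d ^ h * be2 q d ^ t)) =
    if r = 1 ∧ h = 0 ∧ t = 0 then -(q - q⁻¹)⁻¹ else 0) ?_ ?_ ?_ ?_ h t
  · simpa using der1_be1_pow r
  · simpa using der1_be1_pow_mul_of_D1 r D1_be2 (isChar_ε (q := q) (d := d)).be2
  · simpa using der1_be1_pow_mul_be3 r
  · simpa using der1_be1_pow_mul_of_D1 r (D1_be3_be2 (q := q) (d := d)) (by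
      rw [isChar_ε.mul, isChar_ε.be2, mul_zero])

theorem der2_bword (i j r : ℕ) (h t : Fin 2) : der2 q d (bword q d i j r h t) =
    q⁻¹ ^ i * 1 ^ j * if r = 0 ∧ (h : ℕ) = 0 ∧ (t : ℕ) = 1 then (q - q⁻¹)⁻¹ else 0 := by
  rw [bword_assoc, der2_isSkew.apply_kpow_mul chr2i_isChar]
  congr 1
  refine two_cases (p := fun h t => der2 q d (be1 q d ^ r * (be3 q d ^ h * be2 q d ^ t)) =
    if r = 0 ∧ h = 0 ∧ t = 1 then (q - q⁻¹)⁻¹ else 0) ?_ ?_ ?_ ?_ h t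
  · simpa using der2_be1_pow r
  · simpa using der2_be1_pow_mul_be2 r
  · simpa using der2_be1_pow_mul_be3 r
  · simpa using der2_be1_pow_mul_be3_be2 r

/-- Put `c = (q - q⁻¹)⁻¹`. On `e₁ e₂` the two terms give `-q⁻¹ c² + q c² = c`; on `e₃` only the
second contributes, again with value `c`. This explains the two families in `α_{e₃}` with equal
coefficients. -/
theorem der3_bword (i j r : ℕ) (h t : Fin 2) : der3 q d (bword q d i j r h t) =
    (q ^ i * q⁻¹ ^ j) * if r = 1 ∧ (h : ℕ) = 0 ∧ (t : ℕ) = 1 ∨ r = 0 ∧ (h : ℕ) = 1 ∧ (t : ℕ) = 0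
      then (q - q⁻¹)⁻¹ else 0 := by
  have hq := q_ne_zero q d
  have hs := q_sub_ne q d
  have key : ∀ y, der3 q d (bk1 q d ^ i * bk2 q d ^ j * y) = (q ^ i * q⁻¹ ^ j) * der3 q d y :=
    fun y => by
    rw [der3_apply, der3_apply, D1_kpow_mul, D2_kpow_mul, map_smul, map_smul,
      der1_isSkew.apply_kpow_mul chr1i_isChar, der2_isSkew.apply_kpow_mul chr2i_isChar]
    have e : (q * q) ^ i * q⁻¹ ^ i = q ^ i := by rw [← mul_pow, mul_inv_cancel_right₀ hq]
    simp only [smul_eq_mul, one_pow, mul_one]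
    linear_combination (der1 q d (D2 q d y) - q * der2 q d (D1 q d y)) * q⁻¹ ^ j * e
  rw [bword_assoc, key]
  congr 1
  refine two_cases (p := fun h t => der3 q d (be1 q d ^ r * (be3 q d ^ h * be2 q d ^ t)) =
    if r = 1 ∧ h = 0 ∧ t = 1 ∨ r = 0 ∧ h = 1 ∧ t = 0 then (q - q⁻¹)⁻¹ else 0) ?_ ?_ ?_ ?_ h t
  · simp [der3_apply, D2_be1_pow, D1_be1_pow, der2_be1_pow]
  · simp only [pow_zero, pow_one, one_mul]
    rw [der3_apply, D2_be1_pow_mul, D1_be1_pow_mul, D2_be2, D1_be2]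
    simp only [mul_smul_comm, map_smul, mul_one, mul_zero, smul_zero, zero_add,
      der1_be1_pow, der2_be1_pow_mul_be2]
    have := mul_inv_cancel₀ hs
    rcases r with _ | _ | r
    · simp [qnum]
    · simp [qnum]
      linear_combination (q - q⁻¹)⁻¹ * this
    · simp
  · simp only [pow_zero, pow_one, mul_one]
    rw [der3_apply, D2_be1_pow_mul, D1_be1_pow_mul, D2_be3, D1_be3]
    simp only [mul_smul_comm, map_smul, map_add, mul_zero, smul_zero, map_zero,
      der2_be1_pow_mul_be2, der2_be1_pow_mul_be3]
    rcases r with _ | r <;> simp [hq]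
  · simp only [pow_one]
    rw [der3_apply, D2_be1_pow_mul, D1_be1_pow_mul, D2_be3_be2, D1_be3_be2]
    simp only [mul_smul_comm, map_smul, mul_zero, smul_zero, zero_add,
      der1_be1_pow_mul_be3, der2_be1_pow_mul_be3_be2]
    simp

theorem star_apply (v p : Fin d) (r h t : Fin 2) (m : PosIdx d) :
    star (posBasis q d) v p r h t (posBasis q d m) =
      if m = (v, p, r.castLE (OddRoot.one_lt (q := q)), h, t) then 1 else 0 := by
  rw [star, Basis.coord_apply, Basis.repr_self, Finsupp.single_apply]

theorem sum_star_apply (g : Fin d → Fin d → F) (r h t : Fin 2) (i j r' : Fin d) (h' t' : Fin 2) :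
    (∑ v : Fin d, ∑ p : Fin d, g v p • star (posBasis q d) v p r h t)
      (posBasis q d (i, j, r', h', t')) =
      g i j * if (r' : ℕ) = r ∧ (h' : ℕ) = h ∧ (t' : ℕ) = t then 1 else 0 := by
  simp only [LinearMap.sum_apply, LinearMap.smul_apply, star_apply, Prod.mk.injEq, Fin.ext_iff,
    Fin.val_castLE, smul_eq_mul]
  rw [Finset.sum_eq_single i, Finset.sum_eq_single j]
  · simp
  · intro p _ hp
    rw [if_neg, mul_zero]
    exact fun e => hp (Fin.ext e.2.1.symm)
  · simp
  · intro v _ hv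
    refine Finset.sum_eq_zero fun p _ => ?_
    rw [if_neg, mul_zero]
    exact fun e => hv (Fin.ext e.1.symm)
  · simp

theorem αk1_posBasis : αk1 (posBasis q d) = chr1 q d := by
  have hq := q_ne_zero q d
  refine (posBasis q d).ext fun ⟨i, j, r, h, t⟩ => ?_
  rw [αk1, sum_star_apply, posBasis_apply, chr1_isChar.apply_bword]
  congr 1
  rw [zpow_add₀ hq, zpow_mul]
  simp [zpow_neg, ← sq]

theorem αk2_posBasis : αk2 (posBasis q d) = chr2 q d := by
  refine (posBasis q d).ext fun ⟨i, j, r, h, t⟩ => ?_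
  rw [αk2, sum_star_apply, posBasis_apply, chr2_isChar.apply_bword]
  simp

theorem αe1_posBasis : αe1 (posBasis q d) = der1 q d := by
  have hq := q_ne_zero q d
  refine (posBasis q d).ext fun ⟨i, j, r, h, t⟩ => ?_
  rw [αe1, LinearMap.smul_apply, sum_star_apply, posBasis_apply, der1_bword]
  rw [zpow_sub₀ hq, zpow_mul]
  simp only [smul_eq_mul, zpow_ofNat, zpow_natCast, div_eq_mul_inv, sq, inv_pow, Fin.val_zero,
    Fin.val_one]
  split_ifs <;> ring

theorem αe2_posBasis : αe2 (posBasis q d) = der2 q d := by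
  refine (posBasis q d).ext fun ⟨i, j, r, h, t⟩ => ?_
  rw [αe2, LinearMap.smul_apply, sum_star_apply, posBasis_apply, der2_bword]
  simp only [smul_eq_mul, zpow_neg, zpow_natCast, inv_pow, Fin.val_zero, Fin.val_one, one_pow]
  split_ifs <;> ring

theorem αe3_posBasis : αe3 (posBasis q d) = der3 q d := by
  have hq := q_ne_zero q d
  refine (posBasis q d).ext fun ⟨i, j, r, h, t⟩ => ?_
  rw [αe3, LinearMap.smul_apply, LinearMap.add_apply, sum_star_apply, sum_star_apply,
    posBasis_apply, der3_bword]
  rw [zpow_sub₀ hq]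
  simp only [smul_eq_mul, zpow_natCast, div_eq_mul_inv, inv_pow, Fin.val_zero, Fin.val_one]
  split_ifs <;> first | (exfalso; omega) | ring

end Ubar.Bplus

end QDouble

end

/-! ### The basis of `X` and the multiplicative map `φ` -/

noncomputable section

set_option linter.unusedSectionVars false

namespace QDouble

open TensorProduct Module

variable {F : Type*} [Field F]

namespace Ubar

theorem NegRel.map_word {q : F} {A B : Type*} [Ring A] [Algebra F A] [Ring B] [Algebra F B]
    (φ : A →ₐ[F] B) (k1 k2 f1 f2 : A) (w s l i j : ℕ) :
    φ (NegRel.word q k1 k2 f1 f2 w s l i j) =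
      NegRel.word q (φ k1) (φ k2) (φ f1) (φ f2) w s l i j := by
  simp [NegRel.word, NegRel.f3]

namespace Bplus

variable {q : F} {d : ℕ} [CharZero F] [OddRoot q d]

/-- `pd` as an algebra morphism from `X`. -/
def pdo : Dual F (Bplus q d) →ₗ[F] (Module.End F (Bplus q d))ᵐᵒᵖ :=
  (MulOpposite.opLinearEquiv F).toLinearMap ∘ₗ pd

theorem pdo_xmul (f g : Dual F (Bplus q d)) : pdo (xmul f g) = pdo f * pdo g :=
  congrArg MulOpposite.op (pd_xmul f g)

theorem pdo_ε : pdo (εB q d) = 1 := congrArg MulOpposite.op pd_ε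

theorem pdo_xpow (f : Dual F (Bplus q d)) (n : ℕ) : pdo (xpow f n) = pdo f ^ n :=
  congrArg MulOpposite.op (pd_xpow f n)

theorem pdo_injective : Function.Injective (pdo (q := q) (d := d)) :=
  MulOpposite.op_injective.comp pd_injective

theorem negRel_pdo : NegRel q d (pdo (chr1 q d)) (pdo (chr2 q d)) (pdo (der1 q d))
    (pdo (der2 q d)) := negRel_op

theorem pdo_der3 : pdo (der3 q d) = NegRel.f3 q (pdo (der1 q d)) (pdo (der2 q d)) := by
  rw [der3, map_sub, map_smul, pdo_xmul, pdo_xmul, NegRel.f3]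

theorem pdo_alphaMono (n : NegIdx d) : pdo (alphaMono (posBasis q d) n) =
    NegRel.word q (pdo (chr1 q d)) (pdo (chr2 q d)) (pdo (der1 q d)) (pdo (der2 q d))
      n.1 n.2.1 n.2.2.1 n.2.2.2.1 n.2.2.2.2 := by
  obtain ⟨w, s, l, i, j⟩ := n
  simp only [alphaMono, pdo_xmul, pdo_xpow, αk1_posBasis, αk2_posBasis, αe1_posBasis, αe2_posBasis,
    αe3_posBasis, pdo_der3, NegRel.word]

theorem map_pdo_span : (Submodule.span F (Set.range (alphaMono (posBasis q d)))).map pdo =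
    NegRel.wordSpan q d (pdo (chr1 q d)) (pdo (chr2 q d)) (pdo (der1 q d)) (pdo (der2 q d)) := by
  rw [Submodule.map_span, ← Set.range_comp, NegRel.wordSpan]
  congr 2
  exact funext pdo_alphaMono

/-- The span `Y` is stable under left multiplication by the four generators and contains `ε`.
Dually, its annihilator in `B_q⁺` is stable under their operators and `ε` vanishes on it, so it is
zero by `coeff_eq_zero_of_mem`; duality in finite dimension gives the claim. -/
theorem span_alphaMono : Submodule.span F (Set.range (alphaMono (posBasis q d))) = ⊤ := by
  set Y := Submodule.span F (Set.range (alphaMono (posBasis q d))) with hY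
  have mem : ∀ {f : Dual F (Bplus q d)}, f ∈ Y ↔ pdo f ∈ NegRel.wordSpan q d (pdo (chr1 q d))
      (pdo (chr2 q d)) (pdo (der1 q d)) (pdo (der2 q d)) := fun {f} => by
    rw [← map_pdo_span, ← hY]
    exact (Function.Injective.mem_set_image pdo_injective).symm
  have st : ∀ g : Dual F (Bplus q d), (∀ f ∈ Y, xmul g f ∈ Y) →
      ∀ x ∈ Y.dualCoannihilator, pd g x ∈ Y.dualCoannihilator := fun g hg x hx => by
    rw [Submodule.mem_dualCoannihilator] at hx ⊢
    intro f hf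
    rw [← xmul_apply]
    exact hx _ (hg f hf)
  have H := negRel_pdo (q := q) (d := d)
  have hbot : Y.dualCoannihilator = ⊥ := by
    refine eq_bot_iff.2 fun x hx => ?_
    have hsum := (posBasis q d).sum_repr x
    simp only [posBasis_apply] at hsum
    have h0 := coeff_eq_zero_of_mem (N := Y.dualCoannihilator) (q := q) (d := d)
      (c := fun m => (posBasis q d).repr x m)
      (st _ fun f hf => mem.2 (by rw [pdo_xmul]; exact H.k1_mul_mem _ (mem.1 hf)))
      (st _ fun f hf => mem.2 (by rw [pdo_xmul]; exact H.k2_mul_mem _ (mem.1 hf)))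
      (st _ fun f hf => mem.2 (by rw [pdo_xmul]; exact H.f1_mul_mem _ (mem.1 hf)))
      (st _ fun f hf => mem.2 (by rw [pdo_xmul]; exact H.f2_mul_mem _ (mem.1 hf)))
      (fun y hy => (Submodule.mem_dualCoannihilator _ ).1 hy _
        (mem.2 (by rw [pdo_ε]; exact H.one_mem)))
      (by rw [hsum]; exact hx)
    rw [Submodule.mem_bot, ← hsum]
    exact Finset.sum_eq_zero fun m _ => by rw [congrFun h0 m, Pi.zero_apply, zero_smul]
  rw [← Subspace.dualCoannihilator_dualAnnihilator_eq (W := Y), hbot]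
  exact Submodule.dualAnnihilator_bot

variable (q d) in
/-- The basis of `X` of the monomials in the `α`. -/
def alphaBasis : Basis (NegIdx d) F (Dual F (Bplus q d)) :=
  -- Both index sets have `4 d³` elements, so spanning suffices.
  basisOfTopLeSpanOfCardEqFinrank (alphaMono (posBasis q d)) span_alphaMono.ge (by
    rw [Subspace.dual_finrank_eq, finrank_eq_card_basis (posBasis q d)]
    simp only [Fintype.card_prod, Fintype.card_fin]
    ring)

theorem alphaBasis_apply (n : NegIdx d) : alphaBasis q d n = alphaMono (posBasis q d) n := by
  rw [alphaBasis, coe_basisOfTopLeSpanOfCardEqFinrank]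

variable (q d) in
/-- The restriction of `χ` to `X`. -/
def φ : Dual F (Bplus q d) →ₗ[F] Ubar q d :=
  (alphaBasis q d).constr F fun n => NegRel.word q (gen q d .k1) (gen q d .k2) (gen q d .f1)
    (gen q d .f2) n.1 n.2.1 n.2.2.1 n.2.2.2.1 n.2.2.2.2

theorem φ_alphaBasis (n : NegIdx d) : φ q d (alphaBasis q d n) = NegRel.word q (gen q d .k1)
    (gen q d .k2) (gen q d .f1) (gen q d .f2) n.1 n.2.1 n.2.2.1 n.2.2.2.1 n.2.2.2.2 := by
  rw [φ, Basis.constr_basis]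

variable (q d) in
/-- The graph of `φ`. -/
def graph : Dual F (Bplus q d) →ₗ[F] (Module.End F (Bplus q d))ᵐᵒᵖ × Ubar q d :=
  LinearMap.prod pdo (φ q d)

/-- A word in pairs is the pair of the corresponding words, so the basis elements of `X` have
exactly the ordered words in the pairs as their graph points. -/
theorem range_graph : LinearMap.range (graph q d) = NegRel.wordSpan q d
    (pdo (chr1 q d), gen q d .k1) (pdo (chr2 q d), gen q d .k2) (pdo (der1 q d), gen q d .f1)
    (pdo (der2 q d), gen q d .f2) := by
  rw [LinearMap.range_eq_map, ← (alphaBasis q d).span_eq, Submodule.map_span, ← Set.range_comp,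
    NegRel.wordSpan]
  congr 2
  funext n
  refine Prod.ext ?_ ?_
  · change pdo (alphaBasis q d n) =
      AlgHom.fst F (Module.End F (Bplus q d))ᵐᵒᵖ (Ubar q d) (NegRel.word q _ _ _ _ _ _ _ _ _)
    rw [NegRel.map_word, alphaBasis_apply, pdo_alphaMono]; rfl
  · change φ q d (alphaBasis q d n) =
      AlgHom.snd F (Module.End F (Bplus q d))ᵐᵒᵖ (Ubar q d) (NegRel.word q _ _ _ _ _ _ _ _ _)
    rw [NegRel.map_word, φ_alphaBasis]; rfl

theorem negRel_graph : NegRel q d (pdo (chr1 q d), gen q d .k1) (pdo (chr2 q d), gen q d .k2)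
    (pdo (der1 q d), gen q d .f1) (pdo (der2 q d), gen q d .f2) := negRel_pdo.prod negRel_gen

/-- `pdo` is injective, so the first component of a point of the graph determines the point. Values
of `φ` are found by exhibiting a pair in the span. -/
theorem φ_eq_of_mem {f : Dual F (Bplus q d)} {x : Ubar q d}
    (h : (pdo f, x) ∈ NegRel.wordSpan q d
    (pdo (chr1 q d), gen q d .k1) (pdo (chr2 q d), gen q d .k2) (pdo (der1 q d), gen q d .f1)
    (pdo (der2 q d), gen q d .f2)) : φ q d f = x := by
  rw [← range_graph] at h
  obtain ⟨g, hg⟩ := h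
  have h1 : g = f := pdo_injective (congrArg Prod.fst hg)
  subst h1
  exact congrArg Prod.snd hg

/-- The pairs satisfy the negative Borel relations, hence the graph is closed under products; a
linear map whose graph is a subalgebra is multiplicative. -/
theorem φ_xmul (f g : Dual F (Bplus q d)) : φ q d (xmul f g) = φ q d f * φ q d g := by
  refine φ_eq_of_mem ?_
  rw [pdo_xmul]
  have mem : ∀ f, graph q d f ∈ NegRel.wordSpan q d
    (pdo (chr1 q d), gen q d .k1) (pdo (chr2 q d), gen q d .k2) (pdo (der1 q d), gen q d .f1)
    (pdo (der2 q d), gen q d .f2) := fun f => by rw [← range_graph]; exact ⟨f, rfl⟩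
  exact negRel_graph.mul_mem (mem f) (mem g)

theorem φ_ε : φ q d (εB q d) = 1 :=
  φ_eq_of_mem (by rw [pdo_ε]; exact negRel_graph.one_mem)

theorem φ_chr1 : φ q d (chr1 q d) = gen q d .k1 :=
  φ_eq_of_mem (by simpa using negRel_graph.k1_mul_mem _ negRel_graph.one_mem)

theorem φ_chr2 : φ q d (chr2 q d) = gen q d .k2 :=
  φ_eq_of_mem (by simpa using negRel_graph.k2_mul_mem _ negRel_graph.one_mem)

theorem φ_der1 : φ q d (der1 q d) = gen q d .f1 :=
  φ_eq_of_mem (by simpa using negRel_graph.f1_mul_mem _ negRel_graph.one_mem)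

theorem φ_der2 : φ q d (der2 q d) = gen q d .f2 :=
  φ_eq_of_mem (by simpa using negRel_graph.f2_mul_mem _ negRel_graph.one_mem)

theorem φ_xpow (f : Dual F (Bplus q d)) (n : ℕ) : φ q d (xpow f n) = φ q d f ^ n := by
  induction n with
  | zero => rw [xpow_zero, φ_ε, pow_zero]
  | succ n ih => rw [xpow_succ, φ_xmul, ih, pow_succ]

theorem φ_chr1i : φ q d (chr1i q d) = gen q d .k1i := by
  rw [chr1i, φ_xpow, φ_chr1]
  have h : gen q d .k1 ^ (d - 1) * gen q d .k1 = 1 := by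
    rw [← pow_succ, Nat.sub_add_cancel (OddRoot.one_lt (q := q) (d := d)).le, k1_pow]
  calc _ = gen q d .k1 ^ (d - 1) * (gen q d .k1 * gen q d .k1i) := by rw [k1_k1i, mul_one]
    _ = _ := by rw [← mul_assoc, h, one_mul]

theorem φ_chr2i : φ q d (chr2i q d) = gen q d .k2i := by
  rw [chr2i, φ_xpow, φ_chr2]
  have h : gen q d .k2 ^ (d - 1) * gen q d .k2 = 1 := by
    rw [← pow_succ, Nat.sub_add_cancel (OddRoot.one_lt (q := q) (d := d)).le, k2_pow]
  calc _ = gen q d .k2 ^ (d - 1) * (gen q d .k2 * gen q d .k2i) := by rw [k2_k2i, mul_one]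
    _ = _ := by rw [← mul_assoc, h, one_mul]

/-- `X` is generated by `chr1, chr2, der1, der2`. -/
theorem dual_induction {p : Dual F (Bplus q d) → Prop} (hε : p (εB q d))
    (add : ∀ f g, p f → p g → p (f + g)) (smul : ∀ (c : F) f, p f → p (c • f))
    (mul : ∀ f g, p f → p g → p (xmul f g)) (h1 : p (chr1 q d)) (h2 : p (chr2 q d))
    (h3 : p (der1 q d)) (h4 : p (der2 q d)) (f : Dual F (Bplus q d)) : p f := by
  have pw : ∀ f, p f → ∀ n, p (xpow f n) := fun f hf n => by
    induction n with
    | zero => exact hε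
    | succ n ih => exact mul _ _ ih hf
  have h5 : p (der3 q d) := by
    have e : der3 q d = xmul (der2 q d) (der1 q d) + (-q) • xmul (der1 q d) (der2 q d) := by
      rw [der3]; module
    rw [e]
    exact add _ _ (mul _ _ h4 h3) (smul _ _ (mul _ _ h3 h4))
  have hf : f ∈ Submodule.span F (Set.range (alphaMono (posBasis q d))) := by
    rw [span_alphaMono]; trivial
  induction hf using Submodule.span_induction with
  | mem x hx =>
    obtain ⟨⟨w, s, l, i, j⟩, rfl⟩ := hx
    simp only [alphaMono, αk1_posBasis, αk2_posBasis, αe1_posBasis, αe2_posBasis, αe3_posBasis]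
    exact mul _ _ (mul _ _ (mul _ _ (mul _ _ (pw _ h3 _) (pw _ h5 _)) (pw _ h4 _)) (pw _ h1 _))
      (pw _ h2 _)
  | zero => simpa using smul 0 _ hε
  | add x y _ _ hx hy => exact add _ _ hx hy
  | smul c x _ hx => exact smul _ _ hx

end Bplus

end Ubar

end QDouble

end

/-! ### Convolution inverses, and the exchange rule for skew primitive elements -/

noncomputable section

set_option linter.unusedSectionVars false

namespace QDouble

open TensorProduct Module

variable {F : Type*} [Field F]

namespace HopfSuperData

section Convolution

variable {V : Type*} [AddCommGroup V] [Module F V] {W : Type*} [AddCommGroup W] [Module F W]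
variable {H : HopfSuperData F V} {K : HopfSuperData F W}

variable (H K) in
/-- The convolution product of linear maps. -/
def conv (f g : V →ₗ[F] W) : V →ₗ[F] W := K.mul ∘ₗ TensorProduct.map f g ∘ₗ H.comul

theorem conv_assoc (hH : H.IsHopfSuperalgebra) (hK : K.IsHopfSuperalgebra) (f g h : V →ₗ[F] W) :
    conv H K (conv H K f g) h = conv H K f (conv H K g h) := by
  refine LinearMap.ext fun a => ?_
  have e1 : conv H K (conv H K f g) h a = K.mul (TensorProduct.map K.mul LinearMap.id
      (TensorProduct.map (TensorProduct.map f g) h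
        (TensorProduct.map H.comul LinearMap.id (H.comul a)))) := by
    simp only [conv, LinearMap.comp_apply, TensorProduct.map_map]
    rfl
  have e2 : conv H K f (conv H K g h) a = K.mul (TensorProduct.map LinearMap.id K.mul
      (TensorProduct.map f (TensorProduct.map g h)
        (TensorProduct.map LinearMap.id H.comul (H.comul a)))) := by
    simp only [conv, LinearMap.comp_apply, TensorProduct.map_map]
    rfl
  have e3 := LinearMap.congr_fun hH.coassoc a
  simp only [LinearMap.comp_apply, LinearEquiv.coe_coe] at e3
  rw [e1, e2, ← e3]
  generalize TensorProduct.map H.comul LinearMap.id (H.comul a) = t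
  induction t using TensorProduct.induction_on with
  | zero => simp
  | add s t hs ht => simp only [map_add, hs, ht]
  | tmul s c =>
    induction s using TensorProduct.induction_on with
    | zero => simp
    | add s t hs ht => simp only [add_tmul, map_add, hs, ht]
    | tmul a b => simp [hK.mul_assoc]

theorem conv_counit_left (hH : H.IsHopfSuperalgebra) (hK : K.IsHopfSuperalgebra)
    (f : V →ₗ[F] W) : conv H K (H.counit.smulRight K.one) f = f := by
  refine LinearMap.ext fun a => ?_
  have e := LinearMap.congr_fun hH.counit_comul a
  simp only [LinearMap.comp_apply, LinearEquiv.coe_coe, LinearMap.id_apply] at e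
  conv_rhs => rw [← e]
  simp only [conv, LinearMap.comp_apply]
  generalize H.comul a = t
  induction t using TensorProduct.induction_on with
  | zero => simp
  | add s t hs ht => simp only [map_add, hs, ht]
  | tmul s c => simp [← smul_tmul', hK.one_mul]

theorem conv_counit_right (hH : H.IsHopfSuperalgebra) (hK : K.IsHopfSuperalgebra)
    (f : V →ₗ[F] W) : conv H K f (H.counit.smulRight K.one) = f := by
  refine LinearMap.ext fun a => ?_
  have e := LinearMap.congr_fun hH.comul_counit a
  simp only [LinearMap.comp_apply, LinearEquiv.coe_coe, LinearMap.id_apply] at e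
  conv_rhs => rw [← e]
  simp only [conv, LinearMap.comp_apply]
  generalize H.comul a = t
  induction t using TensorProduct.induction_on with
  | zero => simp
  | add s t hs ht => simp only [map_add, hs, ht]
  | tmul s c => simp [hK.mul_one]

/-- Bialgebra morphisms respect the antipodes. -/
theorem map_antipode_of_bialgebra (hH : H.IsHopfSuperalgebra) (hK : K.IsHopfSuperalgebra)
    {χ : V →ₗ[F] W} (map_mul : ∀ a b, χ (H.mul (a ⊗ₜ b)) = K.mul (χ a ⊗ₜ χ b))
    (map_one : χ H.one = K.one)
    (map_comul : ∀ a, K.comul (χ a) = TensorProduct.map χ χ (H.comul a))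
    (map_counit : ∀ a, K.counit (χ a) = H.counit a) (a : V) :
    K.antipode (χ a) = χ (H.antipode a) := by
  -- `S ∘ χ` is a left and `χ ∘ S` a right convolution inverse of `χ`, so the two coincide.
  have h1 : conv H K (K.antipode ∘ₗ χ) χ = H.counit.smulRight K.one := by
    refine LinearMap.ext fun a => ?_
    have := hK.antipode_left (χ a)
    rw [map_comul, TensorProduct.map_map, map_counit] at this
    exact this
  have h2 : conv H K χ (χ ∘ₗ H.antipode) = H.counit.smulRight K.one := by
    refine LinearMap.ext fun a => ?_
    have := congrArg χ (hH.antipode_right a)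
    rw [map_smul, map_one] at this
    refine Eq.trans ?_ this
    simp only [conv, LinearMap.comp_apply]
    generalize H.comul a = t
    induction t using TensorProduct.induction_on with
    | zero => simp
    | add s t hs ht => simp only [map_add, hs, ht]
    | tmul s c => simp [map_mul]
  have h3 : K.antipode ∘ₗ χ = χ ∘ₗ H.antipode := by
    rw [← conv_counit_right hH hK (K.antipode ∘ₗ χ), ← h2, ← conv_assoc hH hK, h1,
      conv_counit_left hH hK]
  exact LinearMap.congr_fun h3 a

end Convolution

end HopfSuperData

namespace Ubar.Bplus

variable {q : F} {d : ℕ} [CharZero F] [OddRoot q d]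

/-- `e` is skew primitive with respect to the group-like element `k`, whose inverse is `ki`. -/
structure IsPrim (i : ZMod 2) (e k ki : Bplus q d) : Prop where
  par_e : IsHomog (PB q d) i e
  par_k : IsHomog (PB q d) 0 k
  comul_e : (hopf q d).comul e = e ⊗ₜ 1 + k ⊗ₜ e
  comul_k : (hopf q d).comul k = k ⊗ₜ k
  ε_e : εB q d e = 0
  ε_k : εB q d k = 1
  ε_ki : εB q d ki = 1
  inv_e : (hopf q d).antipodeInv e = -(e * ki)
  inv_k : (hopf q d).antipodeInv k = ki
  ki_k : ki * k = 1

variable (q d) in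
/-- `k₁⁻¹` -/
def bk1i : Bplus q d := ⟨gen q d .k1i, k1i_mem⟩

variable (q d) in
/-- `k₂⁻¹` -/
def bk2i : Bplus q d := ⟨gen q d .k2i, k2i_mem⟩

theorem antipodeInv_eq {x y : Bplus q d} (h : antipode q d y = x) :
    (hopf q d).antipodeInv x = y := by
  have : (hopf q d).antipode y = x := Subtype.ext h
  rw [← this, HopfSuperData.antipodeInv_antipode antipode_bijective]

theorem isPrim_e1 : IsPrim 0 (be1 q d) (bk1 q d) (bk1i q d) where
  par_e := isHomog_zero_iff.2 PB_be1
  par_k := isHomog_zero_iff.2 PB_bk1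
  comul_e := comul_be1
  comul_k := comul_bk1
  ε_e := counit_gen .e1
  ε_k := counit_gen .k1
  ε_ki := counit_gen .k1i
  inv_e := antipodeInv_eq (by
    change antipode q d (-(gen q d .e1 * gen q d .k1i)) = gen q d .e1
    rw [map_neg, antipode_mul (gen_homog _) (gen_homog _), antipode_gen, antipode_gen]
    simp [antipodeGen, Gen.deg])
  inv_k := antipodeInv_eq (antipode_gen .k1i)
  ki_k := Subtype.ext k1i_k1

theorem isPrim_e2 : IsPrim 1 (be2 q d) (bk2 q d) (bk2i q d) where
  par_e := isHomog_one_iff.2 PB_be2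
  par_k := isHomog_zero_iff.2 PB_bk2
  comul_e := comul_be2
  comul_k := comul_bk2
  ε_e := counit_gen .e2
  ε_k := counit_gen .k2
  ε_ki := counit_gen .k2i
  inv_e := antipodeInv_eq (by
    change antipode q d (-(gen q d .e2 * gen q d .k2i)) = gen q d .e2
    rw [map_neg, antipode_mul (gen_homog _) (gen_homog _), antipode_gen, antipode_gen]
    simp [antipodeGen, Gen.deg])
  inv_k := antipodeInv_eq (antipode_gen .k2i)
  ki_k := Subtype.ext k2i_k2

variable {i j : ZMod 2} {e k ki : Bplus q d}

theorem bone_homog : IsHomog (PB q d) 0 (1 : Bplus q d) := isHomog_zero_iff.2 PB_one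

theorem straighten₃_homog {i₁ i₂ i₃ : ZMod 2} {a₁ a₂ a₃ : Bplus q d} {g : Dual F (Bplus q d)}
    (h₁ : IsHomog (PB q d) i₁ a₁) (h₂ : IsHomog (PB q d) i₂ a₂) (h₃ : IsHomog (PB q d) i₃ a₃)
    (hg : IsHomog (hopf q d).dualPar j g) :
    (hopf q d).straighten₃ (((a₁ ⊗ₜ a₂) ⊗ₜ a₃) ⊗ₜ g) =
      (sg F ((i₁ + i₂ + i₃) * j) * sg F ((i₁ + i₂) * i₃)) •
        ((g ∘ₗ (hopf q d).conj a₁ a₃) ⊗ₜ[F] a₂) := by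
  have hp : IsHomog (hopf q d).par₃ (i₁ + i₂ + i₃) ((a₁ ⊗ₜ a₂) ⊗ₜ a₃) := (h₁.tmul h₂).tmul h₃
  simp only [HopfSuperData.straighten₃, LinearMap.comp_apply]
  rw [koszul_homog hp hg, map_smul, lift.tmul, LinearMap.comp_apply,
    koszul_homog (h₁.tmul h₂) h₃, map_smul, LinearMap.smul_apply, smul_smul]
  rfl

theorem conj_homog {i : ZMod 2} {a c x : Bplus q d} {n : ZMod 2} (hx : IsHomog (PB q d) n x)
    (ha : IsHomog (PB q d) i a) : (hopf q d).conj a c x =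
      sg F (n * i) • ((hopf q d).antipodeInv c * (x * a)) := by
  rw [HopfSuperData.conj_apply, koszul_homog hx ha, map_smul, tmul_smul, map_smul]
  rfl

theorem conj_even {a c x : Bplus q d} (ha : IsHomog (PB q d) 0 a) :
    (hopf q d).conj a c x = (hopf q d).antipodeInv c * (x * a) := by
  rw [HopfSuperData.conj_apply, koszul_even_right _ _ _ (isHomog_zero_iff.1 ha)]
  rfl

theorem antipodeInv_bone : (hopf q d).antipodeInv 1 = 1 :=
  HopfSuperData.antipodeInv_one antipode_bijective hopf_isHopfSuperalgebra

theorem IsPrim.straighten_k (h : IsPrim i e k ki) {g : Dual F (Bplus q d)}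
    (hg : IsHomog (hopf q d).dualPar j g) : (hopf q d).straighten (k ⊗ₜ g) =
      (g ∘ₗ (hopf q d).conj k k) ⊗ₜ k := by
  have hc : (hopf q d).comul₃ k = (k ⊗ₜ k) ⊗ₜ k := by
    simp [HopfSuperData.comul₃, h.comul_k]
  rw [HopfSuperData.straighten_eq hopf_isHopfSuperalgebra, hc,
    straighten₃_homog h.par_k h.par_k h.par_k hg]
  simp

theorem IsPrim.straighten_e (h : IsPrim i e k ki) {g : Dual F (Bplus q d)}
    (hg : IsHomog (hopf q d).dualPar j g) : (hopf q d).straighten (e ⊗ₜ g) =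
      sg F (i * j) • ((g ∘ₗ (hopf q d).conj e 1) ⊗ₜ 1 + (g ∘ₗ (hopf q d).conj k 1) ⊗ₜ e +
        (g ∘ₗ (hopf q d).conj k e) ⊗ₜ k) := by
  have hc : (hopf q d).comul₃ e = (e ⊗ₜ 1) ⊗ₜ 1 + (k ⊗ₜ e) ⊗ₜ 1 + (k ⊗ₜ k) ⊗ₜ e := by
    simp [HopfSuperData.comul₃, h.comul_k, h.comul_e, add_tmul]
  rw [HopfSuperData.straighten_eq hopf_isHopfSuperalgebra, hc, add_tmul, add_tmul, map_add, map_add,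
    straighten₃_homog h.par_k h.par_k h.par_e hg, straighten₃_homog h.par_k h.par_e bone_homog hg,
    straighten₃_homog h.par_e bone_homog bone_homog hg]
  simp [smul_add]

/-- Only the shape is recorded: after an exchange with a group-like `k` the right-hand factor is
again `k`. This is what the induction over products in `X` uses. -/
theorem IsPrim.exists_straighten_k (h : IsPrim i e k ki) (g : Dual F (Bplus q d)) :
    ∃ g', (hopf q d).straighten (k ⊗ₜ g) = g' ⊗ₜ k := by
  refine homog_induction (HopfSuperData.dualPar_par PB_PB) (fun f g hf hg => ?_)
    (fun j g hg => ⟨_, h.straighten_k hg⟩) g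
  obtain ⟨f', hf⟩ := hf
  obtain ⟨g', hg⟩ := hg
  exact ⟨f' + g', by rw [tmul_add, map_add, hf, hg, add_tmul]⟩

/-- The middle legs of the threefold coproduct of `e` are `1`, `e` and `k`, so no other right-hand
factors can occur. -/
theorem IsPrim.exists_straighten_e (h : IsPrim i e k ki) (g : Dual F (Bplus q d)) :
    ∃ g₁ g₂ g₃, (hopf q d).straighten (e ⊗ₜ g) = g₁ ⊗ₜ 1 + g₂ ⊗ₜ e + g₃ ⊗ₜ k := by
  refine homog_induction (HopfSuperData.dualPar_par PB_PB) (fun f g hf hg => ?_)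
    (fun j g hg => ⟨sg F (i * j) • (g ∘ₗ (hopf q d).conj e 1),
      sg F (i * j) • (g ∘ₗ (hopf q d).conj k 1), sg F (i * j) • (g ∘ₗ (hopf q d).conj k e), ?_⟩) g
  · obtain ⟨f₁, f₂, f₃, hf⟩ := hf
    obtain ⟨g₁, g₂, g₃, hg⟩ := hg
    refine ⟨f₁ + g₁, f₂ + g₂, f₃ + g₃, ?_⟩
    rw [tmul_add, map_add, hf, hg, add_tmul, add_tmul, add_tmul]
    abel
  · rw [h.straighten_e hg, smul_add, smul_add, smul_tmul', smul_tmul', smul_tmul']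

theorem IsPrim.straighten_k_char (h : IsPrim i e k ki) {μ : Dual F (Bplus q d)} {s t : F}
    (hμ : IsChar μ s t) : (hopf q d).straighten (k ⊗ₜ μ) = μ ⊗ₜ k := by
  rw [h.straighten_k hμ.par]
  congr 1
  refine LinearMap.ext fun x => ?_
  have e1 := congrArg μ h.ki_k
  rw [hμ.mul, hμ.one] at e1
  rw [LinearMap.comp_apply, conj_even h.par_k, h.inv_k, hμ.mul, hμ.mul]
  linear_combination μ x * e1

theorem IsPrim.straighten_k_skew (h : IsPrim i e k ki) {κ g : Dual F (Bplus q d)} {a b : F}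
    (hg : IsSkew j κ (εB q d) g a b) (hk : g k = 0) (hki : g ki = 0) :
    (hopf q d).straighten (k ⊗ₜ g) = κ ki • g ⊗ₜ k := by
  rw [h.straighten_k hg.par, smul_tmul']
  congr 1
  refine LinearMap.ext fun x => ?_
  rw [LinearMap.comp_apply, conj_even h.par_k, h.inv_k, hg.mul, hg.mul, hk, hki, h.ε_k]
  simp

theorem IsPrim.straighten_e_char (h : IsPrim i e k ki) {μ : Dual F (Bplus q d)} {s t : F}
    (hμ : IsChar μ s t) (he : μ e = 0) : (hopf q d).straighten (e ⊗ₜ μ) = μ k • μ ⊗ₜ e := by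
  have h1 : μ ∘ₗ (hopf q d).conj e 1 = 0 := by
    refine LinearMap.ext fun x => homog_induction PB_PB (fun x y hx hy => by
      rw [map_add, hx, hy]; simp) (fun n x hx => ?_) x
    rw [LinearMap.comp_apply, conj_homog hx h.par_e, map_smul, hμ.mul, hμ.mul, he]
    simp
  have h2 : μ ∘ₗ (hopf q d).conj k 1 = μ k • μ := by
    refine LinearMap.ext fun x => ?_
    rw [LinearMap.comp_apply, conj_even h.par_k, antipodeInv_bone, one_mul, hμ.mul, mul_comm]; rfl
  have h3 : μ ∘ₗ (hopf q d).conj k e = 0 := by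
    refine LinearMap.ext fun x => ?_
    rw [LinearMap.comp_apply, conj_even h.par_k, h.inv_e, hμ.mul, map_neg, hμ.mul, he]
    simp
  rw [h.straighten_e hμ.par, h1, h2, h3]
  simp [smul_tmul']

/-- The legs `e ⊗ 1 ⊗ 1`, `k ⊗ e ⊗ 1` and `k ⊗ k ⊗ e` give the three terms. In the first, `g` meets
`e` on the right and yields `g(e) κ`; in the third, `S⁻¹(e) = -e k⁻¹` puts `e` on the left and
yields `-g(e) ε`. This is the commutation relation of `e` and `f`, with `κ` in the role of `k⁻¹`. -/
theorem IsPrim.straighten_e_skew (h : IsPrim i e k ki) {κ g : Dual F (Bplus q d)} {a b s t : F}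
    (hg : IsSkew j κ (εB q d) g a b) (hκ : IsChar κ s t) (hk : g k = 0) (hki : g ki = 0)
    (he : κ e = 0) : (hopf q d).straighten (e ⊗ₜ g) =
      (sg F i * g e) • κ ⊗ₜ 1 + sg F (i * j) • g ⊗ₜ e - (sg F (i * j) * g e) • εB q d ⊗ₜ k := by
  have h1 : g ∘ₗ (hopf q d).conj e 1 = (sg F (i * j) * sg F i * g e) • κ := by
    refine LinearMap.ext fun x => homog_induction PB_PB (fun x y hx hy => by
      rw [map_add, hx, hy, map_add]) (fun n x hx => ?_) x
    rw [LinearMap.comp_apply, conj_homog hx h.par_e, map_smul, antipodeInv_bone, one_mul, hg.mul,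
      h.ε_e, mul_zero, add_zero, LinearMap.smul_apply, smul_eq_mul, smul_eq_mul]
    by_cases hn : 0 = n
    · by_cases hij : j = i
      · subst hn hij
        have : j * j = j := by clear * -; revert j; decide
        simp [this, sg_mul_self]; ring
      · rw [apply_eq_zero hg.par h.par_e hij]; simp
    · rw [apply_eq_zero hκ.par hx hn]; simp
  have h2 : g ∘ₗ (hopf q d).conj k 1 = g := by
    refine LinearMap.ext fun x => ?_
    rw [LinearMap.comp_apply, conj_even h.par_k, antipodeInv_bone, one_mul, hg.mul, hk, h.ε_k]
    simp
  have h3 : g ∘ₗ (hopf q d).conj k e = -g e • εB q d := by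
    refine LinearMap.ext fun x => ?_
    rw [LinearMap.comp_apply, conj_even h.par_k, h.inv_e, hg.mul, hg.mul, map_neg, map_neg, hκ.mul,
      hg.mul, he, hki, hk, h.ε_ki, isChar_ε.mul, h.ε_k]
    simp
  rw [h.straighten_e hg.par, h1, h2, h3]
  simp only [smul_tmul', smul_add, smul_smul, mul_neg, neg_smul, neg_tmul, ← mul_assoc,
    sg_mul_self, one_mul, sub_eq_add_neg]

end Ubar.Bplus

end QDouble

end

/-! ### Multiplicativity of `χ` -/

noncomputable section

set_option linter.unusedSectionVars false

namespace QDouble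

open TensorProduct Module

variable {F : Type*} [Field F]

namespace Ubar.Bplus

variable {q : F} {d : ℕ} [CharZero F] [OddRoot q d]

variable (q d) in
/-- The morphism `f ⊗ a ↦ φ(f) a` from the double to `Ū_q`. -/
def χ : Dual F (Bplus q d) ⊗[F] Bplus q d →ₗ[F] Ubar q d :=
  LinearMap.mul' F (Ubar q d) ∘ₗ TensorProduct.map (φ q d) (Bplus q d).val.toLinearMap

theorem χ_tmul (f : Dual F (Bplus q d)) (a : Bplus q d) :
    χ q d (f ⊗ₜ a) = φ q d f * (a : Ubar q d) := rfl

theorem χ_lmul (f : Dual F (Bplus q d)) (z : Dual F (Bplus q d) ⊗[F] Bplus q d) :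
    χ q d ((hopf q d).lmul f z) = φ q d f * χ q d z := by
  induction z using TensorProduct.induction_on with
  | zero => simp
  | add s t hs ht => rw [map_add, map_add, map_add, hs, ht, mul_add]
  | tmul g a =>
    change χ q d (xmul f g ⊗ₜ a) = _
    rw [χ_tmul, χ_tmul, φ_xmul, mul_assoc]

/-- `χ` respects the product `(1 ⊗ a) (g ⊗ 1)`. -/
def Exch (a : Bplus q d) (g : Dual F (Bplus q d)) : Prop :=
  χ q d ((hopf q d).straighten (a ⊗ₜ g)) = (a : Ubar q d) * φ q d g

theorem χ_act {a : Bplus q d} (h : ∀ g, Exch a g) (z : Dual F (Bplus q d) ⊗[F] Bplus q d) :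
    χ q d ((hopf q d).act a z) = (a : Ubar q d) * χ q d z := by
  induction z using TensorProduct.induction_on with
  | zero => simp [HopfSuperData.act]
  | add s t hs ht =>
    simp only [HopfSuperData.act, tmul_add, map_add, mul_add] at hs ht ⊢
    rw [hs, ht]
  | tmul g b =>
    rw [HopfSuperData.act, HopfSuperData.act₃_tmul,
      ← HopfSuperData.straighten_eq hopf_isHopfSuperalgebra, χ_tmul, ← mul_assoc, ← h g]
    generalize (hopf q d).straighten (a ⊗ₜ g) = z
    induction z using TensorProduct.induction_on with
    | zero => simp
    | add s t hs ht => rw [map_add, map_add, map_add, hs, ht, add_mul]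
    | tmul f c =>
      change φ q d f * ((c * b : Bplus q d) : Ubar q d) = _
      rw [χ_tmul, mul_assoc]; rfl

theorem act_tmul_one (a : Bplus q d) (g : Dual F (Bplus q d)) :
    (hopf q d).act a (g ⊗ₜ 1) = (hopf q d).straighten (a ⊗ₜ g) :=
  HopfSuperData.act_tmul_one hopf_isHopfSuperalgebra a g

/-- Since `H` acts on the double by left multiplication, exchanging `a b` means exchanging `b` and
then `a`. -/
theorem exch_mul {a b : Bplus q d} (ha : ∀ g, Exch a g) (hb : ∀ g, Exch b g)
    (g : Dual F (Bplus q d)) : Exch (a * b) g := by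
  have e := HopfSuperData.act_mul hopf_isHopfSuperalgebra antipode_bijective antipodeAnti a b
    (g ⊗ₜ (1 : Bplus q d))
  rw [Exch, ← act_tmul_one]
  refine (congrArg (χ q d) e).trans ?_
  rw [χ_act ha, act_tmul_one, hb g, ← mul_assoc]; rfl

theorem exch_one (g : Dual F (Bplus q d)) : Exch 1 g := by
  rw [Exch, ← act_tmul_one]
  refine (congrArg (χ q d) (HopfSuperData.act_one hopf_isHopfSuperalgebra antipode_bijective
    _)).trans ?_
  rw [χ_tmul]; simp

theorem exch_ε (a : Bplus q d) : Exch a (εB q d) := by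
  rw [Exch, HopfSuperData.straighten_counit hopf_isHopfSuperalgebra antipode_bijective, χ_tmul, φ_ε,
    one_mul, mul_one]

theorem exch_add {a : Bplus q d} {f g : Dual F (Bplus q d)} (hf : Exch a f) (hg : Exch a g) :
    Exch a (f + g) := by
  rw [Exch, tmul_add, map_add, map_add, hf, hg, map_add, mul_add]

theorem exch_smul {a : Bplus q d} {f : Dual F (Bplus q d)} (c : F) (hf : Exch a f) :
    Exch a (c • f) := by
  rw [Exch, tmul_smul, map_smul, map_smul, hf, map_smul, mul_smul_comm]

/-- This is `act_lmul` at `g ⊗ 1`: an exchange with a product is an exchange with the first factor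
followed by one with the second. -/
theorem straighten_xmul (a : Bplus q d) (f g : Dual F (Bplus q d)) :
    (hopf q d).straighten (a ⊗ₜ xmul f g) =
      (hopf q d).double.mul ((hopf q d).straighten (a ⊗ₜ f) ⊗ₜ (g ⊗ₜ 1)) := by
  rw [← act_tmul_one]
  exact HopfSuperData.act_lmul hopf_isHopfSuperalgebra antipode_bijective antipodeCoanti a f
    (g ⊗ₜ (1 : Bplus q d))

theorem χ_double_mul_tmul_one {f g : Dual F (Bplus q d)} {a : Bplus q d} (h : Exch a g) :
    χ q d ((hopf q d).double.mul ((f ⊗ₜ a) ⊗ₜ (g ⊗ₜ 1))) = χ q d (f ⊗ₜ a) * φ q d g := by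
  rw [HopfSuperData.double_mul_apply hopf_isHopfSuperalgebra, χ_lmul, act_tmul_one, h, χ_tmul,
    mul_assoc]

section Generators

variable {i j : ZMod 2} {e k ki : Bplus q d}

/-- After passing `f` the right-hand factor is still `k`, so the hypothesis on `g` applies directly
and the four generators of `X` suffice. -/
theorem IsPrim.exch_k (h : IsPrim i e k ki) (h1 : Exch k (chr1 q d)) (h2 : Exch k (chr2 q d))
    (h3 : Exch k (der1 q d)) (h4 : Exch k (der2 q d)) (g : Dual F (Bplus q d)) : Exch k g := by
  refine dual_induction (exch_ε k) (fun _ _ => exch_add) (fun c _ => exch_smul c)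
    (fun f g hf hg => ?_) h1 h2 h3 h4 g
  obtain ⟨f', hf'⟩ := h.exists_straighten_k f
  rw [Exch, hf'] at hf
  rw [Exch, straighten_xmul, hf', χ_double_mul_tmul_one hg, hf, φ_xmul, mul_assoc]

/-- After passing `f` the right-hand factors are `1`, `e` and `k`, so the exchange property of `k`
must be known for every functional beforehand. -/
theorem IsPrim.exch_e (h : IsPrim i e k ki) (hk : ∀ g, Exch k g) (h1 : Exch e (chr1 q d))
    (h2 : Exch e (chr2 q d)) (h3 : Exch e (der1 q d)) (h4 : Exch e (der2 q d))
    (g : Dual F (Bplus q d)) : Exch e g := by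
  refine dual_induction (exch_ε e) (fun _ _ => exch_add) (fun c _ => exch_smul c)
    (fun f g hf hg => ?_) h1 h2 h3 h4 g
  obtain ⟨f₁, f₂, f₃, hf'⟩ := h.exists_straighten_e f
  rw [Exch, hf'] at hf
  rw [Exch, straighten_xmul, hf', add_tmul, add_tmul, map_add, map_add, map_add, map_add,
    χ_double_mul_tmul_one (exch_one g), χ_double_mul_tmul_one hg, χ_double_mul_tmul_one (hk g),
    ← add_mul, ← add_mul, ← map_add, ← map_add, hf, φ_xmul, mul_assoc]

variable {κ g μ : Dual F (Bplus q d)} {a b s t : F}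

theorem IsPrim.skew_ki (h : IsPrim i e k ki) (hg : IsSkew j κ (εB q d) g a b) (hk : g k = 0) :
    g ki = 0 := by
  have := hg.mul ki k
  rw [h.ki_k, hg.one, hk, h.ε_k] at this
  simpa using this.symm

theorem IsPrim.char_ki (h : IsPrim i e k ki) (hμ : IsChar μ s t) : μ ki = (μ k)⁻¹ := by
  have := hμ.mul ki k
  rw [h.ki_k, hμ.one] at this
  exact eq_inv_of_mul_eq_one_left this.symm

theorem IsPrim.exch_k_char (h : IsPrim i e k ki) (hμ : IsChar μ s t)
    (H : (k : Ubar q d) * φ q d μ = φ q d μ * k) : Exch k μ := by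
  rw [Exch, h.straighten_k_char hμ, χ_tmul, H]

theorem IsPrim.exch_k_skew (h : IsPrim i e k ki) (hg : IsSkew j κ (εB q d) g a b)
    (hκ : IsChar κ s t) (hk : g k = 0)
    (H : (k : Ubar q d) * φ q d g = (κ k)⁻¹ • (φ q d g * k)) : Exch k g := by
  rw [Exch, h.straighten_k_skew hg hk (h.skew_ki hg hk), map_smul, χ_tmul, H, h.char_ki hκ]

theorem IsPrim.exch_e_char (h : IsPrim i e k ki) (hμ : IsChar μ s t) (he : μ e = 0)
    (H : (e : Ubar q d) * φ q d μ = μ k • (φ q d μ * e)) : Exch e μ := by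
  rw [Exch, h.straighten_e_char hμ he, map_smul, χ_tmul, H]

theorem IsPrim.exch_e_skew (h : IsPrim i e k ki) (hg : IsSkew j κ (εB q d) g a b)
    (hκ : IsChar κ s t) (hk : g k = 0) (he : κ e = 0)
    (H : (e : Ubar q d) * φ q d g = (sg F i * g e) • φ q d κ + sg F (i * j) • (φ q d g * e) -
      (sg F (i * j) * g e) • (k : Ubar q d)) : Exch e g := by
  rw [Exch, h.straighten_e_skew hg hκ hk (h.skew_ki hg hk) he, map_sub, map_add, map_smul, map_smul,
    map_smul, χ_tmul, χ_tmul, χ_tmul, φ_ε, one_mul, H]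
  simp

end Generators

theorem coe_bk1 : (bk1 q d : Ubar q d) = gen q d .k1 := rfl
theorem coe_bk2 : (bk2 q d : Ubar q d) = gen q d .k2 := rfl
theorem coe_be1 : (be1 q d : Ubar q d) = gen q d .e1 := rfl
theorem coe_be2 : (be2 q d : Ubar q d) = gen q d .e2 := rfl

theorem exch_bk1 (g : Dual F (Bplus q d)) : Exch (bk1 q d) g := by
  refine isPrim_e1.exch_k (isPrim_e1.exch_k_char chr1_isChar ?_)
    (isPrim_e1.exch_k_char chr2_isChar ?_)
    (isPrim_e1.exch_k_skew der1_isSkew chr1i_isChar der1_isSkew.bk1 ?_)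
    (isPrim_e1.exch_k_skew der2_isSkew chr2i_isChar der2_isSkew.bk1 ?_) g
  · rw [φ_chr1, coe_bk1]
  · rw [φ_chr2, coe_bk1, k2_k1]
  · rw [φ_der1, coe_bk1, k1_f1, chr1i_isChar.bk1, sq]
  · rw [φ_der2, coe_bk1, k1_f2, chr2i_isChar.bk1, inv_inv]

theorem exch_bk2 (g : Dual F (Bplus q d)) : Exch (bk2 q d) g := by
  refine isPrim_e2.exch_k (isPrim_e2.exch_k_char chr1_isChar ?_)
    (isPrim_e2.exch_k_char chr2_isChar ?_)
    (isPrim_e2.exch_k_skew der1_isSkew chr1i_isChar der1_isSkew.bk2 ?_)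
    (isPrim_e2.exch_k_skew der2_isSkew chr2i_isChar der2_isSkew.bk2 ?_) g
  · rw [φ_chr1, coe_bk2, k2_k1]
  · rw [φ_chr2, coe_bk2]
  · rw [φ_der1, coe_bk2, k2_f1, chr1i_isChar.bk2, inv_inv]
  · rw [φ_der2, coe_bk2, k2_f2, chr2i_isChar.bk2, inv_one, one_smul]

/-- The value `-(q - q⁻¹)⁻¹` of `der1` at `e₁`, together with `φ(chr1i) = k₁⁻¹`, turns the exchange
formula into the relation between `e₁` and `f₁`. -/
theorem exch_be1 (g : Dual F (Bplus q d)) : Exch (be1 q d) g := by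
  refine isPrim_e1.exch_e exch_bk1 (isPrim_e1.exch_e_char chr1_isChar chr1_isChar.be1 ?_)
    (isPrim_e1.exch_e_char chr2_isChar chr2_isChar.be1 ?_)
    (isPrim_e1.exch_e_skew der1_isSkew chr1i_isChar der1_isSkew.bk1 chr1i_isChar.be1 ?_)
    (isPrim_e1.exch_e_skew der2_isSkew chr2i_isChar der2_isSkew.bk1 chr2i_isChar.be1 ?_) g
  · rw [φ_chr1, coe_be1, e1_k1, chr1_isChar.bk1, ← mul_inv, sq]
  · rw [φ_chr2, coe_be1, e1_k2, chr2_isChar.bk1]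
  · rw [φ_der1, coe_be1, coe_bk1, e1_f1, der1_isSkew.be1, φ_chr1i]
    simp only [sg_zero, mul_zero, one_mul, one_smul]
    module
  · rw [φ_der2, coe_be1, coe_bk1, e1_f2, der2_isSkew.be1]
    simp

/-- Both `e₂` and `der2` are odd, so the signs in the exchange formula produce the anticommutator of
`e₂` and `f₂`. -/
theorem exch_be2 (g : Dual F (Bplus q d)) : Exch (be2 q d) g := by
  refine isPrim_e2.exch_e exch_bk2 (isPrim_e2.exch_e_char chr1_isChar chr1_isChar.be2 ?_)
    (isPrim_e2.exch_e_char chr2_isChar chr2_isChar.be2 ?_)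
    (isPrim_e2.exch_e_skew der1_isSkew chr1i_isChar der1_isSkew.bk2 chr1i_isChar.be2 ?_)
    (isPrim_e2.exch_e_skew der2_isSkew chr2i_isChar der2_isSkew.bk2 chr2i_isChar.be2 ?_) g
  · rw [φ_chr1, coe_be2, e2_k1, chr1_isChar.bk2]
  · rw [φ_chr2, coe_be2, e2_k2, chr2_isChar.bk2, one_smul]
  · rw [φ_der1, coe_be2, coe_bk2, e2_f1, der1_isSkew.be2]
    simp
  · rw [φ_der2, coe_be2, coe_bk2, e2_f2, der2_isSkew.be2, φ_chr2i]
    simp only [sg_one, mul_one]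
    module

theorem exch (a : Bplus q d) (g : Dual F (Bplus q d)) : Exch a g := by
  refine mem_of_gen (p := fun a => ∀ g, Exch a g) (fun c g => ?_) (fun a b ha hb g => ?_)
    (fun a b => exch_mul) exch_bk1 exch_bk2 exch_be1 exch_be2 a g
  · rw [Exch, Algebra.algebraMap_eq_smul_one, ← smul_tmul', map_smul, map_smul, exch_one g]
    simp
  · rw [Exch, add_tmul, map_add, map_add, ha, hb, ← add_mul]; rfl

theorem χ_mul (s t : Dual F (Bplus q d) ⊗[F] Bplus q d) :
    χ q d ((hopf q d).double.mul (s ⊗ₜ t)) = χ q d s * χ q d t := by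
  induction s using TensorProduct.induction_on with
  | zero => simp
  | add s s' hs hs' => rw [add_tmul, map_add, map_add, map_add, hs, hs', add_mul]
  | tmul f a =>
    rw [HopfSuperData.double_mul_apply hopf_isHopfSuperalgebra, χ_lmul, χ_act (exch a), χ_tmul,
      mul_assoc]

theorem χ_one : χ q d (hopf q d).double.one = 1 := by
  change φ q d (εB q d) * 1 = 1
  rw [φ_ε, mul_one]

end Ubar.Bplus

end QDouble

end

/-! ### `χ` as a surjective morphism of Hopf superalgebras -/

noncomputable section

set_option linter.unusedSectionVars false

namespace QDouble

open TensorProduct Module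

variable {F : Type*} [Field F]

theorem HopfSuperData.mem_gr {V : Type*} [AddCommGroup V] [Module F V] {H : HopfSuperData F V}
    {i : ZMod 2} {v : V} : v ∈ H.gr i ↔ H.par v = ((-1 : F) ^ i.val) • v := by
  simp [gr, sub_eq_zero]

/-- Coproducts are multiplicative on both sides and an even multiplicative map induces one on tensor
squares. Compatibility with coproducts thus needs to be tested on generators only. -/
theorem HopfSuperData.map_comul_mul [CharZero F] {V : Type*} [AddCommGroup V] [Module F V]
    {W : Type*} [AddCommGroup W] [Module F W] {H : HopfSuperData F V} {K : HopfSuperData F W}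
    (hH : H.IsHopfSuperalgebra) (hK : K.IsHopfSuperalgebra) {A : V →ₗ[F] W}
    (hA : ∀ v, A (H.par v) = K.par (A v)) (hm : ∀ a b, A (H.mul (a ⊗ₜ b)) = K.mul (A a ⊗ₜ A b))
    {x y : V} (hx : K.comul (A x) = TensorProduct.map A A (H.comul x))
    (hy : K.comul (A y) = TensorProduct.map A A (H.comul y)) :
    K.comul (A (H.mul (x ⊗ₜ y))) = TensorProduct.map A A (H.comul (H.mul (x ⊗ₜ y))) := by
  have e1 := LinearMap.congr_fun hH.comul_mul (x ⊗ₜ y)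
  have e2 := LinearMap.congr_fun hK.comul_mul (A x ⊗ₜ A y)
  have hA' : A ∘ₗ H.par = K.par ∘ₗ A := LinearMap.ext hA
  simp only [LinearMap.comp_apply, TensorProduct.map_tmul] at e1 e2
  rw [hm, e1, e2, hx, hy]
  exact (superMul_map hH.par_par hH.par_par hA' hA' hm hm _ _).symm

namespace Ubar.Bplus

variable {q : F} {d : ℕ} [CharZero F] [OddRoot q d]

theorem dualPar_xmul (f g : Dual F (Bplus q d)) : (hopf q d).dualPar (xmul f g) =
    xmul ((hopf q d).dualPar f) ((hopf q d).dualPar g) :=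
  LinearMap.congr_fun (HopfSuperData.dualOp_par_mul hopf_isHopfSuperalgebra) (f ⊗ₜ g)

theorem φ_dualPar (f : Dual F (Bplus q d)) : φ q d ((hopf q d).dualPar f) = P q d (φ q d f) := by
  refine dual_induction (p := fun f => φ q d ((hopf q d).dualPar f) = P q d (φ q d f)) ?_
    (fun f g hf hg => by simp only [map_add, hf, hg]) (fun c f hf => by simp only [map_smul, hf])
    (fun f g hf hg => ?_) ?_ ?_ ?_ ?_ f
  · rw [isHomog_zero_iff.1 isChar_ε.par, φ_ε]; simp
  · rw [dualPar_xmul, φ_xmul, hf, hg, φ_xmul]; simp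
  · rw [isHomog_zero_iff.1 chr1_isChar.par, φ_chr1]; simp [Gen.sign]
  · rw [isHomog_zero_iff.1 chr2_isChar.par, φ_chr2]; simp [Gen.sign]
  · rw [isHomog_zero_iff.1 der1_isSkew.par, φ_der1]; simp [Gen.sign]
  · rw [isHomog_one_iff.1 der2_isSkew.par, map_neg, φ_der2]; simp [Gen.sign]

theorem χ_par (z : Dual F (Bplus q d) ⊗[F] Bplus q d) :
    χ q d ((hopf q d).double.par z) = P q d (χ q d z) := by
  induction z using TensorProduct.induction_on with
  | zero => simp
  | add s t hs ht => rw [map_add, map_add, map_add, map_add, hs, ht]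
  | tmul f a =>
    change φ q d ((hopf q d).dualPar f) * P q d (a : Ubar q d) = _
    rw [φ_dualPar, χ_tmul]; simp

theorem counit_φ (f : Dual F (Bplus q d)) : counit q d (φ q d f) = f 1 := by
  refine dual_induction (p := fun f => counit q d (φ q d f) = f 1) ?_
    (fun f g hf hg => by rw [map_add, map_add, hf, hg]; rfl)
    (fun c f hf => by rw [map_smul, map_smul, hf]; rfl) (fun f g hf hg => ?_) ?_ ?_ ?_ ?_ f
  · rw [φ_ε, map_one, isChar_ε.one]
  · rw [φ_xmul, map_mul, hf, hg, xmul_apply, pd_one, map_smul, smul_eq_mul]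
  · rw [φ_chr1, counit_gen, chr1_isChar.one]
  · rw [φ_chr2, counit_gen, chr2_isChar.one]
  · rw [φ_der1, counit_gen, der1_isSkew.one]
  · rw [φ_der2, counit_gen, der2_isSkew.one]

theorem counit_χ (z : Dual F (Bplus q d) ⊗[F] Bplus q d) :
    counit q d (χ q d z) = (hopf q d).double.counit z := by
  induction z using TensorProduct.induction_on with
  | zero => simp
  | add s t hs ht => rw [map_add, map_add, map_add, hs, ht]
  | tmul f a => rw [χ_tmul, map_mul, counit_φ]; rfl

theorem xcomul_char {μ : Dual F (Bplus q d)} {s t : F} (h : IsChar μ s t) :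
    (hopf q d).dualOp.comul μ = μ ⊗ₜ μ := by
  refine HopfSuperData.dualDistrib_ext fun x y => ?_
  rw [HopfSuperData.ev_dualOp_comul PB_PB, HopfSuperData.ev_tmul]
  exact (h.mul y x).trans (mul_comm _ _)

/-- The coproduct of `X` evaluates `g` on `y x`, so the skew Leibniz rule reads off its two terms.
Under `φ` they match the coproducts of `f₁` and `f₂`, because `κ` is the inverse of the
corresponding `chr1` or `chr2`. -/
theorem xcomul_skew {i : ZMod 2} {κ g : Dual F (Bplus q d)} {a b : F}
    (h : IsSkew i κ (εB q d) g a b) :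
    (hopf q d).dualOp.comul g = g ⊗ₜ κ + εB q d ⊗ₜ g := by
  refine HopfSuperData.dualDistrib_ext fun x y => ?_
  rw [HopfSuperData.ev_dualOp_comul PB_PB, HopfSuperData.ev_add, HopfSuperData.ev_tmul,
    HopfSuperData.ev_tmul]
  refine (h.mul y x).trans ?_
  simp only [LinearMap.add_apply, LinearMap.smul_apply, smul_eq_mul]
  ring

theorem comul_φ (f : Dual F (Bplus q d)) : comul q d (φ q d f) =
    TensorProduct.map (φ q d) (φ q d) ((hopf q d).dualOp.comul f) := by
  refine dual_induction (p := fun f => comul q d (φ q d f) =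
    TensorProduct.map (φ q d) (φ q d) ((hopf q d).dualOp.comul f)) ?_
    (fun f g hf hg => by simp only [map_add, hf, hg]) (fun c f hf => by simp only [map_smul, hf])
    (fun f g hf hg => ?_) ?_ ?_ ?_ ?_ f
  · rw [xcomul_char isChar_ε, TensorProduct.map_tmul, φ_ε, comul_one]
  · exact HopfSuperData.map_comul_mul (K := Ubar.hopf q d)
      (HopfSuperData.dualOp_isHopfSuperalgebra hopf_isHopfSuperalgebra antipode_bijective
        antipodeAnti) Ubar.hopf_isHopfSuperalgebra φ_dualPar φ_xmul hf hg
  · rw [xcomul_char chr1_isChar, TensorProduct.map_tmul, φ_chr1, comul_gen]; rfl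
  · rw [xcomul_char chr2_isChar, TensorProduct.map_tmul, φ_chr2, comul_gen]; rfl
  · rw [xcomul_skew der1_isSkew, map_add, TensorProduct.map_tmul, TensorProduct.map_tmul, φ_der1,
      φ_chr1i, φ_ε, comul_gen]; rfl
  · rw [xcomul_skew der2_isSkew, map_add, TensorProduct.map_tmul, TensorProduct.map_tmul, φ_der2,
      φ_chr2i, φ_ε, comul_gen]; rfl

/-- `f ⊗ a` is the product of `f ⊗ 1` and `1 ⊗ a`; on the first `χ` is `φ`, on the second it is the
inclusion of `B_q⁺`. -/
theorem comul_χ (z : Dual F (Bplus q d) ⊗[F] Bplus q d) : comul q d (χ q d z) =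
    TensorProduct.map (χ q d) (χ q d) ((hopf q d).double.comul z) := by
  induction z using TensorProduct.induction_on with
  | zero => simp
  | add s t hs ht => simp only [map_add, hs, ht]
  | tmul f a =>
    have H := hopf_isHopfSuperalgebra (q := q) (d := d)
    have hS := antipode_bijective (q := q) (d := d)
    have eX : χ q d ∘ₗ (hopf q d).inclX = φ q d := LinearMap.ext fun f => by
      change φ q d f * 1 = _
      rw [mul_one]
    have eV : χ q d ∘ₗ (hopf q d).inclV = (Bplus q d).val.toLinearMap := LinearMap.ext fun a => by
      change φ q d (εB q d) * (a : Ubar q d) = _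
      rw [φ_ε, one_mul]; rfl
    have h1 : comul q d (χ q d ((hopf q d).inclX f)) =
        TensorProduct.map (χ q d) (χ q d) ((hopf q d).double.comul ((hopf q d).inclX f)) := by
      rw [HopfSuperData.double_comul_inclX H, TensorProduct.map_map, eX, ← comul_φ, ← eX]; rfl
    have h2 : comul q d (χ q d ((hopf q d).inclV a)) =
        TensorProduct.map (χ q d) (χ q d) ((hopf q d).double.comul ((hopf q d).inclV a)) := by
      rw [HopfSuperData.double_comul_inclV H, TensorProduct.map_map, eV]
      exact (congrArg (comul q d) (LinearMap.congr_fun eV a)).trans (incl₂_comul a).symm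
    have h3 := HopfSuperData.map_comul_mul (K := Ubar.hopf q d) double_isHopfSuperalgebra
      Ubar.hopf_isHopfSuperalgebra χ_par χ_mul h1 h2
    rw [HopfSuperData.inclX_mul_inclV H f a hS] at h3
    exact h3

theorem χ_isHopfHom : (hopf q d).double.IsHopfHom (Ubar.hopf q d) (χ q d) where
  even i z hz := by
    rw [HopfSuperData.mem_gr] at hz ⊢
    exact (χ_par z).symm.trans ((congrArg _ hz).trans (map_smul _ _ _))
  map_mul := χ_mul
  map_one := χ_one
  map_comul := comul_χ
  map_counit := counit_χ
  map_antipode := HopfSuperData.map_antipode_of_bialgebra double_isHopfSuperalgebra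
    Ubar.hopf_isHopfSuperalgebra χ_mul χ_one comul_χ counit_χ

/-- The range contains `k_i^{±1}` and `e_i` through `B_q⁺` and `f_i` through `φ`, and it is closed
under products. -/
theorem χ_surjective : Function.Surjective (χ q d) := by
  have hX : ∀ f, φ q d f ∈ LinearMap.range (χ q d) := fun f =>
    ⟨f ⊗ₜ 1, by rw [χ_tmul]; exact mul_one _⟩
  have hV : ∀ a ∈ Bplus q d, a ∈ LinearMap.range (χ q d) := fun a ha =>
    ⟨εB q d ⊗ₜ ⟨a, ha⟩, by rw [χ_tmul, φ_ε, one_mul]⟩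
  have hg : ∀ x, gen q d x ∈ LinearMap.range (χ q d) := fun x => by
    cases x
    · exact hV _ k1_mem
    · exact hV _ k1i_mem
    · exact hV _ k2_mem
    · exact hV _ k2i_mem
    · exact hV _ e1_mem
    · exact hV _ e2_mem
    · exact φ_der1 (q := q) (d := d) ▸ hX _
    · exact φ_der2 (q := q) (d := d) ▸ hX _
  intro u
  refine mem_of_gen_mul (LinearMap.range (χ q d)) (hV 1 (one_mem _)) (fun x u hu => ?_) u
  obtain ⟨s, hs⟩ := hg x
  obtain ⟨t, rfl⟩ := hu
  exact ⟨_, (χ_mul s t).trans (by rw [hs])⟩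

/-- The only reordering needed moves `k₂^{j₁}` past `k₁^{i₂}`. -/
theorem χ_basis (w i₁ j₁ i₂ j₂ r : Fin d) (s l h t : Fin 2) :
    χ q d (alphaBasis q d (w, s, l, i₁, j₁) ⊗ₜ posBasis q d (i₂, j₂, r, h, t)) =
      gen q d .f1 ^ (w : ℕ) * Ubar.f3 q d ^ (s : ℕ) * gen q d .f2 ^ (l : ℕ) *
      gen q d .k1 ^ (i₁ + i₂ : ℕ) * gen q d .k2 ^ (j₁ + j₂ : ℕ) * gen q d .e1 ^ (r : ℕ) *
      e3 q d ^ (h : ℕ) * gen q d .e2 ^ (t : ℕ) := by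
  have hc : gen q d .k2 ^ (j₁ : ℕ) * gen q d .k1 ^ (i₂ : ℕ) =
      gen q d .k1 ^ (i₂ : ℕ) * gen q d .k2 ^ (j₁ : ℕ) :=
    (Commute.pow_pow (show Commute (gen q d .k2) (gen q d .k1) from k2_k1) _ _)
  rw [χ_tmul, φ_alphaBasis, coe_posBasis]
  simp only [NegRel.word, posMono, posWord, pow_add]
  have e : NegRel.f3 q (gen q d .f1) (gen q d .f2) = Ubar.f3 q d := rfl
  rw [e]
  simp only [mul_assoc]
  rw [← mul_assoc (gen q d .k2 ^ (j₁ : ℕ)) (gen q d .k1 ^ (i₂ : ℕ)), hc]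
  simp only [mul_assoc]

end Ubar.Bplus

end QDouble

end

theorem mainTheorem7 {F : Type*} [Field F] [CharZero F] (q : F) (d : ℕ) [QDouble.OddRoot q d] :
    ∃ b : Module.Basis (QDouble.Ubar.PosIdx d) F (QDouble.Ubar.Bplus q d),
      (∀ m, (b m : QDouble.Ubar q d) = QDouble.Ubar.posMono q d m) ∧
      ∃ bD : Module.Basis (QDouble.Ubar.Bplus.NegIdx d × QDouble.Ubar.PosIdx d) F
          (Module.Dual F (QDouble.Ubar.Bplus q d) ⊗[F] QDouble.Ubar.Bplus q d),
        (∀ n m, bD (n, m) = QDouble.Ubar.Bplus.alphaMono b n ⊗ₜ[F] b m) ∧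
        (QDouble.Ubar.Bplus.hopf q d).IsHopfSuperalgebra ∧
        Function.Bijective (QDouble.Ubar.Bplus.hopf q d).antipode ∧
        (QDouble.Ubar.Bplus.hopf q d).double.IsHopfSuperalgebra ∧
        (QDouble.Ubar.hopf q d).IsHopfSuperalgebra ∧
        ∃ χ : Module.Dual F (QDouble.Ubar.Bplus q d) ⊗[F] QDouble.Ubar.Bplus q d →ₗ[F]
            QDouble.Ubar q d,
          (∀ (w i₁ j₁ i₂ j₂ r : Fin d) (s l h t : Fin 2),
            χ (bD ((w, s, l, i₁, j₁), (i₂, j₂, r, h, t))) =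
              QDouble.Ubar.gen q d .f1 ^ (w : ℕ) * QDouble.Ubar.f3 q d ^ (s : ℕ) *
              QDouble.Ubar.gen q d .f2 ^ (l : ℕ) *
              QDouble.Ubar.gen q d .k1 ^ (i₁ + i₂ : ℕ) * QDouble.Ubar.gen q d .k2 ^ (j₁ + j₂ : ℕ) *
              QDouble.Ubar.gen q d .e1 ^ (r : ℕ) * QDouble.Ubar.e3 q d ^ (h : ℕ) *
              QDouble.Ubar.gen q d .e2 ^ (t : ℕ)) ∧
          (QDouble.Ubar.Bplus.hopf q d).double.IsHopfHom (QDouble.Ubar.hopf q d) χ ∧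
          Function.Surjective χ := by
  refine ⟨QDouble.Ubar.Bplus.posBasis q d, QDouble.Ubar.Bplus.coe_posBasis,
    (QDouble.Ubar.Bplus.alphaBasis q d).tensorProduct (QDouble.Ubar.Bplus.posBasis q d),
    fun n m => ?_, QDouble.Ubar.Bplus.hopf_isHopfSuperalgebra,
    QDouble.Ubar.Bplus.antipode_bijective, QDouble.Ubar.Bplus.double_isHopfSuperalgebra,
    QDouble.Ubar.hopf_isHopfSuperalgebra, QDouble.Ubar.Bplus.χ q d,
    fun w i₁ j₁ i₂ j₂ r s l h t => ?_, QDouble.Ubar.Bplus.χ_isHopfHom,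
    QDouble.Ubar.Bplus.χ_surjective⟩
  · rw [Module.Basis.tensorProduct_apply, QDouble.Ubar.Bplus.alphaBasis_apply]
  · rw [Module.Basis.tensorProduct_apply, QDouble.Ubar.Bplus.χ_basis]
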